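/- **Conventions.** For a category $V$, let $MV$ be the category of finite sequences $(X_1,\dots,X_n)$, $n\ge 0$, of objects of $V$; a morphism $(X_1,\dots,X_n)\to(Y_1,\dots,Y_n)$ is a sequence of morphisms $X_i\to Y_i$, and there are no morphisms between sequences of different lengths. A *multitensor* $(E,u,\sigma)$ on $V$ is a lax algebra structure on $V$ for the free monoid monad $M$ on categories: a functor $E:MV\to V$, with restrictions $E_n:V^n\to V$, and natural maps $u_X:X\to E_1X$ and $\sigma:E_iE_jX_{ij}\to E_{ij}X_{ij}$ satisfying the two unit axioms and the associativity axiom. Its *unary part* is the monad $(E_1,u,\sigma)$ on $V$, with category of algebras $U^{E_1}:V^{E_1}\to V$; $E$ is a *functor operad* if its unary part is the identity monad. $E$ is *distributive* if each $E_n$ preserves small coproducts in each variable, and *$\lambda$-accessible* if $E:MV\to V$ preserves $\lambda$-filtered colimits. An isomorphism of multitensors on $V$ is a natural isomorphism of the functors $MV\to V$ compatible with units and substitutions. For a functor $H:V\to W$ and multitensors $E$ on $V$, $F$ on $W$, an isomorphism $E\cong F$ along $H$ is a natural isomorphism $H(E_iX_i)\cong F_i(HX_i)$ compatible with units and substitutions.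 $\mathcal GV$ is the category of graphs enriched in $V$ (a small set $X_0$ and objects $X(a,b)\in V$ for $a,b\in X_0$). An *$E$-category* is a $V$-graph $X$ with composition maps $E_iX(x_{i-1},x_i)\to X(x_0,x_n)$ for all $n\ge 0$ and all $x_0,\dots,x_n\in X_0$, satisfying the unit and associativity axioms; with the $V$-graph morphisms compatible with composition these form a category $E\text{-}\mathrm{Cat}$, with forgetful functor to $\mathcal GV$. The unary compositions $E_1X(a,b)\to X(a,b)$ make each hom an $E_1$-algebra, so that this functor factors as $E\text{-}\mathrm{Cat}\to\mathcal G(V^{E_1})\to\mathcal GV$. "Isomorphic over $B$" means that there is an isomorphism of categories commuting strictly with the given functors to $B$. **Theorem (multitensor lifting).** Let $\lambda$ be a regular cardinal and $E$ a $\lambda$-accessible distributive multitensor on a (locally small) cocomplete category $V$. Then there is a distributive functor operad $E'$ on $V^{E_1}$ such that $$E'\text{-}\mathrm{Cat}\;\cong\;E\text{-}\mathrm{Cat}\quad\text{over }\mathcal G(V^{E_1}),$$ and hence also over $\mathcal GV$. Moreover $E'$ is $\lambda$-accessible, and it is unique in the following sense. Let $F$ be any distributive functor operad on $V^{E_1}$.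 1. If $F\text{-}\mathrm{Cat}\cong E\text{-}\mathrm{Cat}$ over $\mathcal G(V^{E_1})$, then $F\cong E'$ as multitensors on $V^{E_1}$. 2. If $F\text{-}\mathrm{Cat}\cong E\text{-}\mathrm{Cat}$ only over $\mathcal GV$, then there are an automorphism $H$ of the category $V^{E_1}$ with $U^{E_1}H=U^{E_1}$ and an isomorphism of multitensors $F\cong E'$ along $H$. -/

import Mathlib

open CategoryTheory CategoryTheory.Limits

universe v u v' u'

namespace Multi

/-! ## The category `MV` of finite sequences of objects of `V` -/

/-- Objects of `MV`: finite sequences `(X₁, …, Xₙ)`. -/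
abbrev Seq (V : Type u) : Type u := List V

namespace Seq

/-- A morphism of sequences exists only between sequences of the same length, and is then a
sequence of morphisms `Xᵢ ⟶ Yᵢ`. -/
def Hom {V : Type u} [Category.{v} V] : List V → List V → Type v
  | [], [] => PUnit
  | X :: l, Y :: m => (X ⟶ Y) × Hom l m
  | [], _ :: _ => PEmpty
  | _ :: _, [] => PEmpty

section Basic

variable {V : Type u} [Category.{v} V]

/-- Identities of `MV`. -/
def Hom.id : ∀ l : List V, Hom l l
  | [] => PUnit.unit
  | X :: l => (𝟙 X, Hom.id l)

/-- Composition of `MV`. -/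
def Hom.comp : ∀ {l m n : List V}, Hom l m → Hom m n → Hom l n
  | [], [], [], _, _ => PUnit.unit
  | _ :: _, _ :: _, _ :: _, f, g => (f.1 ≫ g.1, Hom.comp f.2 g.2)
  | [], _ :: _, _, f, _ => f.elim
  | _ :: _, [], _, f, _ => f.elim
  | [], [], _ :: _, _, g => g.elim
  | _ :: _, _ :: _, [], _, g => g.elim

theorem Hom.id_comp : ∀ {l m : List V} (f : Hom l m), Hom.comp (Hom.id l) f = f
  | [], [], _ => rfl
  | _ :: _, _ :: _, f => Prod.ext (Category.id_comp f.1) (Hom.id_comp f.2)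
  | [], _ :: _, f => f.elim
  | _ :: _, [], f => f.elim

theorem Hom.comp_id : ∀ {l m : List V} (f : Hom l m), Hom.comp f (Hom.id m) = f
  | [], [], _ => rfl
  | _ :: _, _ :: _, f => Prod.ext (Category.comp_id f.1) (Hom.comp_id f.2)
  | [], _ :: _, f => f.elim
  | _ :: _, [], f => f.elim

theorem Hom.assoc : ∀ {l m n k : List V} (f : Hom l m) (g : Hom m n) (h : Hom n k),
    Hom.comp (Hom.comp f g) h = Hom.comp f (Hom.comp g h)
  | [], [], [], [], _, _, _ => rfl
  | _ :: _, _ :: _, _ :: _, _ :: _, f, g, h =>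
      Prod.ext (Category.assoc f.1 g.1 h.1) (Hom.assoc f.2 g.2 h.2)
  | [], _ :: _, _, _, f, _, _ => f.elim
  | _ :: _, [], _, _, f, _, _ => f.elim
  | [], [], _ :: _, _, _, g, _ => g.elim
  | _ :: _, _ :: _, [], _, _, g, _ => g.elim
  | [], [], [], _ :: _, _, _, h => h.elim
  | _ :: _, _ :: _, _ :: _, [], _, _, h => h.elim

instance : Category.{v} (Seq V) where
  Hom l m := Hom l m
  id l := Hom.id l
  comp f g := Hom.comp f g
  id_comp f := Hom.id_comp f
  comp_id f := Hom.comp_id f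
  assoc f g h := Hom.assoc f g h

/-- The empty sequence. -/
abbrev nil : Seq V := ([] : List V)

/-- Prefixing a sequence by one object. -/
abbrev cons (X : V) (l : Seq V) : Seq V := List.cons X l

/-- Prefixing a morphism of sequences by one morphism. -/
def consHom {X Y : V} {l m : Seq V} (f : X ⟶ Y) (g : l ⟶ m) : cons X l ⟶ cons Y m :=
  ((f, g) : (X ⟶ Y) × Hom l m)

theorem consHom_id (X : V) (l : Seq V) : consHom (𝟙 X) (𝟙 l) = 𝟙 (cons X l) := rfl

theorem consHom_comp {X Y Z : V} {l m n : Seq V} (f : X ⟶ Y) (g : Y ⟶ Z) (f' : l ⟶ m)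
    (g' : m ⟶ n) : consHom (f ≫ g) (f' ≫ g') = consHom f f' ≫ consHom g g' := rfl

/-- The functor `V ⥤ MV` sending `X` to the one-term sequence `(X)`. -/
def single : V ⥤ Seq V where
  obj X := cons X nil
  map f := consHom f (𝟙 nil)

/-- Concatenation of sequences. -/
def append (l m : Seq V) : Seq V := List.append l m

/-- Concatenation of morphisms of sequences. -/
def appendHom : ∀ {l l' m m' : List V}, Hom l l' → Hom m m' → Hom (l ++ m) (l' ++ m')
  | [], [], _, _, _, g => g
  | _ :: _, _ :: _, _, _, f, g => (f.1, appendHom f.2 g)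
  | [], _ :: _, _, _, f, _ => f.elim
  | _ :: _, [], _, _, f, _ => f.elim

theorem appendHom_id : ∀ l m : List V, appendHom (Hom.id l) (Hom.id m) = Hom.id (l ++ m)
  | [], _ => rfl
  | _ :: l, m => Prod.ext rfl (appendHom_id l m)

theorem appendHom_comp : ∀ {l l' l'' m m' m'' : List V} (f : Hom l l') (f' : Hom l' l'')
    (g : Hom m m') (g' : Hom m' m''),
    appendHom (Hom.comp f f') (Hom.comp g g') = Hom.comp (appendHom f g) (appendHom f' g')
  | [], [], [], _, _, _, _, _, _, _ => rfl
  | _ :: _, _ :: _, _ :: _, _, _, _, f, f', g, g' =>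
      Prod.ext rfl (appendHom_comp f.2 f'.2 g g')
  | [], _ :: _, _, _, _, _, f, _, _, _ => f.elim
  | _ :: _, [], _, _, _, _, f, _, _, _ => f.elim
  | [], [], _ :: _, _, _, _, _, f', _, _ => f'.elim
  | _ :: _, _ :: _, [], _, _, _, _, f', _, _ => f'.elim

/-- The functor `V ⥤ MV` sending `Z` to `(X₁, …, Xₘ, Z, Y₁, …, Yₙ)`: all the entries of a sequence
but one are kept fixed. -/
def insert (l r : Seq V) : V ⥤ Seq V where
  obj Z := append l (cons Z r)
  map f := appendHom (Hom.id l) (consHom f (𝟙 r))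
  map_id Z := appendHom_id l (Z :: r)
  map_comp f g := by
    have h₁ : Hom.id l = Hom.comp (Hom.id l) (Hom.id l) := (Hom.id_comp _).symm
    have h₂ : consHom (f ≫ g) (𝟙 r) = consHom f (𝟙 r) ≫ consHom g (𝟙 r) := by
      rw [← consHom_comp, Category.comp_id]
    exact (congrArg₂ appendHom h₁ h₂).trans (appendHom_comp _ _ _ _)

/-- Flattening a morphism of sequences of sequences. -/
def flattenHom : ∀ {L M : List (Seq V)}, Hom L M → Hom (List.flatten L) (List.flatten M)
  | [], [], _ => PUnit.unit
  | _ :: _, _ :: _, f => appendHom f.1 (flattenHom f.2)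
  | [], _ :: _, f => f.elim
  | _ :: _, [], f => f.elim

theorem flattenHom_id : ∀ L : List (Seq V), flattenHom (Hom.id L) = Hom.id (List.flatten L)
  | [] => rfl
  | l :: L => by
      change appendHom (Hom.id l) (flattenHom (Hom.id L)) = _
      rw [flattenHom_id L]
      exact appendHom_id l _

theorem flattenHom_comp : ∀ {L M N : List (Seq V)} (f : Hom L M) (g : Hom M N),
    flattenHom (Hom.comp f g) = Hom.comp (flattenHom f) (flattenHom g)
  | [], [], [], _, _ => rfl
  | _ :: _, _ :: _, _ :: _, f, g => by
      change appendHom (Hom.comp f.1 g.1) (flattenHom (Hom.comp f.2 g.2)) = _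
      rw [flattenHom_comp f.2 g.2]
      exact appendHom_comp f.1 g.1 _ _
  | [], _ :: _, _, f, _ => f.elim
  | _ :: _, [], _, f, _ => f.elim
  | [], [], _ :: _, _, g => g.elim
  | _ :: _, _ :: _, [], _, g => g.elim

/-- The multiplication `MMV ⥤ MV` of the monoid monad: a sequence of sequences is sent to its
concatenation. -/
def flatten : Seq (Seq V) ⥤ Seq V where
  obj L := List.flatten L
  map f := flattenHom f
  map_id L := flattenHom_id L
  map_comp f g := flattenHom_comp f g

end Basic

section Map

variable {V : Type u} [Category.{v} V] {W : Type u'} [Category.{v'} W]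

/-- Applying a functor to each entry of a morphism of sequences. -/
def mapHom (F : V ⥤ W) : ∀ {l m : List V}, Hom l m → Hom (l.map F.obj) (m.map F.obj)
  | [], [], _ => PUnit.unit
  | _ :: _, _ :: _, f => (F.map f.1, mapHom F f.2)
  | [], _ :: _, f => f.elim
  | _ :: _, [], f => f.elim

theorem mapHom_id (F : V ⥤ W) : ∀ l : List V, mapHom F (Hom.id l) = Hom.id (l.map F.obj)
  | [] => rfl
  | X :: l => Prod.ext (F.map_id X) (mapHom_id F l)

theorem mapHom_comp (F : V ⥤ W) : ∀ {l m n : List V} (f : Hom l m) (g : Hom m n),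
    mapHom F (Hom.comp f g) = Hom.comp (mapHom F f) (mapHom F g)
  | [], [], [], _, _ => rfl
  | _ :: _, _ :: _, _ :: _, f, g => Prod.ext (F.map_comp f.1 g.1) (mapHom_comp F f.2 g.2)
  | [], _ :: _, _, f, _ => f.elim
  | _ :: _, [], _, f, _ => f.elim
  | [], [], _ :: _, _, g => g.elim
  | _ :: _, _ :: _, [], _, g => g.elim

/-- The functor `MF : MV ⥤ MW`. -/
def map (F : V ⥤ W) : Seq V ⥤ Seq W where
  obj l := List.map F.obj l
  map f := mapHom F f
  map_id l := mapHom_id F l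
  map_comp f g := mapHom_comp F f g

/-- A morphism of sequences given entrywise by a natural transformation. -/
def mapNat {F G : V ⥤ W} (φ : F ⟶ G) : ∀ l : List V, ((map F).obj l ⟶ (map G).obj l)
  | [] => 𝟙 nil
  | X :: l => consHom (φ.app X) (mapNat φ l)

/-- A morphism of sequences given entrywise by a natural transformation between composites. -/
def mapNat₂ {C : Type*} [Category* C] {D : Type*} [Category* D] {D' : Type*} [Category* D']
    {F : C ⥤ D} {G : D ⥤ W} {F' : C ⥤ D'} {G' : D' ⥤ W} (φ : F ⋙ G ⟶ F' ⋙ G') :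
    ∀ l : List C, ((map G).obj ((map F).obj l) ⟶ (map G').obj ((map F').obj l))
  | [] => 𝟙 nil
  | X :: l => consHom (φ.app X) (mapNat₂ φ l)

/-- The morphism `(X₁, …, Xₙ) ⟶ (GF X₁, …, GF Xₙ)` given entrywise by a natural transformation
`𝟭 ⟶ F ⋙ G`. -/
def mapNatUnit {F : V ⥤ W} {G : W ⥤ V} (φ : 𝟭 V ⟶ F ⋙ G) :
    ∀ l : List V, ((𝟭 (Seq V)).obj l ⟶ (map G).obj ((map F).obj l))
  | [] => 𝟙 nil
  | X :: l => consHom (φ.app X) (mapNatUnit φ l)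

end Map

section Eq

variable {V : Type u} [Category.{v} V]

theorem flatten_single (l : Seq V) : flatten.obj (single.obj l) = l :=
  List.append_nil l

theorem flatten_map_single (l : Seq V) : flatten.obj ((map single).obj l) = l := by
  induction l with
  | nil => rfl
  | cons X l ih => exact congrArg (List.cons X) ih

theorem flatten_map_map {W : Type u'} [Category.{v'} W] (F : V ⥤ W) (L : Seq (Seq V)) :
    flatten.obj ((map (map F)).obj L) = (map F).obj (flatten.obj L) :=
  (List.map_flatten (L := L) (f := F.obj)).symm

theorem flatten_map_flatten (L : Seq (Seq (Seq V))) :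
    flatten.obj ((map flatten).obj L) = flatten.obj (flatten.obj L) :=
  (List.flatten_flatten (L := L)).symm

end Eq

end Seq

/-! ## Multitensors -/

/-- A multitensor (lax monoidal structure) `(E, u, σ)` on `V`, that is, a lax algebra structure on
`V` for the monoid monad `M`. -/
structure Multitensor (V : Type u) [Category.{v} V] where
  /-- The functor `E : MV ⥤ V`. -/
  tensor : Seq V ⥤ V
  /-- The unit `u_X : X ⟶ E(X)`. -/
  unit : 𝟭 V ⟶ Seq.single ⋙ tensor
  /-- The substitution `σ : E_i E_j X_ij ⟶ E_ij X_ij`. -/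
  subst : Seq.map tensor ⋙ tensor ⟶ Seq.flatten ⋙ tensor
  /-- `E_j X_j ⟶ E₁ E_j X_j ⟶ E_j X_j` is the identity. -/
  unit_subst (l : Seq V) :
    unit.app (tensor.obj l) ≫ subst.app (Seq.single.obj l) ≫
      tensor.map (eqToHom (Seq.flatten_single l)) = 𝟙 (tensor.obj l)
  /-- `E_i X_i ⟶ E_i E₁ X_i ⟶ E_i X_i` is the identity. -/
  map_unit_subst (l : Seq V) :
    tensor.map (Seq.mapNatUnit unit l) ≫ subst.app ((Seq.map Seq.single).obj l) ≫
      tensor.map (eqToHom (Seq.flatten_map_single l)) = 𝟙 (tensor.obj l)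
  /-- The two composites `E_i E_j E_k X_ijk ⟶ E_ijk X_ijk` agree. -/
  assoc (L : Seq (Seq (Seq V))) :
    tensor.map (Seq.mapNat₂ subst L) ≫ subst.app ((Seq.map Seq.flatten).obj L) ≫
        tensor.map (eqToHom (Seq.flatten_map_flatten L)) =
      subst.app ((Seq.map (Seq.map tensor)).obj L) ≫
        tensor.map (eqToHom (Seq.flatten_map_map tensor L)) ≫ subst.app (Seq.flatten.obj L)

namespace Multitensor

section

variable {V : Type u} [Category.{v} V] (E : Multitensor V)

/-- The unary part of a multitensor, as a monad on `V`. -/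
def unaryMonad : Monad V where
  toFunctor := Seq.single ⋙ E.tensor
  η := E.unit
  μ :=
    { app := fun X => E.subst.app (Seq.single.obj (Seq.single.obj X))
      naturality := fun _ _ f => E.subst.naturality (Seq.single.map (Seq.single.map f)) }
  assoc X := by
    have h := E.assoc (Seq.single.obj (Seq.single.obj (Seq.single.obj X)))
    refine ((congrArg (_ ≫ ·) ?_).trans h).trans (congrArg (_ ≫ ·) ?_)
    · exact ((congrArg (_ ≫ ·) (E.tensor.map_id _)).trans (Category.comp_id _)).symm
    · exact (congrArg (· ≫ _) (E.tensor.map_id _)).trans (Category.id_comp _)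
  left_unit X := by
    refine Eq.trans (congrArg (_ ≫ ·) ?_) (E.unit_subst (Seq.single.obj X))
    exact ((congrArg (_ ≫ ·) (E.tensor.map_id _)).trans (Category.comp_id _)).symm
  right_unit X := by
    refine Eq.trans (congrArg (_ ≫ ·) ?_) (E.map_unit_subst (Seq.single.obj X))
    exact ((congrArg (_ ≫ ·) (E.tensor.map_id _)).trans (Category.comp_id _)).symm

/-- `E` is a functor operad when its unary part is the identity monad: its unary functor is the
identity functor and its unit is the identity. (By the unit law, the multiplication of the unary
part is then the identity as well.) -/
def IsFunctorOperad : Prop :=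
  ∃ h : 𝟭 V = Seq.single ⋙ E.tensor, E.unit = eqToHom h

/-- `E` is distributive when each `Eₙ` preserves (small) coproducts in each variable. -/
def IsDistributive : Prop :=
  ∀ (l r : Seq V) (I : Type v),
    PreservesColimitsOfShape (Discrete I) (Seq.insert l r ⋙ E.tensor)

/-- `E` is `κ`-accessible when `E : MV ⥤ V` preserves `κ`-filtered colimits. -/
def IsAccessible (κ : Cardinal.{v}) [Fact κ.IsRegular] : Prop :=
  E.tensor.IsCardinalAccessible κ

end

/-- An isomorphism of multitensors on the same category: a natural isomorphism compatible with the
units and the substitutions. -/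
structure Iso {V : Type u} [Category.{v} V] (E F : Multitensor V) where
  iso : E.tensor ≅ F.tensor
  unit_iso (X : V) : E.unit.app X ≫ iso.hom.app (Seq.single.obj X) = F.unit.app X
  subst_iso (L : Seq (Seq V)) :
    E.subst.app L ≫ iso.hom.app (Seq.flatten.obj L) =
      iso.hom.app ((Seq.map E.tensor).obj L) ≫ F.tensor.map (Seq.mapNat iso.hom L) ≫
        F.subst.app L

/-- Coherence data making a functor `H : V ⥤ W` into a strong monoidal functor
`(V, E) ⥤ (W, F)`: a natural isomorphism `H (E_i X_i) ≅ F_i (H X_i)` compatible with the units and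
the substitutions. -/
structure IsoAlong {V : Type u} [Category.{v} V] {W : Type u'} [Category.{v'} W]
    (H : V ⥤ W) (E : Multitensor V) (F : Multitensor W) where
  iso : E.tensor ⋙ H ≅ Seq.map H ⋙ F.tensor
  unit_iso (X : V) :
    H.map (E.unit.app X) ≫ iso.hom.app (Seq.single.obj X) = F.unit.app (H.obj X)
  subst_iso (L : Seq (Seq V)) :
    H.map (E.subst.app L) ≫ iso.hom.app (Seq.flatten.obj L) =
      iso.hom.app ((Seq.map E.tensor).obj L) ≫ F.tensor.map (Seq.mapNat₂ iso.hom L) ≫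
        F.subst.app ((Seq.map (Seq.map H)).obj L) ≫
          F.tensor.map (eqToHom (Seq.flatten_map_map H L))

end Multitensor

/-! ## Enriched graphs -/

/-- A graph enriched in `V`: a set of objects, and an object of `V` for each pair of objects. -/
structure VGraph (V : Type u) [Category.{v} V] where
  vert : Type v
  hom : vert → vert → V

namespace VGraph

/-- Morphisms of `V`-graphs. -/
@[ext]
structure Hom {V : Type u} [Category.{v} V] (X Y : VGraph V) where
  obj : X.vert → Y.vert
  map (a b : X.vert) : X.hom a b ⟶ Y.hom (obj a) (obj b)

instance {V : Type u} [Category.{v} V] : Category.{v} (VGraph V) where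
  Hom X Y := Hom X Y
  id _ := ⟨fun a => a, fun _ _ => 𝟙 _⟩
  comp f g := ⟨fun a => g.obj (f.obj a), fun a b => f.map a b ≫ g.map _ _⟩
  id_comp f := by
    cases f; simp only [Category.id_comp]
  comp_id f := by
    cases f; simp only [Category.comp_id]
  assoc f g h := by
    simp only [Category.assoc]

/-- The functor `𝒢F : 𝒢V ⥤ 𝒢W` applying `F` to all homs. -/
def mapFunctor {V : Type u} [Category.{v} V] {W : Type u'} [Category.{v} W] (F : V ⥤ W) :
    VGraph V ⥤ VGraph W where
  obj X := ⟨X.vert, fun a b => F.obj (X.hom a b)⟩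
  map f := ⟨f.obj, fun a b => F.map (f.map a b)⟩
  map_id _ := congrArg (Hom.mk _) (funext fun _ => funext fun _ => F.map_id _)
  map_comp _ _ := congrArg (Hom.mk _) (funext fun _ => funext fun _ => F.map_comp _ _)

end VGraph

/-- `VPath O a b` is the set of sequences `(x₀, …, xₙ)` of elements of `O` with `x₀ = a` and
`xₙ = b`, of any length `n ≥ 0`. -/
inductive VPath (O : Type v) : O → O → Type v
  | nil (a : O) : VPath O a a
  | cons (a : O) {b c : O} (p : VPath O b c) : VPath O a c

/-- Composable sequences of paths from `a` to `b`. -/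
inductive PathSeq (O : Type v) : O → O → Type v
  | nil (a : O) : PathSeq O a a
  | cons {a b c : O} (p : VPath O a b) (P : PathSeq O b c) : PathSeq O a c

namespace VPath

/-- The path `(a, b)` of length one. -/
def edge {O : Type v} (a b : O) : VPath O a b := .cons a (.nil b)

/-- Concatenation of paths. -/
def append {O : Type v} : ∀ {a b c : O}, VPath O a b → VPath O b c → VPath O a c
  | _, _, _, .nil _, q => q
  | _, _, _, .cons a p, q => .cons a (append p q)

/-- The image of a path under a map. -/
def map {O O' : Type v} (f : O → O') : ∀ {a b : O}, VPath O a b → VPath O' (f a) (f b)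
  | _, _, .nil a => .nil (f a)
  | _, _, .cons a p => .cons (f a) (map f p)

/-- The sequence of homs `(X(x₀, x₁), …, X(xₙ₋₁, xₙ))` along a path. -/
def seq {V : Type u} [Category.{v} V] (X : VGraph V) :
    ∀ {a b : X.vert}, VPath X.vert a b → Seq V
  | _, _, .nil _ => Seq.nil
  | _, _, .cons a (b := b) p => Seq.cons (X.hom a b) (seq X p)

/-- The morphism between the sequences of homs along a path and along its image. -/
def seqMap {V : Type u} [Category.{v} V] {X Y : VGraph V} (f : X ⟶ Y) :
    ∀ {a b : X.vert} (p : VPath X.vert a b), seq X p ⟶ seq Y (p.map f.obj)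
  | _, _, .nil _ => 𝟙 Seq.nil
  | _, _, .cons a (b := b) p => Seq.consHom (f.map a b) (seqMap f p)

theorem seq_append {V : Type u} [Category.{v} V] (X : VGraph V) {a b c : X.vert}
    (p : VPath X.vert a b) (q : VPath X.vert b c) :
    seq X (p.append q) = Seq.append (seq X p) (seq X q) := by
  induction p with
  | nil a => rfl
  | cons a p ih => exact congrArg (List.cons _) (ih q)

end VPath

namespace PathSeq

/-- The concatenation of a composable sequence of paths. -/
def flat {O : Type v} : ∀ {a b : O}, PathSeq O a b → VPath O a b
  | _, _, .nil a => .nil a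
  | _, _, .cons p P => p.append (flat P)

/-- The path formed by the endpoints of a composable sequence of paths. -/
def ends {O : Type v} : ∀ {a b : O}, PathSeq O a b → VPath O a b
  | _, _, .nil a => .nil a
  | _, _, .cons (a := a) _ P => .cons a (ends P)

/-- The sequence of the sequences of homs along the members of a composable sequence of paths. -/
def seqs {V : Type u} [Category.{v} V] (X : VGraph V) :
    ∀ {a b : X.vert}, PathSeq X.vert a b → Seq (Seq V)
  | _, _, .nil _ => Seq.nil
  | _, _, .cons p P => Seq.cons (p.seq X) (seqs X P)

theorem flatten_seqs {V : Type u} [Category.{v} V] (X : VGraph V) {a b : X.vert}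
    (P : PathSeq X.vert a b) : Seq.flatten.obj (seqs X P) = P.flat.seq X := by
  induction P with
  | nil a => rfl
  | cons p P ih =>
      exact (congrArg (Seq.append (p.seq X)) ih).trans (VPath.seq_append X p P.flat).symm

/-- Given composition maps, the morphism composing each member of a sequence of paths. -/
def compSeq {V : Type u} [Category.{v} V] (T : Seq V ⥤ V) (X : VGraph V)
    (comp : ∀ {a b : X.vert} (p : VPath X.vert a b), T.obj (p.seq X) ⟶ X.hom a b) :
    ∀ {a b : X.vert} (P : PathSeq X.vert a b), ((Seq.map T).obj (seqs X P) ⟶ P.ends.seq X)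
  | _, _, .nil _ => 𝟙 Seq.nil
  | _, _, .cons p P => Seq.consHom (comp p) (compSeq T X comp P)

end PathSeq

/-! ## Enriched categories -/

/-- A category enriched in the multitensor `E`. -/
structure Enrich {V : Type u} [Category.{v} V] (E : Multitensor V) where
  /-- The underlying `V`-graph. -/
  graph : VGraph V
  /-- The composition maps `E_i X(xᵢ₋₁, xᵢ) ⟶ X(x₀, xₙ)`. -/
  comp {a b : graph.vert} (p : VPath graph.vert a b) : E.tensor.obj (p.seq graph) ⟶ graph.hom a b
  unit_comp (a b : graph.vert) :
    E.unit.app (graph.hom a b) ≫ comp (VPath.edge a b) = 𝟙 (graph.hom a b)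
  assoc {a b : graph.vert} (P : PathSeq graph.vert a b) :
    E.subst.app (P.seqs graph) ≫ E.tensor.map (eqToHom (P.flatten_seqs graph)) ≫ comp P.flat =
      E.tensor.map (P.compSeq E.tensor graph comp) ≫ comp P.ends

namespace Enrich

variable {V : Type u} [Category.{v} V] {E : Multitensor V}

/-- `E`-functors: morphisms of `V`-graphs compatible with the composition maps. -/
@[ext]
structure Hom (X Y : Enrich E) where
  graphHom : X.graph ⟶ Y.graph
  map_comp {a b : X.graph.vert} (p : VPath X.graph.vert a b) :
    X.comp p ≫ graphHom.map a b =
      E.tensor.map (p.seqMap graphHom) ≫ Y.comp (p.map graphHom.obj)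

theorem seqMap_id_comp (X : Enrich E) {a b : X.graph.vert} (p : VPath X.graph.vert a b) :
    E.tensor.map (p.seqMap (𝟙 X.graph)) ≫
      X.comp (p.map (VGraph.Hom.obj (𝟙 X.graph))) = X.comp p := by
  have key : ∃ h : p.map (VGraph.Hom.obj (𝟙 X.graph)) = p,
      p.seqMap (𝟙 X.graph) = eqToHom (congrArg (VPath.seq X.graph) h.symm) := by
    induction p with
    | nil a => exact ⟨rfl, rfl⟩
    | cons a p ih =>
        obtain ⟨h, e⟩ := ih
        refine ⟨congrArg (VPath.cons a) h, ?_⟩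
        change Seq.consHom (𝟙 _) (p.seqMap (𝟙 X.graph)) = _
        rw [e]
        have aux : ∀ {q : VPath X.graph.vert _ _} (h : p = q),
            Seq.consHom (𝟙 (X.graph.hom a _))
                (eqToHom (congrArg (VPath.seq X.graph) h)) =
              eqToHom (congrArg (fun q => VPath.seq X.graph (VPath.cons a q)) h) := by
          intro q h
          subst h
          rfl
        exact aux h.symm
  obtain ⟨h, e⟩ := key
  rw [e]
  have aux : ∀ {q : VPath X.graph.vert a b} (h : p = q),
      E.tensor.map (eqToHom (congrArg (VPath.seq X.graph) h)) ≫ X.comp q = X.comp p := by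
    intro q h
    subst h
    simp
  exact aux h.symm

theorem seqMap_comp_comp {X Y Z : Enrich E} (f : X.graph ⟶ Y.graph) (g : Y.graph ⟶ Z.graph)
    {a b : X.graph.vert} (p : VPath X.graph.vert a b) :
    E.tensor.map (p.seqMap (f ≫ g)) ≫ Z.comp (p.map (VGraph.Hom.obj (f ≫ g))) =
      E.tensor.map (p.seqMap f) ≫ E.tensor.map ((p.map f.obj).seqMap g) ≫
        Z.comp ((p.map f.obj).map g.obj) := by
  have key : ∃ h : (p.map f.obj).map g.obj = p.map (VGraph.Hom.obj (f ≫ g)),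
      p.seqMap (f ≫ g) = p.seqMap f ≫ (p.map f.obj).seqMap g ≫
        eqToHom (congrArg (VPath.seq Z.graph) h) := by
    induction p with
    | nil a => exact ⟨rfl, rfl⟩
    | cons a p ih =>
        obtain ⟨h, e⟩ := ih
        refine ⟨congrArg (VPath.cons _) h, ?_⟩
        change Seq.consHom (f.map _ _ ≫ g.map _ _) (p.seqMap (f ≫ g)) = _
        rw [e]
        have aux : ∀ {q : VPath Z.graph.vert _ _} (h : (p.map f.obj).map g.obj = q),
            eqToHom (congrArg (fun q => VPath.seq Z.graph (VPath.cons (g.obj (f.obj a)) q)) h) =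
              Seq.consHom (𝟙 (Z.graph.hom (g.obj (f.obj a)) _))
                (eqToHom (congrArg (VPath.seq Z.graph) h)) := by
          intro q h
          subst h
          rfl
        refine Eq.trans ?_ (congrArg (fun t => _ ≫ _ ≫ t) (aux h).symm)
        refine Prod.ext ?_ rfl
        exact (congrArg (f.map _ _ ≫ ·) (Category.comp_id _)).symm
  obtain ⟨h, e⟩ := key
  rw [e]
  have aux : ∀ {q : VPath Z.graph.vert _ _} (h : (p.map f.obj).map g.obj = q),
      E.tensor.map (eqToHom (congrArg (VPath.seq Z.graph) h)) ≫ Z.comp q =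
        Z.comp ((p.map f.obj).map g.obj) := by
    intro q h
    subst h
    simp
  rw [E.tensor.map_comp, E.tensor.map_comp, Category.assoc, Category.assoc, aux h]

instance : Category.{v} (Enrich E) where
  Hom X Y := Hom X Y
  id X := ⟨𝟙 X.graph, fun p => (Category.comp_id _).trans (seqMap_id_comp X p).symm⟩
  comp {X Y Z} f g := ⟨f.graphHom ≫ g.graphHom, fun p => by
    rw [seqMap_comp_comp, ← g.map_comp, ← Category.assoc (E.tensor.map _), ← f.map_comp,
      Category.assoc]
    rfl⟩
  id_comp f := Hom.ext (Category.id_comp f.graphHom)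
  comp_id f := Hom.ext (Category.comp_id f.graphHom)
  assoc f g h := Hom.ext (Category.assoc f.graphHom g.graphHom h.graphHom)

variable (E)

/-- The forgetful functor from `E`-categories to `V`-graphs. -/
def forget : Enrich E ⥤ VGraph V where
  obj X := X.graph
  map f := f.graphHom

/-- The forgetful functor from `E`-categories to graphs enriched in the category `V^{E₁}` of
algebras of the unary part of `E`: the unary composition maps `E₁ X(a, b) ⟶ X(a, b)` make each hom
an algebra. -/
def forgetToAlgebra : Enrich E ⥤ VGraph E.unaryMonad.Algebra where
  obj X :=
    { vert := X.graph.vert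
      hom := fun a b =>
        { A := X.graph.hom a b
          a := X.comp (VPath.edge a b)
          unit := X.unit_comp a b
          assoc := by
            refine Eq.trans (congrArg (_ ≫ ·) ?_)
              (X.assoc (PathSeq.cons (VPath.edge a b) (PathSeq.nil b)))
            exact ((congrArg (· ≫ _) (E.tensor.map_id _)).trans (Category.id_comp _)).symm } }
  map {X Y} f :=
    { obj := f.graphHom.obj
      map := fun a b =>
        { f := f.graphHom.map a b
          h := by
            have h : E.unaryMonad.map (f.graphHom.map a b) ≫
                Y.comp (VPath.edge (f.graphHom.obj a) (f.graphHom.obj b)) =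
              X.comp (VPath.edge a b) ≫ f.graphHom.map a b := (f.map_comp (VPath.edge a b)).symm
            exact h } }

theorem forgetToAlgebra_comp :
    forgetToAlgebra E ⋙ VGraph.mapFunctor E.unaryMonad.forget = forget E := rfl

end Enrich

/-- Isomorphism of categories over `B`, for categories `C` and `D` equipped with functors to `B`. -/
def IsoOver {C : Type*} [Category* C] {D : Type*} [Category* D] {B : Type*} [Category* B]
    (P : C ⥤ B) (Q : D ⥤ B) : Prop :=
  ∃ (K : C ⥤ D) (L : D ⥤ C), K ⋙ L = 𝟭 C ∧ L ⋙ K = 𝟭 D ∧ K ⋙ Q = P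

end Multi

universe w w'

namespace Multi

theorem comp_eq_left {C : Type*} [Category* C] {X Y Z W : C} {f : X ⟶ Y} {g : Y ⟶ Z} {k : X ⟶ Z}
    {h : Z ⟶ W} (e : f ≫ g = k) : f ≫ g ≫ h = k ≫ h := by
  rw [← e, Category.assoc]

theorem comp_eq_right {C : Type*} [Category* C] {X Y Z W : C} {f : X ⟶ Y} {g : Y ⟶ Z} {h : Z ⟶ W}
    {k : Y ⟶ W} (e : g ≫ h = k) : (f ≫ g) ≫ h = f ≫ k := by
  rw [← e, Category.assoc]

end Multi

namespace Multi

/-- A stage of the construction of an algebra for `Φ`: an action of `Φ` on `src` with values in a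
further object `tgt`. -/
structure PreAlg {C : Type u} [Category.{v} C] (Φ : C ⥤ C) where
  src : C
  tgt : C
  str : Φ.obj src ⟶ tgt

namespace PreAlg

variable {C : Type u} [Category.{v} C] {Φ : C ⥤ C}

/-- Morphisms of stages. -/
@[ext]
structure Hom (s t : PreAlg Φ) where
  src : s.src ⟶ t.src
  tgt : s.tgt ⟶ t.tgt
  w : Φ.map src ≫ t.str = s.str ≫ tgt

instance : Category.{v} (PreAlg Φ) where
  Hom := Hom
  id t := ⟨𝟙 _, 𝟙 _, by simp⟩
  comp f g := ⟨f.src ≫ g.src, f.tgt ≫ g.tgt, by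
    rw [Φ.map_comp, Category.assoc, g.w, reassoc_of% f.w]⟩
  id_comp f := Hom.ext (Category.id_comp _) (Category.id_comp _)
  comp_id f := Hom.ext (Category.comp_id _) (Category.comp_id _)
  assoc f g h := Hom.ext (Category.assoc _ _ _) (Category.assoc _ _ _)

@[ext]
theorem hom_ext {s t : PreAlg Φ} {f g : s ⟶ t} (h₁ : f.src = g.src) (h₂ : f.tgt = g.tgt) :
    f = g := Hom.ext h₁ h₂

@[simp] theorem id_src (t : PreAlg Φ) : Hom.src (𝟙 t) = 𝟙 t.src := rfl
@[simp] theorem id_tgt (t : PreAlg Φ) : Hom.tgt (𝟙 t) = 𝟙 t.tgt := rfl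
@[simp] theorem comp_src {r s t : PreAlg Φ} (f : r ⟶ s) (g : s ⟶ t) :
    Hom.src (f ≫ g) = f.src ≫ g.src := rfl
@[simp] theorem comp_tgt {r s t : PreAlg Φ} (f : r ⟶ s) (g : s ⟶ t) :
    Hom.tgt (f ≫ g) = f.tgt ≫ g.tgt := rfl

variable (Φ)

/-- The functor of sources. -/
@[simps] abbrev srcFunctor : PreAlg Φ ⥤ C where
  obj t := t.src
  map f := f.src

/-- The functor of targets. -/
@[simps] abbrev tgtFunctor : PreAlg Φ ⥤ C where
  obj t := t.tgt
  map f := f.tgt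

/-- The action, as a natural transformation. -/
@[simps] def strNat : srcFunctor Φ ⋙ Φ ⟶ tgtFunctor Φ where
  app t := t.str
  naturality _ _ f := f.w

variable {Φ}

section Colimits

variable {J : Type*} [Category* J] (D : J ⥤ PreAlg Φ)

section

variable [HasColimitsOfShape J C] [HasPushouts C]

/-- The colimit of a diagram of stages. -/
noncomputable def colim : PreAlg Φ where
  src := colimit (D ⋙ srcFunctor Φ)
  tgt := pushout (colimit.post (D ⋙ srcFunctor Φ) Φ) (colimMap (Functor.whiskerLeft D (strNat Φ)))
  str := pushout.inl _ _

/-- The colimit cocone of a diagram of stages. -/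
noncomputable def colimCocone : Cocone D where
  pt := colim D
  ι :=
    { app := fun j =>
        { src := colimit.ι (D ⋙ srcFunctor Φ) j
          tgt := colimit.ι (D ⋙ tgtFunctor Φ) j ≫ pushout.inr _ _
          w := by
            refine Eq.trans ?_ ((congrArg (colimit.ι ((D ⋙ srcFunctor Φ) ⋙ Φ) j ≫ ·)
              (pushout.condition (f := colimit.post (D ⋙ srcFunctor Φ) Φ)
                (g := colimMap (Functor.whiskerLeft D (strNat Φ))))).trans ?_)
            · exact (colimit.ι_post_assoc _ _ _ _).symm
            · exact ι_colimMap_assoc _ _ _ }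
      naturality := fun i j f => by
        refine hom_ext ?_ ?_
        · exact (colimit.w (D ⋙ srcFunctor Φ) f).trans (Category.comp_id _).symm
        · refine Eq.trans ?_ (Category.comp_id _).symm
          exact comp_eq_left (colimit.w (D ⋙ tgtFunctor Φ) f) }

/-- The colimit cocone is a colimit cocone. -/
noncomputable def colimIsColimit : IsColimit (colimCocone D) where
  desc s :=
    { src := colimit.desc (D ⋙ srcFunctor Φ) ((srcFunctor Φ).mapCocone s)
      tgt := pushout.desc
        (Φ.map (colimit.desc (D ⋙ srcFunctor Φ) ((srcFunctor Φ).mapCocone s)) ≫ s.pt.str)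
        (colimit.desc (D ⋙ tgtFunctor Φ) ((tgtFunctor Φ).mapCocone s)) (by
          refine colimit.hom_ext fun j => ?_
          refine (colimit.ι_post_assoc _ _ _ _).trans ?_
          refine Eq.trans ?_ (((s.ι.app j).w).trans ?_)
          · refine comp_eq_left ?_
            exact (Φ.map_comp _ _).symm.trans (congrArg Φ.map (colimit.ι_desc _ _))
          · refine Eq.trans ?_ (ι_colimMap_assoc (Functor.whiskerLeft D (strNat Φ)) j _).symm
            exact congrArg (_ ≫ ·) (colimit.ι_desc ((tgtFunctor Φ).mapCocone s) j).symm)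
      w := (pushout.inl_desc _ _ _).symm }
  fac s j := by
    refine hom_ext (colimit.ι_desc _ _) ?_
    exact (comp_eq_right (pushout.inr_desc _ _ _)).trans (colimit.ι_desc _ _)
  uniq s m hm := by
    have h₁ : m.src = colimit.desc (D ⋙ srcFunctor Φ) ((srcFunctor Φ).mapCocone s) := by
      exact colimit.hom_ext fun j =>
        (congrArg Hom.src (hm j)).trans (colimit.ι_desc ((srcFunctor Φ).mapCocone s) j).symm
    refine hom_ext h₁ ?_
    refine pushout.hom_ext ?_ ?_
    · refine Eq.trans ?_ (pushout.inl_desc _ _ _).symm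
      exact m.w.symm.trans (congrArg (fun k => Φ.map k ≫ s.pt.str) h₁)
    · refine Eq.trans ?_ (pushout.inr_desc _ _ _).symm
      refine colimit.hom_ext fun j => ?_
      exact (Category.assoc _ _ _).symm.trans
        ((congrArg Hom.tgt (hm j)).trans (colimit.ι_desc ((tgtFunctor Φ).mapCocone s) j).symm)

instance : HasColimitsOfShape J (PreAlg Φ) where
  has_colimit D := ⟨⟨⟨_, colimIsColimit D⟩⟩⟩

instance : PreservesColimitsOfShape J (srcFunctor Φ) where
  preservesColimit {D} := preservesColimit_of_preserves_colimit_cocone (colimIsColimit D)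
    (colimit.isColimit (D ⋙ srcFunctor Φ))

end

variable {D} in
/-- A cocone of stages is a colimit as soon as its sources and its targets are, if `Φ` preserves
the colimit of the sources. -/
noncomputable def isColimitOfSrcTgt {c : Cocone D}
    (h₁ : IsColimit ((srcFunctor Φ).mapCocone c)) (h₂ : IsColimit ((tgtFunctor Φ).mapCocone c))
    (h₃ : IsColimit (Φ.mapCocone ((srcFunctor Φ).mapCocone c))) : IsColimit c where
  desc s :=
    { src := h₁.desc ((srcFunctor Φ).mapCocone s)
      tgt := h₂.desc ((tgtFunctor Φ).mapCocone s)
      w := by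
        refine h₃.hom_ext fun j => ?_
        have key : ∀ (d₁ : c.pt.src ⟶ s.pt.src) (d₂ : c.pt.tgt ⟶ s.pt.tgt),
            (c.ι.app j).src ≫ d₁ = (s.ι.app j).src → (c.ι.app j).tgt ≫ d₂ = (s.ι.app j).tgt →
            Φ.map (c.ι.app j).src ≫ Φ.map d₁ ≫ s.pt.str =
              Φ.map (c.ι.app j).src ≫ c.pt.str ≫ d₂ := by
          intro d₁ d₂ e₁ e₂
          rw [← Φ.map_comp_assoc, e₁]
          exact (s.ι.app j).w.trans ((congrArg (_ ≫ ·) e₂.symm).trans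
            ((reassoc_of% (Hom.w (t := c.pt) (c.ι.app j))) d₂).symm)
        exact key _ _ (h₁.fac ((srcFunctor Φ).mapCocone s) j)
          (h₂.fac ((tgtFunctor Φ).mapCocone s) j) }
  fac s j := hom_ext (h₁.fac ((srcFunctor Φ).mapCocone s) j)
    (h₂.fac ((tgtFunctor Φ).mapCocone s) j)
  uniq s m hm := hom_ext
    (h₁.uniq ((srcFunctor Φ).mapCocone s) m.src fun j => congrArg Hom.src (hm j))
    (h₂.uniq ((tgtFunctor Φ).mapCocone s) m.tgt fun j => congrArg Hom.tgt (hm j))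

instance [HasColimitsOfShape J C] [HasPushouts C] [PreservesColimitsOfShape J Φ] :
    PreservesColimitsOfShape J (tgtFunctor Φ) where
  preservesColimit {D} := by
    let c₂ : Cocone (D ⋙ tgtFunctor Φ) := colimit.cocone (D ⋙ tgtFunctor Φ)
    let h := isColimitOfPreserves Φ (colimit.isColimit (D ⋙ srcFunctor Φ))
    let k : Cocone ((D ⋙ srcFunctor Φ) ⋙ Φ) :=
      (Cocone.precompose (Functor.whiskerLeft D (strNat Φ))).obj c₂
    let c : Cocone D :=
      { pt := ⟨colimit (D ⋙ srcFunctor Φ), c₂.pt, h.desc k⟩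
        ι :=
          { app := fun j => ⟨colimit.ι (D ⋙ srcFunctor Φ) j, c₂.ι.app j, h.fac k j⟩
            naturality := fun i j f => hom_ext
              ((colimit.w (D ⋙ srcFunctor Φ) f).trans (Category.comp_id _).symm)
              (c₂.ι.naturality f) } }
    have hc : IsColimit c := isColimitOfSrcTgt (colimit.isColimit _) (colimit.isColimit _) h
    exact preservesColimit_of_preserves_colimit_cocone hc (colimit.isColimit _)

end Colimits

end PreAlg

end Multi

namespace Multi

section Iteration

open SmallObject Order

variable {T : Type u} [Category.{v} T] {F : T ⥤ T} (ε : 𝟭 T ⟶ F) (X₀ : T)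

/-- Iterating a pointed endofunctor, starting from an object. -/
abbrev iterStruct : SuccStruct T where
  X₀ := X₀
  succ X := F.obj X
  toSucc X := ε.app X

variable (J : Type w) [LinearOrder J] [OrderBot J] [SuccOrder J] [WellFoundedLT J]
  [HasIterationOfShape J T]

/-- The pointed object obtained by a long enough iteration of an accessible well-pointed
endofunctor is a fixed point. -/
theorem isIso_iteration [NoMaxOrder J] [PreservesColimitsOfShape J F]
    (wp : ∀ X, F.map (ε.app X) = ε.app (F.obj X)) :
    IsIso (ε.app ((iterStruct ε X₀).iteration J)) := by
  let S := iterStruct ε X₀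
  let D := S.iterationFunctor J
  let X := S.iteration J
  let ι : ∀ j, D.obj j ⟶ X := fun j => (S.iterationCocone J).ι.app j
  have hι : ∀ {i j} (f : i ⟶ j), D.map f ≫ ι j = ι i := fun f => (S.iterationCocone J).w f
  let e : ∀ j, D.obj (succ j) ≅ F.obj (D.obj j) :=
    fun j => S.iterationFunctorObjSuccIso j (not_isMax j)
  have he : ∀ j, D.map (homOfLE (le_succ j)) = ε.app (D.obj j) ≫ (e j).inv :=
    fun j => S.iterationFunctor_map_succ j (not_isMax j)
  have key : ∀ {i : J} {Z : T} (f : D.obj i ⟶ Z) (g : D.obj (succ i) ⟶ Z),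
      D.map (homOfLE (le_succ i)) ≫ g = f → F.map f = (e i).inv ≫ g ≫ ε.app Z := by
    intro i Z f g h
    have nat := ε.naturality ((e i).inv ≫ g)
    dsimp only [Functor.id_map] at nat
    rw [← h, he, Category.assoc, F.map_comp, wp, ← nat, Category.assoc]
  have hF := isColimitOfPreserves F (S.isColimitIterationCocone J)
  have nat : ∀ {i j : J} (f : i ⟶ j), F.map (D.map f) ≫ (e j).inv ≫ ι (succ j) =
      (e i).inv ≫ ι (succ i) := by
    intro i j f
    rcases (leOfHom f).eq_or_lt with rfl | h
    · rw [Subsingleton.elim f (𝟙 i), D.map_id, F.map_id, Category.id_comp]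
    · rw [key (D.map f) (D.map (homOfLE (succ_le_of_lt h)))
        ((D.map_comp _ _).symm.trans (congrArg D.map (Subsingleton.elim _ _))),
        Category.assoc, Category.assoc, ← Category.assoc (ε.app _), ← he, hι, hι]
  let c : Cocone (D ⋙ F) :=
    { pt := X
      ι :=
        { app := fun j => (e j).inv ≫ ι (succ j)
          naturality := fun i j f => (nat f).trans (Category.comp_id _).symm } }
  let r : F.obj X ⟶ X := hF.desc c
  have hr : ∀ j, F.map (ι j) ≫ r = (e j).inv ≫ ι (succ j) := fun j => hF.fac c j
  refine ⟨r, ?_, ?_⟩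
  · refine (S.isColimitIterationCocone J).hom_ext fun j => ?_
    change ι j ≫ ε.app X ≫ r = ι j ≫ 𝟙 X
    have n := ε.naturality (ι j)
    dsimp only [Functor.id_map] at n
    rw [← Category.assoc, n, Category.assoc, hr, ← Category.assoc, ← he, hι, Category.comp_id]
  · refine hF.hom_ext fun j => ?_
    change F.map (ι j) ≫ r ≫ ε.app X = F.map (ι j) ≫ 𝟙 _
    rw [← Category.assoc, hr, Category.comp_id, key (ι j) (ι (succ j)) (hι _), Category.assoc]

/-- A functor inverting the point of a pointed endofunctor inverts its iterations, if it preserves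
the colimits occurring in them. -/
theorem isIso_map_iteration {D : Type u'} [Category.{v'} D] (Ω : T ⥤ D)
    [PreservesWellOrderContinuousOfShape J Ω] [PreservesColimitsOfShape J Ω]
    (h : ∀ X, IsIso (Ω.map (ε.app X))) :
    IsIso (Ω.map ((iterStruct ε X₀).ιIteration J)) := by
  have t : ((MorphismProperty.isomorphisms D).inverseImage Ω).TransfiniteCompositionOfShape J
      ((iterStruct ε X₀).ιIteration J) :=
    ((iterStruct ε X₀).transfiniteCompositionOfShapeιIteration J).ofLE (by
      intro _ _ f hf
      obtain ⟨X⟩ := hf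
      exact h _)
  exact t.map.isIso

end Iteration

/-- The data presenting a class of algebras: an endofunctor `Φ` of operations with a unit, and a
functor `Ψ` of equations between operations and composites of two operations. -/
structure Presentation (C : Type u) [Category.{v} C] where
  Φ : C ⥤ C
  Ψ : C ⥤ C
  unit (A : C) : A ⟶ Φ.obj A
  unit_nat {A B : C} (f : A ⟶ B) : f ≫ unit B = unit A ≫ Φ.map f
  mul (A : C) : Ψ.obj A ⟶ Φ.obj A
  mul_nat {A B : C} (f : A ⟶ B) : Ψ.map f ≫ mul B = mul A ≫ Φ.map f
  sec (A : C) : Φ.obj A ⟶ Ψ.obj A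
  sec_mul (A : C) : sec A ≫ mul A = 𝟙 _
  act (t : PreAlg Φ) : Ψ.obj t.src ⟶ Φ.obj t.tgt
  act_nat {s t : PreAlg Φ} (f : s ⟶ t) : Ψ.map f.src ≫ act t = act s ≫ Φ.map f.tgt
  sec_act (t : PreAlg Φ) : sec t.src ≫ act t = Φ.map (unit t.src ≫ t.str)

namespace Presentation

variable {C : Type u} [Category.{v} C] (P : Presentation C)

attribute [simp] sec_mul sec_act

section Next

variable [HasCoequalizers C]

/-- The next stage. -/
noncomputable def nextObj (t : PreAlg P.Φ) : C :=
  coequalizer (P.act t) (P.mul t.src ≫ t.str ≫ P.unit t.tgt)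

/-- The action with values in the next stage. -/
noncomputable def nextπ (t : PreAlg P.Φ) : P.Φ.obj t.tgt ⟶ P.nextObj t :=
  coequalizer.π _ _

theorem next_condition (t : PreAlg P.Φ) :
    P.act t ≫ P.nextπ t = P.mul t.src ≫ t.str ≫ P.unit t.tgt ≫ P.nextπ t := by
  simpa using! coequalizer.condition (P.act t) (P.mul t.src ≫ t.str ≫ P.unit t.tgt)

variable {P} in
/-- Maps out of the next stage. -/
noncomputable def nextDesc {t : PreAlg P.Φ} {Z : C} (k : P.Φ.obj t.tgt ⟶ Z)
    (h : P.act t ≫ k = P.mul t.src ≫ t.str ≫ P.unit t.tgt ≫ k) : P.nextObj t ⟶ Z :=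
  coequalizer.desc k (by simpa using h)

@[simp]
theorem nextπ_desc {t : PreAlg P.Φ} {Z : C} (k : P.Φ.obj t.tgt ⟶ Z)
    (h : P.act t ≫ k = P.mul t.src ≫ t.str ≫ P.unit t.tgt ≫ k) :
    P.nextπ t ≫ nextDesc k h = k :=
  coequalizer.π_desc _ _

theorem next_ext {t : PreAlg P.Φ} {Z : C} {k l : P.nextObj t ⟶ Z}
    (h : P.nextπ t ≫ k = P.nextπ t ≫ l) : k = l :=
  coequalizer.hom_ext h

/-- The next stage is functorial. -/
noncomputable def nextMap {s t : PreAlg P.Φ} (f : s ⟶ t) : P.nextObj s ⟶ P.nextObj t :=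
  nextDesc (P.Φ.map f.tgt ≫ P.nextπ t) (by
    rw [← reassoc_of% P.act_nat, P.next_condition, reassoc_of% P.mul_nat, reassoc_of% f.w, reassoc_of% P.unit_nat])

@[simp]
theorem nextπ_map {s t : PreAlg P.Φ} (f : s ⟶ t) :
    P.nextπ s ≫ P.nextMap f = P.Φ.map f.tgt ≫ P.nextπ t :=
  P.nextπ_desc _ _

/-- The endofunctor on stages whose fixed points are the algebras. -/
@[simps] noncomputable def next : PreAlg P.Φ ⥤ PreAlg P.Φ where
  obj t := ⟨t.tgt, P.nextObj t, P.nextπ t⟩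
  map f := ⟨f.tgt, P.nextMap f, (P.nextπ_map f).symm⟩
  map_id t := PreAlg.hom_ext rfl (P.next_ext (by simp))
  map_comp {r s t} f g := PreAlg.hom_ext rfl (P.next_ext (by
    have e : P.nextπ r ≫ P.nextMap f ≫ P.nextMap g = P.Φ.map (f.tgt ≫ g.tgt) ≫ P.nextπ t := by
      rw [reassoc_of% (P.nextπ_map f), P.nextπ_map, P.Φ.map_comp, Category.assoc]
    exact (P.nextπ_map _).trans e.symm))

/-- The comparison of a stage with the next one. -/
@[simps] noncomputable def toNext : 𝟭 (PreAlg P.Φ) ⟶ P.next where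
  app t :=
    { src := P.unit t.src ≫ t.str
      tgt := P.unit t.tgt ≫ P.nextπ t
      w := by
        have h := congrArg (P.sec t.src ≫ ·) (P.next_condition t)
        rw [reassoc_of% P.sec_act, reassoc_of% P.sec_mul] at h
        exact h }
  naturality s t f := by
    refine PreAlg.hom_ext ?_ ?_
    · change f.src ≫ P.unit t.src ≫ t.str = (P.unit s.src ≫ s.str) ≫ f.tgt
      rw [reassoc_of% P.unit_nat, f.w, Category.assoc]
    · change f.tgt ≫ P.unit t.tgt ≫ P.nextπ t = (P.unit s.tgt ≫ P.nextπ s) ≫ P.nextMap f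
      rw [reassoc_of% P.unit_nat, Category.assoc, P.nextπ_map]

theorem next_map_toNext (t : PreAlg P.Φ) :
    P.next.map (P.toNext.app t) = P.toNext.app (P.next.obj t) := by
  refine PreAlg.hom_ext rfl (P.next_ext ?_)
  refine (P.nextπ_map _).trans ?_
  exact (P.toNext.app (P.next.obj t)).w

variable {J : Type*} [Category* J] [HasColimitsOfShape J C] [HasPushouts C]

instance [PreservesColimitsOfShape J P.Φ] [PreservesColimitsOfShape J P.Ψ] :
    PreservesColimitsOfShape J P.next where
  preservesColimit {D} := ⟨fun {c} hc => by
    have h₁ := isColimitOfPreserves (PreAlg.srcFunctor P.Φ) hc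
    have h₂ := isColimitOfPreserves (PreAlg.tgtFunctor P.Φ) hc
    have h₃ := isColimitOfPreserves P.Φ h₂
    have h₄ := isColimitOfPreserves P.Ψ h₁
    have ext₃ : ∀ {Z : C} {k l : P.Φ.obj c.pt.tgt ⟶ Z},
      (∀ j, P.Φ.map (c.ι.app j).tgt ≫ k = P.Φ.map (c.ι.app j).tgt ≫ l) → k = l :=
        fun h => h₃.hom_ext h
    have ext₄ : ∀ {Z : C} {k l : P.Ψ.obj c.pt.src ⟶ Z},
      (∀ j, P.Ψ.map (c.ι.app j).src ≫ k = P.Ψ.map (c.ι.app j).src ≫ l) → k = l :=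
        fun h => h₄.hom_ext h
    have desc₃ : ∀ (Z : C) (k : ∀ j, P.Φ.obj (D.obj j).tgt ⟶ Z),
        (∀ {i j} (f : i ⟶ j), P.Φ.map (D.map f).tgt ≫ k j = k i) →
        ∃ l : P.Φ.obj c.pt.tgt ⟶ Z, ∀ j, P.Φ.map (c.ι.app j).tgt ≫ l = k j := by
      intro Z k hk
      exact ⟨h₃.desc ⟨Z, ⟨k, fun i j f => (hk f).trans (Category.comp_id _).symm⟩⟩,
        fun j => h₃.fac _ j⟩
    refine ⟨PreAlg.isColimitOfSrcTgt h₂ ?_ h₃⟩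
    have ex : ∀ s : Cocone ((D ⋙ P.next) ⋙ PreAlg.tgtFunctor P.Φ),
        ∃ l : P.nextObj c.pt ⟶ s.pt, ∀ j, P.nextMap (c.ι.app j) ≫ l = s.ι.app j := by
      intro s
      have hs : ∀ {i j} (f : i ⟶ j), P.nextMap (D.map f) ≫ s.ι.app j = s.ι.app i :=
        fun f => s.w f
      obtain ⟨l, hl⟩ := desc₃ s.pt (fun j => P.nextπ (D.obj j) ≫ s.ι.app j) (fun {i j} f => by
        exact ((reassoc_of% (P.nextπ_map (D.map f))) _).symm.trans (congrArg (_ ≫ ·) (hs f)))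
      refine ⟨nextDesc l (ext₄ fun j => ?_), fun j => P.next_ext ?_⟩
      · have n₁ := (reassoc_of% (P.act_nat (t := c.pt) (c.ι.app j))) l
        have n₂ := (reassoc_of% (P.mul_nat (c.ι.app j).src)) (c.pt.str ≫ P.unit c.pt.tgt ≫ l)
        have n₃ := (reassoc_of% (PreAlg.Hom.w (t := c.pt) (c.ι.app j))) (P.unit c.pt.tgt ≫ l)
        have n₄ := (reassoc_of% (P.unit_nat (c.ι.app j).tgt)) l
        refine n₁.trans (Eq.trans ?_ n₂.symm)
        refine Eq.trans ?_ (congrArg (_ ≫ ·) n₃.symm)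
        refine (congrArg (_ ≫ ·) (hl j)).trans ?_
        refine Eq.trans ?_ (congrArg (fun z => _ ≫ _ ≫ z) (n₄.trans (congrArg (_ ≫ ·) (hl j))).symm)
        exact (reassoc_of% (P.next_condition (D.obj j))) _
      · refine ((reassoc_of% (P.nextπ_map (t := c.pt) (c.ι.app j))) _).trans ?_
        exact (congrArg (_ ≫ ·) (P.nextπ_desc _ _)).trans (hl j)
    choose l hl using ex
    refine ⟨l, hl, fun s m hm => P.next_ext (ext₃ fun j => ?_)⟩
    have := (hm j).trans (hl s j).symm
    exact ((reassoc_of% (P.nextπ_map (t := c.pt) (c.ι.app j))) m).symm.trans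
      ((congrArg (P.nextπ (D.obj j) ≫ ·) this).trans
        ((reassoc_of% (P.nextπ_map (t := c.pt) (c.ι.app j))) _))⟩

end Next

/-- A `P`-algebra valued in a further category: an object `X` of `D` together with an extension
operation from maps `K A ⟶ X` to maps `K (Φ A) ⟶ X`. -/
structure Target {D : Type u'} [Category.{v'} D] (K : C ⥤ D) where
  obj : D
  ext {A : C} (x : K.obj A ⟶ obj) : K.obj (P.Φ.obj A) ⟶ obj
  ext_nat {A B : C} (f : A ⟶ B) (x : K.obj B ⟶ obj) :
    ext (K.map f ≫ x) = K.map (P.Φ.map f) ≫ ext x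
  unit_ext {A : C} (x : K.obj A ⟶ obj) : K.map (P.unit A) ≫ ext x = x
  act_ext (t : PreAlg P.Φ) (h : K.obj t.tgt ⟶ obj)
    (w : K.map t.str ≫ h = ext (K.map (P.unit t.src ≫ t.str) ≫ h)) :
    K.map (P.act t) ≫ ext h = K.map (P.mul t.src) ≫ ext (K.map (P.unit t.src ≫ t.str) ≫ h)

namespace Target

variable {P} {D : Type u'} [Category.{v'} D] {K : C ⥤ D} (X : P.Target K)

/-- The compatibility of a map from a stage to a target with the actions. -/
def IsMap (t : PreAlg P.Φ) (h : K.obj t.tgt ⟶ X.obj) : Prop :=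
  K.map t.str ≫ h = X.ext (K.map (P.unit t.src ≫ t.str) ≫ h)

variable {X} in
theorem IsMap.comp {s t : PreAlg P.Φ} (f : s ⟶ t) {h : K.obj t.tgt ⟶ X.obj} (hh : X.IsMap t h) :
    X.IsMap s (K.map f.tgt ≫ h) := by
  unfold IsMap at hh ⊢
  have e : (P.unit s.src ≫ s.str) ≫ f.tgt = f.src ≫ P.unit t.src ≫ t.str := by
    rw [reassoc_of% P.unit_nat, f.w, Category.assoc]
  have e' : K.map (P.unit s.src ≫ s.str) ≫ K.map f.tgt ≫ h =
      K.map f.src ≫ K.map (P.unit t.src ≫ t.str) ≫ h := by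
    rw [← Category.assoc, ← K.map_comp, e, K.map_comp, Category.assoc]
  rw [e', X.ext_nat, ← hh, ← Category.assoc, ← Category.assoc, ← K.map_comp, ← K.map_comp, f.w]

/-- The functor of maps from stages to a target. -/
def maps : (PreAlg P.Φ)ᵒᵖ ⥤ Type v' where
  obj t := { h : K.obj t.unop.tgt ⟶ X.obj // X.IsMap t.unop h }
  map f := ↾fun h => ⟨K.map f.unop.tgt ≫ h.1, h.2.comp f.unop⟩
  map_id t := by
    ext h
    exact congrArg (· ≫ h.1) (K.map_id t.unop.tgt) |>.trans (Category.id_comp h.1)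
  map_comp f g := by
    ext h
    exact congrArg (· ≫ h.1) (K.map_comp g.unop.tgt f.unop.tgt) |>.trans
      (Category.assoc _ _ h.1)

theorem isMap_next_iff [HasCoequalizers C] {t : PreAlg P.Φ} (k : K.obj (P.nextObj t) ⟶ X.obj) :
    X.IsMap (P.next.obj t) k ↔
      K.map (P.nextπ t) ≫ k = X.ext (K.map (P.unit t.tgt ≫ P.nextπ t) ≫ k) := Iff.rfl

theorem existsUnique_next [HasCoequalizers C] [PreservesColimitsOfShape WalkingParallelPair K]
    (t : PreAlg P.Φ) (h : K.obj t.tgt ⟶ X.obj) (hh : X.IsMap t h) :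
    ∃! k : K.obj (P.nextObj t) ⟶ X.obj, X.IsMap (P.next.obj t) k ∧
      K.map (P.unit t.tgt ≫ P.nextπ t) ≫ k = h := by
  have hc := isColimitOfHasCoequalizerOfPreservesColimit K (P.act t)
    (P.mul t.src ≫ t.str ≫ P.unit t.tgt)
  have w : K.map (P.act t) ≫ X.ext h =
      K.map (P.mul t.src ≫ t.str ≫ P.unit t.tgt) ≫ X.ext h := by
    have hh' : K.map t.str ≫ h = X.ext (K.map (P.unit t.src ≫ t.str) ≫ h) := hh
    rw [X.act_ext t h hh, ← hh', K.map_comp, K.map_comp, Category.assoc, Category.assoc,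
      X.unit_ext]
  have ex : ∃ k : K.obj (P.nextObj t) ⟶ X.obj, K.map (P.nextπ t) ≫ k = X.ext h :=
    ⟨Cofork.IsColimit.desc hc _ w, Cofork.IsColimit.π_desc' hc _ w⟩
  obtain ⟨k, hk⟩ := ex
  have hk' : K.map (P.unit t.tgt ≫ P.nextπ t) ≫ k = h := by
    rw [K.map_comp, Category.assoc, hk, X.unit_ext]
  refine ⟨k, ⟨?_, hk'⟩, fun l hl => ?_⟩
  · rw [isMap_next_iff, hk', hk]
  · have h₁ := (X.isMap_next_iff l).1 hl.1
    rw [hl.2] at h₁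
    exact Cofork.IsColimit.hom_ext hc (h₁.trans hk.symm)

theorem isIso_toNext [HasCoequalizers C] [PreservesColimitsOfShape WalkingParallelPair K]
    (t : PreAlg P.Φ) : IsIso (X.maps.rightOp.map (P.toNext.app t)) := by
  have : IsIso (X.maps.map (P.toNext.app t).op) := by
    rw [isIso_iff_bijective]
    refine ⟨fun a b hab => ?_, fun h => ?_⟩
    · obtain ⟨k, -, hk⟩ := X.existsUnique_next t _ (a.2.comp (P.toNext.app t))
      exact Subtype.ext ((hk a.1 ⟨a.2, rfl⟩).trans
        (hk b.1 ⟨b.2, (congrArg Subtype.val hab).symm⟩).symm)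
    · obtain ⟨k, hk, -⟩ := X.existsUnique_next t h.1 h.2
      exact ⟨⟨k, hk.1⟩, Subtype.ext hk.2⟩
  change IsIso (X.maps.map (P.toNext.app t).op).op
  infer_instance

section

variable {J : Type*} [Category* J] [HasColimitsOfShape J C] [HasPushouts C]
  [PreservesColimitsOfShape J K] [PreservesColimitsOfShape WalkingSpan K]

theorem existsUnique_colim (D : J ⥤ PreAlg P.Φ) (h : ∀ j, K.obj (D.obj j).tgt ⟶ X.obj)
    (hh : ∀ j, X.IsMap (D.obj j) (h j))
    (nat : ∀ {i j} (f : i ⟶ j), K.map (D.map f).tgt ≫ h j = h i) :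
    ∃! k : K.obj (PreAlg.colim D).tgt ⟶ X.obj, X.IsMap (PreAlg.colim D) k ∧
      ∀ j, K.map ((PreAlg.colimCocone D).ι.app j).tgt ≫ k = h j := by
  let D₁ := D ⋙ PreAlg.srcFunctor P.Φ
  let D₂ := D ⋙ PreAlg.tgtFunctor P.Φ
  have h₁ := isColimitOfPreserves K (colimit.isColimit D₁)
  have h₂ := isColimitOfPreserves K (colimit.isColimit D₂)
  have hp := isColimitOfHasPushoutOfPreservesColimit K (colimit.post D₁ P.Φ)
    (colimMap (Functor.whiskerLeft D (PreAlg.strNat P.Φ)))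
  let a := PreAlg.colim D
  let ι : ∀ j, D.obj j ⟶ a := (PreAlg.colimCocone D).ι.app
  let q : colimit D₂ ⟶ a.tgt := pushout.inr _ _
  have ext₁ : ∀ {k l : K.obj a.src ⟶ X.obj},
      (∀ j, K.map (ι j).src ≫ k = K.map (ι j).src ≫ l) → k = l := fun w => h₁.hom_ext w
  have ex : ∃ k : K.obj (colimit D₂) ⟶ X.obj, ∀ j, K.map (colimit.ι D₂ j) ≫ k = h j :=
    ⟨h₂.desc ⟨X.obj, ⟨h, fun i j f => (nat f).trans (Category.comp_id _).symm⟩⟩, h₂.fac _⟩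
  obtain ⟨k₂, hk₂⟩ := ex
  have ex : ∃ k : K.obj a.src ⟶ X.obj,
      ∀ j, K.map (ι j).src ≫ k = K.map (P.unit (D.obj j).src ≫ (D.obj j).str) ≫ h j := by
    refine ⟨h₁.desc ⟨X.obj, ⟨fun j => K.map (P.unit (D.obj j).src ≫ (D.obj j).str) ≫ h j,
      fun i j f => ?_⟩⟩, h₁.fac _⟩
    refine Eq.trans ?_ (Category.comp_id _).symm
    have e : (D.map f).src ≫ P.unit (D.obj j).src ≫ (D.obj j).str =
        (P.unit (D.obj i).src ≫ (D.obj i).str) ≫ (D.map f).tgt := by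
      rw [reassoc_of% P.unit_nat, (D.map f).w, Category.assoc]
    change K.map (D.map f).src ≫ K.map _ ≫ h j = _
    rw [← Category.assoc, ← K.map_comp, e, K.map_comp, Category.assoc, nat]
  obtain ⟨x, hx⟩ := ex
  have h₃ := isColimitOfPreserves K (colimit.isColimit (D₁ ⋙ P.Φ))
  have w : K.map (colimit.post D₁ P.Φ) ≫ X.ext x =
      K.map (colimMap (Functor.whiskerLeft D (PreAlg.strNat P.Φ))) ≫ k₂ := by
    refine h₃.hom_ext fun j => ?_
    have e₁ : K.map (colimit.ι (D₁ ⋙ P.Φ) j) ≫ K.map (colimit.post D₁ P.Φ) =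
        K.map (P.Φ.map (ι j).src) := by
      rw [← K.map_comp]
      exact congrArg K.map (colimit.ι_post D₁ P.Φ j)
    have e₂ : K.map (colimit.ι (D₁ ⋙ P.Φ) j) ≫
        K.map (colimMap (Functor.whiskerLeft D (PreAlg.strNat P.Φ))) =
        K.map (D.obj j).str ≫ K.map (colimit.ι D₂ j) := by
      rw [← K.map_comp, ← K.map_comp]
      exact congrArg K.map (ι_colimMap _ j)
    have e₃ : K.map (D.obj j).str ≫ h j = X.ext (K.map (P.unit _ ≫ (D.obj j).str) ≫ h j) := hh j
    refine (comp_eq_left e₁).trans ?_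
    refine Eq.trans ?_ ((congrArg (· ≫ _) e₂.symm).trans (Category.assoc _ _ _))
    rw [Category.assoc, hk₂, e₃, ← hx, X.ext_nat]
    rfl
  have ex : ∃ k : K.obj a.tgt ⟶ X.obj, K.map a.str ≫ k = X.ext x ∧ K.map q ≫ k = k₂ :=
    ⟨_, PushoutCocone.IsColimit.inl_desc hp _ _ w, PushoutCocone.IsColimit.inr_desc hp _ _ w⟩
  obtain ⟨k, hk₁, hk₃⟩ := ex
  have hkx : K.map (P.unit a.src ≫ a.str) ≫ k = x := by
    rw [K.map_comp, Category.assoc, hk₁, X.unit_ext]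
  have hι : ∀ j, (ι j).tgt = colimit.ι D₂ j ≫ q := fun j => rfl
  refine ⟨k, ⟨?_, fun j => ?_⟩, fun l hl => ?_⟩
  · exact hk₁.trans (congrArg X.ext hkx.symm)
  · change K.map (ι j).tgt ≫ k = h j
    rw [hι, K.map_comp, Category.assoc, hk₃, hk₂]
  · have hl₂ : ∀ j, K.map (ι j).tgt ≫ l = h j := hl.2
    have hl₁ : K.map a.str ≫ l = X.ext (K.map (P.unit a.src ≫ a.str) ≫ l) := hl.1
    refine PushoutCocone.IsColimit.hom_ext hp ?_ ?_
    · refine Eq.trans ?_ hk₁.symm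
      refine hl₁.trans (congrArg X.ext (ext₁ fun j => ?_))
      have e : (ι j).src ≫ P.unit a.src ≫ a.str =
          (P.unit (D.obj j).src ≫ (D.obj j).str) ≫ (ι j).tgt := by
        rw [reassoc_of% P.unit_nat, (ι j).w, Category.assoc]
      rw [hx, ← Category.assoc, ← K.map_comp, e, K.map_comp, Category.assoc, hl₂]
    · refine Eq.trans ?_ hk₃.symm
      refine h₂.hom_ext fun j => ?_
      have := hl₂ j
      rw [hι, K.map_comp, Category.assoc] at this
      exact this.trans (hk₂ j).symm

instance : PreservesColimitsOfShape J X.maps.rightOp where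
  preservesColimit {D} := by
    refine preservesColimit_of_preserves_colimit_cocone (PreAlg.colimIsColimit D) ?_
    have ex : ∀ (s : Cocone (D ⋙ X.maps.rightOp)) (x : s.pt.unop),
        ∃! k : K.obj (PreAlg.colim D).tgt ⟶ X.obj, X.IsMap (PreAlg.colim D) k ∧
          ∀ j, K.map ((PreAlg.colimCocone D).ι.app j).tgt ≫ k =
            Subtype.val ((s.ι.app j).unop x : X.maps.obj (Opposite.op (D.obj j))) := by
      intro s x
      refine X.existsUnique_colim D _ (fun j => Subtype.prop
        ((s.ι.app j).unop x : X.maps.obj (Opposite.op (D.obj j)))) (fun {i j} f => ?_)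
      have := congrArg Quiver.Hom.unop (s.w f)
      exact congrArg Subtype.val (ConcreteCategory.congr_hom this x)
    choose k hk huk using ex
    exact
      { desc := fun s => Quiver.Hom.op (↾fun x => ⟨k s x, (hk s x).1⟩)
        fac := fun s j => by
          apply Quiver.Hom.unop_inj
          ext x
          exact Subtype.ext ((hk s x).2 j)
        uniq := fun s m hm => by
          apply Quiver.Hom.unop_inj
          ext x
          refine Subtype.ext (huk s x _ ⟨Subtype.prop
            (m.unop x : X.maps.obj (Opposite.op (PreAlg.colim D))), fun j => ?_⟩)
          have := congrArg Quiver.Hom.unop (hm j)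
          exact congrArg Subtype.val (ConcreteCategory.congr_hom this x) }

end

end Target

/-- The initial stage. -/
noncomputable abbrev initialStage [HasInitial C] : PreAlg P.Φ := ⟨⊥_ C, P.Φ.obj (⊥_ C), 𝟙 _⟩

theorem Target.existsUnique_initialStage [HasInitial C] {D : Type u'} [Category.{v'} D] {K : C ⥤ D}
    [PreservesColimit (Functor.empty.{0} C) K] (X : P.Target K) :
    ∃! h : K.obj P.initialStage.tgt ⟶ X.obj, X.IsMap P.initialStage h := by
  have hi : IsInitial (K.obj (⊥_ C)) := IsInitial.isInitialObj K _ initialIsInitial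
  refine ⟨X.ext (hi.to _), ?_, fun h hh => ?_⟩
  · change K.map (𝟙 _) ≫ X.ext _ = X.ext _
    rw [K.map_id, Category.id_comp]
    exact congrArg X.ext (hi.hom_ext _ _)
  · have h' : K.map (𝟙 _) ≫ h = X.ext _ := hh
    rw [K.map_id, Category.id_comp] at h'
    exact h'.trans (congrArg X.ext (hi.hom_ext _ _))

/-- The initial algebra of an accessible presentation, with its universal property with respect to
algebras valued in other categories. -/
theorem exists_initial (J : Type w) [LinearOrder J] [OrderBot J] [SuccOrder J] [WellFoundedLT J]
    [NoMaxOrder J] [HasColimitsOfSize.{w, w} C] [PreservesColimitsOfShape J P.Φ]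
    [PreservesColimitsOfShape J P.Ψ] :
    ∃ (G : C) (g : P.Φ.obj G ⟶ G), P.unit G ≫ g = 𝟙 G ∧
      P.act ⟨G, G, g⟩ ≫ g = P.mul G ≫ g ∧
      ∀ {D : Type u'} [Category.{v'} D] (K : C ⥤ D) [PreservesColimitsOfSize.{w, w} K]
        (X : P.Target K), ∃! h : K.obj G ⟶ X.obj, K.map g ≫ h = X.ext h := by
  have : HasFiniteColimits C := hasFiniteColimits_of_hasColimitsOfSize C
  have : HasIterationOfShape J (PreAlg P.Φ) :=
    { hasColimitsOfShape_of_isSuccLimit := fun _ _ => inferInstance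
      hasColimitsOfShape := inferInstance }
  let S := iterStruct P.toNext P.initialStage
  let t := S.iteration J
  have hfix : IsIso (P.toNext.app t) := isIso_iteration P.toNext P.initialStage J P.next_map_toNext
  have h₁ : IsIso (P.unit t.src ≫ t.str) :=
    @Functor.map_isIso _ _ _ _ _ _ (PreAlg.srcFunctor P.Φ) (P.toNext.app t) hfix
  have h₂ : IsIso (P.unit t.tgt ≫ P.nextπ t) :=
    @Functor.map_isIso _ _ _ _ _ _ (PreAlg.tgtFunctor P.Φ) (P.toNext.app t) hfix
  let f := P.unit t.src ≫ t.str
  let g : P.Φ.obj t.src ⟶ t.src := t.str ≫ inv f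
  let a : PreAlg P.Φ := ⟨t.src, t.src, g⟩
  let i : t ⟶ a := ⟨𝟙 _, inv f, by rw [P.Φ.map_id, Category.id_comp]⟩
  let i' : a ⟶ t := ⟨𝟙 _, f, by
    change P.Φ.map (𝟙 _) ≫ t.str = (t.str ≫ inv f) ≫ f
    rw [P.Φ.map_id, Category.id_comp, Category.assoc, IsIso.inv_hom_id, Category.comp_id]⟩
  have hg : P.unit t.src ≫ g = 𝟙 _ :=
    (Category.assoc _ _ _).symm.trans (IsIso.hom_inv_id f)
  refine ⟨t.src, g, hg, ?_, ?_⟩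
  · have e₁ : P.act a = P.act t ≫ P.Φ.map (inv f) := by
      have := P.act_nat i
      rwa [show P.Ψ.map i.src = 𝟙 _ from P.Ψ.map_id _, Category.id_comp] at this
    have e₂ : P.Φ.map (inv f) ≫ t.str ≫ P.unit t.tgt ≫ P.nextπ t = P.nextπ t := by
      have h : P.Φ.map f ≫ P.nextπ t = t.str ≫ P.unit t.tgt ≫ P.nextπ t := (P.toNext.app t).w
      rw [← h, ← Category.assoc, ← P.Φ.map_comp, IsIso.inv_hom_id, P.Φ.map_id, Category.id_comp]
    have e₃ : P.act t ≫ P.Φ.map (inv f) ≫ t.str = P.mul t.src ≫ t.str := by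
      rw [← cancel_mono (P.unit t.tgt ≫ P.nextπ t), Category.assoc, Category.assoc, e₂,
        P.next_condition, Category.assoc]
    change P.act a ≫ t.str ≫ inv f = P.mul t.src ≫ t.str ≫ inv f
    rw [e₁, Category.assoc, reassoc_of% e₃]
  · intro D _ K _ X
    have : PreservesFiniteColimits K := PreservesColimitsOfSize.preservesFiniteColimits K
    have : PreservesWellOrderContinuousOfShape J X.maps.rightOp := ⟨fun _ _ => inferInstance⟩
    have hiso : IsIso (X.maps.rightOp.map (S.ιIteration J)) :=
      isIso_map_iteration P.toNext P.initialStage J X.maps.rightOp X.isIso_toNext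
    have hbij : Function.Bijective (X.maps.map (S.ιIteration J).op) := by
      have : IsIso (X.maps.map (S.ιIteration J).op) := (isIso_op_iff _).1 hiso
      exact (isIso_iff_bijective _).1 this
    have hmap : ∀ k : K.obj t.src ⟶ X.obj, X.IsMap a k ↔ K.map g ≫ k = X.ext k := by
      intro k
      have : K.map (P.unit a.src ≫ a.str) ≫ k = k := by
        change K.map (P.unit t.src ≫ g) ≫ k = k
        rw [hg, K.map_id, Category.id_comp]
      unfold Target.IsMap
      rw [this]
    obtain ⟨h₀, hh₀, hu₀⟩ := X.existsUnique_initialStage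
    obtain ⟨h, hh⟩ := hbij.2 ⟨h₀, hh₀⟩
    refine ⟨K.map f ≫ h.1, (hmap _).1 (h.2.comp i'), fun k hk => ?_⟩
    have hk' := ((hmap k).2 hk).comp i
    have : (⟨_, hk'⟩ : X.maps.obj (Opposite.op t)) = h := by
      refine hbij.1 (Eq.trans ?_ hh.symm)
      exact Subtype.ext (hu₀ _ (hk'.comp (S.ιIteration J)))
    have e : K.map (inv f) ≫ k = h.1 := congrArg Subtype.val this
    rw [← e, ← Category.assoc, ← K.map_comp, IsIso.hom_inv_id, K.map_id, Category.id_comp]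

end Presentation

end Multi

namespace Multi

section Pi

variable {W : Type w} {V : Type u} [Category.{v} V] {J : Type*} [Category* J]

/-- Cocones in a category of families are colimits if they are so pointwise. -/
noncomputable def piIsColimit {D : J ⥤ (W → V)} {c : Cocone D}
    (h : ∀ w, IsColimit ((Pi.eval (fun _ : W => V) w).mapCocone c)) : IsColimit c where
  desc s w := (h w).desc ((Pi.eval (fun _ : W => V) w).mapCocone s)
  fac s j := funext fun w => (h w).fac ((Pi.eval (fun _ : W => V) w).mapCocone s) j
  uniq s m hm := funext fun w => (h w).uniq ((Pi.eval (fun _ : W => V) w).mapCocone s) (m w)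
    fun j => congrFun (hm j) w

/-- The pointwise colimit of a diagram of families. -/
noncomputable def piColimitCocone [HasColimitsOfShape J V] (D : J ⥤ (W → V)) : Cocone D where
  pt w := colimit (D ⋙ Pi.eval (fun _ : W => V) w)
  ι :=
    { app := fun j w => colimit.ι (D ⋙ Pi.eval (fun _ : W => V) w) j
      naturality := fun i j f => funext fun w =>
        (colimit.w (D ⋙ Pi.eval (fun _ : W => V) w) f).trans (Category.comp_id _).symm }

noncomputable def piColimitCoconeIsColimit [HasColimitsOfShape J V] (D : J ⥤ (W → V)) :
    IsColimit (piColimitCocone D) :=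
  piIsColimit fun w => IsColimit.ofIsoColimit
    (colimit.isColimit (D ⋙ Pi.eval (fun _ : W => V) w))
    (Cocone.ext (Iso.refl _) fun _ => Category.comp_id _)

instance [HasColimitsOfShape J V] : HasColimitsOfShape J (W → V) :=
  ⟨fun D => ⟨⟨⟨_, piColimitCoconeIsColimit D⟩⟩⟩⟩

instance [HasColimitsOfSize.{w', w'} V] : HasColimitsOfSize.{w', w'} (W → V) := ⟨inferInstance⟩

instance [HasColimitsOfShape J V] (w : W) :
    PreservesColimitsOfShape J (Pi.eval (fun _ : W => V) w) where
  preservesColimit {D} := preservesColimit_of_preserves_colimit_cocone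
    (piColimitCoconeIsColimit D) (IsColimit.ofIsoColimit
      (colimit.isColimit (D ⋙ Pi.eval (fun _ : W => V) w))
      (Cocone.ext (Iso.refl _) fun _ => Category.comp_id _))

theorem preservesColimitsOfShape_pi {C : Type*} [Category* C] (F : C ⥤ (W → V))
    (h : ∀ w, PreservesColimitsOfShape J (F ⋙ Pi.eval (fun _ : W => V) w)) :
    PreservesColimitsOfShape J F where
  preservesColimit := ⟨fun {_} hc => ⟨piIsColimit fun w =>
    isColimitOfPreserves (F ⋙ Pi.eval (fun _ : W => V) w) hc⟩⟩

/-- Reindexing families. -/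
abbrev piComap {W' : Type w'} (π : W' → W) : (W → V) ⥤ (W' → V) where
  obj X w := X (π w)
  map f w := f (π w)

instance {W' : Type w'} [HasColimitsOfSize.{v', v'} V] (π : W' → W) :
    PreservesColimitsOfSize.{v', v'} (piComap (V := V) π) where
  preservesColimitsOfShape := preservesColimitsOfShape_pi _ fun w =>
    inferInstanceAs (PreservesColimitsOfShape _ (Pi.eval (fun _ : W => V) (π w)))

end Pi

namespace Seq

section

variable {V : Type u} [Category.{v} V]

@[simp] theorem consHom_comp_consHom {X Y Z : V} {l m n : Seq V} (f : X ⟶ Y) (g : Y ⟶ Z)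
    (f' : l ⟶ m) (g' : m ⟶ n) : consHom f f' ≫ consHom g g' = consHom (f ≫ g) (f' ≫ g') := rfl

theorem consHom_inj {X Y : V} {l m : Seq V} {f f' : X ⟶ Y} {g g' : l ⟶ m}
    (h : consHom f g = consHom f' g') : f = f' ∧ g = g' :=
  Prod.ext_iff.1 h

theorem exists_consHom {X Y : V} {l m : Seq V} (h : cons X l ⟶ cons Y m) :
    ∃ f g, h = consHom f g := ⟨h.1, h.2, rfl⟩

theorem nil_hom_ext {l : Seq V} (f g : nil ⟶ l) : f = g := by
  cases l with
  | nil => rfl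
  | cons Y m => exact (f : PEmpty).elim

theorem exists_cons_of_hom {X : V} {l m : Seq V} (h : cons X l ⟶ m) : ∃ Y m', m = cons Y m' := by
  cases m with
  | nil => exact (h : PEmpty).elim
  | cons Y m => exact ⟨Y, m, rfl⟩

variable {J : Type*} [Category* J] {C : Type*} [Category* C]

/-- Prefixing a functor to sequences by a functor. -/
abbrev consFunctor (F : C ⥤ V) (T : C ⥤ Seq V) : C ⥤ Seq V where
  obj c := cons (F.obj c) (T.obj c)
  map f := consHom (F.map f) (T.map f)
  map_id c := by rw [F.map_id, T.map_id]; rfl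
  map_comp f g := by rw [F.map_comp, T.map_comp]; rfl

instance [Nonempty J] (F : C ⥤ V) (T : C ⥤ Seq V) [PreservesColimitsOfShape J F]
    [PreservesColimitsOfShape J T] : PreservesColimitsOfShape J (consFunctor F T) where
  preservesColimit {D} := ⟨fun {c} hc => by
    have h₁ := isColimitOfPreserves F hc
    have h₂ := isColimitOfPreserves T hc
    have ex : ∀ s : Cocone (D ⋙ consFunctor F T), ∃ k : cons (F.obj c.pt) (T.obj c.pt) ⟶ s.pt,
        (∀ j, consHom (F.map (c.ι.app j)) (T.map (c.ι.app j)) ≫ k = s.ι.app j) ∧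
        ∀ k', (∀ j, consHom (F.map (c.ι.app j)) (T.map (c.ι.app j)) ≫ k' = s.ι.app j) →
          k' = k := by
      intro s
      obtain ⟨X, ι⟩ := s
      obtain ⟨j₀⟩ := ‹Nonempty J›
      obtain ⟨Y, m, rfl⟩ := exists_cons_of_hom (ι.app j₀)
      have hι : ∀ j, ∃ f g, ι.app j = consHom f g := fun j => exists_consHom (ι.app j)
      choose f g hfg using hι
      have nat : ∀ {i j} (a : i ⟶ j), consHom (F.map (D.map a)) (T.map (D.map a)) ≫
          consHom (f j) (g j) = consHom (f i) (g i) := by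
        intro i j a
        rw [← hfg, ← hfg]
        exact (ι.naturality a).trans (Category.comp_id _)
      have u₁ : ∃ k : F.obj c.pt ⟶ Y, ∀ j, F.map (c.ι.app j) ≫ k = f j :=
        ⟨h₁.desc ⟨Y, ⟨f, fun i j a => (consHom_inj (nat a)).1.trans (Category.comp_id _).symm⟩⟩,
          h₁.fac _⟩
      have u₂ : ∃ k : T.obj c.pt ⟶ m, ∀ j, T.map (c.ι.app j) ≫ k = g j :=
        ⟨h₂.desc ⟨m, ⟨g, fun i j a => (consHom_inj (nat a)).2.trans (Category.comp_id _).symm⟩⟩,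
          h₂.fac _⟩
      obtain ⟨k₁, hk₁⟩ := u₁
      obtain ⟨k₂, hk₂⟩ := u₂
      refine ⟨consHom k₁ k₂, fun j => ?_, fun k' hk' => ?_⟩
      · rw [consHom_comp_consHom, hk₁, hk₂]
        exact (hfg j).symm
      · obtain ⟨a, b, rfl⟩ := exists_consHom k'
        have hab : ∀ j, consHom (F.map (c.ι.app j) ≫ a) (T.map (c.ι.app j) ≫ b) =
            consHom (f j) (g j) := fun j => (hk' j).trans (hfg j)
        exact congrArg₂ consHom
          (h₁.hom_ext fun j => (consHom_inj (hab j)).1.trans (hk₁ j).symm)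
          (h₂.hom_ext fun j => (consHom_inj (hab j)).2.trans (hk₂ j).symm)
    choose k hk huk using ex
    exact ⟨⟨k, hk, huk⟩⟩⟩

instance [Nonempty J] : PreservesColimitsOfShape J ((Functor.const C).obj (nil : Seq V)) where
  preservesColimit {D} := ⟨fun {c} hc => by
    obtain ⟨j₀⟩ := ‹Nonempty J›
    exact ⟨⟨fun s => s.ι.app j₀, fun s j => nil_hom_ext _ _, fun s m hm => nil_hom_ext _ _⟩⟩⟩

/-- The morphism of sequences with given entries. -/
def homMap {ι : Type*} {f g : ι → V} (x : ∀ i, f i ⟶ g i) :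
    ∀ l : List ι, ((l.map f : Seq V) ⟶ l.map g)
  | [] => 𝟙 nil
  | i :: l => consHom (x i) (homMap x l)

@[simp] theorem homMap_id {ι : Type*} (f : ι → V) (l : List ι) :
    homMap (fun i => 𝟙 (f i)) l = 𝟙 (l.map f : Seq V) := by
  induction l with
  | nil => rfl
  | cons i l ih => exact congrArg (consHom (𝟙 _)) ih

theorem homMap_comp {ι : Type*} {f g h : ι → V} (x : ∀ i, f i ⟶ g i) (y : ∀ i, g i ⟶ h i)
    (l : List ι) : homMap (fun i => x i ≫ y i) l = homMap x l ≫ homMap y l := by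
  induction l with
  | nil => rfl
  | cons i l ih => exact congrArg (consHom (x i ≫ y i)) ih

/-- The functor with values in sequences defined by a sequence of functors. -/
abbrev tuple {ι : Type*} (F : ι → C ⥤ V) (l : List ι) : C ⥤ Seq V where
  obj c := l.map fun i => (F i).obj c
  map f := homMap (fun i => (F i).map f) l
  map_id c := by simp
  map_comp f g := by simp only [Functor.map_comp, homMap_comp]

instance preservesColimitsOfShape_tuple [Nonempty J] {ι : Type*} (F : ι → C ⥤ V)
    [∀ i, PreservesColimitsOfShape J (F i)] (l : List ι) :
    PreservesColimitsOfShape J (tuple F l) := by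
  induction l with
  | nil => exact inferInstanceAs (PreservesColimitsOfShape J ((Functor.const C).obj nil))
  | cons i l ih => exact inferInstanceAs (PreservesColimitsOfShape J (consFunctor (F i) (tuple F l)))

end

end Seq

section Coproduct

variable {V : Type u} [Category.{v} V] {J : Type*} [Category* J] {C : Type*} [Category* C]

instance hasColimitsOfShape_discrete_small [HasColimits V] (I : Type w) [Small.{v} I] :
    HasColimitsOfShape (Discrete I) V :=
  hasColimitsOfShape_of_equivalence (Discrete.equivalence (equivShrink.{v} I).symm)

/-- The coproduct of a family of functors. -/
noncomputable abbrev sigmaFunctor {I : Type w} [HasColimitsOfShape (Discrete I) V]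
    (F : I → C ⥤ V) : C ⥤ V where
  obj c := ∐ fun i => (F i).obj c
  map f := Limits.Sigma.map fun i => (F i).map f
  map_id c := by
    refine Limits.Sigma.hom_ext _ _ fun i => ?_
    simp
  map_comp f g := by
    refine Limits.Sigma.hom_ext _ _ fun i => ?_
    simp

instance {I : Type w} [HasColimitsOfShape (Discrete I) V] (F : I → C ⥤ V)
    [∀ i, PreservesColimitsOfShape J (F i)] : PreservesColimitsOfShape J (sigmaFunctor F) where
  preservesColimit {D} := ⟨fun {c} hc => by
    have h := fun i => isColimitOfPreserves (F i) hc
    have ext : ∀ {Z : V} {k l : (∐ fun i => (F i).obj c.pt) ⟶ Z},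
        (∀ j, Limits.Sigma.map (fun i => (F i).map (c.ι.app j)) ≫ k =
          Limits.Sigma.map (fun i => (F i).map (c.ι.app j)) ≫ l) → k = l := by
      intro Z k l hkl
      refine Limits.Sigma.hom_ext _ _ fun i => (h i).hom_ext fun j => ?_
      have := congrArg (Sigma.ι (fun i => (F i).obj (D.obj j)) i ≫ ·) (hkl j)
      simpa using! this
    have ex : ∀ s : Cocone (D ⋙ sigmaFunctor F), ∃ k : (∐ fun i => (F i).obj c.pt) ⟶ s.pt,
        ∀ j, Limits.Sigma.map (fun i => (F i).map (c.ι.app j)) ≫ k = s.ι.app j := by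
      intro s
      have ex : ∀ i, ∃ k : (F i).obj c.pt ⟶ s.pt,
          ∀ j, (F i).map (c.ι.app j) ≫ k = Sigma.ι (fun i => (F i).obj (D.obj j)) i ≫ s.ι.app j := by
        intro i
        refine ⟨(h i).desc ⟨s.pt, ⟨fun j => Sigma.ι (fun i => (F i).obj (D.obj j)) i ≫ s.ι.app j,
          fun j₁ j₂ a => ?_⟩⟩, (h i).fac _⟩
        refine Eq.trans ?_ (Category.comp_id _).symm
        have e : Limits.Sigma.map (fun i => (F i).map (D.map a)) ≫ s.ι.app j₂ = s.ι.app j₁ := s.w a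
        rw [← e, Sigma.ι_map_assoc]
        rfl
      choose k hk using ex
      refine ⟨Sigma.desc k, fun j => Limits.Sigma.hom_ext _ _ fun i => ?_⟩
      rw [Sigma.ι_map_assoc, Sigma.ι_desc]
      exact hk i j
    choose k hk using ex
    exact ⟨⟨k, hk, fun s m hm => ext fun j => (hm j).trans (hk s j).symm⟩⟩⟩

end Coproduct

end Multi

namespace Multi

namespace Seq

variable {V : Type u} [Category.{v} V]

section homRel

variable {α β γ δ : Type*} {f : α → V} {g : β → V} {h : γ → V} {k : δ → V}

/-- The morphism of sequences whose entries are given by a family of morphisms indexed by a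
relation. -/
def homRel {R : α → β → Prop} (x : ∀ a b, R a b → (f a ⟶ g b)) :
    ∀ {l : List α} {m : List β}, List.Forall₂ R l m → ((l.map f : Seq V) ⟶ m.map g)
  | [], [], _ => 𝟙 nil
  | a :: _, b :: _, r => consHom (x a b (List.forall₂_cons.1 r).1)
      (homRel x (List.forall₂_cons.1 r).2)
  | [], _ :: _, r => (List.not_mem_nil (List.forall₂_nil_left_iff.1 r ▸ List.mem_cons_self)).elim
  | _ :: _, [], r => (List.not_mem_nil (List.forall₂_nil_right_iff.1 r ▸ List.mem_cons_self)).elim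

theorem homRel_comp_homRel_eq_homMap {R : α → β → Prop} {S : β → α → Prop} {f' : α → V}
    {x : ∀ a b, R a b → (f a ⟶ g b)} {y : ∀ a b, S a b → (g a ⟶ f' b)} (z : ∀ a, f a ⟶ f' a)
    (H : ∀ a b (r : R a b) (s : S b a), x a b r ≫ y b a s = z a) :
    ∀ {l : List α} {m : List β} (r : List.Forall₂ R l m) (s : List.Forall₂ S m l),
      homRel x r ≫ homRel y s = homMap z l
  | [], [], _, _ => rfl
  | a :: l, b :: m, r, s => by
    have := homRel_comp_homRel_eq_homMap z H (List.forall₂_cons.1 r).2 (List.forall₂_cons.1 s).2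
    exact congrArg₂ consHom (H ..) this
  | [], _ :: _, r, _ => by cases r
  | _ :: _, [], r, _ => by cases r

theorem homMap_homRel {f' : α → V} (y : ∀ a, f' a ⟶ f a) {R : α → β → Prop}
    (x : ∀ a b, R a b → (f a ⟶ g b)) :
    ∀ {l : List α} {m : List β} (r : List.Forall₂ R l m),
      homMap y l ≫ homRel x r = homRel (fun a b r => y a ≫ x a b r) r
  | [], [], _ => rfl
  | a :: l, b :: m, r => congrArg (consHom _) (homMap_homRel y x (List.forall₂_cons.1 r).2)
  | [], _ :: _, r => by cases r
  | _ :: _, [], r => by cases r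

theorem homRel_homMap {g' : β → V} {R : α → β → Prop}
    (x : ∀ a b, R a b → (f a ⟶ g b)) (y : ∀ a, g a ⟶ g' a) :
    ∀ {l : List α} {m : List β} (r : List.Forall₂ R l m),
      homRel x r ≫ homMap y m = homRel (fun a b r => x a b r ≫ y b) r
  | [], [], _ => rfl
  | a :: l, b :: m, r => congrArg (consHom _) (homRel_homMap x y (List.forall₂_cons.1 r).2)
  | [], _ :: _, r => by cases r
  | _ :: _, [], r => by cases r

theorem homRel_congr {R R' : α → β → Prop} {x : ∀ a b, R a b → (f a ⟶ g b)}
    {x' : ∀ a b, R' a b → (f a ⟶ g b)} (H : ∀ a b r r', x a b r = x' a b r') :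
    ∀ {l : List α} {m : List β} (r : List.Forall₂ R l m) (r' : List.Forall₂ R' l m),
      homRel x r = homRel x' r'
  | [], [], _, _ => rfl
  | a :: l, b :: m, r, r' => by
    change consHom _ _ = consHom _ _
    rw [H, homRel_congr H (List.forall₂_cons.1 r).2 (List.forall₂_cons.1 r').2]
  | [], _ :: _, r, _ => by cases r
  | _ :: _, [], r, _ => by cases r

end homRel

/-- Applying a functor to a sequence indexed by a list. -/
def fuse {W : Type u'} [Category.{v'} W] (T : V ⥤ W) {α : Type*} (f : α → V) :
    ∀ l : List α, ((l.map fun a => T.obj (f a) : Seq W) ⟶ (map T).obj (l.map f))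
  | [] => 𝟙 nil
  | _ :: l => consHom (𝟙 _) (fuse T f l)

theorem consHom_eqToHom {X Y : V} {l m : Seq V} (p : X = Y) (q : l = m) :
    consHom (eqToHom p) (eqToHom q) = eqToHom (congrArg₂ cons p q) := by
  subst p q
  rfl

theorem fuse_naturality {W : Type u'} [Category.{v'} W] (T : V ⥤ W) {α : Type*} {f g : α → V}
    (x : ∀ a, f a ⟶ g a) (l : List α) :
    homMap (fun a => T.map (x a)) l ≫ fuse T g l = fuse T f l ≫ (map T).map (homMap x l) := by
  induction l with
  | nil => rfl
  | cons a l ih =>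
    exact congrArg₂ consHom ((Category.comp_id _).trans (Category.id_comp _).symm) ih

section Arrow

theorem eqToHom_comp_eq_comp_eqToHom {X Y X' Y' : V} {f : X ⟶ Y} {g : X' ⟶ Y'}
    (h : Arrow.mk f = Arrow.mk g) (p : X = X') (q : Y = Y') :
    eqToHom p ≫ g = f ≫ eqToHom q := by
  subst p q
  rw [Arrow.mk_injective _ _ h, eqToHom_refl, eqToHom_refl, Category.id_comp, Category.comp_id]

theorem arrow_mk_map {W : Type u'} [Category.{v'} W] (T : V ⥤ W) {X Y X' Y' : V} {f : X ⟶ Y}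
    {g : X' ⟶ Y'} (h : Arrow.mk f = Arrow.mk g) : Arrow.mk (T.map f) = Arrow.mk (T.map g) :=
  congrArg T.mapArrow.obj h

theorem arrow_mk_comp {X Y Z X' Y' Z' : V} {f : X ⟶ Y} {g : Y ⟶ Z} {f' : X' ⟶ Y'} {g' : Y' ⟶ Z'}
    (h : Arrow.mk f = Arrow.mk f') (k : Arrow.mk g = Arrow.mk g') :
    Arrow.mk (f ≫ g) = Arrow.mk (f' ≫ g') := by
  have h₁ : X = X' := congrArg (fun t : Arrow V => t.left) h
  have h₂ : Y = Y' := congrArg (fun t : Arrow V => t.right) h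
  have h₃ : Z = Z' := congrArg (fun t : Arrow V => t.right) k
  subst h₁ h₂ h₃
  rw [Arrow.mk_injective _ _ h, Arrow.mk_injective _ _ k]

theorem arrow_mk_consHom {X Y X' Y' : V} {l m l' m' : Seq V} {f : X ⟶ Y} {f' : X' ⟶ Y'}
    {g : l ⟶ m} {g' : l' ⟶ m'} (h : Arrow.mk f = Arrow.mk f') (k : Arrow.mk g = Arrow.mk g') :
    Arrow.mk (consHom f g) = Arrow.mk (consHom f' g') := by
  have h₁ : X = X' := congrArg (fun t : Arrow V => t.left) h
  have h₂ : Y = Y' := congrArg (fun t : Arrow V => t.right) h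
  have h₃ : l = l' := congrArg (fun t : Arrow (Seq V) => t.left) k
  have h₄ : m = m' := congrArg (fun t : Arrow (Seq V) => t.right) k
  subst h₁ h₂ h₃ h₄
  rw [Arrow.mk_injective _ _ h, Arrow.mk_injective _ _ k]

/-- Concatenation of morphisms of sequences. -/
def appendMap {l m l₁ m₁ : Seq V} (f : l ⟶ m) (g : l₁ ⟶ m₁) : append l l₁ ⟶ append m m₁ :=
  appendHom f g

theorem arrow_mk_appendMap {l m l' m' : Seq V} {l₁ m₁ l₁' m₁' : Seq V} {f : l ⟶ m} {f' : l' ⟶ m'}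
    {g : l₁ ⟶ m₁} {g' : l₁' ⟶ m₁'} (h : Arrow.mk f = Arrow.mk f')
    (k : Arrow.mk g = Arrow.mk g') :
    Arrow.mk (appendMap f g) = Arrow.mk (appendMap f' g') := by
  have h₁ : l = l' := congrArg (fun t : Arrow (Seq V) => t.left) h
  have h₂ : m = m' := congrArg (fun t : Arrow (Seq V) => t.right) h
  have h₃ : l₁ = l₁' := congrArg (fun t : Arrow (Seq V) => t.left) k
  have h₄ : m₁ = m₁' := congrArg (fun t : Arrow (Seq V) => t.right) k
  subst h₁ h₂ h₃ h₄
  rw [Arrow.mk_injective _ _ h, Arrow.mk_injective _ _ k]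

theorem arrow_mk_comp_eqToHom {X Y Z X' Y' : V} {f : X ⟶ Y} {g : X' ⟶ Y'}
    (h : Arrow.mk f = Arrow.mk g) (p : Y = Z) : Arrow.mk (f ≫ eqToHom p) = Arrow.mk g := by
  subst p
  simpa using h

theorem arrow_mk_eqToHom_comp {X Y Z X' Y' : V} {f : X ⟶ Y} {g : X' ⟶ Y'}
    (h : Arrow.mk f = Arrow.mk g) (p : Z = X) : Arrow.mk (eqToHom p ≫ f) = Arrow.mk g := by
  subst p
  simpa using h

variable {α : Type*} {f g : α → V}

theorem appendMap_homMap (x : ∀ a, f a ⟶ g a) (l m : List α) :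
    Arrow.mk (appendMap (homMap x l) (homMap x m)) = Arrow.mk (homMap x (l ++ m)) := by
  induction l with
  | nil => rfl
  | cons a l ih => exact arrow_mk_consHom rfl ih

theorem flattenHom_homMap (x : ∀ a, f a ⟶ g a) (L : List (List α)) :
    Arrow.mk (flatten.map (homMap (f := fun l : List α => (l.map f : Seq V)) (homMap x) L)) =
      Arrow.mk (homMap x L.flatten) := by
  induction L with
  | nil => rfl
  | cons l L ih =>
    exact (arrow_mk_appendMap rfl ih).trans (appendMap_homMap x l L.flatten)

end Arrow

end Seq

namespace Multitensor

variable {V : Type u} [Category.{v} V] (E : Multitensor V)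

section

variable {α : Type*}

/-- Substitution, for sequences indexed by lists. -/
def substTo (k : α → Seq V) (M : List α) {l : Seq V} (h : (M.map k).flatten = l) :
    E.tensor.obj (M.map fun a => E.tensor.obj (k a)) ⟶ E.tensor.obj l :=
  E.tensor.map (Seq.fuse E.tensor k M) ≫ E.subst.app (M.map k) ≫ E.tensor.map (eqToHom h)

theorem substTo_naturality {k k' : α → Seq V} (x : ∀ a, k a ⟶ k' a) (M : List α) {l l' : Seq V}
    (h : (M.map k).flatten = l) (h' : (M.map k').flatten = l') (y : l ⟶ l')
    (hy : Arrow.mk (Seq.flatten.map (Seq.homMap x M)) = Arrow.mk y) :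
    E.tensor.map (Seq.homMap (fun a => E.tensor.map (x a)) M) ≫ E.substTo k' M h' =
      E.substTo k M h ≫ E.tensor.map y := by
  unfold substTo
  have e₁ := congrArg E.tensor.map (Seq.fuse_naturality E.tensor x M)
  have e₂ := E.subst.naturality (Seq.homMap x M)
  have e₃ := congrArg E.tensor.map (Seq.eqToHom_comp_eq_comp_eqToHom hy h h')
  simp only [Functor.map_comp] at e₁ e₃
  rw [Category.assoc, Category.assoc, e₃, ← Category.assoc (E.tensor.map (Seq.homMap _ _)), e₁,
    Category.assoc]
  exact congrArg (_ ≫ ·) ((reassoc_of% e₂) _)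

/-- Naturality of the substitution with respect to families of morphisms. -/
theorem substTo_naturality_homMap {f g : α → V} (x : ∀ a, f a ⟶ g a) (M : List (List α))
    (L : List α) (h : M.flatten = L) (h₁ : (M.map (List.map f)).flatten = L.map f)
    (h₂ : (M.map (List.map g)).flatten = L.map g) :
    E.tensor.map (Seq.homMap (fun l => E.tensor.map (Seq.homMap x l)) M) ≫
        E.substTo (List.map g) M h₂ =
      E.substTo (List.map f) M h₁ ≫ E.tensor.map (Seq.homMap x L) := by
  subst h
  exact E.substTo_naturality _ M h₁ h₂ _ (Seq.flattenHom_homMap x M)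

theorem map_unit_substTo {β : Type*} {R : β → α → Prop} (f : β → V) (k : α → Seq V)
    (x : ∀ b a, R b a → (f b ⟶ E.tensor.obj (k a)))
    (hR : ∀ b a, R b a → k a = Seq.single.obj (f b))
    (H : ∀ b a r, x b a r = E.unit.app (f b) ≫ E.tensor.map (eqToHom (hR b a r).symm))
    {L : List β} {M : List α} (r : List.Forall₂ R L M) (h : (M.map k).flatten = L.map f) :
    E.tensor.map (Seq.homRel x r) ≫ E.substTo k M h = 𝟙 (E.tensor.obj (L.map f)) := by
  have key : ∃ p : M.map k = (Seq.map Seq.single).obj (L.map f),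
      Seq.homRel x r ≫ Seq.fuse E.tensor k M =
        Seq.mapNatUnit E.unit (L.map f) ≫ (Seq.map E.tensor).map (eqToHom p.symm) := by
    clear h
    induction r with
    | nil => exact ⟨rfl, rfl⟩
    | @cons b a L M hr r ih =>
      obtain ⟨p, hp⟩ := ih
      refine ⟨congrArg₂ List.cons (hR b a hr) p, ?_⟩
      refine (congrArg₂ Seq.consHom (congrArg (· ≫ 𝟙 _) (H b a hr)) hp).trans ?_
      have aux : ∀ (q : k a = Seq.single.obj (f b)) (z : Seq (Seq V))
          (p : z = (Seq.map Seq.single).obj (L.map f)),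
          Seq.consHom ((E.unit.app (f b) ≫ E.tensor.map (eqToHom q.symm)) ≫ 𝟙 _)
            (Seq.mapNatUnit E.unit (L.map f) ≫ (Seq.map E.tensor).map (eqToHom p.symm)) =
          Seq.mapNatUnit E.unit (f b :: L.map f) ≫ (Seq.map E.tensor).map
            (eqToHom (congrArg₂ List.cons q p).symm : _ ⟶ Seq.cons (k a) z) := by
        intro q z p
        generalize k a = y at q
        subst p q
        simp only [eqToHom_refl, Functor.map_id, Category.comp_id]
        rfl
      exact aux (hR b a hr) _ p
  obtain ⟨p, hp⟩ := key
  have aux : ∀ (z : Seq (Seq V)) (p : z = (Seq.map Seq.single).obj (L.map f))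
      (h : List.flatten z = L.map f),
      E.tensor.map (Seq.mapNatUnit E.unit (L.map f) ≫
        (Seq.map E.tensor).map (eqToHom p.symm)) ≫ E.subst.app z ≫ E.tensor.map (eqToHom h) =
        𝟙 _ := by
    rintro _ rfl h
    refine Eq.trans (congrArg (· ≫ _) (congrArg E.tensor.map ?_)) (E.map_unit_subst (L.map f))
    exact (congrArg (_ ≫ ·) ((Seq.map E.tensor).map_id _)).trans (Category.comp_id _)
  refine Eq.trans ?_ (aux _ p h)
  rw [← hp, E.tensor.map_comp, Category.assoc]
  rfl

end

end Multitensor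

end Multi

namespace Multi

/-- Indices of the summands of the operations with values at a word: decompositions of the word as a
concatenation, and letters. -/
abbrev OpIndex {α : Type w} (s : List α) : Type w :=
  { L : List (List α) // L.flatten = s } ⊕ { a : α // [a] = s }

/-- Iterated decompositions of a word as a concatenation. -/
structure DoubleDec {α : Type w} (s : List α) : Type w where
  parts : List (List (List α))
  outer : List (List α)
  inner : List (List α)
  forall₂ : List.Forall₂ (fun m t => List.flatten m = t) parts outer
  flatten_parts : parts.flatten = inner
  flatten_outer : outer.flatten = s

theorem flatten_of_forall₂ {α : Type*} {M : List (List (List α))} {L : List (List α)}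
    (h : List.Forall₂ (fun m t => List.flatten m = t) M L) : M.flatten.flatten = L.flatten := by
  induction h with
  | nil => rfl
  | cons h _ ih => rw [List.flatten_cons, List.flatten_append, ih, h, List.flatten_cons]

theorem map_flatten_of_forall₂ {α : Type*} {M : List (List (List α))} {L : List (List α)}
    (h : List.Forall₂ (fun m t => List.flatten m = t) M L) : M.map List.flatten = L := by
  induction h with
  | nil => rfl
  | cons h _ ih => rw [List.map_cons, ih, h]

theorem DoubleDec.flatten_inner {α : Type*} {s : List α} (D : DoubleDec s) :
    D.inner.flatten = s := by
  rw [← D.flatten_parts, flatten_of_forall₂ D.forall₂, D.flatten_outer]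

instance {α : Type w} (s : List α) : Countable { L : List (List α) // L.flatten = s } :=
  Function.Injective.countable (f := fun L => L.1.map List.length) fun L L' h =>
    Subtype.ext (List.eq_iff_flatten_eq.2 ⟨L.2.trans L'.2.symm, h⟩)

instance {α : Type w} (s : List α) : Countable { a : α // [a] = s } :=
  have : Subsingleton { a : α // [a] = s } :=
    ⟨fun a b => Subtype.ext (List.cons.inj (a.2.trans b.2.symm)).1⟩
  inferInstance

instance {α : Type w} (s : List α) : Countable (DoubleDec s) :=
  Function.Injective.countable
    (f := fun D => (D.inner.map List.length, D.parts.map List.length)) fun D D' h => by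
      have h₁ : D.inner = D'.inner := List.eq_iff_flatten_eq.2
        ⟨D.flatten_inner.trans D'.flatten_inner.symm, congrArg Prod.fst h⟩
      have h₂ : D.parts = D'.parts := List.eq_iff_flatten_eq.2
        ⟨D.flatten_parts.trans (h₁.trans D'.flatten_parts.symm), congrArg Prod.snd h⟩
      have h₃ : D.outer = D'.outer := by
        rw [← map_flatten_of_forall₂ D.forall₂, ← map_flatten_of_forall₂ D'.forall₂, h₂]
      cases D; cases D'
      cases h₁; cases h₂; cases h₃
      rfl

namespace Words

variable {V : Type u} [Category.{v} V] (E : Multitensor V)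

/-- Words of algebras for the unary part. -/
abbrev Alg := E.unaryMonad.Algebra

section

variable {J : Type*} [Category* J]

variable {E} in
/-- The summands of the operations. -/
abbrev opFunctor (w : List (Alg E)) : OpIndex w → (List (Alg E) → V) ⥤ V
  | .inl L => Seq.tuple (fun t => Pi.eval (fun _ : List (Alg E) => V) t) L.1 ⋙ E.tensor
  | .inr a => (Functor.const _).obj a.1.A

variable {E} in
/-- The summands of the equations. -/
abbrev eqFunctor (w : List (Alg E)) :
    DoubleDec w ⊕ ({ a : Alg E // [a] = w } ⊕ { a : Alg E // [a] = w }) →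
      (List (Alg E) → V) ⥤ V
  | .inl D => Seq.tuple (fun m => Seq.tuple
      (fun t => Pi.eval (fun _ : List (Alg E) => V) t) m ⋙ E.tensor) D.parts ⋙ E.tensor
  | .inr (.inl a) => (Functor.const _).obj (E.tensor.obj [a.1.A])
  | .inr (.inr a) => (Functor.const _).obj a.1.A

variable [HasColimits V]

/-- The functor of operations. -/
noncomputable abbrev opsFunctor : (List (Alg E) → V) ⥤ (List (Alg E) → V) :=
  Functor.pi' fun w => sigmaFunctor (opFunctor w)

/-- The functor of equations. -/
noncomputable abbrev eqsFunctor : (List (Alg E) → V) ⥤ (List (Alg E) → V) :=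
  Functor.pi' fun w => sigmaFunctor (eqFunctor w)

section

variable [IsConnected J]

theorem preservesColimitsOfShape_const {C : Type*} [Category* C] {V : Type u} [Category.{v} V]
    (X : V) : PreservesColimitsOfShape J ((Functor.const C).obj X) where
  preservesColimit {D} := ⟨fun {c} _ => by
    obtain ⟨j₀⟩ := (inferInstance : Nonempty J)
    refine ⟨⟨fun s => s.ι.app j₀, fun s j => ?_, fun s m hm => ?_⟩⟩
    · refine (Category.id_comp _).trans ?_
      let F : J → (X ⟶ s.pt) := fun j => s.ι.app j
      exact constant_of_preserves_morphisms F (fun i j f =>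
        ((s.w f).symm.trans (Category.id_comp (F j)))) _ _
    · exact (Category.id_comp m).symm.trans (hm j₀)⟩

variable [HasColimitsOfShape J V] [PreservesColimitsOfShape J E.tensor]

instance : PreservesColimitsOfShape J (opsFunctor E) := by
  refine preservesColimitsOfShape_pi _ fun w => ?_
  have : ∀ i, PreservesColimitsOfShape J (opFunctor w i) := by
    rintro (L | a)
    · exact inferInstanceAs (PreservesColimitsOfShape J (Seq.tuple
        (fun t => Pi.eval (fun _ : List (Alg E) => V) t) L.1 ⋙ E.tensor))
    · exact preservesColimitsOfShape_const a.1.A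
  exact inferInstanceAs (PreservesColimitsOfShape J (sigmaFunctor (opFunctor w)))

instance : PreservesColimitsOfShape J (eqsFunctor E) := by
  refine preservesColimitsOfShape_pi _ fun w => ?_
  have : ∀ i, PreservesColimitsOfShape J (eqFunctor w i) := by
    rintro (D | a | a)
    · exact inferInstanceAs (PreservesColimitsOfShape J (Seq.tuple (fun m => Seq.tuple
        (fun t => Pi.eval (fun _ : List (Alg E) => V) t) m ⋙ E.tensor) D.parts ⋙ E.tensor))
    · exact preservesColimitsOfShape_const (E.tensor.obj [a.1.A])
    · exact preservesColimitsOfShape_const a.1.A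
  exact inferInstanceAs (PreservesColimitsOfShape J (sigmaFunctor (eqFunctor w)))

end

end

end Words

end Multi

namespace Multi

namespace Words

variable {V : Type u} [Category.{v} V] (E : Multitensor V) [HasColimits V]

variable {E} in
/-- The structure map of an algebra. -/
abbrev strMap (a : Alg E) : E.tensor.obj [a.A] ⟶ a.A := a.a

section ops

variable {E} (G : List (Alg E) → V) {w : List (Alg E)}

/-- The operation attached to a decomposition of a word. -/
noncomputable def op (L : List (List (Alg E))) (h : L.flatten = w) :
    E.tensor.obj (L.map G) ⟶ (opsFunctor E).obj G w :=
  Sigma.ι (fun i => (opFunctor w i).obj G) (.inl ⟨L, h⟩)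

/-- The inclusion of a letter. -/
noncomputable def letter (a : Alg E) (h : [a] = w) : a.A ⟶ (opsFunctor E).obj G w :=
  Sigma.ι (fun i => (opFunctor w i).obj G) (.inr ⟨a, h⟩)

/-- The composite of two operations. -/
noncomputable def dbl (D : DoubleDec w) :
    E.tensor.obj (D.parts.map fun m => E.tensor.obj (m.map G)) ⟶ (eqsFunctor E).obj G w :=
  Sigma.ι (fun i => (eqFunctor w i).obj G) (.inl D)

/-- The action on a letter. -/
noncomputable def actLetter (a : Alg E) (h : [a] = w) :
    E.tensor.obj [a.A] ⟶ (eqsFunctor E).obj G w :=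
  Sigma.ι (fun i => (eqFunctor w i).obj G) (.inr (.inl ⟨a, h⟩))

/-- The inclusion of a letter in the equations. -/
noncomputable def eqLetter (a : Alg E) (h : [a] = w) : a.A ⟶ (eqsFunctor E).obj G w :=
  Sigma.ι (fun i => (eqFunctor w i).obj G) (.inr (.inr ⟨a, h⟩))

variable {G}

theorem ops_ext {Z : V} {k l : (opsFunctor E).obj G w ⟶ Z}
    (h₁ : ∀ L h, op G L h ≫ k = op G L h ≫ l)
    (h₂ : ∀ a h, letter G a h ≫ k = letter G a h ≫ l) : k = l :=
  Limits.Sigma.hom_ext _ _ fun i => match i with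
    | .inl L => h₁ L.1 L.2
    | .inr a => h₂ a.1 a.2

theorem eqs_ext {Z : V} {k l : (eqsFunctor E).obj G w ⟶ Z}
    (h₁ : ∀ D, dbl G D ≫ k = dbl G D ≫ l)
    (h₂ : ∀ a h, actLetter G a h ≫ k = actLetter G a h ≫ l)
    (h₃ : ∀ a h, eqLetter G a h ≫ k = eqLetter G a h ≫ l) : k = l :=
  Limits.Sigma.hom_ext _ _ fun i => match i with
    | .inl D => h₁ D
    | .inr (.inl a) => h₂ a.1 a.2
    | .inr (.inr a) => h₃ a.1 a.2

theorem exists_ops_desc {Z : V} (x : ∀ L (_ : L.flatten = w), E.tensor.obj (L.map G) ⟶ Z)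
    (y : ∀ a : Alg E, [a] = w → (a.A ⟶ Z)) :
    ∃ k : (opsFunctor E).obj G w ⟶ Z, (∀ L h, op G L h ≫ k = x L h) ∧
      ∀ a h, letter G a h ≫ k = y a h :=
  let d : ∀ i : OpIndex w, (opFunctor w i).obj G ⟶ Z := fun i => match i with
    | .inl L => x L.1 L.2
    | .inr a => y a.1 a.2
  ⟨Sigma.desc d, fun L h => Sigma.ι_desc d (.inl ⟨L, h⟩), fun a h => Sigma.ι_desc d (.inr ⟨a, h⟩)⟩

theorem exists_eqs_desc {Z : V}
    (x : ∀ D : DoubleDec w, E.tensor.obj (D.parts.map fun m => E.tensor.obj (m.map G)) ⟶ Z)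
    (y : ∀ a : Alg E, [a] = w → (E.tensor.obj [a.A] ⟶ Z))
    (z : ∀ a : Alg E, [a] = w → (a.A ⟶ Z)) :
    ∃ k : (eqsFunctor E).obj G w ⟶ Z, (∀ D, dbl G D ≫ k = x D) ∧
      (∀ a h, actLetter G a h ≫ k = y a h) ∧ ∀ a h, eqLetter G a h ≫ k = z a h :=
  let d : ∀ i : DoubleDec w ⊕ ({ a : Alg E // [a] = w } ⊕ { a : Alg E // [a] = w }),
      (eqFunctor w i).obj G ⟶ Z := fun i => match i with
    | .inl D => x D
    | .inr (.inl a) => y a.1 a.2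
    | .inr (.inr a) => z a.1 a.2
  ⟨Sigma.desc d, fun D => Sigma.ι_desc d (.inl D), fun a h => Sigma.ι_desc d (.inr (.inl ⟨a, h⟩)),
    fun a h => Sigma.ι_desc d (.inr (.inr ⟨a, h⟩))⟩

variable {G' : List (Alg E) → V} (f : G ⟶ G')

theorem op_map (L : List (List (Alg E))) (h : L.flatten = w) :
    op G L h ≫ (opsFunctor E).map f w = E.tensor.map (Seq.homMap f L) ≫ op G' L h :=
  Sigma.ι_map (fun i => (opFunctor w i).map f) (.inl ⟨L, h⟩)

theorem letter_map (a : Alg E) (h : [a] = w) :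
    letter G a h ≫ (opsFunctor E).map f w = letter G' a h :=
  (Sigma.ι_map (fun i => (opFunctor w i).map f) (.inr ⟨a, h⟩)).trans (Category.id_comp _)

theorem dbl_map (D : DoubleDec w) :
    dbl G D ≫ (eqsFunctor E).map f w =
      E.tensor.map (Seq.homMap (fun m => E.tensor.map (Seq.homMap f m)) D.parts) ≫ dbl G' D :=
  Sigma.ι_map (fun i => (eqFunctor w i).map f) (.inl D)

theorem actLetter_map (a : Alg E) (h : [a] = w) :
    actLetter G a h ≫ (eqsFunctor E).map f w = actLetter G' a h :=
  (Sigma.ι_map (fun i => (eqFunctor w i).map f) (.inr (.inl ⟨a, h⟩))).trans (Category.id_comp _)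

theorem eqLetter_map (a : Alg E) (h : [a] = w) :
    eqLetter G a h ≫ (eqsFunctor E).map f w = eqLetter G' a h :=
  (Sigma.ι_map (fun i => (eqFunctor w i).map f) (.inr (.inr ⟨a, h⟩))).trans (Category.id_comp _)

end ops

section maps

variable {E}

theorem flatten_map_map {α β : Type*} (G : α → β) {M : List (List α)} {L : List α}
    (h : M.flatten = L) : (M.map (List.map G)).flatten = L.map G := by
  rw [← h, List.map_flatten]

/-- The inclusion of families in operations. -/
noncomputable def unit (G : List (Alg E) → V) : G ⟶ (opsFunctor E).obj G := fun w =>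
  E.unit.app (G w) ≫ op G [w] (List.append_nil w)

variable (E) in
theorem exists_mul (G : List (Alg E) → V) :
    ∃ k : (eqsFunctor E).obj G ⟶ (opsFunctor E).obj G, ∀ w,
      (∀ D : DoubleDec w, dbl G D ≫ k w =
        E.substTo (List.map G) D.parts (flatten_map_map G D.flatten_parts) ≫
          op G D.inner D.flatten_inner) ∧
      (∀ a h, actLetter G a h ≫ k w = strMap a ≫ letter G a h) ∧
      ∀ a h, eqLetter G a h ≫ k w = letter G a h := by
  choose k hk using fun w : List (Alg E) => exists_eqs_desc (G := G) (w := w)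
    (fun D => E.substTo (List.map G) D.parts (flatten_map_map G D.flatten_parts) ≫
          op G D.inner D.flatten_inner) (fun a h => strMap a ≫ letter G a h) (fun a h => letter G a h)
  exact ⟨k, hk⟩

/-- The multiplication of operations. -/
noncomputable def mul (G : List (Alg E) → V) : (eqsFunctor E).obj G ⟶ (opsFunctor E).obj G :=
  (exists_mul E G).choose

variable {G : List (Alg E) → V} {w : List (Alg E)}

theorem dbl_mul (D : DoubleDec w) : dbl G D ≫ mul G w =
    E.substTo (List.map G) D.parts (flatten_map_map G D.flatten_parts) ≫
      op G D.inner D.flatten_inner :=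
  ((exists_mul E G).choose_spec w).1 D

theorem actLetter_mul (a : Alg E) (h : [a] = w) :
    actLetter G a h ≫ mul G w = strMap a ≫ letter G a h :=
  ((exists_mul E G).choose_spec w).2.1 a h

theorem eqLetter_mul (a : Alg E) (h : [a] = w) : eqLetter G a h ≫ mul G w = letter G a h :=
  ((exists_mul E G).choose_spec w).2.2 a h

/-- The trivial iterated decomposition. -/
abbrev trivialDec (L : List (List (Alg E))) (h : L.flatten = w) : DoubleDec w where
  parts := L.map fun t => [t]
  outer := L
  inner := L
  forall₂ := by
    clear h
    induction L with
    | nil => exact .nil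
    | cons t L ih => exact .cons (List.append_nil t) ih
  flatten_parts := by
    clear h
    induction L with
    | nil => rfl
    | cons t L ih => exact congrArg (List.cons t) ih
  flatten_outer := h

theorem forall₂_trivial {α : Type*} (L : List α) :
    List.Forall₂ (fun t m => m = [t]) L (L.map fun t => [t]) := by
  induction L with
  | nil => exact .nil
  | cons t L ih => exact .cons rfl ih

/-- The morphism into the trivial composite of operations. -/
noncomputable def secHom (G : List (Alg E) → V) (L : List (List (Alg E))) :
    (L.map G : Seq V) ⟶ (L.map fun t => [t]).map fun m => E.tensor.obj (m.map G) :=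
  Seq.homRel (fun t m (h : m = [t]) => E.unit.app (G t) ≫
    E.tensor.map (eqToHom (by rw [h]; rfl))) (forall₂_trivial L)

variable (E) in
theorem exists_sec (G : List (Alg E) → V) :
    ∃ k : (opsFunctor E).obj G ⟶ (eqsFunctor E).obj G, ∀ w,
      (∀ L (h : L.flatten = w), op G L h ≫ k w =
        E.tensor.map (secHom G L) ≫ dbl G (trivialDec L h)) ∧
      ∀ a h, letter G a h ≫ k w = eqLetter G a h := by
  choose k hk using fun w : List (Alg E) => exists_ops_desc (G := G) (w := w)
    (fun L h => E.tensor.map (secHom G L) ≫ dbl G (trivialDec L h)) (fun a h => eqLetter G a h)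
  exact ⟨k, hk⟩

/-- The section of the multiplication. -/
noncomputable def sec (G : List (Alg E) → V) : (opsFunctor E).obj G ⟶ (eqsFunctor E).obj G :=
  (exists_sec E G).choose

theorem op_sec (L) (h : L.flatten = w) : op G L h ≫ sec G w =
    E.tensor.map (secHom G L) ≫ dbl G (trivialDec L h) :=
  ((exists_sec E G).choose_spec w).1 L h

theorem letter_sec (a : Alg E) (h : [a] = w) : letter G a h ≫ sec G w = eqLetter G a h :=
  ((exists_sec E G).choose_spec w).2 a h

variable (t : PreAlg (opsFunctor E))

/-- The action of the inner operations of a composite. -/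
noncomputable def actHom {M : List (List (List (Alg E)))} {L : List (List (Alg E))}
    (r : List.Forall₂ (fun m t => List.flatten m = t) M L) :
    (M.map fun m => E.tensor.obj (m.map t.src) : Seq V) ⟶ L.map t.tgt :=
  Seq.homRel (fun m s h => op t.src m h ≫ t.str s) r

theorem exists_act :
    ∃ k : (eqsFunctor E).obj t.src ⟶ (opsFunctor E).obj t.tgt, ∀ w,
      (∀ D : DoubleDec w, dbl t.src D ≫ k w =
        E.tensor.map (actHom t D.forall₂) ≫ op t.tgt D.outer D.flatten_outer) ∧
      (∀ a h, actLetter t.src a h ≫ k w =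
        E.tensor.map (Seq.single.map (letter t.src a h ≫ t.str w)) ≫
          op t.tgt [w] (List.append_nil w)) ∧
      ∀ a h, eqLetter t.src a h ≫ k w = letter t.tgt a h := by
  choose k hk using fun w : List (Alg E) => exists_eqs_desc (G := t.src) (w := w)
    (fun D => E.tensor.map (actHom t D.forall₂) ≫ op t.tgt D.outer D.flatten_outer)
    (fun a h => E.tensor.map (Seq.single.map (letter t.src a h ≫ t.str w)) ≫
          op t.tgt [w] (List.append_nil w)) (fun a h => letter t.tgt a h)
  exact ⟨k, hk⟩

/-- The action of the inner operations on the equations. -/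
noncomputable def act : (eqsFunctor E).obj t.src ⟶ (opsFunctor E).obj t.tgt :=
  (exists_act t).choose

theorem dbl_act (D : DoubleDec w) : dbl t.src D ≫ act t w =
    E.tensor.map (actHom t D.forall₂) ≫ op t.tgt D.outer D.flatten_outer :=
  ((exists_act t).choose_spec w).1 D

theorem actLetter_act (a : Alg E) (h : [a] = w) : actLetter t.src a h ≫ act t w =
    E.tensor.map (Seq.single.map (letter t.src a h ≫ t.str w)) ≫
      op t.tgt [w] (List.append_nil w) :=
  ((exists_act t).choose_spec w).2.1 a h

theorem eqLetter_act (a : Alg E) (h : [a] = w) :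
    eqLetter t.src a h ≫ act t w = letter t.tgt a h :=
  ((exists_act t).choose_spec w).2.2 a h

end maps

/-- The presentation of families indexed by words with an action of the multitensor. -/
noncomputable def presentation : Presentation (List (Alg E) → V) where
  Φ := opsFunctor E
  Ψ := eqsFunctor E
  unit G := unit G
  unit_nat {G G'} f := by
    funext w
    refine Eq.trans ?_ (Category.assoc _ _ _).symm
    refine Eq.trans ?_ (congrArg (_ ≫ ·) (op_map f [w] (List.append_nil w)).symm)
    exact (reassoc_of% (E.unit.naturality (f w))) _
  mul G := mul G
  mul_nat {G G'} f := by
    funext w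
    change (eqsFunctor E).map f w ≫ mul G' w = mul G w ≫ (opsFunctor E).map f w
    refine eqs_ext (fun D => ?_) (fun a h => ?_) (fun a h => ?_)
    · rw [reassoc_of% (dbl_map f D), dbl_mul, reassoc_of% (dbl_mul D), op_map,
        ← Category.assoc, ← Category.assoc,
        E.substTo_naturality_homMap f D.parts D.inner D.flatten_parts]
    · rw [reassoc_of% (actLetter_map f a h), actLetter_mul, reassoc_of% (actLetter_mul a h),
        letter_map]
    · rw [reassoc_of% (eqLetter_map f a h), eqLetter_mul, reassoc_of% (eqLetter_mul a h),
        letter_map]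
  sec G := sec G
  sec_mul G := by
    funext w
    change sec G w ≫ mul G w = 𝟙 _
    refine ops_ext (fun L h => ?_) (fun a h => ?_)
    · rw [reassoc_of% (op_sec L h), dbl_mul, Category.comp_id]
      refine Eq.trans ?_ (Category.id_comp _)
      rw [← E.map_unit_substTo G (List.map G) _ _ (fun _ _ _ => rfl) (forall₂_trivial L)
        (flatten_map_map G (trivialDec L h).flatten_parts), Category.assoc]
      · rfl
      · rintro _ _ rfl
        rfl
    · rw [reassoc_of% (letter_sec a h), eqLetter_mul, Category.comp_id]
  act t := act t
  act_nat {s t} f := by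
    funext w
    change (eqsFunctor E).map f.src w ≫ act t w = act s w ≫ (opsFunctor E).map f.tgt w
    refine eqs_ext (fun D => ?_) (fun a h => ?_) (fun a h => ?_)
    · rw [reassoc_of% (dbl_map f.src D), dbl_act, reassoc_of% (dbl_act s D), op_map,
        ← Category.assoc, ← Category.assoc, ← Functor.map_comp, ← Functor.map_comp]
      congr 2
      unfold actHom
      rw [Seq.homMap_homRel, Seq.homRel_homMap]
      refine Seq.homRel_congr (fun m s' h _ => ?_) _ _
      have := congrFun f.w s'
      change (opsFunctor E).map f.src s' ≫ t.str s' = s.str s' ≫ f.tgt s' at this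
      rw [Category.assoc, ← this, reassoc_of% (op_map f.src m h)]
    · rw [reassoc_of% (actLetter_map f.src a h), actLetter_act, reassoc_of% (actLetter_act s a h)]
      refine Eq.trans ?_ (Category.assoc _ _ _).symm
      refine Eq.trans ?_ (congrArg (_ ≫ ·) (op_map f.tgt [w] (List.append_nil w)).symm)
      refine Eq.trans (congrArg (· ≫ _) ?_) (Category.assoc _ _ _)
      have := congrFun f.w w
      change (opsFunctor E).map f.src w ≫ t.str w = s.str w ≫ f.tgt w at this
      have e : letter t.src a h ≫ t.str w = (letter s.src a h ≫ s.str w) ≫ f.tgt w := by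
        rw [Category.assoc, ← this, reassoc_of% (letter_map f.src a h)]
      rw [e, Functor.map_comp, Functor.map_comp]
      rfl
    · rw [reassoc_of% (eqLetter_map f.src a h), eqLetter_act, reassoc_of% (eqLetter_act s a h),
        letter_map]
  sec_act t := by
    funext w
    change sec t.src w ≫ act t w = (opsFunctor E).map (unit t.src ≫ t.str) w
    refine ops_ext (fun L h => ?_) (fun a h => ?_)
    · rw [reassoc_of% (op_sec L h), dbl_act, op_map, ← Category.assoc, ← Functor.map_comp]
      refine congrArg (fun z => E.tensor.map z ≫ _) ?_
      refine Seq.homRel_comp_homRel_eq_homMap (unit t.src ≫ t.str) ?_ _ _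
      rintro s _ rfl h
      have e : (unit t.src ≫ t.str) s = E.unit.app (t.src s) ≫
          (op (E := E) t.src [s] (List.append_nil s) ≫ t.str s :) := Category.assoc _ _ _
      refine Eq.trans ?_ e.symm
      exact congrArg (· ≫ _) ((congrArg (_ ≫ ·) (E.tensor.map_id _)).trans (Category.comp_id _))
    · rw [reassoc_of% (letter_sec a h), eqLetter_act, letter_map]

end Words

end Multi

namespace Multi

/-- A type of words labelled by sequences of elements of `α`, with a relation of decomposition
lifting uniquely the decompositions of the labels as concatenations. -/
structure Index (α : Type u) where
  W : Type u
  π : W → List α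
  Dec : List W → W → Prop
  flatten_eq {l : List W} {t : W} : Dec l t → (l.map π).flatten = π t
  exists_lift {t : W} (L : List (List α)) : L.flatten = π t → ∃ l, Dec l t ∧ l.map π = L
  lift_unique {t : W} {l l' : List W} : Dec l t → Dec l' t → l.map π = l'.map π → l = l'
  dec_single (t : W) : Dec [t] t
  dec_flatten {ls : List (List W)} {l : List W} {t : W} :
    List.Forall₂ Dec ls l → Dec l t → Dec ls.flatten t

variable {V : Type u} [Category.{v} V] (E : Multitensor V)

/-- Objects indexed by words, with composition maps along decompositions. -/
structure MultiAlg {α : Type u'} (I : Index α) where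
  obj : I.W → V
  comp {l : List I.W} {t : I.W} (d : I.Dec l t) : E.tensor.obj (l.map obj) ⟶ obj t
  unit_comp (t : I.W) : E.unit.app (obj t) ≫ comp (I.dec_single t) = 𝟙 (obj t)
  assoc {ls : List (List I.W)} {l : List I.W} {t : I.W} (r : List.Forall₂ I.Dec ls l)
    (d : I.Dec l t) :
    E.tensor.map (Seq.homRel (fun _ _ d => comp d) r) ≫ comp d =
      E.substTo (List.map obj) ls (Words.flatten_map_map obj rfl) ≫ comp (I.dec_flatten r d)

namespace MultiAlg

variable {E} {α : Type u'} {I : Index α} (X : MultiAlg E I)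

/-- The values of a multialgebra are algebras for the unary part. -/
@[simps] abbrev alg (t : I.W) : Words.Alg E where
  A := X.obj t
  a := X.comp (I.dec_single t)
  unit := X.unit_comp t
  assoc := by
    have := X.assoc (.cons (I.dec_single t) .nil) (I.dec_single t)
    refine Eq.trans ?_ this.symm
    refine congrArg (· ≫ _) ?_
    refine Eq.symm (Eq.trans (congrArg (_ ≫ ·) (congrArg (_ ≫ ·) (E.tensor.map_id _))) ?_)
    refine Eq.trans (congrArg (· ≫ _) (E.tensor.map_id _)) ?_
    exact (Category.id_comp _).trans (Category.comp_id _)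

end MultiAlg

namespace Seq

variable {α : Type*} {β : Type*} {γ : Type*}

/-- The morphism of sequences with given entries, the source being indexed by the image of a
list. -/
def homPi {f : β → V} {g : α → V} (π : α → β) (x : ∀ a, f (π a) ⟶ g a) :
    ∀ l : List α, (((l.map π).map f : Seq V) ⟶ l.map g)
  | [] => 𝟙 nil
  | a :: l => consHom (x a) (homPi π x l)

theorem homMap_homPi {f f' : β → V} {g : α → V} (π : α → β) (y : ∀ b, f b ⟶ f' b)
    (x : ∀ a, f' (π a) ⟶ g a) (l : List α) :
    homMap y (l.map π) ≫ homPi π x l = homPi π (fun a => y (π a) ≫ x a) l := by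
  induction l with
  | nil => rfl
  | cons a l ih => exact congrArg (consHom _) ih

theorem homPi_homMap {f : β → V} {g g' : α → V} (π : α → β) (x : ∀ a, f (π a) ⟶ g a)
    (y : ∀ a, g a ⟶ g' a) (l : List α) :
    homPi π x l ≫ homMap y l = homPi π (fun a => x a ≫ y a) l := by
  induction l with
  | nil => rfl
  | cons a l ih => exact congrArg (consHom _) ih

theorem appendMap_homPi {f : β → V} {g : α → V} (π : α → β) (x : ∀ a, f (π a) ⟶ g a)
    (l m : List α) :
    Arrow.mk (appendMap (homPi π x l) (homPi π x m)) = Arrow.mk (homPi π x (l ++ m)) := by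
  induction l with
  | nil => rfl
  | cons a l ih => exact arrow_mk_consHom rfl ih

theorem flattenHom_homPi {f : β → V} {g : α → V} (π : α → β) (x : ∀ a, f (π a) ⟶ g a)
    (L : List (List α)) :
    Arrow.mk (flatten.map (homPi (f := fun l : List β => (l.map f : Seq V))
      (g := fun l : List α => (l.map g : Seq V)) (List.map π) (homPi π x) L)) =
      Arrow.mk (homPi π x L.flatten) := by
  induction L with
  | nil => rfl
  | cons l L ih =>
    exact (arrow_mk_appendMap rfl ih).trans (appendMap_homPi π x l L.flatten)

/-- Comparison of two composites of a morphism given by a relation and a morphism given by a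
map. -/
theorem homRel_homPi_eq {δ : Type*} {f : β → V} {g : δ → V} {h : γ → V} {k : α → V} (π : α → β)
    (ρ : γ → δ) {R : β → δ → Prop} {S : α → γ → Prop} (x : ∀ b c, R b c → (f b ⟶ g c))
    (y : ∀ c, g (ρ c) ⟶ h c) (x' : ∀ a, f (π a) ⟶ k a) (y' : ∀ a c, S a c → (k a ⟶ h c))
    (H : ∀ a c r s, x (π a) (ρ c) r ≫ y c = x' a ≫ y' a c s) :
    ∀ {l : List α} {m : List γ} (r : List.Forall₂ R (l.map π) (m.map ρ))
      (s : List.Forall₂ S l m), homRel x r ≫ homPi ρ y m = homPi π x' l ≫ homRel y' s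
  | [], [], _, _ => rfl
  | a :: l, b :: m, r, s => congrArg₂ consHom (H _ _ _ _)
      (homRel_homPi_eq π ρ x y x' y' H (List.forall₂_cons.1 r).2 (List.forall₂_cons.1 s).2)
  | [], _ :: _, r, _ => by cases r
  | _ :: _, [], r, _ => by cases r

end Seq

namespace Multitensor

variable {E}

theorem substTo_naturality_homPi {α β : Type*} {f : β → V} {g : α → V} (π : α → β)
    (x : ∀ a, f (π a) ⟶ g a) (M : List (List α)) (L : List α) (h : M.flatten = L)
    (h₁ : ((M.map (List.map π)).map (List.map f)).flatten = (L.map π).map f)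
    (h₂ : (M.map (List.map g)).flatten = L.map g) :
    E.tensor.map (Seq.homPi (f := fun l => E.tensor.obj (l.map f)) (List.map π)
        (fun l => E.tensor.map (Seq.homPi π x l)) M) ≫ E.substTo (List.map g) M h₂ =
      E.substTo (List.map f) (M.map (List.map π)) h₁ ≫ E.tensor.map (Seq.homPi π x L) := by
  subst h
  unfold substTo
  have e₀ : Seq.homPi (f := fun l => E.tensor.obj (l.map f)) (List.map π)
        (fun l => E.tensor.map (Seq.homPi π x l)) M ≫ Seq.fuse E.tensor (List.map g) M =
      Seq.fuse E.tensor (List.map f) (M.map (List.map π)) ≫ (Seq.map E.tensor).map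
        (Seq.homPi (f := fun l : List β => (l.map f : Seq V))
          (g := fun l : List α => (l.map g : Seq V)) (List.map π) (Seq.homPi π x) M) := by
    clear h₁ h₂
    induction M with
    | nil => rfl
    | cons m M ih =>
      exact congrArg₂ Seq.consHom ((Category.comp_id _).trans (Category.id_comp _).symm) ih
  have e₁ := congrArg E.tensor.map e₀
  have e₂ := E.subst.naturality (Seq.homPi (f := fun l : List β => (l.map f : Seq V))
          (g := fun l : List α => (l.map g : Seq V)) (List.map π) (Seq.homPi π x) M)
  have e₃ := congrArg E.tensor.map
    (Seq.eqToHom_comp_eq_comp_eqToHom (Seq.flattenHom_homPi π x M) h₁ h₂)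
  simp only [Functor.map_comp] at e₁ e₃
  rw [Category.assoc, Category.assoc, e₃, ← Category.assoc (E.tensor.map (Seq.homPi _ _ _)), e₁,
    Category.assoc]
  exact congrArg (_ ≫ ·) ((reassoc_of% e₂) _)

end Multitensor

namespace Index

/-- All the words. -/
abbrev words (α : Type u) : Index α where
  W := List α
  π w := w
  Dec L t := L.flatten = t
  flatten_eq h := by simpa using h
  exists_lift L h := ⟨L, h, List.map_id L⟩
  lift_unique _ _ e := by simpa using e
  dec_single t := List.append_nil t
  dec_flatten r d := (flatten_of_forall₂ r).trans d

variable {α : Type u} (I : Index α)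

theorem forall₂_lift {M : List (List (List α))} {l : List I.W}
    (r : List.Forall₂ (fun m t => List.flatten m = t) M (l.map I.π)) :
    ∃ ls : List (List I.W), ls.map (List.map I.π) = M ∧ List.Forall₂ I.Dec ls l := by
  induction l generalizing M with
  | nil =>
    cases r
    exact ⟨[], rfl, .nil⟩
  | cons t l ih =>
    cases r with
    | cons h r =>
      obtain ⟨ls, rfl, hls⟩ := ih r
      obtain ⟨l', d, rfl⟩ := I.exists_lift _ h
      exact ⟨l' :: ls, rfl, .cons d hls⟩

theorem dbl_lift {t : I.W} (D : DoubleDec (I.π t)) :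
    ∃ (ls : List (List I.W)) (l : List I.W) (_ : List.Forall₂ I.Dec ls l) (_ : I.Dec l t)
      (h₁ : _) (h₂ : _) (h₃ : _), D = ⟨ls.map (List.map I.π), l.map I.π, ls.flatten.map I.π,
        h₁, h₂, h₃⟩ := by
  obtain ⟨M, L, L', h₁, h₂, h₃⟩ := D
  obtain ⟨l, d, rfl⟩ := I.exists_lift L h₃
  obtain ⟨ls, rfl, r⟩ := I.forall₂_lift h₁
  obtain rfl : ls.flatten.map I.π = L' := by rw [← h₂, List.map_flatten]
  exact ⟨ls, l, r, d, h₁, h₂, h₃, rfl⟩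

end Index

namespace MultiAlg

variable {E}

/-- A system of letters in a multialgebra. -/
abbrev Letters {I : Index (Words.Alg E)} (X : MultiAlg E I) :=
  ∀ (t : I.W) (a : Words.Alg E), [a] = I.π t → (a ⟶ X.alg t)

/-- A morphism from a multialgebra indexed by words, compatible with composition and letters. -/
structure IsHom {I : Index (Words.Alg E)} (G : MultiAlg E (Index.words (Words.Alg E)))
    (j : G.Letters) (X : MultiAlg E I) (f : X.Letters) (h : ∀ t, G.obj (I.π t) ⟶ X.obj t) :
    Prop where
  comp {l : List I.W} {t : I.W} (d : I.Dec l t) :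
    G.comp (l := l.map I.π) (t := I.π t) (I.flatten_eq d) ≫ h t =
      E.tensor.map (Seq.homPi I.π h l) ≫ X.comp d
  letter (t : I.W) (a : Words.Alg E) (e : [a] = I.π t) : (j _ a e).f ≫ h t = (f t a e).f

end MultiAlg

namespace Words

variable {E} [HasColimits V] {I : Index (Alg E)} (X : MultiAlg E I) (f : X.Letters)

theorem exists_ext {G : List (Alg E) → V} (x : ∀ t, G (I.π t) ⟶ X.obj t) :
    ∃ k : ∀ t, (opsFunctor E).obj G (I.π t) ⟶ X.obj t, ∀ t,
      (∀ l (d : I.Dec l t), op G (l.map I.π) (I.flatten_eq d) ≫ k t =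
        E.tensor.map (Seq.homPi I.π x l) ≫ X.comp d) ∧
      ∀ a e, letter G a e ≫ k t = (f t a e).f := by
  have key : ∀ t (L : List (List (Alg E))), L.flatten = I.π t →
      ∃ k : E.tensor.obj (L.map G) ⟶ X.obj t, ∀ l (d : I.Dec l t) (h : L = l.map I.π),
        k = E.tensor.map (eqToHom (congrArg (List.map G) h)) ≫
          E.tensor.map (Seq.homPi I.π x l) ≫ X.comp d := by
    intro t L h
    obtain ⟨l, d, rfl⟩ := I.exists_lift L h
    refine ⟨E.tensor.map (Seq.homPi I.π x l) ≫ X.comp d, fun l' d' h' => ?_⟩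
    obtain rfl := I.lift_unique d d' h'
    simp
  choose k hk using key
  choose k' hk' using fun t => exists_ops_desc (G := G) (w := I.π t) (k t) (fun a e => (f t a e).f)
  refine ⟨k', fun t => ⟨fun l d => ?_, (hk' t).2⟩⟩
  rw [(hk' t).1, hk t _ (I.flatten_eq d) l d rfl]
  simp

/-- The extension of a family of morphisms along operations. -/
noncomputable def ext {G : List (Alg E) → V} (x : ∀ t, G (I.π t) ⟶ X.obj t) :
    ∀ t, (opsFunctor E).obj G (I.π t) ⟶ X.obj t :=
  (exists_ext X f x).choose

theorem op_ext {G : List (Alg E) → V} (x : ∀ t, G (I.π t) ⟶ X.obj t) {l t} (d : I.Dec l t) :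
    op G (l.map I.π) (I.flatten_eq d) ≫ ext X f x t = E.tensor.map (Seq.homPi I.π x l) ≫ X.comp d :=
  ((exists_ext X f x).choose_spec t).1 l d

theorem letter_ext {G : List (Alg E) → V} (x : ∀ t, G (I.π t) ⟶ X.obj t) (t a) (e : [a] = I.π t) :
    letter G a e ≫ ext X f x t = (f t a e).f :=
  ((exists_ext X f x).choose_spec t).2 a e

/-- The extension of morphisms on operations is determined on the decompositions that lift. -/
theorem ops_ext_lift {G : List (Alg E) → V} {t : I.W} {Z : V}
    {k k' : (opsFunctor E).obj G (I.π t) ⟶ Z}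
    (h₁ : ∀ l (d : I.Dec l t), op G (l.map I.π) (I.flatten_eq d) ≫ k =
      op G (l.map I.π) (I.flatten_eq d) ≫ k')
    (h₂ : ∀ a h, letter G a h ≫ k = letter G a h ≫ k') : k = k' :=
  ops_ext (fun L h => by
    obtain ⟨l, d, rfl⟩ := I.exists_lift L h
    exact h₁ l d) h₂

theorem ext_naturality {G G' : List (Alg E) → V} (g : G ⟶ G') (x : ∀ t, G' (I.π t) ⟶ X.obj t) :
    ext X f (fun t => g (I.π t) ≫ x t) =
      fun t => (opsFunctor E).map g (I.π t) ≫ ext X f x t := by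
  funext t
  refine ops_ext_lift (fun l d => ?_) (fun a e => ?_)
  · rw [op_ext X f _ d, reassoc_of% (op_map g (l.map I.π)), op_ext X f _ d, ← Category.assoc,
      ← Functor.map_comp, Seq.homMap_homPi]
  · rw [letter_ext, reassoc_of% (letter_map g), letter_ext]

theorem act_ext (s : PreAlg (opsFunctor E)) (h : ∀ t, s.tgt (I.π t) ⟶ X.obj t)
    (w : ∀ t, s.str (I.π t) ≫ h t =
      ext X f (fun t => (unit s.src ≫ s.str) (I.π t) ≫ h t) t) :
    (fun t => act s (I.π t) ≫ ext X f h t) =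
      fun t => mul s.src (I.π t) ≫ ext X f (fun t => (unit s.src ≫ s.str) (I.π t) ≫ h t) t := by
  funext t
  refine eqs_ext (fun D => ?_) (fun a e => ?_) (fun a e => ?_)
  · obtain ⟨ls, l, r, d, h₁, h₂, h₃, rfl⟩ := I.dbl_lift D
    refine ((reassoc_of% (dbl_act s ⟨_, _, _, h₁, h₂, h₃⟩)) _).trans (Eq.trans ?_
      ((reassoc_of% (dbl_mul (G := s.src) ⟨_, _, _, h₁, h₂, h₃⟩)) _).symm)
    change E.tensor.map (actHom s h₁) ≫ op s.tgt (l.map I.π) (I.flatten_eq d) ≫ ext X f h t =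
      E.substTo (List.map s.src) (ls.map (List.map I.π)) (flatten_map_map _ h₂) ≫
        op s.src (ls.flatten.map I.π) (I.flatten_eq (I.dec_flatten r d)) ≫ ext X f _ t
    rw [op_ext X f h d,
      op_ext X f _ (I.dec_flatten r d), ← Category.assoc, ← Functor.map_comp,
      ← Category.assoc (E.substTo _ _ _),
      ← Multitensor.substTo_naturality_homPi I.π _ ls ls.flatten rfl _ (flatten_map_map _ rfl),
      Category.assoc, ← X.assoc r d, ← Category.assoc (E.tensor.map _), ← Functor.map_comp]
    refine congrArg (fun z => E.tensor.map z ≫ _) ?_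
    refine Seq.homRel_homPi_eq (List.map I.π) I.π _ _ _ _ (fun l' t' e d' => ?_) h₁ r
    rw [Category.assoc, w, op_ext X f _ d']
  · rw [reassoc_of% (actLetter_act s), reassoc_of% (actLetter_mul (w := I.π t)), letter_ext]
    refine (Category.assoc _ _ _).trans ?_
    refine (congrArg (_ ≫ ·) (op_ext X f h (I.dec_single t))).trans ?_
    have e₁ : (letter s.src a e ≫ s.str (I.π t)) ≫ h t = (f t a e).f := by
      rw [Category.assoc, w, letter_ext]
    refine (Category.assoc _ _ _).symm.trans ?_
    refine Eq.trans (congrArg (· ≫ _) ?_) (f t a e).h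
    refine (E.tensor.map_comp _ _).symm.trans (congrArg E.tensor.map ?_)
    exact congrArg (fun z => Seq.consHom z (𝟙 Seq.nil)) e₁
  · rw [reassoc_of% (eqLetter_act s), reassoc_of% (eqLetter_mul (w := I.π t)), letter_ext,
      letter_ext]

/-- A multialgebra with letters as an algebra for the presentation. -/
noncomputable def target : (presentation E).Target (piComap I.π) where
  obj := X.obj
  ext x := ext X f x
  ext_nat g x := ext_naturality X f g x
  unit_ext {G} x := by
    funext t
    have e := op_ext X f x (I.dec_single t)
    refine (comp_eq_right e).trans ?_
    have e' := (reassoc_of% (E.unit.naturality (x t))) (X.comp (I.dec_single t))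
    refine Eq.trans e'.symm ?_
    exact (congrArg (x t ≫ ·) (X.unit_comp t)).trans (Category.comp_id _)
  act_ext s h w := act_ext X f s h fun t => congrFun w t

/-- The multialgebra given by an algebra for the presentation. -/
noncomputable def toMultiAlg (G : List (Alg E) → V) (g : (opsFunctor E).obj G ⟶ G)
    (h₁ : unit G ≫ g = 𝟙 G) (h₂ : act ⟨G, G, g⟩ ≫ g = mul G ≫ g) :
    MultiAlg E (Index.words (Alg E)) where
  obj := G
  comp {l t} d := op G l d ≫ g t
  unit_comp t := (Category.assoc _ _ _).symm.trans (congrFun h₁ t)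
  assoc {ls l t} r d := by
    let D : DoubleDec t := ⟨ls, l, ls.flatten, r, rfl, d⟩
    have e := congrArg (dbl G D ≫ ·) (congrFun h₂ t)
    have e₁ := (reassoc_of% (dbl_act ⟨G, G, g⟩ D)) (g t)
    have e₂ := (reassoc_of% (dbl_mul (G := G) D)) (g t)
    exact e₁.symm.trans (e.trans e₂)

/-- The letters of the multialgebra given by an algebra for the presentation. -/
noncomputable def toMultiAlgLetters (G : List (Alg E) → V) (g : (opsFunctor E).obj G ⟶ G)
    (h₁ : unit G ≫ g = 𝟙 G) (h₂ : act ⟨G, G, g⟩ ≫ g = mul G ≫ g) :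
    (toMultiAlg G g h₁ h₂).Letters := fun t a e =>
  { f := letter G a e ≫ g t
    h := by
      have e' := congrArg (actLetter G a e ≫ ·) (congrFun h₂ t)
      have e₁ := (reassoc_of% (actLetter_act ⟨G, G, g⟩ a e)) (g t)
      have e₂ := (reassoc_of% (actLetter_mul (G := G) a e)) (g t)
      exact (Category.assoc _ _ _).symm.trans (e₁.symm.trans (e'.trans e₂)) }

theorem isHom_iff (G : List (Alg E) → V) (g : (opsFunctor E).obj G ⟶ G)
    (h₁ : unit G ≫ g = 𝟙 G) (h₂ : act ⟨G, G, g⟩ ≫ g = mul G ≫ g)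
    (h : ∀ t, G (I.π t) ⟶ X.obj t) :
    MultiAlg.IsHom (toMultiAlg G g h₁ h₂) (toMultiAlgLetters G g h₁ h₂) X f h ↔
      (fun t => g (I.π t) ≫ h t) = ext X f h := by
  constructor
  · intro H
    funext t
    refine ops_ext_lift (fun l d => ?_) (fun a e => ?_)
    · exact (Category.assoc _ _ _).symm.trans ((H.comp d).trans (op_ext X f h d).symm)
    · exact (Category.assoc _ _ _).symm.trans
        ((H.letter t a e).trans (letter_ext X f h t a e).symm)
  · intro H
    refine ⟨fun {l t} d => ?_, fun t a e => ?_⟩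
    · exact (comp_eq_right (congrFun H t)).trans (op_ext X f h d)
    · exact (comp_eq_right (congrFun H t)).trans (letter_ext X f h t a e)

variable (E)

/-- The initial multialgebra with letters indexed by words. -/
theorem exists_initial (κ : Cardinal.{v}) [Fact κ.IsRegular] (hE : E.IsAccessible κ) :
    ∃ (G : MultiAlg E (Index.words (Alg E))) (j : G.Letters),
      ∀ (I : Index (Alg E)) (X : MultiAlg E I) (f : X.Letters),
        ∃! h : ∀ t, G.obj (I.π t) ⟶ X.obj t, G.IsHom j X f h := by
  have : E.tensor.IsCardinalAccessible κ := hE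
  have hκ : Cardinal.aleph0 ≤ κ := (Fact.out : κ.IsRegular).aleph0_le
  have := Cardinal.noMaxOrder hκ
  have hne : κ.ord ≠ 0 := by
    rw [Ne, Cardinal.ord_eq_zero]
    exact (Cardinal.aleph0_pos.trans_le hκ).ne'
  have : Nonempty κ.ord.ToType := Ordinal.nonempty_toType_iff.2 hne
  let : OrderBot κ.ord.ToType := WellFoundedLT.toOrderBot _
  let : SuccOrder κ.ord.ToType := SuccOrder.ofLinearWellFoundedLT _
  have := E.tensor.preservesColimitsOfShape_of_isCardinalAccessible κ κ.ord.ToType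
  have : PreservesColimitsOfShape κ.ord.ToType (presentation E).Φ :=
    inferInstanceAs (PreservesColimitsOfShape κ.ord.ToType (opsFunctor E))
  have : PreservesColimitsOfShape κ.ord.ToType (presentation E).Ψ :=
    inferInstanceAs (PreservesColimitsOfShape κ.ord.ToType (eqsFunctor E))
  obtain ⟨G, g, h₁, h₂, h₃⟩ := (presentation E).exists_initial κ.ord.ToType
  refine ⟨toMultiAlg G g h₁ h₂, toMultiAlgLetters G g h₁ h₂, fun I X f => ?_⟩
  obtain ⟨h, hh, hu⟩ := h₃ (piComap I.π) (target X f)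
  exact ⟨h, (isHom_iff X f G g h₁ h₂ h).2 hh, fun k hk => hu k ((isHom_iff X f G g h₁ h₂ k).1 hk)⟩

end Words

end Multi

namespace Multi

namespace Seq

variable {V : Type u} [Category.{v} V] {α β : Type*}

theorem arrow_mk_eqToHom {X Y X' Y' : V} (p : X = Y) (q : X' = Y') (h : X = X') :
    Arrow.mk (eqToHom p) = Arrow.mk (eqToHom q) := by
  subst p q h
  rfl

theorem arrow_mk_comp_map_eqToHom {W : Type u'} [Category.{v'} W] (T : V ⥤ W) {X Y : V} {Z : W}
    (f : Z ⟶ T.obj X) (p : X = Y) : Arrow.mk (f ≫ T.map (eqToHom p)) = Arrow.mk f := by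
  subst p
  rw [eqToHom_refl, T.map_id, Category.comp_id]

/-- The morphism of sequences with given entries, source and target being indexed by images of a
list. -/
def homMap₂ {γ : Type*} {f : β → V} {g : γ → V} (p : α → β) (q : α → γ)
    (x : ∀ a, f (p a) ⟶ g (q a)) : ∀ l : List α, (((l.map p).map f : Seq V) ⟶ (l.map q).map g)
  | [] => 𝟙 nil
  | a :: l => consHom (x a) (homMap₂ p q x l)

theorem appendMap_fuse {W : Type u'} [Category.{v'} W] (T : V ⥤ W) (f : α → V) (l m : List α) :
    Arrow.mk (appendMap (fuse T f l) (fuse T f m)) = Arrow.mk (fuse T f (l ++ m)) := by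
  induction l with
  | nil => rfl
  | cons a l ih => exact arrow_mk_consHom rfl ih

theorem flattenHom_fuse {W : Type u'} [Category.{v'} W] (T : V ⥤ W) (f : β → V)
    (K : α → List β) (L : List α) :
    Arrow.mk (flatten.map (homMap (f := fun a => ((K a).map fun b => T.obj (f b) : Seq W))
      (g := fun a => ((K a).map f).map T.obj) (fun a => fuse T f (K a)) L)) =
      Arrow.mk (fuse T f (L.map K).flatten) := by
  induction L with
  | nil => rfl
  | cons l L ih => exact (arrow_mk_appendMap rfl ih).trans (appendMap_fuse T f _ _)

end Seq

namespace Multitensor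

variable {V : Type u} [Category.{v} V] (E : Multitensor V) {α β : Type*}

theorem unit_substTo (k : α → Seq V) (a : α) {l : Seq V} (h : ([a].map k).flatten = l) :
    E.unit.app (E.tensor.obj (k a)) ≫ E.substTo k [a] h =
      E.tensor.map (eqToHom ((List.append_nil (k a)).symm.trans h)) := by
  obtain rfl : l = k a := h.symm.trans (List.append_nil (k a))
  refine Eq.trans (congrArg (_ ≫ ·) ?_) ((E.unit_subst (k a)).trans (E.tensor.map_id _).symm)
  exact (congrArg (· ≫ _) (E.tensor.map_id _)).trans (Category.id_comp _)

theorem arrow_mk_app {C D : Type*} [Category* C] [Category* D] {F G : C ⥤ D} (φ : F ⟶ G) {X Y : C}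
    (h : X = Y) : Arrow.mk (φ.app X) = Arrow.mk (φ.app Y) := by
  subst h
  rfl

theorem substTo_assoc (k : β → Seq V) (K : α → List β) {m : α → Seq V}
    (hm : ∀ a, ((K a).map k).flatten = m a) (P : List α) {l : Seq V} (hl : (P.map m).flatten = l)
    (h : (((P.map K).flatten).map k).flatten = l)
    (h' : (P.map fun a => (K a).map fun b => E.tensor.obj (k b)).flatten =
      (P.map K).flatten.map fun b => E.tensor.obj (k b)) :
    E.tensor.map (Seq.homMap (fun a => E.substTo k (K a) (hm a)) P) ≫ E.substTo m P hl =
      E.substTo (fun a => (K a).map fun b => E.tensor.obj (k b)) P h' ≫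
        E.substTo k (P.map K).flatten h := by
  obtain rfl : (fun a => ((K a).map k).flatten) = m := funext hm
  let L : Seq (Seq (Seq V)) := P.map fun a => (K a).map k
  let P' : Seq (Seq V) := P.map fun a => ((K a).map k).map E.tensor.obj
  have hP' : P' = (Seq.map (Seq.map E.tensor)).obj L := (List.map_map).symm
  have hPm : P.map (fun a => ((K a).map k).flatten) = (Seq.map Seq.flatten).obj L :=
    (List.map_map).symm
  have hL : Seq.flatten.obj L = (P.map K).flatten.map k := by
    change (P.map fun a => (K a).map k).flatten = _
    rw [List.map_flatten, List.map_map]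
    rfl
  have hP'' : Seq.flatten.obj P' = ((P.map K).flatten.map k).map E.tensor.obj := by
    change (P.map fun a => ((K a).map k).map E.tensor.obj).flatten = _
    rw [List.map_flatten, List.map_flatten, List.map_map, List.map_map]
    rfl
  let X₁ := Seq.homMap (f := fun a => E.tensor.obj ((K a).map fun b => E.tensor.obj (k b)))
    (g := fun a => E.tensor.obj (((K a).map k).map E.tensor.obj))
    (fun a => E.tensor.map (Seq.fuse E.tensor k (K a))) P
  let X₂ := Seq.homMap (f := fun a => E.tensor.obj (((K a).map k).map E.tensor.obj))
    (g := fun a => E.tensor.obj (((K a).map k).flatten)) (fun a => E.subst.app ((K a).map k)) P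
  have hX : Seq.homMap (fun a => E.substTo k (K a) (hm a)) P = X₁ ≫ X₂ := by
    refine Eq.trans ?_ (Seq.homMap_comp _ _ P)
    refine congrArg (fun x => Seq.homMap x P) (funext fun a => ?_)
    exact congrArg (_ ≫ ·) ((congrArg (_ ≫ ·) (E.tensor.map_id _)).trans (Category.comp_id _))
  let F : (P.map fun a => E.tensor.obj (((K a).map k).map E.tensor.obj) : Seq V) ⟶
      (Seq.map E.tensor).obj P' := Seq.fuse E.tensor (fun a => ((K a).map k).map E.tensor.obj) P
  let Z : (Seq.map E.tensor).obj P' ⟶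
      (Seq.map E.tensor).obj (P.map fun a => ((K a).map k).flatten) :=
    Seq.homMap₂ (f := E.tensor.obj) (g := E.tensor.obj) (fun a => ((K a).map k).map E.tensor.obj)
      (fun a => ((K a).map k).flatten) (fun a => E.subst.app ((K a).map k)) P
  have hF : X₂ ≫ Seq.fuse E.tensor (fun a => ((K a).map k).flatten) P = F ≫ Z := by
    clear hX hl h h' hP'' hL hPm hP'
    induction P with
    | nil => rfl
    | cons a P ih => exact congrArg₂ Seq.consHom ((Category.comp_id _).trans
        (Category.id_comp _).symm) ih
  have hZ : Arrow.mk Z = Arrow.mk (Seq.mapNat₂ E.subst L) := by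
    clear hX hF hl h h' hP'' hL hPm hP'
    induction P with
    | nil => rfl
    | cons a P ih => exact Seq.arrow_mk_consHom rfl ih
  let N : (P.map (fun a => (K a).map fun b => E.tensor.obj (k b)) : Seq (Seq V)) ⟶ P' :=
    Seq.homMap (f := fun a => ((K a).map fun b => E.tensor.obj (k b) : Seq V))
      (g := fun a => ((K a).map k).map E.tensor.obj) (fun a => Seq.fuse E.tensor k (K a)) P
  have e₁ : E.tensor.map (eqToHom h') ≫ E.tensor.map (Seq.fuse E.tensor k (P.map K).flatten) =
      E.tensor.map (Seq.flatten.map N) ≫ E.tensor.map (eqToHom hP'') := by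
    rw [← Functor.map_comp, ← Functor.map_comp]
    exact congrArg E.tensor.map (Seq.eqToHom_comp_eq_comp_eqToHom
      (Seq.flattenHom_fuse E.tensor k K P) h' hP'')
  have e₂ : E.tensor.map (Seq.fuse E.tensor _ P) ≫ E.tensor.map ((Seq.map E.tensor).map N) =
      E.tensor.map X₁ ≫ E.tensor.map F := by
    rw [← Functor.map_comp, ← Functor.map_comp]
    exact congrArg E.tensor.map (Seq.fuse_naturality E.tensor
      (fun a => Seq.fuse E.tensor k (K a)) P).symm
  have e₃ : E.tensor.map ((Seq.map E.tensor).map N) ≫ E.subst.app P' =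
      E.subst.app _ ≫ E.tensor.map (Seq.flatten.map N) := E.subst.naturality N
  have e₄ : E.tensor.map Z ≫ E.subst.app _ ≫ E.tensor.map (eqToHom hl) =
      E.subst.app P' ≫ E.tensor.map (eqToHom hP'') ≫ E.subst.app ((P.map K).flatten.map k) ≫
        E.tensor.map (eqToHom h) := by
    apply Arrow.mk_injective
    have a := congrArg Arrow.mk (E.assoc L)
    have l₁ : Arrow.mk (E.tensor.map Z ≫ E.subst.app _ ≫ E.tensor.map (eqToHom hl)) =
        Arrow.mk (E.tensor.map (Seq.mapNat₂ E.subst L) ≫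
          E.subst.app ((Seq.map Seq.flatten).obj L) ≫
            E.tensor.map (eqToHom (Seq.flatten_map_flatten L))) := by
      refine Seq.arrow_mk_comp (Seq.arrow_mk_map _ hZ)
        (Seq.arrow_mk_comp (arrow_mk_app E.subst hPm) (Seq.arrow_mk_map _ ?_))
      exact Seq.arrow_mk_eqToHom _ _ (congrArg Seq.flatten.obj hPm)
    refine l₁.trans (a.trans ?_)
    refine Seq.arrow_mk_comp (arrow_mk_app E.subst hP'.symm) (Seq.arrow_mk_comp ?_ ?_)
    · exact Seq.arrow_mk_map _ (Seq.arrow_mk_eqToHom _ _ (congrArg Seq.flatten.obj hP'.symm))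
    · exact (arrow_mk_app E.subst hL).trans (Seq.arrow_mk_comp_map_eqToHom E.tensor
        (X := ((P.map K).flatten.map k).flatten) (E.subst.app _) h).symm
  have hX' : E.tensor.map (Seq.homMap (fun a => E.substTo k (K a) (hm a)) P) =
      E.tensor.map X₁ ≫ E.tensor.map X₂ := (congrArg _ hX).trans (E.tensor.map_comp _ _)
  have hF' : E.tensor.map X₂ ≫
      E.tensor.map (Seq.fuse E.tensor (fun a => ((K a).map k).flatten) P) =
      E.tensor.map F ≫ E.tensor.map Z := by
    rw [← Functor.map_comp, ← Functor.map_comp, hF]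
  refine (congrArg (· ≫ _) hX').trans ?_
  change (E.tensor.map X₁ ≫ E.tensor.map X₂) ≫
    (E.tensor.map (Seq.fuse E.tensor (fun a => ((K a).map k).flatten) P) ≫ E.subst.app _ ≫
      E.tensor.map (eqToHom hl)) =
    (E.tensor.map (Seq.fuse E.tensor _ P) ≫ E.subst.app _ ≫ E.tensor.map (eqToHom h')) ≫
      (E.tensor.map (Seq.fuse E.tensor k _) ≫ E.subst.app _ ≫ E.tensor.map (eqToHom h))
  refine (Category.assoc _ _ _).trans ?_
  refine (congrArg (_ ≫ ·) ((reassoc_of% hF') _)).trans ?_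
  refine (congrArg (fun z => _ ≫ _ ≫ z) e₄).trans ?_
  refine Eq.trans ?_ (comp_eq_right (Category.assoc _ _ _)).symm
  refine Eq.trans ?_ (congrArg (fun z => _ ≫ _ ≫ z) ((reassoc_of% e₁) _)).symm
  refine Eq.trans ?_ (congrArg (fun z => _ ≫ _ ≫ z) (Category.assoc _ _ _)).symm
  refine Eq.trans ?_ (congrArg (fun z => _ ≫ z) ((reassoc_of% e₃) _))
  exact ((reassoc_of% e₂) _).symm

end Multitensor

end Multi

namespace Multi

namespace Seq

variable {V : Type u} [Category.{v} V] {α β γ δ : Type*}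

/-- The identity, from a sequence indexed by a list to the sequence indexed by its image. -/
def unfuse (φ : α → β) (f : β → V) :
    ∀ l : List α, ((l.map fun a => f (φ a) : Seq V) ⟶ (l.map φ).map f)
  | [] => 𝟙 nil
  | _ :: l => consHom (𝟙 _) (unfuse φ f l)

theorem unfuse_homPi (φ : α → β) {f : β → V} {g : α → V} (x : ∀ a, f (φ a) ⟶ g a) (l : List α) :
    unfuse φ f l ≫ homPi φ x l = homMap x l := by
  induction l with
  | nil => rfl
  | cons a l ih => exact congrArg₂ consHom (Category.id_comp _) ih

theorem homPi_id_unfuse (φ : α → β) (f : β → V) (l : List α) :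
    homPi φ (fun a => 𝟙 (f (φ a))) l ≫ unfuse φ f l = 𝟙 _ := by
  induction l with
  | nil => rfl
  | cons a l ih => exact congrArg₂ consHom (Category.id_comp _) ih

theorem unfuse_homMap (φ : α → β) {f g : β → V} (x : ∀ b, f b ⟶ g b) (l : List α) :
    unfuse φ f l ≫ homMap x (l.map φ) = homMap (fun a => x (φ a)) l ≫ unfuse φ g l := by
  induction l with
  | nil => rfl
  | cons a l ih =>
    exact congrArg₂ consHom ((Category.id_comp _).trans (Category.comp_id _).symm) ih

theorem homRel_unfuse (φ : γ → δ) (ψ : α → β) {f : α → V} {f' : β → V} {g : δ → V}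
    {R : α → γ → Prop} {S : β → δ → Prop} (x : ∀ a c, R a c → (f a ⟶ g (φ c)))
    (y : ∀ b d, S b d → (f' b ⟶ g d)) (z : ∀ a, f a ⟶ f' (ψ a))
    (H : ∀ a c r s, x a c r = z a ≫ y (ψ a) (φ c) s) :
    ∀ {l : List α} {m : List γ} (r : List.Forall₂ R l m)
      (s : List.Forall₂ S (l.map ψ) (m.map φ)),
      homRel x r ≫ unfuse φ g m = homMap z l ≫ unfuse ψ f' l ≫ homRel y s
  | [], [], _, _ => rfl
  | a :: l, c :: m, r, s => by
    have ih := homRel_unfuse φ ψ x y z H (List.forall₂_cons.1 r).2 (List.forall₂_cons.1 s).2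
    refine congrArg₂ consHom ?_ ih
    refine (Category.comp_id _).trans ((H a c (List.forall₂_cons.1 r).1
      (List.forall₂_cons.1 s).1).trans ?_)
    exact congrArg (_ ≫ ·) (Category.id_comp _).symm
  | [], _ :: _, r, _ => by cases r
  | _ :: _, [], r, _ => by cases r

theorem appendMap_unfuse (φ : α → β) (f : β → V) (l m : List α) :
    Arrow.mk (appendMap (unfuse φ f l) (unfuse φ f m)) = Arrow.mk (unfuse φ f (l ++ m)) := by
  induction l with
  | nil => rfl
  | cons a l ih => exact arrow_mk_consHom rfl ih

theorem flattenHom_unfuse (φ : α → β) (f : β → V) (L : List (List α)) :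
    Arrow.mk (flatten.map (homMap (f := fun l : List α => (l.map fun a => f (φ a) : Seq V))
      (g := fun l : List α => (l.map φ).map f) (unfuse φ f) L)) =
      Arrow.mk (unfuse φ f L.flatten) := by
  induction L with
  | nil => rfl
  | cons l L ih => exact (arrow_mk_appendMap rfl ih).trans (appendMap_unfuse φ f _ _)

theorem homMap_eq_unfuse_homRel (φ : α → β) {f : β → V} {g : α → V} {R : β → α → Prop}
    (x : ∀ a, f (φ a) ⟶ g a) (y : ∀ b a, R b a → (f b ⟶ g a)) (H : ∀ a r, x a = y (φ a) a r) :
    ∀ {l : List α} (r : List.Forall₂ R (l.map φ) l), homMap x l = unfuse φ f l ≫ homRel y r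
  | [], _ => rfl
  | a :: l, r => by
    refine congrArg₂ consHom ((H a (List.forall₂_cons.1 r).1).trans (Category.id_comp _).symm) ?_
    exact homMap_eq_unfuse_homRel φ x y H (List.forall₂_cons.1 r).2

theorem fuse_eq {W : Type u'} [Category.{v'} W] (T : V ⥤ W) (f : α → V) (l : List α) :
    fuse T f l = eqToHom (List.map_map).symm := by
  induction l with
  | nil => rfl
  | cons a l ih => exact (congrArg (consHom _) ih).trans (consHom_eqToHom rfl _)

theorem unfuse_eq (φ : α → β) (f : β → V) (l : List α) :
    unfuse φ f l = eqToHom (List.map_map).symm := by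
  induction l with
  | nil => rfl
  | cons a l ih => exact (congrArg (consHom _) ih).trans (consHom_eqToHom rfl _)

end Seq

namespace Multitensor

variable {V : Type u} [Category.{v} V] (E : Multitensor V) {α β γ : Type*}

theorem substTo_congr {m : α → Seq V} {m' : β → Seq V} {P : List α} {Q : List β}
    (h : P.map m = Q.map m') (p) {l : Seq V} (hP : (P.map m).flatten = l)
    (hQ : (Q.map m').flatten = l) :
    E.tensor.map (eqToHom p) ≫ E.substTo m' Q hQ = E.substTo m P hP := by
  have aux : ∀ (z : Seq (Seq V)) (hz : P.map m = z) (X : Seq V) (q : X = List.map E.tensor.obj z)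
      (q' : X = (P.map m).map E.tensor.obj) (hz' : List.flatten z = l),
      E.tensor.map (eqToHom q) ≫ E.subst.app z ≫ E.tensor.map (eqToHom hz') =
        E.tensor.map (eqToHom q') ≫ E.subst.app (P.map m) ≫ E.tensor.map (eqToHom hP) := by
    rintro _ rfl _ rfl _ _
    rfl
  unfold substTo
  refine Eq.trans ?_ ((aux _ h _ (p.trans List.map_map.symm) List.map_map.symm hQ).trans ?_)
  · refine comp_eq_left ?_
    refine (E.tensor.map_comp _ _).symm.trans (congrArg E.tensor.map ?_)
    exact (congrArg (_ ≫ ·) (Seq.fuse_eq _ _ _)).trans (eqToHom_trans _ _)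
  · exact congrArg (fun z => E.tensor.map z ≫ _) (Seq.fuse_eq _ _ _).symm

theorem substTo_assoc_rel (k : β → Seq V) (K : α → List β) {m : γ → Seq V} {R : α → γ → Prop}
    (hR : ∀ a c, R a c → ((K a).map k).flatten = m c) {P : List α} {Q : List γ}
    (r : List.Forall₂ R P Q) {l : Seq V} (hl : (Q.map m).flatten = l)
    (h : (((P.map K).flatten).map k).flatten = l)
    (h' : (P.map fun a => (K a).map fun b => E.tensor.obj (k b)).flatten =
      (P.map K).flatten.map fun b => E.tensor.obj (k b)) :
    E.tensor.map (Seq.homRel (fun a c r => E.substTo k (K a) (hR a c r)) r) ≫ E.substTo m Q hl =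
      E.substTo (fun a => (K a).map fun b => E.tensor.obj (k b)) P h' ≫
        E.substTo k (P.map K).flatten h := by
  have key : ∃ (h₀ : P.map (fun a => ((K a).map k).flatten) = Q.map m) (p : _),
      Seq.homRel (fun a c r => E.substTo k (K a) (hR a c r)) r =
        Seq.homMap (f := fun a => E.tensor.obj ((K a).map fun b => E.tensor.obj (k b)))
          (g := fun a => E.tensor.obj (((K a).map k).flatten))
          (fun a => E.substTo k (K a) rfl) P ≫ eqToHom p := by
    clear h h' hl
    induction r with
    | nil => exact ⟨rfl, rfl, rfl⟩
    | @cons a c P Q hr r ih =>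
      obtain ⟨h₀, p, e⟩ := ih
      refine ⟨congrArg₂ List.cons (hR a c hr) h₀, congrArg₂ List.cons
        (congrArg E.tensor.obj (hR a c hr)) p, ?_⟩
      refine Eq.trans (congrArg (Seq.consHom _) e) ?_
      refine Eq.trans ?_ (congrArg (_ ≫ ·) (Seq.consHom_eqToHom
        (congrArg E.tensor.obj (hR a c hr)) p))
      refine congrArg₂ Seq.consHom ?_ rfl
      have aux : ∀ (z : Seq V) (hz : ((K a).map k).flatten = z),
          E.substTo k (K a) hz = E.substTo k (K a) rfl ≫ eqToHom (congrArg E.tensor.obj hz) := by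
        rintro _ rfl
        exact (Category.comp_id _).symm
      exact aux _ _
  obtain ⟨h₀, p, e⟩ := key
  rw [e, E.tensor.map_comp, Category.assoc, E.substTo_congr h₀ p (h₀ ▸ hl) hl]
  exact E.substTo_assoc k K (fun _ => rfl) P _ h h'

theorem unfuse_substTo (φ : α → β) (m : β → Seq V) (P : List α) {l : Seq V}
    (h : ((P.map φ).map m).flatten = l) (h' : (P.map fun a => m (φ a)).flatten = l) :
    E.tensor.map (Seq.unfuse φ (fun b => E.tensor.obj (m b)) P) ≫ E.substTo m (P.map φ) h =
      E.substTo (fun a => m (φ a)) P h' := by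
  unfold substTo
  rw [← Category.assoc, ← Functor.map_comp]
  have key : ∃ p : P.map (fun a => m (φ a)) = (P.map φ).map m,
      Seq.unfuse φ (fun b => E.tensor.obj (m b)) P ≫ Seq.fuse E.tensor m (P.map φ) =
        Seq.fuse E.tensor (fun a => m (φ a)) P ≫ (Seq.map E.tensor).map (eqToHom p) := by
    refine ⟨List.map_map.symm, ?_⟩
    refine ((congrArg₂ (· ≫ ·) (Seq.unfuse_eq _ _ _) (Seq.fuse_eq _ _ _)).trans
      (eqToHom_trans _ _)).trans ?_
    exact ((congrArg₂ (· ≫ ·) (Seq.fuse_eq _ _ _) (eqToHom_map _ _)).trans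
      (eqToHom_trans _ _)).symm
  obtain ⟨p, e⟩ := key
  rw [e]
  generalize_proofs at *
  revert h
  have aux : ∀ (z : Seq (Seq V)) (p : P.map (fun a => m (φ a)) = z) (h : List.flatten z = l),
    E.tensor.map (Seq.fuse E.tensor (fun a => m (φ a)) P ≫ (Seq.map E.tensor).map (eqToHom p)) ≫
      E.subst.app z ≫ E.tensor.map (eqToHom h) =
    E.tensor.map (Seq.fuse E.tensor (fun a => m (φ a)) P) ≫
      E.subst.app (P.map fun a => m (φ a)) ≫ E.tensor.map (eqToHom h') := by
    rintro _ rfl h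
    refine congrArg (fun z => E.tensor.map z ≫ _) ?_
    exact (congrArg (_ ≫ ·) ((Seq.map E.tensor).map_id _)).trans (Category.comp_id _)
  intro h
  exact aux _ p h

end Multitensor

namespace MultiAlg

variable {V : Type u} [Category.{v} V] {E : Multitensor V} {α β : Type*} {I : Index α}
  {I' : Index β} (X : MultiAlg E I') (φ : I.W → I'.W)

theorem assoc' (X : MultiAlg E I) {ls : List (List I.W)} {l L : List I.W} {t : I.W}
    (r : List.Forall₂ I.Dec ls l) (d : I.Dec l t) (h : ls.flatten = L) (d' : I.Dec L t)
    (h' : (ls.map (List.map X.obj)).flatten = L.map X.obj) :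
    E.tensor.map (Seq.homRel (fun _ _ d => X.comp d) r) ≫ X.comp d =
      E.substTo (List.map X.obj) ls h' ≫ X.comp d' := by
  subst h
  exact X.assoc r d

/-- Reindexing a multialgebra. -/
@[simps] abbrev pull (hφ : ∀ l t, I.Dec l t → I'.Dec (l.map φ) (φ t)) : MultiAlg E I where
  obj t := X.obj (φ t)
  comp {l t} d := E.tensor.map (Seq.unfuse φ X.obj l) ≫ X.comp (hφ l t d)
  unit_comp t := by
    refine Eq.trans ?_ (X.unit_comp (φ t))
    refine congrArg (_ ≫ ·) ((congrArg (· ≫ _) (E.tensor.map_id _)).trans ?_)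
    exact Category.id_comp _
  assoc {ls l t} r d := by
    have r' : List.Forall₂ I'.Dec (ls.map (List.map φ)) (l.map φ) := by
      rw [List.forall₂_map_left_iff, List.forall₂_map_right_iff]
      exact r.imp fun l t d => hφ l t d
    have h₁ : (ls.map (List.map φ)).flatten = ls.flatten.map φ := List.map_flatten.symm
    have h₂ : ((ls.map (List.map φ)).map (List.map X.obj)).flatten =
        (ls.flatten.map φ).map X.obj := Words.flatten_map_map _ h₁
    have h₃ : (ls.map fun l => (l.map φ).map X.obj).flatten = (ls.flatten.map φ).map X.obj := by
      rw [← h₂, List.map_map]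
      rfl
    have e := X.assoc' r' (hφ l t d) h₁ (hφ _ t (I.dec_flatten r d)) h₂
    have e₁ := Seq.homRel_unfuse φ (List.map φ)
      (f := fun l => E.tensor.obj (l.map fun t => X.obj (φ t)))
      (f' := fun l => E.tensor.obj (l.map X.obj)) (g := X.obj)
      (fun l t d => E.tensor.map (Seq.unfuse φ X.obj l) ≫ X.comp (hφ l t d))
      (fun _ _ d => X.comp d) (fun l => E.tensor.map (Seq.unfuse φ X.obj l))
      (fun _ _ _ _ => rfl) r r'
    have e₂ := E.substTo_naturality (fun l => Seq.unfuse φ X.obj l) ls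
      (Words.flatten_map_map (fun t => X.obj (φ t)) rfl) h₃ _ (Seq.flattenHom_unfuse φ X.obj ls)
    rw [← Category.assoc, ← Functor.map_comp, e₁, Functor.map_comp, Functor.map_comp,
      Category.assoc, Category.assoc, e]
    rw [← Category.assoc (E.tensor.map (Seq.unfuse _ _ _)),
      E.unfuse_substTo (List.map φ) (List.map X.obj) ls h₂ h₃, ← Category.assoc, e₂,
      Category.assoc]

end MultiAlg

end Multi

namespace Multi

namespace Index

theorem eq_map_toList {α : Type*} {L : List (List α)} {t : Option α} (h : L.flatten = t.toList) :
    ∃ l : List (Option α), l.map Option.toList = L := by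
  refine ⟨L.map List.head?, ?_⟩
  rw [List.map_map]
  refine (List.map_congr_left fun w hw => ?_).trans (List.map_id L)
  have h₁ : w.length ≤ t.toList.length := h ▸ (List.sublist_flatten_of_mem hw).length_le
  have h₂ : t.toList.length ≤ 1 := by cases t <;> simp
  match w, h₁.trans h₂ with
  | [], _ => rfl
  | [a], _ => rfl

theorem toList_injective {α : Type*} : Function.Injective (Option.toList (α := α)) := by
  intro a b h
  cases a <;> cases b <;> simp_all

/-- Words of length at most one. -/
abbrev short (α : Type u) : Index α where
  W := Option α
  π := Option.toList
  Dec l t := (l.map Option.toList).flatten = t.toList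
  flatten_eq h := h
  exists_lift L h := by
    obtain ⟨l, rfl⟩ := eq_map_toList h
    exact ⟨l, h, rfl⟩
  lift_unique _ _ e := toList_injective.list_map e
  dec_single t := by simp
  dec_flatten {ls l t} r d := by
    rw [← d, List.map_flatten]
    clear d
    induction r with
    | nil => rfl
    | cons h _ ih => rw [List.map_cons, List.flatten_cons, List.flatten_append, ih, h]; rfl

/-- The letters of a word of length at most one. -/
abbrev shortLetters {α : Type*} (t : Option α) : List (Option α) := t.toList.map some

theorem flatten_shortLetters {α : Type*} {l : List (Option α)} {t : Option α}
    (h : (l.map Option.toList).flatten = t.toList) :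
    (l.map shortLetters).flatten = shortLetters t := by
  unfold shortLetters
  rw [← h, List.map_flatten, List.map_map]
  rfl

theorem dec_shortLetters {α : Type u} (t : Option α) : (short α).Dec (shortLetters t) t := by
  cases t <;> rfl

end Index

namespace Short

open Index

variable {V : Type u} [Category.{v} V] (E : Multitensor V)

/-- The values of the multialgebra of short words. -/
abbrev obj : Option (Words.Alg E) → V
  | none => E.tensor.obj Seq.nil
  | some a => a.A

/-- The letters of a short word. -/
abbrev seq (t : Option (Words.Alg E)) : Seq V := (shortLetters t).map (obj E)

/-- The projection from the free multialgebra. -/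
abbrev proj : ∀ t, E.tensor.obj (seq E t) ⟶ obj E t
  | none => 𝟙 _
  | some a => a.a

/-- The inclusion in the free multialgebra. -/
abbrev incl : ∀ t, obj E t ⟶ E.tensor.obj (seq E t)
  | none => 𝟙 _
  | some a => E.unit.app a.A

/-- The unary action on the values. -/
abbrev str : ∀ t, E.tensor.obj [obj E t] ⟶ obj E t
  | none => E.subst.app [Seq.nil]
  | some a => a.a

/-- The insertion of a unary operation. -/
abbrev ins : ∀ t, E.tensor.obj (seq E t) ⟶
    E.tensor.obj ((shortLetters t).map fun s => E.tensor.obj [obj E s])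
  | none => 𝟙 _
  | some a => E.unit.app (E.tensor.obj [a.A])

theorem seq_eq (t : Option (Words.Alg E)) :
    ((shortLetters t).map fun s => [obj E s]).flatten = seq E t := by
  cases t <;> rfl

/-- The multiplication of a unary operation. -/
abbrev mult (t) : E.tensor.obj ((shortLetters t).map fun s => E.tensor.obj [obj E s]) ⟶
    E.tensor.obj (seq E t) :=
  E.substTo (fun s => [obj E s]) (shortLetters t) (seq_eq E t)

theorem mult_none : mult E none = 𝟙 _ := by
  have := E.map_unit_substTo (R := fun (b a : Option (Words.Alg E)) => b = a) (obj E)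
    (fun s => [obj E s]) (fun b a h => E.unit.app (obj E b) ≫
      E.tensor.map (eqToHom (by rw [h]; rfl))) (fun b a h => by rw [h]; rfl) (fun _ _ _ => rfl)
    (L := []) (M := []) .nil rfl
  exact ((Category.id_comp _).symm.trans (congrArg (· ≫ _) (E.tensor.map_id _).symm)).trans this

theorem incl_proj (t) : incl E t ≫ proj E t = 𝟙 _ := by
  cases t with
  | none => exact Category.id_comp _
  | some a => exact a.unit

theorem ins_mult (t) : ins E t ≫ mult E t = 𝟙 _ := by
  cases t with
  | none => exact (Category.id_comp _).trans (mult_none E)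
  | some a => exact (E.unit_substTo (fun s => [obj E s]) (some a) _).trans (E.tensor.map_id _)

theorem ins_str (t) : ins E t ≫ E.tensor.map (Seq.homMap (str E) (shortLetters t)) =
    proj E t ≫ incl E t := by
  cases t with
  | none => exact congrArg (_ ≫ ·) (E.tensor.map_id _)
  | some a => exact (E.unit.naturality a.a).symm

theorem str_proj (t) : E.tensor.map (Seq.homMap (str E) (shortLetters t)) ≫ proj E t =
    mult E t ≫ proj E t := by
  cases t with
  | none => rw [mult_none]; exact congrArg (· ≫ _) (E.tensor.map_id _)
  | some a =>
    refine a.assoc.symm.trans (congrArg (· ≫ _) ?_)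
    refine Eq.symm (Eq.trans (congrArg (_ ≫ ·) (congrArg (_ ≫ ·) (E.tensor.map_id _))) ?_)
    refine Eq.trans (congrArg (· ≫ _) (E.tensor.map_id _)) ?_
    exact (Category.id_comp _).trans (Category.comp_id _)

variable {l : List (Option (Words.Alg E))} {t : Option (Words.Alg E)}

theorem flatten_seq (d : (short (Words.Alg E)).Dec l t) : (l.map (seq E)).flatten = seq E t := by
  unfold seq
  rw [← flatten_shortLetters d, List.map_flatten, List.map_map]
  rfl

/-- The substitution of short words. -/
abbrev sub (d : (short (Words.Alg E)).Dec l t) :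
    E.tensor.obj (l.map fun s => E.tensor.obj (seq E s)) ⟶ E.tensor.obj (seq E t) :=
  E.substTo (seq E) l (flatten_seq E d)

theorem map_proj_incl (d : (short (Words.Alg E)).Dec l t) :
    E.tensor.map (Seq.homMap (fun s => proj E s ≫ incl E s) l) ≫ sub E d ≫ proj E t =
      sub E d ≫ proj E t := by
  have h₁ : (l.map fun s => (shortLetters s).map fun b => E.tensor.obj [obj E b]).flatten =
      (shortLetters t).map fun b => E.tensor.obj [obj E b] := by
    rw [← flatten_shortLetters d, List.map_flatten, List.map_map]
    rfl
  have e₁ : (fun s => proj E s ≫ incl E s) =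
      fun s => ins E s ≫ E.tensor.map (Seq.homMap (str E) (shortLetters s)) :=
    funext fun s => (ins_str E s).symm
  have hn : Arrow.mk (Seq.flatten.map (Seq.homMap (f := fun s => ((shortLetters s).map fun b =>
      E.tensor.obj [obj E b] : Seq V)) (g := seq E)
      (fun s => Seq.homMap (str E) (shortLetters s)) l)) =
      Arrow.mk (Seq.homMap (str E) (shortLetters t)) := by
    rw [← flatten_shortLetters d, ← Seq.flattenHom_homMap]
    refine congrArg Seq.flatten.mapArrow.obj (?_ : Arrow.mk _ = Arrow.mk _)
    clear d h₁
    induction l with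
    | nil => rfl
    | cons s l ih => exact Seq.arrow_mk_consHom rfl ih
  have e₂ := E.substTo_naturality (fun s => Seq.homMap (str E) (shortLetters s)) l h₁
    (flatten_seq E d) _ hn
  have e₃ : E.tensor.map (Seq.homMap (mult E) l) ≫ sub E d =
      E.substTo (fun s => (shortLetters s).map fun b => E.tensor.obj [obj E b]) l h₁ ≫
        mult E t := by
    have aux : ∀ (T : List (Option (Words.Alg E))) (h : (l.map shortLetters).flatten = T)
      (h₁ : (l.map fun s => (shortLetters s).map fun b => E.tensor.obj [obj E b]).flatten =
        T.map fun b => E.tensor.obj [obj E b]) (h₂ : (T.map fun s => [obj E s]).flatten = seq E t),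
      E.tensor.map (Seq.homMap (mult E) l) ≫ sub E d =
        E.substTo (fun s => (shortLetters s).map fun b => E.tensor.obj [obj E b]) l h₁ ≫
          E.substTo (fun s => [obj E s]) T h₂ := by
      rintro _ rfl h₁ h₂
      exact E.substTo_assoc _ shortLetters (seq_eq E) l _ _ _
    exact aux _ (flatten_shortLetters d) h₁ _
  have e₄ : E.tensor.map (Seq.homMap (ins E) l) ≫ E.tensor.map (Seq.homMap (mult E) l) = 𝟙 _ := by
    rw [← Functor.map_comp, ← Seq.homMap_comp, funext (ins_mult E), Seq.homMap_id]
    exact E.tensor.map_id _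
  rw [e₁, Seq.homMap_comp, Functor.map_comp, Category.assoc, reassoc_of% e₂, str_proj,
    ← reassoc_of% e₃, reassoc_of% e₄]

theorem map_sub_sub {ls : List (List (Option (Words.Alg E)))} {l : List (Option (Words.Alg E))}
    {t : Option (Words.Alg E)} (r : List.Forall₂ (short (Words.Alg E)).Dec ls l)
    (d : (short (Words.Alg E)).Dec l t) (d' : (short (Words.Alg E)).Dec ls.flatten t)
    (h : (ls.map (List.map fun s => E.tensor.obj (seq E s))).flatten =
      ls.flatten.map fun s => E.tensor.obj (seq E s)) :
    E.tensor.map (Seq.homRel (fun _ _ d => sub E d) r) ≫ sub E d =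
      E.substTo (List.map fun s => E.tensor.obj (seq E s)) ls h ≫ sub E d' := by
  have hid : ls.map id = ls := List.map_id ls
  refine (E.substTo_assoc_rel (seq E) id (fun _ _ d => flatten_seq E d) r (flatten_seq E d)
    ((congrArg (fun z => (z.flatten.map (seq E)).flatten) hid).trans (flatten_seq E d'))
    (h.trans (congrArg (fun z => z.flatten.map fun s => E.tensor.obj (seq E s)) hid.symm))).trans ?_
  have aux : ∀ (ls' : List (List (Option (Words.Alg E)))) (_ : ls' = ls) (h' h''),
      E.substTo (List.map fun s => E.tensor.obj (seq E s)) ls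
        (l := ls'.flatten.map fun s => E.tensor.obj (seq E s)) h' ≫
        E.substTo (seq E) ls'.flatten (l := seq E t) h'' =
      E.substTo (List.map fun s => E.tensor.obj (seq E s)) ls h ≫ sub E d' := by
    rintro _ rfl _ _
    rfl
  exact aux _ hid _ _

theorem homRel_comp_incl {ls : List (List (Option (Words.Alg E)))}
    {l : List (Option (Words.Alg E))} (r : List.Forall₂ (short (Words.Alg E)).Dec ls l) :
    Seq.homRel (fun l t d => E.tensor.map (Seq.homMap (incl E) l) ≫ sub E d ≫ proj E t) r ≫
        Seq.homMap (incl E) l =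
      Seq.homMap (f := fun l => E.tensor.obj (l.map (obj E)))
          (fun l => E.tensor.map (Seq.homMap (incl E) l)) ls ≫
        Seq.homRel (fun _ _ d => sub E d) r ≫
        Seq.homMap (fun t => proj E t ≫ incl E t) l := by
  refine (Seq.homRel_homMap _ _ _).trans (Eq.symm ((congrArg (_ ≫ ·)
    (Seq.homRel_homMap _ _ _)).trans ((Seq.homMap_homRel _ _ _).trans ?_)))
  refine Seq.homRel_congr (fun _ _ _ _ => ?_) _ _
  simp only [Category.assoc]

/-- The multialgebra of short words. -/
@[simps] abbrev multiAlg : MultiAlg E (short (Words.Alg E)) where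
  obj := obj E
  comp {l t} d := E.tensor.map (Seq.homMap (incl E) l) ≫ sub E d ≫ proj E t
  unit_comp t := by
    have e := E.unit_substTo (seq E) t (flatten_seq E ((short _).dec_single t))
    have n := (reassoc_of% (E.unit.naturality (incl E t)))
      (sub E ((short _).dec_single t) ≫ proj E t)
    refine n.symm.trans ?_
    refine (congrArg (_ ≫ ·) (comp_eq_left (e.trans (E.tensor.map_id _)))).trans ?_
    exact (congrArg (_ ≫ ·) (Category.id_comp _)).trans (incl_proj E t)
  assoc {ls l t} r d := by
    have d' := (short _).dec_flatten r d
    have h₁ : (ls.map (List.map fun s => E.tensor.obj (seq E s))).flatten =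
      ls.flatten.map fun s => E.tensor.obj (seq E s) := Words.flatten_map_map _ rfl
    have e₁ := E.substTo_naturality_homMap (incl E) ls ls.flatten rfl
      (Words.flatten_map_map _ rfl) h₁
    have e₃ := map_sub_sub E r d d' h₁
    have e₄ := homRel_comp_incl E r
    refine (Category.assoc _ _ _).symm.trans ?_
    refine (congrArg (· ≫ _) ((E.tensor.map_comp _ _).symm.trans
      ((congrArg E.tensor.map e₄).trans (E.tensor.map_comp _ _)))).trans ?_
    refine (Category.assoc _ _ _).trans ?_
    refine (congrArg (_ ≫ ·) ((congrArg (· ≫ _) (E.tensor.map_comp _ _)).trans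
      ((comp_eq_right (map_proj_incl E d)).trans
        ((comp_eq_left e₃).trans
          (Category.assoc _ _ _))))).trans ?_
    refine (comp_eq_left e₁).trans ?_
    exact Category.assoc _ _ _

end Short

end Multi

namespace Multi

variable {V : Type u} [Category.{v} V] {E : Multitensor V}

theorem Multitensor.substTo_naturality_map {α β : Type*} (K : α → List β) {f g : β → V}
    (x : ∀ b, f b ⟶ g b) (l : List α) {T : List β} (h : (l.map K).flatten = T)
    (h₁ : (l.map fun a => (K a).map f).flatten = T.map f)
    (h₂ : (l.map fun a => (K a).map g).flatten = T.map g) :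
    E.tensor.map (Seq.homMap (fun a => E.tensor.map (Seq.homMap x (K a))) l) ≫
        E.substTo (fun a => (K a).map g) l h₂ =
      E.substTo (fun a => (K a).map f) l h₁ ≫ E.tensor.map (Seq.homMap x T) := by
  refine E.substTo_naturality (fun a => Seq.homMap x (K a)) l h₁ h₂ _ ?_
  subst h
  rw [← Seq.flattenHom_homMap]
  refine congrArg Seq.flatten.mapArrow.obj (?_ : Arrow.mk _ = Arrow.mk _)
  clear h₁ h₂
  induction l with
  | nil => rfl
  | cons s l ih => exact Seq.arrow_mk_consHom rfl ih

namespace MultiAlg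

theorem comp_map {α : Type*} {I : Index α} (X : MultiAlg E I) (K : I.W → List I.W)
    (hK : ∀ t, I.Dec (K t) t) {l T : List I.W} {t : I.W} (h : (l.map K).flatten = T)
    (h₁ : (l.map fun s => (K s).map X.obj).flatten = T.map X.obj) (d : I.Dec l t)
    (d' : I.Dec T t) :
    E.tensor.map (Seq.homMap (fun s => X.comp (hK s)) l) ≫ X.comp d =
      E.substTo (fun s => (K s).map X.obj) l h₁ ≫ X.comp d' := by
  have r : List.Forall₂ I.Dec (l.map K) l := by
    rw [List.forall₂_map_left_iff, List.forall₂_same]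
    exact fun t _ => hK t
  have e₁ := Seq.homMap_eq_unfuse_homRel K (f := fun l => E.tensor.obj (l.map X.obj))
    (fun s => X.comp (hK s)) (fun _ _ d => X.comp d) (fun _ _ => rfl) r
  have h₂ : ((l.map K).map (List.map X.obj)).flatten = T.map X.obj := by
    rw [← h₁, List.map_map]
    rfl
  rw [e₁, Functor.map_comp, Category.assoc, X.assoc' r d h d' h₂, ← Category.assoc,
    E.unfuse_substTo K (List.map X.obj) l h₂ h₁]

/-- Reindexing letters. -/
@[simps] abbrev pullLetters {I I' : Index (Words.Alg E)} {X : MultiAlg E I'} (f : X.Letters)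
    (φ : I.W → I'.W) (hφ) (hπ : ∀ t, I.π t = I'.π (φ t)) : (X.pull (I := I) φ hφ).Letters :=
  fun t a e =>
  { f := (f (φ t) a (e.trans (hπ t))).f
    h := by
      refine Eq.trans ?_ (f (φ t) a (e.trans (hπ t))).h
      refine congrArg (_ ≫ ·) ((congrArg (· ≫ _) (E.tensor.map_id _)).trans ?_)
      exact Category.id_comp _ }

/-- Transport of a multialgebra along isomorphisms. -/
@[simps] abbrev transport {α : Type*} {I : Index α} (X : MultiAlg E I) {Y : I.W → V}
    (e : ∀ t, Y t ≅ X.obj t) : MultiAlg E I where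
  obj := Y
  comp {l t} d := E.tensor.map (Seq.homMap (fun t => (e t).hom) l) ≫ X.comp d ≫ (e t).inv
  unit_comp t := by
    have n := (reassoc_of% (E.unit.naturality (e t).hom)) (X.comp (I.dec_single t) ≫ (e t).inv)
    refine n.symm.trans ((congrArg (_ ≫ ·) (comp_eq_left (X.unit_comp t))).trans ?_)
    exact (congrArg (_ ≫ ·) (Category.id_comp _)).trans (e t).hom_inv_id
  assoc {ls l t} r d := by
    have e₁ := E.substTo_naturality_homMap (fun t => (e t).hom) ls ls.flatten rfl
      (Words.flatten_map_map _ rfl) (Words.flatten_map_map _ rfl)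
    have e₂ : Seq.homRel (fun l t (d : I.Dec l t) =>
        E.tensor.map (Seq.homMap (fun t => (e t).hom) l) ≫ X.comp d ≫ (e t).inv) r ≫
        Seq.homMap (fun t => (e t).hom) l =
        Seq.homMap (f := fun l => E.tensor.obj (l.map Y))
          (fun l => E.tensor.map (Seq.homMap (fun t => (e t).hom) l)) ls ≫
          Seq.homRel (fun _ _ d => X.comp d) r := by
      rw [Seq.homRel_homMap, Seq.homMap_homRel]
      refine Seq.homRel_congr (fun _ _ _ _ => ?_) _ _
      simp
    rw [← Category.assoc, ← Functor.map_comp, e₂, Functor.map_comp, Category.assoc,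
      ← Category.assoc (E.tensor.map (Seq.homRel _ _)), X.assoc, Category.assoc,
      ← Category.assoc, e₁, Category.assoc]

theorem isHom_transport {I : Index (Words.Alg E)} {G : MultiAlg E (Index.words (Words.Alg E))}
    {Y : List (Words.Alg E) → V} (e : ∀ t, Y t ≅ G.obj t) {j : G.Letters}
    {j' : (G.transport e).Letters} (hj : ∀ t a h, (j' t a h).f ≫ (e t).hom = (j t a h).f)
    {X : MultiAlg E I} {f : X.Letters} (h : ∀ t, Y (I.π t) ⟶ X.obj t) :
    (G.transport e).IsHom j' X f h ↔ G.IsHom j X f (fun t => (e (I.π t)).inv ≫ h t) := by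
  have key : ∀ l : List I.W, Seq.homMap (fun t => (e t).inv) (l.map I.π) ≫ Seq.homPi I.π h l =
      Seq.homPi I.π (fun t => (e (I.π t)).inv ≫ h t) l := Seq.homMap_homPi _ _ _
  have inv : ∀ l : List (List (Words.Alg E)), Seq.homMap (fun t => (e t).inv) l ≫
      Seq.homMap (fun t => (e t).hom) l = 𝟙 _ := by
    intro l
    rw [← Seq.homMap_comp]
    simp
  have inv' : ∀ l : List (List (Words.Alg E)), Seq.homMap (fun t => (e t).hom) l ≫
      Seq.homMap (fun t => (e t).inv) l = 𝟙 _ := by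
    intro l
    rw [← Seq.homMap_comp]
    simp
  constructor
  · intro H
    refine ⟨fun {l t} d => ?_, fun t a q => ?_⟩
    · have := congrArg (E.tensor.map (Seq.homMap (fun t => (e t).inv) (l.map I.π)) ≫ ·) (H.comp d)
      change _ ≫ (E.tensor.map (Seq.homMap (fun t => (e t).hom) (l.map I.π)) ≫
        G.comp (I.flatten_eq d) ≫ (e (I.π t)).inv) ≫ h t = _ at this
      rw [← Category.assoc, ← Category.assoc, ← Functor.map_comp, inv] at this
      rw [← key, Functor.map_comp, Category.assoc]
      refine Eq.trans ?_ this
      rw [← Category.assoc, ← Category.assoc]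
      refine congrArg (· ≫ _) (congrArg (· ≫ _) ?_)
      exact ((congrArg (· ≫ _) (E.tensor.map_id _)).trans (Category.id_comp _)).symm
    · rw [← H.letter t a q, ← hj]
      simp
  · intro H
    refine ⟨fun {l t} d => ?_, fun t a q => ?_⟩
    · have := congrArg (E.tensor.map (Seq.homMap (fun t => (e t).hom) (l.map I.π)) ≫ ·) (H.comp d)
      dsimp only at this
      rw [← key, Functor.map_comp, Category.assoc,
        ← Category.assoc (E.tensor.map _) (E.tensor.map _), ← Functor.map_comp, inv'] at this
      refine Eq.trans ?_ (this.trans ((congrArg (· ≫ _) (E.tensor.map_id _)).trans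
        (Category.id_comp _)))
      simp
    · rw [← H.letter t a q, ← hj]
      simp

end MultiAlg

end Multi

namespace Multi

variable {V : Type u} [Category.{v} V] {E : Multitensor V}

namespace Short

open Index

theorem multiAlg_comp_single (a : Words.Alg E) :
    (multiAlg E).comp ((short _).dec_single (some a)) = a.a := by
  have h := E.map_unit_substTo (R := fun (b a : Option (Words.Alg E)) => b = a) (obj E)
    (fun s => [obj E s]) (fun b a h => E.unit.app (obj E b) ≫
      E.tensor.map (eqToHom (by rw [h]; rfl))) (fun b a h => by rw [h]; rfl) (fun _ _ _ => rfl)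
    (L := [some a]) (M := [some a]) (.cons rfl .nil) rfl
  refine (comp_eq_left (Eq.trans ?_ h)).trans
    (Category.id_comp _)
  refine congrArg (· ≫ _) (congrArg E.tensor.map ?_)
  refine congrArg (fun z => Seq.consHom z (𝟙 Seq.nil)) ?_
  exact ((congrArg (_ ≫ ·) (E.tensor.map_id _)).trans (Category.comp_id _)).symm

/-- The tautological letters of the multialgebra of short words. -/
abbrev letters : (multiAlg E).Letters
  | none, _, e => absurd e (List.cons_ne_nil _ _)
  | some b, a, e =>
    { f := eqToHom (congrArg Monad.Algebra.A (List.singleton_inj.1 e : a = b) : a.A = b.A)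
      h := by
        obtain rfl : a = b := List.singleton_inj.1 e
        refine (congrArg (· ≫ _) (E.tensor.map_id _)).trans ?_
        exact (Category.id_comp _).trans ((multiAlg_comp_single a).trans (Category.comp_id _).symm) }

variable (P : MultiAlg E (short (Words.Alg E))) (f : P.Letters)

/-- The canonical morphism to a multialgebra of short words with letters. -/
abbrev toLetters : ∀ t, obj E t ⟶ P.obj t
  | none => P.comp (dec_shortLetters none)
  | some a => (f (some a) a rfl).f

theorem proj_toLetters (t) : proj E t ≫ toLetters P f t =
    E.tensor.map (Seq.homMap (toLetters P f) (shortLetters t)) ≫ P.comp (dec_shortLetters t) := by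
  cases t with
  | none => exact congrArg (· ≫ _) (E.tensor.map_id _).symm
  | some a => exact (f (some a) a rfl).h.symm

theorem comp_toLetters {l : List (Option (Words.Alg E))} {t : Option (Words.Alg E)}
    (d : (short (Words.Alg E)).Dec l t) : (multiAlg E).comp d ≫ toLetters P f t =
      E.tensor.map (Seq.homMap (toLetters P f) l) ≫ P.comp d := by
  have h : (l.map shortLetters).flatten = shortLetters t := flatten_shortLetters d
  have h₁ : ∀ g : Option (Words.Alg E) → V, (l.map fun a => (shortLetters a).map g).flatten =
      (shortLetters t).map g := by
    intro g
    rw [← h, List.map_flatten, List.map_map]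
    rfl
  have e₁ := E.substTo_naturality_map shortLetters (toLetters P f) l h (flatten_seq E d) (h₁ _)
  have e₂ := P.comp_map shortLetters dec_shortLetters h (h₁ _) d (dec_shortLetters t)
  have e₃ : ∀ s, (incl E s ≫ E.tensor.map (Seq.homMap (toLetters P f) (shortLetters s))) ≫
      P.comp (dec_shortLetters s) = toLetters P f s := by
    intro s
    rw [Category.assoc, ← proj_toLetters, ← Category.assoc, incl_proj, Category.id_comp]
  have e₄ : (multiAlg E).comp d ≫ toLetters P f t = E.tensor.map (Seq.homMap (incl E) l) ≫
      sub E d ≫ proj E t ≫ toLetters P f t :=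
    comp_eq_right (Category.assoc _ _ _)
  rw [e₄, proj_toLetters, ← reassoc_of% e₁, ← e₂, ← Functor.map_comp_assoc, ← Seq.homMap_comp,
    ← Functor.map_comp_assoc, ← Seq.homMap_comp, funext e₃]

end Short

namespace Words

open Index

variable {G : MultiAlg E (words (Alg E))} {j : G.Letters}

theorem exists_letter_inv (hG : ∀ (I : Index (Alg E)) (X : MultiAlg E I) (f : X.Letters),
    ∃! h : ∀ t, G.obj (I.π t) ⟶ X.obj t, G.IsHom j X f h) (a : Alg E) :
    ∃ k : G.obj [a] ⟶ a.A, (j [a] a rfl).f ≫ k = 𝟙 _ ∧ k ≫ (j [a] a rfl).f = 𝟙 _ := by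
  obtain ⟨h, hh, -⟩ := hG _ (Short.multiAlg E) Short.letters
  have hw : ∀ (l : List (Option (Alg E))) (t : Option (Alg E)), (short _).Dec l t →
    (words (Alg E)).Dec (l.map Option.toList) t.toList := fun l t d => d
  let P := G.pull (I := short (Alg E)) Option.toList hw
  let p : P.Letters := MultiAlg.pullLetters j (I := short (Alg E)) Option.toList hw fun t => rfl
  refine ⟨h (some a), hh.letter (some a) a rfl, ?_⟩
  have h₁ : G.IsHom j P p (fun t => h t ≫ Short.toLetters P p t) := by
    refine ⟨fun {l t} d => ?_, fun t b e => ?_⟩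
    · have e₁ := hh.comp d
      have e₂ := Short.comp_toLetters P p d
      refine (comp_eq_left e₁).trans
        ((comp_eq_right e₂).trans
          ((Category.assoc _ _ _).symm.trans ?_))
      refine congrArg (· ≫ _) ((E.tensor.map_comp _ _).symm.trans (congrArg E.tensor.map ?_))
      exact Seq.homPi_homMap _ _ _ _
    · obtain ⟨s, rfl⟩ : ∃ s, t = some s := by cases t <;> simp_all
      obtain rfl : b = s := List.singleton_inj.1 e
      refine (comp_eq_left (hh.letter (some b) b rfl)).trans ?_
      exact Category.id_comp _
  have h₂ : G.IsHom j P p (fun t => 𝟙 (G.obj t.toList)) := by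
    refine ⟨fun {l t} d => ?_, fun t b e => Category.comp_id _⟩
    refine (Category.comp_id _).trans ?_
    refine Eq.symm ((comp_eq_left ?_).trans
      (Category.id_comp _))
    refine (E.tensor.map_comp _ _).symm.trans ((congrArg E.tensor.map ?_).trans
      (E.tensor.map_id _))
    exact Seq.homPi_id_unfuse Option.toList G.obj l
  exact congrFun ((hG _ P p).unique h₁ h₂) (some a)

/-- A multialgebra indexed by words whose value at a letter is that letter, and which is initial
with this property. -/
structure Free (E : Multitensor V) where
  toMultiAlg : MultiAlg E (words (Alg E))
  alg_single (a : Alg E) : toMultiAlg.alg [a] = a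
  existsUnique (I : Index (Alg E)) (X : MultiAlg E I) (f : X.Letters) :
    ∃! h : ∀ t, toMultiAlg.obj (I.π t) ⟶ X.obj t, toMultiAlg.IsHom
      (fun _ a e => eqToHom ((alg_single a).symm.trans (congrArg toMultiAlg.alg e))) X f h

/-- The object assigned to a word after prescribing the values at letters. -/
abbrev strictObj (G : List (Alg E) → V) : List (Alg E) → V
  | [a] => a.A
  | w => G w

theorem exists_strict (hG : ∀ (I : Index (Alg E)) (X : MultiAlg E I) (f : X.Letters),
    ∃! h : ∀ t, G.obj (I.π t) ⟶ X.obj t, G.IsHom j X f h) : Nonempty (Free E) := by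
  choose k hk hk' using exists_letter_inv hG
  let e : ∀ t, strictObj G.obj t ≅ G.obj t := fun t => match t with
    | [] => CategoryTheory.Iso.refl _
    | [a] => ⟨(j [a] a rfl).f, k a, hk a, hk' a⟩
    | _ :: _ :: _ => CategoryTheory.Iso.refl _
  have hcomp : ∀ a, (G.transport e).comp ((words (Alg E)).dec_single [a]) = a.a := by
    intro a
    have h := (j [a] a rfl).h
    refine (comp_eq_left h).trans ?_
    exact (comp_eq_right (hk a)).trans (Category.comp_id _)
  have halg : ∀ a, (G.transport e).alg [a] = a := by
    intro a
    obtain ⟨A, s, p, q⟩ := a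
    have := hcomp ⟨A, s, p, q⟩
    unfold MultiAlg.alg
    congr
  refine ⟨⟨G.transport e, halg, fun I X f => ?_⟩⟩
  have key : ∀ t (a : Alg E) (h : [a] = t),
      (eqToHom ((halg a).symm.trans (congrArg (G.transport e).alg h))).f ≫ (e t).hom =
        (j t a h).f := by
    rintro _ a rfl
    refine (congrArg (· ≫ _) ?_).trans (Category.id_comp _)
    have aux : ∀ (x y : Alg E) (h : x = y), (eqToHom h).f = eqToHom (congrArg Monad.Algebra.A h) := by
      rintro x _ rfl
      rfl
    exact aux _ _ _
  obtain ⟨h, hh, hu⟩ := hG I X f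
  have iff := fun h => MultiAlg.isHom_transport (X := X) (f := f) e key h
  refine ⟨fun t => (e (I.π t)).hom ≫ h t, (iff _).2 ?_, fun h' hh' => ?_⟩
  · simpa using! hh
  · have := hu _ ((iff h').1 hh')
    funext t
    exact ((Iso.eq_inv_comp _).1 (congrFun this t).symm).symm

end Words

end Multi

namespace Multi

theorem flatten_injective_of_map {α β : Type*} (φ : α → β) {l l' : List (List α)}
    (h : l.flatten = l'.flatten) (e : l.map (List.map φ) = l'.map (List.map φ)) : l = l' := by
  rw [List.eq_iff_flatten_eq]
  refine ⟨h, ?_⟩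
  have := congrArg (List.map List.length) e
  simpa [List.map_map, Function.comp_def] using this

theorem exists_flatten_lift {α β : Type*} (φ : α → β) (L : List (List β)) :
    ∀ y : List α, L.flatten = y.map φ → ∃ l : List (List α), l.flatten = y ∧ l.map (List.map φ) = L := by
  induction L with
  | nil =>
    intro y h
    obtain rfl : y = [] := by simpa using h.symm
    exact ⟨[], rfl, rfl⟩
  | cons w L ih =>
    intro y h
    obtain ⟨y₁, y₂, rfl, h₁, h₂⟩ := List.map_eq_append_iff.1 h.symm
    obtain ⟨l, rfl, rfl⟩ := ih y₂ h₂.symm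
    exact ⟨y₁ :: l, rfl, congrArg (List.cons · _) h₁⟩

/-- The words on a set mapping to the given one. -/
abbrev Index.ofMap {S α : Type u} (φ : S → α) : Index α where
  W := List S
  π y := y.map φ
  Dec L y := L.flatten = y
  flatten_eq h := Words.flatten_map_map φ h
  exists_lift L h := exists_flatten_lift φ L _ h
  lift_unique h h' e := flatten_injective_of_map φ (h.trans h'.symm) e
  dec_single y := List.append_nil y
  dec_flatten r d := (flatten_of_forall₂ r).trans d

namespace Seq

variable {V : Type u} [Category.{v} V] {α β γ δ : Type*}

theorem homMap₂_comp {δ : Type*} {f : β → V} {g : γ → V} {h : δ → V} (p : α → β) (q : α → γ)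
    (r : α → δ) (x : ∀ a, f (p a) ⟶ g (q a)) (y : ∀ a, g (q a) ⟶ h (r a)) (l : List α) :
    homMap₂ p q x l ≫ homMap₂ q r y l = homMap₂ p r (fun a => x a ≫ y a) l := by
  induction l with
  | nil => rfl
  | cons a l ih => exact congrArg (consHom _) ih

theorem homMap₂_id {f : β → V} (p : α → β) (l : List α) :
    homMap₂ p p (fun a => 𝟙 (f (p a))) l = 𝟙 _ := by
  induction l with
  | nil => rfl
  | cons a l ih => exact congrArg (consHom _) ih

theorem arrow_mk_homMap₂ {f : β → V} {g : γ → V} (p : α → β) (q : α → γ)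
    (x : ∀ a, f (p a) ⟶ g (q a)) (ρ : δ → α) (l : List δ) :
    Arrow.mk (homMap₂ p q x (l.map ρ)) =
      Arrow.mk (homMap₂ (fun a => p (ρ a)) (fun a => q (ρ a)) (fun a => x (ρ a)) l) := by
  induction l with
  | nil => rfl
  | cons a l ih => exact arrow_mk_consHom rfl ih

theorem homPi_unfuse {f : β → V} {g : γ → V} (p : α → β) (q : α → γ)
    (x : ∀ a, f (p a) ⟶ g (q a)) (l : List α) :
    homPi (g := fun a => g (q a)) p x l ≫ unfuse q g l = homMap₂ p q x l := by
  induction l with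
  | nil => rfl
  | cons a l ih => exact congrArg₂ consHom (Category.comp_id _) ih

end Seq

variable {V : Type u} [Category.{v} V] {E : Multitensor V}

theorem MultiAlg.comp_congr {α : Type*} {I : Index α} (X : MultiAlg E I) {l l' : List I.W}
    {t : I.W} (h : l = l') (d : I.Dec l t) (d' : I.Dec l' t)
    (p : l.map X.obj = l'.map X.obj) : E.tensor.map (eqToHom p) ≫ X.comp d' = X.comp d := by
  subst h
  exact (congrArg (· ≫ _) (E.tensor.map_id _)).trans (Category.id_comp _)

namespace Words

theorem eqToHom_f {x y : Alg E} (h : x = y) :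
    (eqToHom h).f = eqToHom (congrArg Monad.Algebra.A h) := by
  subst h
  rfl

namespace Free

variable (G : Free E)

/-- The algebra assigned to a word. -/
abbrev alg (w : List (Alg E)) : Alg E := G.toMultiAlg.alg w

/-- Composition in the free multialgebra. -/
abbrev comp {L : List (List (Alg E))} {w : List (Alg E)} (h : L.flatten = w) :
    E.tensor.obj (L.map fun w => (G.alg w).A) ⟶ (G.alg w).A :=
  G.toMultiAlg.comp (I := Index.words (Alg E)) h

variable {S : Type*} {T : Type*}

/-- A family of morphisms between values of the free multialgebra is multiplicative when it is
compatible with composition. -/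
def IsMult (π ψ : List S → List (Alg E)) (h : ∀ y, G.alg (π y) ⟶ G.alg (ψ y)) : Prop :=
  ∀ (L : List (List S)) (y : List S), L.flatten = y → ∀ (p : (L.map π).flatten = π y)
    (q : (L.map ψ).flatten = ψ y), G.comp p ≫ (h y).f =
      E.tensor.map (Seq.homMap₂ (f := fun w => (G.alg w).A) (g := fun w => (G.alg w).A) π ψ
        (fun y => (h y).f) L) ≫ G.comp q

/-- Compatibility of a function on words with concatenation. -/
def IsConcat {α : Type*} (ψ : List S → List α) : Prop :=
  ∀ (L : List (List S)) (y : List S), L.flatten = y → (L.map ψ).flatten = ψ y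

theorem isConcat_map {α : Type*} (φ : S → α) : IsConcat (List.map φ) :=
  fun _ _ h => flatten_map_map φ h

theorem isConcat_flatten {α : Type*} : IsConcat (List.flatten (α := α)) := by
  rintro L _ rfl
  exact List.flatten_flatten.symm

theorem IsConcat.comp {α : Type*} {ρ : List T → List S} {ψ : List S → List α} (hψ : IsConcat ψ)
    (hρ : IsConcat ρ) : IsConcat fun y => ψ (ρ y) := by
  intro L y h
  change _ = ψ (ρ y)
  rw [← hψ (L.map ρ) (ρ y) (hρ L y h), List.map_map]
  rfl

variable {G}

namespace IsMult

variable {π ψ χ : List S → List (Alg E)} {h : ∀ y, G.alg (π y) ⟶ G.alg (ψ y)}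
  {k : ∀ y, G.alg (ψ y) ⟶ G.alg (χ y)}

theorem comp (hh : G.IsMult π ψ h) (hk : G.IsMult ψ χ k) (hψ : IsConcat ψ) :
    G.IsMult π χ (fun y => h y ≫ k y) := by
  intro L y e p q
  have e₁ := hh L y e p (hψ L y e)
  have e₂ := hk L y e (hψ L y e) q
  refine (comp_eq_left e₁).trans
    ((comp_eq_right e₂).trans
      ((Category.assoc _ _ _).symm.trans ?_))
  refine congrArg (· ≫ _) ((E.tensor.map_comp _ _).symm.trans (congrArg E.tensor.map ?_))
  exact Seq.homMap₂_comp (f := fun w => (G.alg w).A) (g := fun w => (G.alg w).A)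
    (h := fun w => (G.alg w).A) _ _ _ _ _ _

theorem id (π : List S → List (Alg E)) : G.IsMult π π (fun _ => 𝟙 _) := by
  intro L y e p q
  refine (Category.comp_id _).trans (Eq.symm ((congrArg (· ≫ _) ?_).trans (Category.id_comp _)))
  refine (congrArg E.tensor.map ?_).trans (E.tensor.map_id _)
  exact Seq.homMap₂_id (f := fun w => (G.alg w).A) _ _

theorem eqTo (e : ∀ y, π y = ψ y) :
    G.IsMult π ψ (fun y => CategoryTheory.eqToHom (congrArg G.alg (e y))) := by
  obtain rfl : π = ψ := funext e
  exact id π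

theorem reindex (hh : G.IsMult π ψ h) (hπ : IsConcat π) (hψ : IsConcat ψ) {ρ : List T → List S}
    (hρ : IsConcat ρ) :
    G.IsMult (fun y => π (ρ y)) (fun y => ψ (ρ y)) (fun y => h (ρ y)) := by
  intro L y e p q
  have e₀ := hρ L y e
  have e₁ := hh (L.map ρ) (ρ y) e₀ (hπ _ _ e₀) (hψ _ _ e₀)
  have h₁ : (L.map fun y => π (ρ y)) = (L.map ρ).map π := by rw [List.map_map]; rfl
  have h₂ : (L.map fun y => ψ (ρ y)) = (L.map ρ).map ψ := by rw [List.map_map]; rfl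
  have e₂ := G.toMultiAlg.comp_congr (I := Index.words (Alg E)) (t := π (ρ y)) h₁ p (hπ _ _ e₀)
    (congrArg (List.map _) h₁)
  have e₃ := G.toMultiAlg.comp_congr (I := Index.words (Alg E)) (t := ψ (ρ y)) h₂ q (hψ _ _ e₀)
    (congrArg (List.map _) h₂)
  have e₄ := congrArg E.tensor.map (Seq.eqToHom_comp_eq_comp_eqToHom
    (Seq.arrow_mk_homMap₂ (f := fun w => (G.alg w).A) (g := fun w => (G.alg w).A) π ψ
      (fun y => (h y).f) ρ L).symm (congrArg (List.map _) h₁) (congrArg (List.map _) h₂))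
  rw [E.tensor.map_comp, E.tensor.map_comp] at e₄
  refine (congrArg (· ≫ _) e₂.symm).trans ((comp_eq_right e₁).trans ((comp_eq_left e₄).trans (comp_eq_right e₃)))

end IsMult

section Lift

variable {S : Type (max u v)} {φ : S → Alg E} {ψ : List S → List (Alg E)}

/-- The letters defining a multiplicative family. -/
abbrev liftLetters (hψ : IsConcat ψ) (x : ∀ s, φ s ⟶ G.alg (ψ [s])) :
    (G.toMultiAlg.pull (I := Index.ofMap φ) (I' := Index.words (Alg E)) ψ hψ).Letters
  | [], _, e => absurd e (List.cons_ne_nil _ _)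
  | [s], a, e =>
    { f := (eqToHom (List.singleton_inj.1 e : a = φ s) ≫ x s).f
      h := by
        refine Eq.trans ?_ (eqToHom (List.singleton_inj.1 e : a = φ s) ≫ x s).h
        refine congrArg (_ ≫ ·) ((congrArg (· ≫ _) (E.tensor.map_id _)).trans ?_)
        exact Category.id_comp _ }
  | _ :: _ :: _, _, e => absurd (List.cons_eq_cons.1 e).2 (List.cons_ne_nil _ _).symm

theorem isHom_iff_isMult (hψ : IsConcat ψ) (x : ∀ s, φ s ⟶ G.alg (ψ [s]))
    (h : ∀ y, G.alg (y.map φ) ⟶ G.alg (ψ y)) :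
    G.toMultiAlg.IsHom
      (fun _ a e => eqToHom ((G.alg_single a).symm.trans (congrArg G.toMultiAlg.alg e)))
      (G.toMultiAlg.pull (I := Index.ofMap φ) (I' := Index.words (Alg E)) ψ hψ)
      (liftLetters hψ x) (fun y => (h y).f) ↔
    G.IsMult (List.map φ) ψ h ∧ ∀ s, eqToHom (G.alg_single (φ s)).symm ≫ h [s] = x s := by
  have key : ∀ L : List (List S), E.tensor.map (Seq.homPi (f := fun w => (G.alg w).A)
      (g := fun y => (G.alg (ψ y)).A) (List.map φ) (fun y => (h y).f) L) ≫
      E.tensor.map (Seq.unfuse ψ G.toMultiAlg.obj L) = E.tensor.map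
        (Seq.homMap₂ (f := fun w => (G.alg w).A) (g := fun w => (G.alg w).A) (List.map φ) ψ
          (fun y => (h y).f) L) := by
    intro L
    refine (E.tensor.map_comp _ _).symm.trans (congrArg E.tensor.map ?_)
    exact Seq.homPi_unfuse (f := fun w => (G.alg w).A) (g := fun w => (G.alg w).A) _ _ _ _
  constructor
  · intro H
    refine ⟨fun L y e p q => ?_, fun s => ?_⟩
    · refine (H.comp (l := L) (t := y) e).trans ?_
      exact comp_eq_left (key L)
    · ext
      refine (H.letter [s] (φ s) rfl).trans ?_
      exact congrArg Monad.Algebra.Hom.f (Category.id_comp (x s))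
  · rintro ⟨h₁, h₂⟩
    refine ⟨fun {L y} e => ?_, fun y a e => ?_⟩
    · refine (h₁ L y e _ (hψ L y e)).trans ?_
      exact (congrArg (· ≫ _) (key L).symm).trans (Category.assoc _ _ _)
    · match y, e with
      | [s], e =>
        obtain rfl : a = φ s := List.singleton_inj.1 e
        exact (congrArg Monad.Algebra.Hom.f (h₂ s)).trans
          (congrArg Monad.Algebra.Hom.f (Category.id_comp (x s))).symm

theorem existsUnique_lift (hψ : IsConcat ψ) (x : ∀ s, φ s ⟶ G.alg (ψ [s])) :
    ∃! h : ∀ y, G.alg (y.map φ) ⟶ G.alg (ψ y), G.IsMult (List.map φ) ψ h ∧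
      ∀ s, eqToHom (G.alg_single (φ s)).symm ≫ h [s] = x s := by
  obtain ⟨h, hh, hu⟩ := G.existsUnique (Index.ofMap φ)
    (G.toMultiAlg.pull (I := Index.ofMap φ) (I' := Index.words (Alg E)) ψ hψ) (liftLetters hψ x)
  have hstr : ∀ y, E.unaryMonad.map (h y) ≫ (G.alg (ψ y)).a = (G.alg (y.map φ)).a ≫ h y := by
    intro y
    refine Eq.symm ((hh.comp (l := [y]) (t := y) (List.append_nil y)).trans ?_)
    refine congrArg (_ ≫ ·) ((congrArg (· ≫ _) (E.tensor.map_id _)).trans ?_)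
    exact Category.id_comp _
  refine ⟨fun y => ⟨h y, hstr y⟩, (isHom_iff_isMult hψ x _).1 hh, fun h' hh' => ?_⟩
  have := hu _ ((isHom_iff_isMult hψ x h').2 hh')
  funext y
  ext
  exact congrFun this y

/-- Multiplicative families agreeing on letters are equal. -/
theorem IsMult.ext {π : List S → List (Alg E)} (hπ : ∀ y, π y = y.map φ) (hψ : IsConcat ψ)
    {h h' : ∀ y, G.alg (π y) ⟶ G.alg (ψ y)} (hh : G.IsMult π ψ h) (hh' : G.IsMult π ψ h')
    (e : ∀ s, h [s] = h' [s]) (y : List S) : h y = h' y := by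
  obtain rfl : π = List.map φ := funext hπ
  exact congrFun ((existsUnique_lift hψ fun s => eqToHom (G.alg_single (φ s)).symm ≫ h [s]).unique
    ⟨hh, fun _ => rfl⟩ ⟨hh', fun s => congrArg (_ ≫ ·) (e s).symm⟩) y

/-- The multiplicative family with given values on letters. -/
noncomputable def lift (hψ : IsConcat ψ) (x : ∀ s, φ s ⟶ G.alg (ψ [s])) (y : List S) :
    G.alg (y.map φ) ⟶ G.alg (ψ y) :=
  (existsUnique_lift hψ x).choose y

theorem isMult_lift (hψ : IsConcat ψ) (x : ∀ s, φ s ⟶ G.alg (ψ [s])) :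
    G.IsMult (List.map φ) ψ (lift hψ x) :=
  (existsUnique_lift hψ x).choose_spec.1.1

theorem lift_single (hψ : IsConcat ψ) (x : ∀ s, φ s ⟶ G.alg (ψ [s])) (s : S) :
    eqToHom (G.alg_single (φ s)).symm ≫ lift hψ x [s] = x s :=
  (existsUnique_lift hψ x).choose_spec.1.2 s

end Lift

end Free

end Words

end Multi

namespace Multi

namespace Seq

variable {C : Type u} [Category.{v} C]

/-- The list of the entries of a morphism of sequences. -/
def arrows : ∀ {l m : List C}, Hom l m → List (Arrow C)
  | [], [], _ => []
  | X :: _, Y :: _, f => Arrow.mk (f.1 : X ⟶ Y) :: arrows f.2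
  | [], _ :: _, f => f.elim
  | _ :: _, [], f => f.elim

theorem arrow_mk_arrows : ∀ {l m : List C} (f : Hom l m),
    Arrow.mk (T := Seq C) (homMap (fun s : Arrow C => s.hom) (arrows f)) =
      Arrow.mk (T := Seq C) (X := l) (Y := m) f
  | [], [], _ => rfl
  | X :: _, Y :: _, f => arrow_mk_consHom (f := (f.1 : X ⟶ Y)) rfl (arrow_mk_arrows f.2)
  | [], _ :: _, f => f.elim
  | _ :: _, [], f => f.elim

theorem arrows_congr {l m l' m' : Seq C} {f : l ⟶ m} {g : l' ⟶ m'} (h : Arrow.mk f = Arrow.mk g) :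
    arrows f = arrows g :=
  congrArg (fun t : Arrow (Seq C) => arrows t.hom) h

theorem arrow_mk_eq_of_arrows {l m l' m' : Seq C} {f : l ⟶ m} {g : l' ⟶ m'}
    (h : arrows f = arrows g) : Arrow.mk f = Arrow.mk g := by
  have h₁ := arrow_mk_arrows f
  have h₂ := arrow_mk_arrows g
  rw [h] at h₁
  exact h₁.symm.trans h₂

theorem map_left_arrows {l m : Seq C} (f : l ⟶ m) : (arrows f).map (fun s => s.left) = l :=
  congrArg (fun t : Arrow (Seq C) => t.left) (arrow_mk_arrows f)

theorem map_right_arrows {l m : Seq C} (f : l ⟶ m) : (arrows f).map (fun s => s.right) = m :=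
  congrArg (fun t : Arrow (Seq C) => t.right) (arrow_mk_arrows f)

theorem arrows_appendMap : ∀ {l m l' m' : Seq C} (f : l ⟶ m) (g : l' ⟶ m'),
    arrows (appendMap f g) = arrows f ++ arrows g
  | [], [], _, _, _, _ => rfl
  | _ :: _, _ :: _, _, _, f, g => congrArg (List.cons _) (arrows_appendMap (Prod.snd f) g)
  | [], _ :: _, _, _, f, _ => PEmpty.elim f
  | _ :: _, [], _, _, f, _ => PEmpty.elim f

theorem arrows_flatten {S : Type*} {π ψ : S → Seq C} (m : ∀ y, π y ⟶ ψ y) (L : List S) :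
    arrows (flatten.map (homMap m L)) = (L.map fun y => arrows (m y)).flatten := by
  induction L with
  | nil => rfl
  | cons y L ih => exact (arrows_appendMap (m y) _).trans (congrArg (_ ++ ·) ih)

/-- Compatibility with concatenation of a family of morphisms of sequences. -/
def IsConcatHom {S : Type*} {π ψ : List S → Seq C} (m : ∀ y, π y ⟶ ψ y) : Prop :=
  ∀ (L : List (List S)) (y : List S), L.flatten = y →
    Arrow.mk (flatten.map (homMap m L)) = Arrow.mk (m y)

section

variable {S : Type*} {π ψ χ : List S → Seq C} {m : ∀ y, π y ⟶ ψ y} {n : ∀ y, ψ y ⟶ χ y}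

theorem isConcatHom_homMap {f g : S → C} (x : ∀ s, f s ⟶ g s) : IsConcatHom (homMap x) := by
  rintro L _ rfl
  exact flattenHom_homMap x L

theorem isConcatHom_of_eq {f g : S → C} (x : ∀ s, f s ⟶ g s)
    (h : ∀ y, Arrow.mk (m y) = Arrow.mk (homMap x y)) : IsConcatHom m := by
  obtain rfl : π = List.map f := funext fun y => congrArg (fun t : Arrow (Seq C) => t.left) (h y)
  obtain rfl : ψ = List.map g := funext fun y => congrArg (fun t : Arrow (Seq C) => t.right) (h y)
  obtain rfl : m = homMap x := funext fun y => Arrow.mk_injective _ _ (h y)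
  exact isConcatHom_homMap x

theorem isConcatHom_of_arrows (h : Words.Free.IsConcat fun y => arrows (m y)) :
    IsConcatHom m := by
  intro L y e
  exact arrow_mk_eq_of_arrows ((arrows_flatten m L).trans (h L y e))

theorem isConcatHom_flatten {f g : S → Seq C} (x : ∀ s, f s ⟶ g s) :
    IsConcatHom fun y => flatten.map (homMap x y) := by
  refine isConcatHom_of_arrows fun L y e => ?_
  refine Eq.trans (congrArg List.flatten (List.map_congr_left fun l _ => arrows_flatten x l)) ?_
  refine Eq.trans ?_ (arrows_flatten x y).symm
  exact (Words.Free.isConcat_flatten.comp (Words.Free.isConcat_map fun s => arrows (x s))) L y e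

theorem exists_comp {l m n : List C} (f : Hom l m) (g : Hom m n) :
    ∃ y : List (Σ a b c : C, (a ⟶ b) × (b ⟶ c)),
      Arrow.mk (T := Seq C) (X := l) (Y := m) f =
        Arrow.mk (homMap (f := fun s => s.1) (g := fun s => s.2.1) (fun s => s.2.2.2.1) y) ∧
      Arrow.mk (T := Seq C) (X := m) (Y := n) g =
        Arrow.mk (homMap (f := fun s => s.2.1) (g := fun s => s.2.2.1) (fun s => s.2.2.2.2) y) := by
  induction l generalizing m n with
  | nil =>
    cases m with
    | cons b m => exact f.elim
    | nil =>
      cases n with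
      | cons c n => exact g.elim
      | nil => exact ⟨[], rfl, rfl⟩
  | cons a l ih =>
    cases m with
    | nil => exact f.elim
    | cons b m =>
      cases n with
      | nil => exact g.elim
      | cons c n =>
        obtain ⟨y, h₁, h₂⟩ := ih f.2 g.2
        exact ⟨⟨a, b, c, f.1, g.1⟩ :: y, arrow_mk_consHom (f := (f.1 : a ⟶ b)) rfl h₁,
          arrow_mk_consHom (f := (g.1 : b ⟶ c)) rfl h₂⟩

end

end Seq

variable {V : Type u} [Category.{v} V] {E : Multitensor V}

namespace Words

namespace Free

variable (G : Free E)

theorem isConcat_id {α : Type*} : IsConcat fun y : List α => y := fun _ _ h => by simpa using h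

/-- The action of the tensor on morphisms. -/
noncomputable def tensorMap {l m : Seq (Alg E)} (f : l ⟶ m) : G.alg l ⟶ G.alg m :=
  eqToHom (congrArg G.alg (Seq.map_left_arrows f).symm) ≫
    lift (S := Arrow (Alg E)) (isConcat_map fun s => s.right)
      (fun s => s.hom ≫ eqToHom (G.alg_single _).symm) (Seq.arrows f) ≫
    eqToHom (congrArg G.alg (Seq.map_right_arrows f))

theorem isMult_tensorMap {S : Type*} {π ψ : List S → Seq (Alg E)} (m : ∀ y, π y ⟶ ψ y)
    (hm : Seq.IsConcatHom m) : G.IsMult π ψ (fun y => G.tensorMap (m y)) := by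
  have h := isMult_lift (G := G) (S := Arrow (Alg E)) (isConcat_map fun s => s.right)
      (fun s => s.hom ≫ eqToHom (G.alg_single _).symm)
  have hρ : IsConcat fun y => Seq.arrows (m y) := by
    intro L y e
    exact (Seq.arrows_flatten m L).symm.trans (Seq.arrows_congr (hm L y e))
  have h' := h.reindex (isConcat_map _) (isConcat_map _) hρ
  exact (IsMult.eqTo fun y => (Seq.map_left_arrows (m y)).symm).comp
    (h'.comp (IsMult.eqTo fun y => Seq.map_right_arrows (m y)) ((isConcat_map _).comp hρ))
    ((isConcat_map _).comp hρ)

theorem tensorMap_single {a b : Alg E} (f : a ⟶ b) :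
    eqToHom (G.alg_single a).symm ≫ G.tensorMap (Seq.consHom f (𝟙 Seq.nil)) =
      f ≫ eqToHom (G.alg_single b).symm := by
  have := lift_single (G := G) (S := Arrow (Alg E)) (isConcat_map fun s => s.right)
      (fun s => s.hom ≫ eqToHom (G.alg_single _).symm) (Arrow.mk f)
  refine Eq.trans (congrArg (_ ≫ ·) ?_) this
  exact (Category.id_comp _).trans (Category.comp_id _)

theorem tensorMap_single_ext {a b : Alg E} {X : Alg E} {f : ([a] : Seq (Alg E)) ⟶ [b]}
    {k : G.alg [b] ⟶ X} {k' : G.alg [a] ⟶ X}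
    (h : f.1 ≫ eqToHom (G.alg_single b).symm ≫ k = eqToHom (G.alg_single a).symm ≫ k') :
    G.tensorMap f ≫ k = k' := by
  have e := G.tensorMap_single f.1
  refine (cancel_epi (eqToHom (G.alg_single a).symm)).1 (Eq.trans ?_ h)
  exact (Category.assoc _ _ _).symm.trans ((congrArg (· ≫ k) e).trans (Category.assoc _ _ _))

theorem tensorMap_id (l : Seq (Alg E)) : G.tensorMap (𝟙 l) = 𝟙 (G.alg l) := by
  have hm : Seq.IsConcatHom fun y : List (Alg E) => 𝟙 (y : Seq (Alg E)) := by
    refine Seq.isConcatHom_of_eq (fun a => 𝟙 a) fun y => ?_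
    rw [Seq.homMap_id, List.map_id']
  refine IsMult.ext (φ := fun a => a) (fun y => (List.map_id' y).symm) isConcat_id
    (G.isMult_tensorMap _ hm) (IsMult.id _) (fun s => ?_) l
  refine (Category.comp_id _).symm.trans (G.tensorMap_single_ext ?_)
  exact Category.id_comp _

theorem tensorMap_comp {l m n : Seq (Alg E)} (f : l ⟶ m) (g : m ⟶ n) :
    G.tensorMap (f ≫ g) = G.tensorMap f ≫ G.tensorMap g := by
  obtain ⟨y, h₁, h₂⟩ := Seq.exists_comp f g
  obtain rfl : l = _ := congrArg (fun t : Arrow (Seq (Alg E)) => t.left) h₁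
  obtain rfl : m = _ := congrArg (fun t : Arrow (Seq (Alg E)) => t.right) h₁
  obtain rfl : n = _ := congrArg (fun t : Arrow (Seq (Alg E)) => t.right) h₂
  obtain rfl := Arrow.mk_injective _ _ h₁
  obtain rfl := Arrow.mk_injective _ _ h₂
  rw [← Seq.homMap_comp]
  refine IsMult.ext (fun y => rfl) (isConcat_map _)
    (G.isMult_tensorMap _ (Seq.isConcatHom_homMap _))
    ((G.isMult_tensorMap _ (Seq.isConcatHom_homMap _)).comp
      (G.isMult_tensorMap _ (Seq.isConcatHom_homMap _)) (isConcat_map _)) (fun s => ?_) y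
  refine (Category.comp_id _).symm.trans (G.tensorMap_single_ext ?_)
  refine (congrArg (_ ≫ ·) (Category.comp_id _)).trans ?_
  refine Eq.symm ((comp_eq_left
    (G.tensorMap_single s.2.2.2.1)).trans ?_)
  refine (comp_eq_right (G.tensorMap_single s.2.2.2.2)).trans ?_
  exact (Category.assoc _ _ _).symm

/-- The tensor of the lifted multitensor. -/
@[simps] noncomputable def tensor : Seq (Alg E) ⥤ Alg E where
  obj := G.alg
  map := G.tensorMap
  map_id := G.tensorMap_id
  map_comp := G.tensorMap_comp

/-- The substitution of the lifted multitensor. -/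
noncomputable def subst (L : List (Seq (Alg E))) : G.alg (L.map G.alg) ⟶ G.alg L.flatten :=
  lift (φ := G.alg) isConcat_flatten
    (fun l => eqToHom (congrArg G.alg (List.append_nil l).symm)) L

theorem isMult_subst : G.IsMult (List.map G.alg) List.flatten G.subst :=
  isMult_lift isConcat_flatten _

theorem subst_single (l : Seq (Alg E)) : eqToHom (G.alg_single (G.alg l)).symm ≫ G.subst [l] =
    eqToHom (congrArg G.alg (List.append_nil l).symm) :=
  lift_single _ _ l

theorem subst_naturality {L M : Seq (Seq (Alg E))} (f : L ⟶ M) :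
    G.tensorMap ((Seq.map G.tensor).map f) ≫ G.subst M =
      G.subst L ≫ G.tensorMap (Seq.flatten.map f) := by
  have h := Seq.arrow_mk_arrows f
  generalize Seq.arrows f = y at h
  obtain rfl : _ = L := congrArg (fun t : Arrow (Seq (Seq (Alg E))) => t.left) h
  obtain rfl : _ = M := congrArg (fun t : Arrow (Seq (Seq (Alg E))) => t.right) h
  obtain rfl := Arrow.mk_injective _ _ h
  clear h
  have h₁ : Seq.IsConcatHom fun y : List (Arrow (Seq (Alg E))) =>
      (Seq.map G.tensor).map (Seq.homMap (fun s => s.hom) y) := by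
    refine Seq.isConcatHom_of_eq (fun s => G.tensor.map s.hom) fun y => ?_
    induction y with
    | nil => rfl
    | cons s y ih => exact Seq.arrow_mk_consHom rfl ih
  have h₂ : Seq.IsConcatHom fun y : List (Arrow (Seq (Alg E))) =>
      Seq.flatten.map (Seq.homMap (fun s => s.hom) y) := Seq.isConcatHom_flatten _
  refine IsMult.ext (φ := fun s => G.alg s.left) (fun y => List.map_map) 
    (isConcat_flatten.comp (isConcat_map _))
    ((G.isMult_tensorMap _ h₁).comp (G.isMult_subst.reindex (isConcat_map _) isConcat_flatten
      (isConcat_map fun s : Arrow (Seq (Alg E)) => s.right)) ((isConcat_map _).comp (isConcat_map _)))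
    ((G.isMult_subst.reindex (isConcat_map _) isConcat_flatten
      (isConcat_map fun s : Arrow (Seq (Alg E)) => s.left)).comp (G.isMult_tensorMap _ h₂)
        (isConcat_flatten.comp (isConcat_map _))) (fun s => ?_) y
  refine G.tensorMap_single_ext ?_
  refine (congrArg (_ ≫ ·) (G.subst_single s.right)).trans ?_
  refine Eq.symm ((comp_eq_left
    (G.subst_single s.left)).trans ?_)
  refine Seq.eqToHom_comp_eq_comp_eqToHom (Seq.arrow_mk_map G.tensor ?_) _ _
  exact Seq.arrow_mk_eq_of_arrows
    ((Seq.arrows_flatten (fun s : Arrow (Seq (Alg E)) => s.hom) [s]).trans (List.append_nil _)).symm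

/-- The unit of the lifted multitensor. -/
@[simps] noncomputable def unit : 𝟭 (Alg E) ⟶ Seq.single ⋙ G.tensor where
  app a := eqToHom (G.alg_single a).symm
  naturality _ _ f := (G.tensorMap_single f).symm

/-- The substitution of the lifted multitensor, as a natural transformation. -/
@[simps] noncomputable def substNat : Seq.map G.tensor ⋙ G.tensor ⟶ Seq.flatten ⋙ G.tensor where
  app L := G.subst L
  naturality _ _ f := G.subst_naturality f

theorem tensorMap_eqToHom {l m : Seq (Alg E)} (h : l = m) :
    G.tensorMap (eqToHom h) = eqToHom (congrArg G.alg h) := by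
  subst h
  exact G.tensorMap_id l

/-- A value of the substitution on a sequence of length one. -/
theorem tensorMap_subst {a : Alg E} {l : Seq (Alg E)} (f : ([a] : Seq (Alg E)) ⟶ [G.alg l]) :
    G.tensorMap f ≫ G.subst [l] = eqToHom (G.alg_single a) ≫ f.1 ≫
      eqToHom (congrArg G.alg (List.append_nil l).symm) := by
  refine G.tensorMap_single_ext ?_
  refine (congrArg (_ ≫ ·) (G.subst_single l)).trans ?_
  simp

theorem unit_subst (l : Seq (Alg E)) :
    G.unit.app (G.alg l) ≫ G.subst [l] ≫ G.tensorMap (eqToHom (Seq.flatten_single l)) =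
      𝟙 (G.alg l) := by
  refine (comp_eq_left (G.subst_single l)).trans ?_
  exact (congrArg (_ ≫ ·) (G.tensorMap_eqToHom (Seq.flatten_single l))).trans (eqToHom_trans _ _)

theorem map_unit_subst (l : Seq (Alg E)) :
    G.tensorMap (Seq.mapNatUnit G.unit l) ≫ G.subst ((Seq.map Seq.single).obj l) ≫
      G.tensorMap (eqToHom (Seq.flatten_map_single l)) = 𝟙 (G.alg l) := by
  have h₁ : Seq.IsConcatHom fun y : List (Alg E) => Seq.mapNatUnit G.unit y := by
    refine Seq.isConcatHom_of_eq (fun a => G.unit.app a) fun y => ?_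
    induction y with
    | nil => rfl
    | cons s y ih => exact Seq.arrow_mk_consHom rfl ih
  have h₂ : IsConcat fun y : List (Alg E) => y.map fun a => [a] := isConcat_map _
  refine (congrArg (fun z => _ ≫ _ ≫ z) (G.tensorMap_eqToHom (Seq.flatten_map_single l))).trans ?_
  refine IsMult.ext (φ := fun a => a) (fun y => (List.map_id' y).symm) isConcat_id
    ((G.isMult_tensorMap _ h₁).comp ((G.isMult_subst.reindex (isConcat_map _) isConcat_flatten
      h₂).comp (IsMult.eqTo Seq.flatten_map_single) (isConcat_flatten.comp h₂))
      ((isConcat_map _).comp h₂)) (IsMult.id _) (fun a => ?_) l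
  refine (comp_eq_left
    (G.tensorMap_subst (l := [a]) (Seq.consHom (G.unit.app a) (𝟙 Seq.nil)))).trans ?_
  refine (congrArg (· ≫ _) ((congrArg (eqToHom (G.alg_single a) ≫ ·) (eqToHom_trans
    (G.alg_single a).symm _)).trans (eqToHom_trans _ _))).trans (eqToHom_trans _ _)

theorem subst_assoc (L : Seq (Seq (Seq (Alg E)))) :
    G.tensorMap (Seq.mapNat₂ G.substNat L) ≫ G.subst ((Seq.map Seq.flatten).obj L) ≫
        G.tensorMap (eqToHom (Seq.flatten_map_flatten L)) =
      G.subst ((Seq.map (Seq.map G.tensor)).obj L) ≫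
        G.tensorMap (eqToHom (Seq.flatten_map_map G.tensor L)) ≫ G.subst (Seq.flatten.obj L) := by
  have h₁ : Seq.IsConcatHom fun L : List (Seq (Seq (Alg E))) => Seq.mapNat₂ G.substNat L := by
    refine Seq.isConcatHom_of_eq (fun a => G.substNat.app a) fun y => ?_
    induction y with
    | nil => rfl
    | cons s y ih => exact Seq.arrow_mk_consHom rfl ih
  have h₂ : IsConcat fun L : List (List (List (Alg E))) => L.map List.flatten := isConcat_map _
  have h₃ : IsConcat fun L : List (List (List (Alg E))) => L.map (List.map G.alg) := isConcat_map _
  refine (congrArg (fun z => _ ≫ _ ≫ z)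
    (G.tensorMap_eqToHom (Seq.flatten_map_flatten L))).trans (Eq.trans ?_
      (congrArg (fun z => _ ≫ z ≫ _) (G.tensorMap_eqToHom (Seq.flatten_map_map G.tensor L))).symm)
  refine IsMult.ext (φ := fun M => G.alg (List.map G.alg M)) (fun y => List.map_map)
    (isConcat_flatten.comp isConcat_flatten)
    ((G.isMult_tensorMap _ h₁).comp ((G.isMult_subst.reindex (isConcat_map _) isConcat_flatten
      h₂).comp (IsMult.eqTo Seq.flatten_map_flatten) (isConcat_flatten.comp h₂))
      ((isConcat_map _).comp h₂))
    ((G.isMult_subst.reindex (isConcat_map _) isConcat_flatten h₃).comp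
      ((IsMult.eqTo (Seq.flatten_map_map G.tensor)).comp
        (G.isMult_subst.reindex (isConcat_map _) isConcat_flatten isConcat_flatten)
          ((isConcat_map _).comp isConcat_flatten)) (isConcat_flatten.comp h₃)) (fun M => ?_) L
  have aux : ∀ {X : Alg E} (N : List (List (Alg E))) (_ : M = N)
      (q : X = G.alg (M.map G.alg)) (r : G.alg M.flatten = G.alg N.flatten)
      (s : X = G.alg (N.map G.alg)),
      eqToHom q ≫ G.subst M ≫ eqToHom r = eqToHom s ≫ G.subst N := by
    rintro X _ rfl q r s
    simp
  have e₁ : G.subst [M.map G.alg] = eqToHom (G.alg_single (G.alg (M.map G.alg))) ≫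
      eqToHom (congrArg G.alg (List.append_nil (M.map G.alg)).symm) := by
    rw [← G.subst_single (M.map G.alg), eqToHom_trans_assoc, eqToHom_refl, Category.id_comp]
  refine (comp_eq_left
    (G.tensorMap_subst (l := M.flatten) (Seq.consHom (G.subst M) (𝟙 Seq.nil)))).trans ?_
  refine Eq.trans ?_ (congrArg (· ≫ _) e₁).symm
  refine (comp_eq_right (comp_eq_right (eqToHom_trans _ _))).trans ?_
  refine (aux (M ++ []) (List.append_nil M).symm _ _ ?_).trans (Eq.symm ?_)
  · exact (G.alg_single _).trans (congrArg (fun N => G.alg (N.map G.alg)) (List.append_nil M).symm)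
  · refine (Category.assoc _ _ _).symm.trans (congrArg (· ≫ G.subst (M ++ [])) ?_)
    exact (congrArg (· ≫ _) (eqToHom_trans _ _)).trans (eqToHom_trans _ _)

/-- The lifted multitensor. -/
@[simps] noncomputable def multitensor : Multitensor (Alg E) where
  tensor := G.tensor
  unit := G.unit
  subst := G.substNat
  unit_subst := G.unit_subst
  map_unit_subst := G.map_unit_subst
  assoc := G.subst_assoc

theorem isFunctorOperad_multitensor : G.multitensor.IsFunctorOperad := by
  have h : 𝟭 (Alg E) = Seq.single ⋙ G.tensor := by
    refine CategoryTheory.Functor.ext (fun a => (G.alg_single a).symm) fun a b f => ?_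
    have := G.tensorMap_single f
    exact Eq.symm ((comp_eq_left this).trans
      ((Category.assoc _ _ _).trans ((congrArg (f ≫ ·) (eqToHom_trans _ _)).trans
        (Category.comp_id f))))
  refine ⟨h, ?_⟩
  ext a : 2
  refine Eq.trans ?_ (eqToHom_app h a).symm
  rfl

end Free

end Words

end Multi

namespace Multi

section Lan

variable {C : Type u} [Category.{v} C] {D : Type u'} [Category.{v'} D] {Z : Type w} {S : Type w'}

/-- The object `P s` is the coproduct of the objects `Y z` for `z` in the fibre at `s`. -/
def IsLanAt (p : Z → S) {Y : Z → C} {P : S → C} (ι : ∀ z, Y z ⟶ P (p z)) (s : S) : Prop :=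
  ∀ (Q : C) (g : ∀ z, p z = s → (Y z ⟶ Q)), ∃! h : P s ⟶ Q,
    ∀ z (e : p z = s), ι z ≫ eqToHom (congrArg P e) ≫ h = g z e

variable {p : Z → S} {Y : Z → C} {P : S → C} {ι : ∀ z, Y z ⟶ P (p z)} {s : S}

theorem IsLanAt.hom_ext (hs : IsLanAt p ι s) {Q : C} {h h' : P s ⟶ Q}
    (e : ∀ z (e : p z = s), ι z ≫ eqToHom (congrArg P e) ≫ h =
      ι z ≫ eqToHom (congrArg P e) ≫ h') : h = h' :=
  (hs Q fun z e => ι z ≫ eqToHom (congrArg P e) ≫ h).unique (fun _ _ => rfl)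
    fun z e' => (e z e').symm

theorem isLanAt_iff_isColimit : IsLanAt p ι s ↔ Nonempty (IsColimit (Cofan.mk (P s)
    fun z : {z // p z = s} => ι z.1 ≫ eqToHom (congrArg P z.2))) := by
  constructor
  · intro h
    choose k hk hu using fun c : Cofan fun z : {z // p z = s} => Y z.1 =>
      h c.pt fun z e => c.inj ⟨z, e⟩
    exact ⟨Cofan.IsColimit.mk _ k (fun c z => (Category.assoc _ _ _).trans (hk c z.1 z.2))
      fun c m hm => hu c m fun z e => (Category.assoc _ _ _).symm.trans (hm ⟨z, e⟩)⟩
  · rintro ⟨h⟩ Q g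
    refine ⟨Cofan.IsColimit.desc h fun z => g z.1 z.2, fun z e => ?_, fun m hm => ?_⟩
    · have := Cofan.IsColimit.fac h (fun z => g z.1 z.2) ⟨z, e⟩
      exact (Category.assoc _ _ _).symm.trans this
    · refine Cofan.IsColimit.hom_ext h _ _ fun z => ?_
      refine Eq.trans ?_ (Cofan.IsColimit.fac h (fun z => g z.1 z.2) z).symm
      exact (Category.assoc _ _ _).trans (hm z.1 z.2)

theorem IsLanAt.map (hs : IsLanAt p ι s) (F : C ⥤ D)
    [PreservesColimitsOfShape (Discrete {z // p z = s}) F] :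
    IsLanAt (P := fun s => F.obj (P s)) p (fun z => F.map (ι z)) s := by
  rw [isLanAt_iff_isColimit] at hs ⊢
  obtain ⟨h⟩ := hs
  have h' := isColimitCofanMkObjOfIsColimit F _ _ h
  refine ⟨h'.ofIsoColimit (Cofan.ext (CategoryTheory.Iso.refl _) fun z => ?_)⟩
  obtain ⟨z, rfl⟩ := z
  change F.map (ι z ≫ 𝟙 _) ≫ 𝟙 _ = F.map (ι z) ≫ 𝟙 _
  rw [Category.comp_id, Category.comp_id, Category.comp_id]

theorem exists_isLanAt [HasColimits C] (p : Z → S) [∀ s, Small.{v} {z // p z = s}] (Y : Z → C) :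
    ∃ (P : S → C) (ι : ∀ z, Y z ⟶ P (p z)), ∀ s, IsLanAt p ι s := by
  refine ⟨fun s => ∐ fun z : {z // p z = s} => Y z.1,
    fun z => Limits.Sigma.ι (fun z' : {z' // p z' = p z} => Y z'.1) ⟨z, rfl⟩, fun s => ?_⟩
  rw [isLanAt_iff_isColimit]
  refine ⟨(coproductIsCoproduct fun z : {z // p z = s} => Y z.1).ofIsoColimit
    (Cofan.ext (CategoryTheory.Iso.refl _) fun z => ?_)⟩
  obtain ⟨z, rfl⟩ := z
  exact rfl

end Lan

theorem small_fiber_map {Z : Type w} {S : Type w'} (p : Z → S) [∀ s, Small.{v} {z // p z = s}]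
    (y : List S) : Small.{v} {z // List.map p z = y} := by
  induction y with
  | nil =>
    have : Subsingleton {z // List.map p z = []} :=
      ⟨fun a b => Subtype.ext ((List.map_eq_nil_iff.1 a.2).trans (List.map_eq_nil_iff.1 b.2).symm)⟩
    infer_instance
  | cons s y ih =>
    refine small_of_surjective (f := fun a : {z // p z = s} × {z // List.map p z = y} =>
      (⟨a.1.1 :: a.2.1, congrArg₂ List.cons a.1.2 a.2.2⟩ : {z // List.map p z = s :: y})) ?_
    rintro ⟨_ | ⟨z, l⟩, h⟩
    · cases h
    · exact ⟨⟨⟨z, (List.cons_eq_cons.1 h).1⟩, ⟨l, (List.cons_eq_cons.1 h).2⟩⟩, rfl⟩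

namespace Seq

variable {C : Type u} [Category.{v} C] {Z : Type w} {S : Type w'}

/-- The morphism of sequences with given entries, the target being indexed by the image of a
list. -/
def homFib (p : Z → S) {Y : Z → C} {P : S → C} (ι : ∀ z, Y z ⟶ P (p z)) :
    ∀ z : List Z, ((z.map Y : Seq C) ⟶ (z.map p).map P)
  | [] => 𝟙 nil
  | a :: z => consHom (ι a) (homFib p ι z)

/-- Preservation of coproducts in each variable. -/
def Distributive (T : Seq C ⥤ C) : Prop :=
  ∀ (l r : Seq C) (I : Type v), PreservesColimitsOfShape (Discrete I) (insert l r ⋙ T)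

theorem Distributive.insert {T : Seq C ⥤ C} (hT : Distributive T) (l r : Seq C) (I : Type w)
    [Small.{v} I] : PreservesColimitsOfShape (Discrete I) (insert l r ⋙ T) := by
  have := hT l r (Shrink.{v} I)
  exact preservesColimitsOfShape_of_equiv (Discrete.equivalence (equivShrink.{v} I).symm) _

/-- Prefixing by a fixed object. -/
abbrev prefixing (X : C) : Seq C ⥤ Seq C where
  obj l := cons X l
  map f := consHom (𝟙 X) f
  map_comp f g := congrArg (fun z => consHom z (f ≫ g)) (Category.comp_id (𝟙 X)).symm

theorem Distributive.prefixing {T : Seq C ⥤ C} (hT : Distributive T) (X : C) :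
    Distributive (Seq.prefixing X ⋙ T) := fun l r I => hT (cons X l) r I

theorem isLanAt_homFib {T : Seq C ⥤ C} (hT : Distributive T) {p : Z → S}
    [∀ s, Small.{v} {z // p z = s}] {Y : Z → C} {P : S → C} {ι : ∀ z, Y z ⟶ P (p z)}
    (hι : ∀ s, IsLanAt p ι s) (y : List S) :
    IsLanAt (P := fun y => T.obj (y.map P)) (List.map p) (fun z => T.map (homFib p ι z)) y := by
  induction y generalizing T with
  | nil =>
    intro Q g
    have aux : ∀ m : T.obj nil ⟶ Q, T.map (𝟙 nil) ≫ 𝟙 _ ≫ m = m := fun m => by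
      rw [T.map_id, Category.id_comp, Category.id_comp]
    refine ⟨g [] rfl, fun z e => ?_, fun h hh => ?_⟩
    · obtain rfl := List.map_eq_nil_iff.1 e
      exact aux _
    · exact (aux h).symm.trans (hh [] rfl)
  | cons s y ih =>
    intro Q g
    choose k hk hku using fun z (e : p z = s) => ih (hT.prefixing (Y z)) Q
      fun z' e' => g (z :: z') (congrArg₂ List.cons e e')
    have := hT.insert nil (y.map P) {z // p z = s}
    obtain ⟨h, hh, hu⟩ := (hι s).map (Seq.insert nil (y.map P) ⋙ T) Q k
    have split : ∀ (z : Z) (z' : List Z) (e : p z = s) (e' : z'.map p = y)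
        (e'' : (z :: z').map p = s :: y) (m : T.obj ((s :: y).map P) ⟶ Q),
        T.map (homFib p ι (z :: z')) ≫ eqToHom (congrArg (fun y => T.obj (y.map P)) e'') ≫ m =
          (Seq.prefixing (Y z) ⋙ T).map (homFib p ι z') ≫ eqToHom (congrArg (fun y =>
            (Seq.prefixing (Y z) ⋙ T).obj (y.map P)) e') ≫
            (Seq.insert nil (y.map P) ⋙ T).map (ι z) ≫ eqToHom (congrArg (fun s =>
              (Seq.insert nil (y.map P) ⋙ T).obj (P s)) e) ≫ m := by
      rintro z z' rfl rfl _ m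
      refine (congrArg (_ ≫ ·) (Category.id_comp m)).trans (Eq.symm ?_)
      refine (congrArg (_ ≫ ·) ((Category.id_comp _).trans
        (congrArg (_ ≫ ·) (Category.id_comp m)))).trans ?_
      refine (Category.assoc _ _ _).symm.trans (congrArg (· ≫ m) (Eq.symm ?_))
      refine Eq.trans (congrArg T.map ?_) (T.map_comp _ _)
      exact congrArg₂ consHom (Category.id_comp _).symm (Category.comp_id _).symm
    refine ⟨h, fun z e => ?_, fun m hm => hu m fun z e => hku z e _ fun z' e' => ?_⟩
    · match z, e with
      | z :: z', e =>
        have e₁ := (List.cons_eq_cons.1 e).1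
        have e₂ := (List.cons_eq_cons.1 e).2
        refine (split z z' e₁ e₂ e h).trans ?_
        refine (congrArg (fun t => _ ≫ _ ≫ t) (hh z e₁)).trans (hk z e₁ z' e₂)
    · exact (split z z' e e' (congrArg₂ List.cons e e') m).symm.trans (hm (z :: z') (congrArg₂ List.cons e e'))

end Seq

end Multi

namespace Multi

theorem IsLanAt.hom_ext_fiber {C : Type u} [Category.{v} C] {Z : Type w} {S : Type w'} {p : Z → S}
    {Y : Z → C} {P : S → C} {ι : ∀ z, Y z ⟶ P (p z)} (hι : ∀ s, IsLanAt p ι s) {Q : S → C}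
    {h h' : ∀ s, P s ⟶ Q s} (e : ∀ z, ι z ≫ h (p z) = ι z ≫ h' (p z)) : h = h' := by
  funext s
  refine (hι s).hom_ext ?_
  intro z q
  cases q
  simpa using! e z

namespace Seq

variable {C : Type u} [Category.{v} C] {Z : Type w} {S : Type w'}

theorem appendMap_homFib (p : Z → S) {Y : Z → C} {P : S → C} (ι : ∀ z, Y z ⟶ P (p z))
    (l m : List Z) :
    Arrow.mk (appendMap (homFib p ι l) (homFib p ι m)) = Arrow.mk (homFib p ι (l ++ m)) := by
  induction l with
  | nil => rfl
  | cons a l ih => exact arrow_mk_consHom rfl ih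

theorem flattenHom_homFib (p : Z → S) {Y : Z → C} {P : S → C} (ι : ∀ z, Y z ⟶ P (p z))
    (L : List (List Z)) :
    Arrow.mk (flatten.map (homFib (Y := fun l : List Z => (l.map Y : Seq C))
      (P := fun l : List S => (l.map P : Seq C)) (List.map p) (homFib p ι) L)) =
      Arrow.mk (homFib p ι L.flatten) := by
  induction L with
  | nil => rfl
  | cons l L ih =>
    exact (arrow_mk_appendMap rfl ih).trans (appendMap_homFib p ι l L.flatten)

theorem homFib_homRel {Z' : Type*} {S' : Type*} (p : Z → S) (p' : Z' → S') {Y : Z → C} {P : S → C}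
    {Y' : Z' → C} {P' : S' → C} {ι : ∀ z, Y z ⟶ P (p z)} {ι' : ∀ z, Y' z ⟶ P' (p' z)}
    {R : S → S' → Prop} {R' : Z → Z' → Prop} (x : ∀ s s', R s s' → (P s ⟶ P' s'))
    (y : ∀ z z', R' z z' → (Y z ⟶ Y' z'))
    (H : ∀ z z' r r', ι z ≫ x (p z) (p' z') r = y z z' r' ≫ ι' z') :
    ∀ {l : List Z} {m : List Z'} (r : List.Forall₂ R (l.map p) (m.map p'))
      (r' : List.Forall₂ R' l m), homFib p ι l ≫ homRel x r = homRel y r' ≫ homFib p' ι' m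
  | [], [], _, _ => rfl
  | a :: l, b :: m, r, r' => congrArg₂ consHom (H _ _ _ _)
      (homFib_homRel p p' x y H (List.forall₂_cons.1 r).2 (List.forall₂_cons.1 r').2)
  | [], _ :: _, _, r => by cases r
  | _ :: _, [], _, r => by cases r

theorem homFib_homMap (p : Z → S) {Y : Z → C} {P Q : S → C} (ι : ∀ z, Y z ⟶ P (p z))
    (x : ∀ s, P s ⟶ Q s) (l : List Z) :
    homFib p ι l ≫ homMap x (l.map p) = homFib p (fun z => ι z ≫ x (p z)) l := by
  induction l with
  | nil => rfl
  | cons a l ih => exact congrArg (consHom _) ih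

end Seq

variable {V : Type u} [Category.{v} V] {E : Multitensor V}

theorem Multitensor.substTo_naturality_homFib {Z : Type w} {S : Type w'} (p : Z → S) {Y : Z → V}
    {P : S → V} (ι : ∀ z, Y z ⟶ P (p z)) (M : List (List Z)) (L : List Z) (h : M.flatten = L)
    (h₁ : (M.map (List.map Y)).flatten = L.map Y)
    (h₂ : ((M.map (List.map p)).map (List.map P)).flatten = (L.map p).map P) :
    E.tensor.map (Seq.homFib (P := fun l => E.tensor.obj (l.map P)) (List.map p)
        (fun l => E.tensor.map (Seq.homFib p ι l)) M) ≫
        E.substTo (List.map P) (M.map (List.map p)) h₂ =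
      E.substTo (List.map Y) M h₁ ≫ E.tensor.map (Seq.homFib p ι L) := by
  subst h
  unfold substTo
  have e₀ : Seq.homFib (P := fun l => E.tensor.obj (l.map P)) (List.map p)
        (fun l => E.tensor.map (Seq.homFib p ι l)) M ≫
        Seq.fuse E.tensor (List.map P) (M.map (List.map p)) =
      Seq.fuse E.tensor (List.map Y) M ≫ (Seq.map E.tensor).map
        (Seq.homFib (Y := fun l : List Z => (l.map Y : Seq V))
          (P := fun l : List S => (l.map P : Seq V)) (List.map p) (Seq.homFib p ι) M) := by
    clear h₁ h₂
    induction M with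
    | nil => rfl
    | cons m M ih =>
      exact congrArg₂ Seq.consHom ((Category.comp_id _).trans (Category.id_comp _).symm) ih
  have e₁ := congrArg E.tensor.map e₀
  have e₂ := E.subst.naturality (Seq.homFib (Y := fun l : List Z => (l.map Y : Seq V))
          (P := fun l : List S => (l.map P : Seq V)) (List.map p) (Seq.homFib p ι) M)
  have e₃ := congrArg E.tensor.map
    (Seq.eqToHom_comp_eq_comp_eqToHom (Seq.flattenHom_homFib p ι M) h₁ h₂)
  simp only [Functor.map_comp] at e₁ e₃
  rw [Category.assoc, Category.assoc, e₃, ← Category.assoc (E.tensor.map (Seq.homFib _ _ _)), e₁,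
    Category.assoc]
  exact congrArg (_ ≫ ·) ((reassoc_of% e₂) _)

namespace MultiAlg

variable {α : Type*} {β : Type*} {I : Index α} {J : Index β}

/-- Maps of indexing words along which multialgebras can be pushed forward. -/
structure IsPushable (J : Index β) (I : Index α) (p : J.W → I.W) : Prop where
  dec {l t} : J.Dec l t → I.Dec (l.map p) (p t)
  lift {l t} : I.Dec (l.map p) t → ∃ w, J.Dec l w ∧ p w = t
  unique {l t t'} : J.Dec l t → J.Dec l t' → t = t'

theorem IsPushable.lift_forall₂ {p : J.W → I.W} (hp : IsPushable J I p) {L : List (List J.W)}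
    {l : List I.W} (r : List.Forall₂ I.Dec (L.map (List.map p)) l) :
    ∃ w : List J.W, List.Forall₂ J.Dec L w ∧ w.map p = l := by
  induction L generalizing l with
  | nil =>
    cases r
    exact ⟨[], .nil, rfl⟩
  | cons z L ih =>
    cases r with
    | cons h r =>
      obtain ⟨w, hw, rfl⟩ := ih r
      obtain ⟨a, ha, rfl⟩ := hp.lift h
      exact ⟨a :: w, .cons ha hw, rfl⟩

theorem exists_push [HasColimits V] (hE : E.IsDistributive) (p : J.W → I.W)
    (hp : IsPushable J I p) [∀ t, Small.{v} {w // p w = t}] (Y : MultiAlg E J) :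
    ∃ (X : MultiAlg E I) (ι : ∀ w, Y.obj w ⟶ X.obj (p w)), (∀ t, IsLanAt p ι t) ∧
      ∀ {l w} (d : J.Dec l w), E.tensor.map (Seq.homFib p ι l) ≫ X.comp (hp.dec d) =
        Y.comp d ≫ ι w := by
  obtain ⟨P, ι, hι⟩ := exists_isLanAt p Y.obj
  have hE' : Seq.Distributive E.tensor := hE
  have h₁ := Seq.isLanAt_homFib hE' hι
  have : ∀ l, Small.{v} {w // List.map p w = l} := small_fiber_map p
  have h₂ := Seq.isLanAt_homFib hE' h₁
  have ex : ∀ l t (d : I.Dec l t), ∃ c : E.tensor.obj (l.map P) ⟶ P t,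
      ∀ ζ w (dJ : J.Dec ζ w) (e : ζ.map p = l) (e' : p w = t),
        E.tensor.map (Seq.homFib p ι ζ) ≫ eqToHom (by rw [e]) ≫ c =
          Y.comp dJ ≫ ι w ≫ eqToHom (by rw [e']) := by
    intro l t d
    have lift : ∀ ζ, ζ.map p = l → ∃ w, J.Dec ζ w ∧ p w = t := by
      rintro ζ rfl
      exact hp.lift d
    choose w hw hw' using lift
    obtain ⟨c, hc, -⟩ := h₁ l (P t) fun ζ e =>
      Y.comp (hw ζ e) ≫ ι (w ζ e) ≫ eqToHom (by rw [hw'])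
    refine ⟨c, fun ζ z dJ e e' => ?_⟩
    obtain rfl := hp.unique dJ (hw ζ e)
    exact hc ζ e
  choose c hc using ex
  have hc' : ∀ {ζ w} (dJ : J.Dec ζ w) (d : I.Dec (ζ.map p) (p w)),
      E.tensor.map (Seq.homFib p ι ζ) ≫ c _ _ d = Y.comp dJ ≫ ι w := by
    intro ζ w dJ d
    have := hc _ _ d ζ w dJ rfl rfl
    simpa only [eqToHom_refl, Category.id_comp, Category.comp_id] using! this
  let X : MultiAlg E I :=
    { obj := P
      comp := fun {l t} d => c l t d
      unit_comp := fun t => by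
        refine (hι t).hom_ext ?_
        intro w q
        cases q
        have e₁ := (reassoc_of% (E.unit.naturality (ι w))) (c _ _ (I.dec_single (p w)))
        have e₂ := hc' (J.dec_single w) (I.dec_single (p w))
        refine (congrArg (_ ≫ ·) (Category.id_comp _)).trans (Eq.trans ?_
          (congrArg (_ ≫ ·) (Category.id_comp _)).symm)
        refine e₁.trans ((congrArg (_ ≫ ·) e₂).trans ?_)
        refine (comp_eq_left (Y.unit_comp w)).trans ?_
        exact (Category.id_comp _).trans (Category.comp_id _).symm
      assoc := fun {ls l t} r d => by
        refine (h₂ ls).hom_ext ?_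
        intro L q
        cases q
        obtain ⟨ws, rJ, rfl⟩ := hp.lift_forall₂ r
        obtain ⟨w, dJ, rfl⟩ := hp.lift d
        refine (congrArg (_ ≫ ·) (Category.id_comp _)).trans (Eq.trans ?_
          (congrArg (_ ≫ ·) (Category.id_comp _)).symm)
        have e₁ := Seq.homFib_homRel (List.map p) p (Y := fun l => E.tensor.obj (l.map Y.obj))
          (P := fun l => E.tensor.obj (l.map P)) (fun l t d => c l t d)
          (fun _ _ d => Y.comp d) (fun l w d dJ => hc' dJ d) r rJ
        have e₂ := congrArg E.tensor.map e₁
        rw [E.tensor.map_comp, E.tensor.map_comp] at e₂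
        refine (comp_eq_left e₂).trans ?_
        refine (comp_eq_right (hc' dJ d)).trans ?_
        refine (comp_eq_left (Y.assoc rJ dJ)).trans ?_
        have aux : ∀ (M : List I.W) (hM : L.flatten.map p = M) (h : ((L.map (List.map p)).map
            (List.map P)).flatten = M.map P) (d' : I.Dec M (p w)),
            (E.substTo (List.map Y.obj) L (Words.flatten_map_map Y.obj rfl) ≫
              Y.comp (J.dec_flatten rJ dJ)) ≫ ι w =
            E.tensor.map (Seq.homFib (P := fun l => E.tensor.obj (l.map P)) (List.map p)
              (fun l => E.tensor.map (Seq.homFib p ι l)) L) ≫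
              E.substTo (List.map P) (L.map (List.map p)) h ≫ c M (p w) d' := by
          rintro _ rfl h d'
          have e₃ := E.substTo_naturality_homFib p ι L L.flatten rfl
            (Words.flatten_map_map Y.obj rfl) h
          rw [Category.assoc, ← hc' (J.dec_flatten rJ dJ) d', ← Category.assoc, ← e₃,
            Category.assoc]
        exact aux _ List.map_flatten _ _ }
  exact ⟨X, ι, hι, fun d => hc' d _⟩

end MultiAlg

end Multi

namespace Multi

variable {V : Type u} [Category.{v} V] {E : Multitensor V}

theorem Seq.homMap_unfuse {Z : Type w} {S : Type w'} (p : Z → S) {Y : Z → V} {P : S → V}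
    (ι : ∀ z, Y z ⟶ P (p z)) (l : List Z) : homMap ι l ≫ unfuse p P l = homFib p ι l := by
  induction l with
  | nil => rfl
  | cons a l ih => exact congrArg₂ consHom (Category.comp_id _) ih

namespace MultiAlg

variable {α : Type*} {β : Type*} {I : Index α} {J : Index β}

/-- Compatibility with composition of a family of morphisms between multialgebras. -/
def IsMor (X Y : MultiAlg E I) (k : ∀ t, X.obj t ⟶ Y.obj t) : Prop :=
  ∀ (l : List I.W) (t : I.W) (d : I.Dec l t),
    X.comp d ≫ k t = E.tensor.map (Seq.homMap k l) ≫ Y.comp d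

variable {X Y Z : MultiAlg E I} {k : ∀ t, X.obj t ⟶ Y.obj t} {k' : ∀ t, Y.obj t ⟶ Z.obj t}

theorem IsMor.comp (hk : IsMor X Y k) (hk' : IsMor Y Z k') : IsMor X Z fun t => k t ≫ k' t := by
  intro l t d
  rw [Seq.homMap_comp, Functor.map_comp, Category.assoc, ← hk' _ _ d, ← Category.assoc, hk _ _ d,
    Category.assoc]

theorem IsMor.id (X : MultiAlg E I) : IsMor X X fun _ => 𝟙 _ := by
  intro l t d
  refine (Category.comp_id _).trans (Eq.symm ?_)
  rw [Seq.homMap_id]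
  exact (congrArg (· ≫ _) (E.tensor.map_id _)).trans (Category.id_comp _)

theorem IsMor.pull (hk : IsMor X Y k) (φ : J.W → I.W) (hφ) :
    IsMor (X.pull (I := J) φ hφ) (Y.pull φ hφ) fun t => k (φ t) := by
  intro l t d
  refine (comp_eq_right (hk _ _ (hφ l t d))).trans ?_
  rw [← Functor.map_comp_assoc, Seq.unfuse_homMap, Functor.map_comp_assoc]

/-- A morphism of multialgebras as a morphism of algebras. -/
@[simps] def IsMor.alg (hk : IsMor X Y k) (t : I.W) : X.alg t ⟶ Y.alg t where
  f := k t
  h := (hk _ _ (I.dec_single t)).symm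

theorem pull_pull_comp {γ : Type*} {K : Index γ} (X : MultiAlg E I) (φ : J.W → I.W) (hφ)
    (ρ : K.W → J.W) (hρ) (hφρ) {l t} (d : K.Dec l t) :
    ((X.pull (I := J) φ hφ).pull (I := K) ρ hρ).comp d =
      (X.pull (I := K) (fun t => φ (ρ t)) hφρ).comp d := by
  have h : (l.map ρ).map φ = l.map fun t => φ (ρ t) := List.map_map
  have e := X.comp_congr h.symm (hφρ l t d) (hφ _ _ (hρ l t d)) (congrArg (List.map X.obj) h.symm)
  change E.tensor.map _ ≫ E.tensor.map _ ≫ X.comp _ = E.tensor.map _ ≫ X.comp _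
  rw [← e, ← Functor.map_comp_assoc, ← Functor.map_comp_assoc]
  refine congrArg (fun z => E.tensor.map z ≫ _) ?_
  refine (congrArg₂ (· ≫ ·) (Seq.unfuse_eq ρ (fun t => X.obj (φ t)) l)
    (Seq.unfuse_eq φ X.obj (l.map ρ))).trans ((eqToHom_trans _ _).trans ?_)
  refine Eq.symm ((congrArg (· ≫ _) (Seq.unfuse_eq (fun t => φ (ρ t)) X.obj l)).trans ?_)
  exact eqToHom_trans _ _

end MultiAlg

namespace Words.Free

variable (G : Free E)

/-- The free multialgebra, reindexed. -/
abbrev reindex (I : Index (Alg E)) : MultiAlg E I :=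
  G.toMultiAlg.pull (I' := Index.words (Alg E)) I.π fun _ _ d => I.flatten_eq d

variable {G} {I : Index (Alg E)}

theorem isHom_iff_isMor (X : MultiAlg E I) (f : X.Letters) (h : ∀ t, G.toMultiAlg.obj (I.π t) ⟶ X.obj t) :
    G.toMultiAlg.IsHom
      (fun _ a e => eqToHom ((G.alg_single a).symm.trans (congrArg G.toMultiAlg.alg e))) X f h ↔
    MultiAlg.IsMor (G.reindex I) X h ∧ ∀ t a (e : [a] = I.π t),
      eqToHom (congrArg Monad.Algebra.A ((G.alg_single a).symm.trans
        (congrArg G.toMultiAlg.alg e))) ≫ h t = (f t a e).f := by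
  constructor
  · intro H
    refine ⟨fun {l t} d => ?_, fun t a e => ?_⟩
    · refine (comp_eq_right (H.comp d)).trans ?_
      refine comp_eq_left ?_
      refine (E.tensor.map_comp _ _).symm.trans (congrArg E.tensor.map ?_)
      exact Seq.unfuse_homPi I.π h l
    · exact (congrArg (· ≫ _) (eqToHom_f _).symm).trans (H.letter t a e)
  · rintro ⟨h₁, h₂⟩
    refine ⟨fun {l t} d => ?_, fun t a e => ?_⟩
    · have e₁ := congrArg (E.tensor.map (Seq.homPi I.π
        (fun t => 𝟙 (G.toMultiAlg.obj (I.π t))) l) ≫ ·) (h₁ _ _ d)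
      have e₂ : Seq.homPi I.π (fun t => 𝟙 (G.toMultiAlg.obj (I.π t))) l ≫ Seq.homMap h l =
          Seq.homPi I.π h l :=
        (Seq.homPi_homMap _ _ _ _).trans
          (congrArg (fun k => Seq.homPi I.π k l) (funext fun t => Category.id_comp _))
      refine Eq.trans ?_ (e₁.trans (comp_eq_left
        ((E.tensor.map_comp _ _).symm.trans (congrArg E.tensor.map e₂))))
      refine Eq.symm ((congrArg (_ ≫ ·) (Category.assoc _ _ _)).trans ?_)
      refine (Category.assoc _ _ _).symm.trans (Eq.trans (congrArg (· ≫ _) ?_) (Category.id_comp _))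
      refine (E.tensor.map_comp _ _).symm.trans ((congrArg E.tensor.map ?_).trans (E.tensor.map_id _))
      exact Seq.homPi_id_unfuse I.π G.toMultiAlg.obj l
    · exact (congrArg (· ≫ _) (eqToHom_f _)).trans (h₂ t a e)

theorem existsUnique_isMor (X : MultiAlg E I) (f : X.Letters) :
    ∃! h : ∀ t, G.toMultiAlg.obj (I.π t) ⟶ X.obj t,
      MultiAlg.IsMor (G.reindex I) X h ∧ ∀ t a (e : [a] = I.π t),
      eqToHom (congrArg Monad.Algebra.A ((G.alg_single a).symm.trans
        (congrArg G.toMultiAlg.alg e))) ≫ h t = (f t a e).f := by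
  simpa only [isHom_iff_isMor] using G.existsUnique I X f

theorem algebra_ext {A : V} {a a' : E.unaryMonad.obj A ⟶ A} (h : a = a') (p q p' q') :
    (⟨A, a, p, q⟩ : Alg E) = ⟨A, a', p', q'⟩ := by
  subst h
  rfl

theorem reindex_alg (t : I.W) : (G.reindex I).alg t = G.alg (I.π t) :=
  algebra_ext ((congrArg (· ≫ _) (E.tensor.map_id _)).trans (Category.id_comp _)) _ _ _ _

theorem isMor_ext {X : MultiAlg E I} {h h' : ∀ t, G.toMultiAlg.obj (I.π t) ⟶ X.obj t}
    (hh : MultiAlg.IsMor (G.reindex I) X h) (hh' : MultiAlg.IsMor (G.reindex I) X h')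
    (e : ∀ t a, [a] = I.π t → h t = h' t) : h = h' := by
  have p : ∀ t a, [a] = I.π t → a = (G.reindex I).alg t := fun t a e =>
    (G.alg_single a).symm.trans ((congrArg G.toMultiAlg.alg e).trans (reindex_alg t).symm)
  let f : X.Letters := fun t a e => eqToHom (p t a e) ≫ hh.alg t
  have key : ∀ t a (e : [a] = I.π t), eqToHom (congrArg Monad.Algebra.A
      ((G.alg_single a).symm.trans (congrArg G.toMultiAlg.alg e))) ≫ h t = (f t a e).f :=
    fun t a e => (congrArg (· ≫ h t) (eqToHom_f (p t a e))).symm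
  refine (existsUnique_isMor X f).unique ⟨hh, key⟩ ⟨hh', fun t a e' => ?_⟩
  rw [← key t a e', e t a e']

section OfMap

variable {S : Type (max u v)} {φ : S → Alg E}

/-- Letters in a multialgebra indexed by words on a set. -/
abbrev mkLetters (X : MultiAlg E (Index.ofMap φ)) (x : ∀ s, φ s ⟶ X.alg [s]) : X.Letters
  | [], _, e => absurd e (List.cons_ne_nil _ _)
  | [s], a, e => eqToHom (List.singleton_inj.1 e : a = φ s) ≫ x s
  | _ :: _ :: _, _, e => absurd (List.cons_eq_cons.1 e).2 (List.cons_ne_nil _ _).symm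

theorem exists_isMor (X : MultiAlg E (Index.ofMap φ)) (x : ∀ s, φ s ⟶ X.alg [s]) :
    ∃ h : ∀ y, (G.alg (y.map φ)).A ⟶ X.obj y, MultiAlg.IsMor (G.reindex (Index.ofMap φ)) X h ∧
      ∀ s, (eqToHom (G.alg_single (φ s)).symm).f ≫ h [s] = (x s).f := by
  obtain ⟨h, ⟨h₁, h₂⟩, -⟩ := existsUnique_isMor (G := G) X (mkLetters X x)
  refine ⟨h, h₁, fun s => ?_⟩
  refine (congrArg (· ≫ _) (eqToHom_f _)).trans ((h₂ [s] (φ s) rfl).trans ?_)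
  exact congrArg Monad.Algebra.Hom.f (Category.id_comp (x s))

theorem isMor_ext_ofMap {X : MultiAlg E (Index.ofMap φ)} {h h' : ∀ y, (G.alg (y.map φ)).A ⟶ X.obj y}
    (hh : MultiAlg.IsMor (G.reindex (Index.ofMap φ)) X h)
    (hh' : MultiAlg.IsMor (G.reindex (Index.ofMap φ)) X h') (e : ∀ s, h [s] = h' [s]) : h = h' := by
  refine isMor_ext hh hh' fun y a e' => ?_
  match y, e' with
  | [s], _ => exact e s

theorem IsMult.isMor {π ψ : List S → List (Alg E)} (hπ : IsConcat π) (hψ : IsConcat ψ)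
    {h : ∀ y, G.alg (π y) ⟶ G.alg (ψ y)} (hh : G.IsMult π ψ h) :
    MultiAlg.IsMor (G.toMultiAlg.pull (I := Index.ofMap φ) (I' := Index.words (Alg E)) π hπ)
      (G.toMultiAlg.pull (I := Index.ofMap φ) (I' := Index.words (Alg E)) ψ hψ)
      fun y => (h y).f := by
  intro L y d
  refine (comp_eq_right (hh L y d (hπ L y d) (hψ L y d))).trans ?_
  refine (Category.assoc _ _ _).symm.trans (Eq.trans ?_ (Category.assoc _ _ _))
  refine congrArg (· ≫ _) (Eq.trans (E.tensor.map_comp _ _).symm (Eq.trans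
    (congrArg E.tensor.map ?_) (E.tensor.map_comp _ _)))
  clear d
  induction L with
  | nil => rfl
  | cons a L ih =>
    exact congrArg₂ Seq.consHom ((Category.id_comp _).trans (Category.comp_id _).symm) ih

end OfMap

end Words.Free

end Multi

namespace Multi

theorem IsLanAt.exists_desc {C : Type u} [Category.{v} C] {Z : Type w} {S : Type w'} {p : Z → S}
    {Y : Z → C} {P : S → C} {ι : ∀ z, Y z ⟶ P (p z)} (hι : ∀ s, IsLanAt p ι s) {Q : S → C}
    (g : ∀ z, Y z ⟶ Q (p z)) : ∃ h : ∀ s, P s ⟶ Q s, ∀ z, ι z ≫ h (p z) = g z := by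
  choose h hh _ using fun s => hι s (Q s) fun z e => g z ≫ eqToHom (congrArg Q e)
  refine ⟨h, fun z => ?_⟩
  have := hh (p z) z rfl
  simpa only [eqToHom_refl, Category.id_comp, Category.comp_id] using! this

theorem Seq.isConcatHom_homFib {C : Type u} [Category.{v} C] {Z : Type w} {S : Type w'} (p : Z → S)
    {Y : Z → C} {P : S → C} (ι : ∀ z, Y z ⟶ P (p z)) : IsConcatHom (homFib p ι) := by
  refine isConcatHom_of_eq (g := fun z => P (p z)) ι fun y => ?_
  induction y with
  | nil => rfl
  | cons a y ih => exact arrow_mk_consHom rfl ih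

variable {V : Type u} [Category.{v} V] {E : Multitensor V}

theorem MultiAlg.isPushable_map {Z S : Type u'} {α : Type u'} (p : Z → S) (β : Z → α) (φ : S → α) :
    MultiAlg.IsPushable (Index.ofMap β) (Index.ofMap φ) (List.map p) where
  dec h := Words.flatten_map_map p h
  lift {l t} h := ⟨l.flatten, rfl, by rw [List.map_flatten]; exact h⟩
  unique h h' := h.symm.trans h'

theorem Words.eqToHom_f_cancel {x y : Words.Alg E} (h : x = y) {Z : V} {k k' : y.A ⟶ Z}
    (e : (eqToHom h).f ≫ k = (eqToHom h).f ≫ k') : k = k' := by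
  subst h
  exact (Category.id_comp k).symm.trans (e.trans (Category.id_comp k'))

namespace Words.Free

variable (G : Free E) [HasColimits V] {Z S : Type (max u v)} {p : Z → S}
  {β : Z → Alg E} {φ : S → Alg E} {ι : ∀ z, β z ⟶ φ (p z)}

theorem isLanAt_tensorMap (hE : E.IsDistributive) [∀ s, Small.{v} {z // p z = s}]
    (hι : ∀ s, IsLanAt p ι s) (y : List S) :
    IsLanAt (P := fun y => (G.alg (y.map φ)).A) (List.map p)
      (fun w => (G.tensorMap (Seq.homFib p ι w)).f) y := by
  have hp := MultiAlg.isPushable_map p β φ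
  have : ∀ t : (Index.ofMap φ).W, Small.{v} {w : (Index.ofMap β).W // List.map p w = t} :=
    small_fiber_map p
  obtain ⟨X, j, hj, hcomp⟩ := MultiAlg.exists_push (I := Index.ofMap φ) hE (List.map p) hp
    (G.reindex (Index.ofMap β))
  have hdec : ∀ l t, (Index.ofMap β).Dec l t →
    (Index.ofMap φ).Dec (l.map (List.map p)) (t.map p) := fun _ _ d => hp.dec d
  have hjm : MultiAlg.IsMor (G.reindex (Index.ofMap β))
      (X.pull (I := Index.ofMap β) (List.map p) hdec) j := by
    intro L y d
    refine (hcomp d).symm.trans ?_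
    refine Eq.trans ?_ (Category.assoc _ _ _)
    refine congrArg (· ≫ _) (Eq.trans ?_ (E.tensor.map_comp _ _))
    exact congrArg E.tensor.map (Seq.homMap_unfuse _ _ _).symm
  have halg : ∀ w, (X.pull (I := Index.ofMap β) (List.map p) hdec).alg w = X.alg (w.map p) :=
    fun w => algebra_ext ((congrArg (· ≫ _) (E.tensor.map_id _)).trans (Category.id_comp _)) _ _ _ _
  have hβ : ∀ z, β z = (G.reindex (Index.ofMap β)).alg [z] := fun z =>
    (G.alg_single (β z)).symm.trans (reindex_alg (I := Index.ofMap β) [z]).symm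
  obtain ⟨x, hx⟩ := IsLanAt.exists_desc hι (Q := fun s => X.alg [s])
    fun z => eqToHom (hβ z) ≫ hjm.alg [z] ≫ eqToHom (halg [z])
  have hx' : ∀ z, (ι z).f ≫ (x (p z)).f = (eqToHom (G.alg_single (β z)).symm).f ≫ j [z] := by
    intro z
    refine (congrArg Monad.Algebra.Hom.f (hx z)).trans ?_
    refine (congrArg₂ (fun a b => a ≫ j [z] ≫ b) (eqToHom_f (hβ z)) (eqToHom_f (halg [z]))).trans ?_
    refine Eq.trans ?_ (congrArg (· ≫ j [z]) (eqToHom_f (G.alg_single (β z)).symm).symm)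
    exact congrArg (_ ≫ ·) (Category.comp_id _)
  obtain ⟨θ, hθ, hθs⟩ := exists_isMor (G := G) X x
  let T := fun w => (G.tensorMap (Seq.homFib p ι w)).f
  have hTs : ∀ z, (eqToHom (G.alg_single (β z)).symm).f ≫ T [z] =
      (ι z).f ≫ (eqToHom (G.alg_single (φ (p z))).symm).f := fun z =>
    congrArg Monad.Algebra.Hom.f (G.tensorMap_single (ι z))
  have hconcat : IsConcat fun w : List Z => (w.map p).map φ :=
    (isConcat_map φ).comp (isConcat_map p)
  have hT : MultiAlg.IsMor (G.reindex (Index.ofMap β))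
      ((G.reindex (Index.ofMap φ)).pull (I := Index.ofMap β) (List.map p) hdec) T := by
    intro L y d
    refine ((G.isMult_tensorMap _ (Seq.isConcatHom_homFib p ι)).isMor (φ := β)
      (isConcat_map β) hconcat _ _ d).trans ?_
    exact congrArg (_ ≫ ·) (MultiAlg.pull_pull_comp (K := Index.ofMap β) (J := Index.ofMap φ)
      G.toMultiAlg (List.map φ) _ (List.map p) hdec hconcat d).symm
  have h₂ : (fun w => T w ≫ θ (w.map p)) = j := by
    refine isMor_ext_ofMap (hT.comp (hθ.pull (J := Index.ofMap β) (List.map p) hdec)) hjm fun z => ?_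
    refine eqToHom_f_cancel (G.alg_single (β z)).symm ?_
    refine (comp_eq_left (hTs z)).trans ?_
    exact (comp_eq_right (hθs (p z))).trans (hx' z)
  obtain ⟨can, hcan⟩ := IsLanAt.exists_desc hj (Q := fun y => (G.alg (y.map φ)).A) T
  have hcanm : MultiAlg.IsMor X (G.reindex (Index.ofMap φ)) can := by
    intro L y d
    refine (Seq.isLanAt_homFib hE hj L).hom_ext ?_
    intro ζ q
    cases q
    obtain ⟨w, dJ, rfl⟩ := hp.lift d
    refine (congrArg (_ ≫ ·) (Category.id_comp _)).trans (Eq.trans ?_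
      (congrArg (_ ≫ ·) (Category.id_comp _)).symm)
    refine (comp_eq_left (hcomp dJ)).trans ?_
    refine (comp_eq_right (hcan w)).trans ?_
    refine (hT _ _ dJ).trans ((Category.assoc _ _ _).symm.trans (Eq.trans ?_ (Category.assoc _ _ _)))
    refine congrArg (· ≫ _) (((E.tensor.map_comp _ _).symm.trans (congrArg E.tensor.map ?_)).trans
      (E.tensor.map_comp _ _))
    refine (Seq.homMap_unfuse (P := fun y : List S => (G.alg (y.map φ)).A) (List.map p) T ζ).trans
      (Eq.trans ?_ (Seq.homFib_homMap (P := X.obj) (Q := fun y : List S => (G.alg (y.map φ)).A)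
        (List.map p) j can ζ).symm)
    exact congrArg (fun k => Seq.homFib (List.map p) k ζ) (funext fun w => (hcan w).symm)
  have h₁ : (fun y => θ y ≫ can y) = fun y => 𝟙 _ := by
    refine isMor_ext_ofMap (hθ.comp hcanm) (MultiAlg.IsMor.id _) fun s => ?_
    have e : (fun s => x s ≫ hcanm.alg [s] ≫ eqToHom (reindex_alg (I := Index.ofMap φ) [s])) =
        fun s => eqToHom (G.alg_single (φ s)).symm := by
      refine IsLanAt.hom_ext_fiber hι fun z => ?_
      ext
      refine (congrArg (fun t => _ ≫ _ ≫ _ ≫ t) (eqToHom_f _)).trans ?_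
      refine (congrArg (fun t => _ ≫ _ ≫ t) (Category.comp_id _)).trans ?_
      refine (comp_eq_left (hx' z)).trans ?_
      exact (comp_eq_right (hcan [z])).trans (hTs z)
    have e' := congrArg Monad.Algebra.Hom.f (congrFun e s)
    refine eqToHom_f_cancel (G.alg_single (φ s)).symm ?_
    refine (comp_eq_left (hθs s)).trans ?_
    refine Eq.trans ?_ (e'.trans (Category.comp_id _).symm)
    refine (congrArg (_ ≫ ·) ?_)
    exact ((congrArg (_ ≫ ·) (eqToHom_f _)).trans (Category.comp_id _)).symm
  intro Q g
  obtain ⟨h, hh, hu⟩ := hj y Q g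
  refine ⟨θ y ≫ h, fun w q => ?_, fun m hm => ?_⟩
  · have e := hh w q
    cases q
    refine Eq.trans (congrArg (_ ≫ ·) (Category.id_comp _)) (Eq.trans ?_ e)
    refine Eq.trans ?_ (congrArg (_ ≫ ·) (Category.id_comp _)).symm
    exact (Category.assoc _ _ _).symm.trans (congrArg (· ≫ h) (congrFun h₂ w))
  · have e : can y ≫ m = h := by
      refine hu _ fun w q => ?_
      have e := hm w q
      cases q
      refine Eq.trans (congrArg (_ ≫ ·) (Category.id_comp _)) (Eq.trans ?_ e)
      refine Eq.trans ?_ (congrArg (_ ≫ ·) (Category.id_comp _)).symm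
      exact (Category.assoc _ _ _).symm.trans (congrArg (· ≫ m) (hcan w))
    rw [← e]
    refine Eq.symm ((Category.assoc _ _ _).symm.trans ((congrArg (· ≫ m) (congrFun h₁ y)).trans ?_))
    exact Category.id_comp _

end Words.Free

end Multi

namespace Multi

theorem IsLanAt.isColimit {C : Type u} [Category.{v} C] {Z : Type w} {S : Type w'} {p : Z → S}
    {Y : Z → C} {P : S → C} {ι : ∀ z, Y z ⟶ P (p z)} {s : S} (hs : IsLanAt p ι s) {I : Type u'}
    {K : Discrete I ⥤ C} (c : Cocone K) (f : I → Z) (hf : ∀ i, p (f i) = s)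
    (hinj : Function.Injective f) (hsurj : ∀ z, p z = s → ∃ i, f i = z) (hpt : P s = c.pt)
    (h : ∀ i, Arrow.mk (c.ι.app ⟨i⟩) = Arrow.mk (ι (f i))) : Nonempty (IsColimit c) := by
  have hK : ∀ i, K.obj ⟨i⟩ = Y (f i) := fun i => congrArg (fun t : Arrow C => t.left) (h i)
  have key : ∀ i, ι (f i) ≫ eqToHom (congrArg P (hf i)) =
      eqToHom (hK i).symm ≫ c.ι.app ⟨i⟩ ≫ eqToHom hpt.symm := fun i => by
    have := Seq.eqToHom_comp_eq_comp_eqToHom (h i).symm (hK i).symm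
      (congrArg (fun t : Arrow C => t.right) (h i)).symm
    rw [reassoc_of% this, eqToHom_trans]
  choose j hj using hsurj
  have hjf : ∀ i, j (f i) (hf i) = i := fun i => hinj (hj _ _)
  choose d hd hu using fun t : Cocone K => hs t.pt fun z e =>
    eqToHom ((congrArg Y (hj z e).symm).trans (hK (j z e)).symm) ≫ t.ι.app ⟨j z e⟩
  have hcongr : ∀ (t : Cocone K) {i i' : I} (e : i = i') (p : Y (f i) = K.obj ⟨i⟩)
      (q : Y (f i) = K.obj ⟨i'⟩), eqToHom q ≫ t.ι.app ⟨i'⟩ = eqToHom p ≫ t.ι.app ⟨i⟩ := by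
    intro t i i' e p q
    cases e
    rfl
  refine ⟨⟨fun t => eqToHom hpt.symm ≫ d t, ?_, ?_⟩⟩
  · rintro t ⟨i⟩
    have := hd t (f i) (hf i)
    rw [← Category.assoc, key, hcongr t (hjf i).symm (hK i).symm, Category.assoc,
      Category.assoc] at this
    exact (cancel_epi (eqToHom (hK i).symm)).1 this
  · intro t m hm
    have : eqToHom hpt ≫ m = d t := hu t _ fun z e => by
      obtain ⟨i, rfl⟩ : ∃ i, f i = z := ⟨j z e, hj z e⟩
      change ι (f i) ≫ eqToHom (congrArg P (hf i)) ≫ eqToHom hpt ≫ m = _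
      rw [← Category.assoc, key]
      simp only [Category.assoc, eqToHom_trans_assoc, eqToHom_refl, Category.id_comp]
      rw [hm ⟨i⟩]
      exact (hcongr t (hjf i).symm (hK i).symm _).symm
    rw [← this]
    simp

theorem Seq.arrow_mk_homFib_insert {C : Type u} [Category.{v} C] {Z : Type w} {S : Type w'}
    {p : Z → S} {Y : Z → C} {P : S → C} {ι : ∀ z, Y z ⟶ P (p z)} {f : C → Z}
    (hf : ∀ a, Arrow.mk (ι (f a)) = Arrow.mk (𝟙 a)) (l r : List C) (z : Z) {X X' : C} {k : X ⟶ X'}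
    (hz : Arrow.mk (ι z) = Arrow.mk k) :
    Arrow.mk (homFib p ι (l.map f ++ z :: r.map f)) = Arrow.mk ((insert l r).map k) := by
  have hr : ∀ r : List C, Arrow.mk (homFib p ι (r.map f)) = Arrow.mk (𝟙 (r : Seq C)) := by
    intro r
    induction r with
    | nil => rfl
    | cons a r ih => exact arrow_mk_consHom (hf a) ih
  induction l with
  | nil => exact arrow_mk_consHom hz (hr r)
  | cons a l ih => exact arrow_mk_consHom (hf a) ih

namespace Multitensor

variable {V : Type u} [Category.{v} V] {E : Multitensor V}

theorem IsDistributive.preserves_unary (hE : E.IsDistributive) (I : Type v) :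
    PreservesColimitsOfShape (Discrete I) (E.unaryMonad : V ⥤ V) :=
  hE [] [] I

end Multitensor

namespace Words.Free

variable {V : Type u} [Category.{v} V] {E : Multitensor V} (G : Free E) [HasColimits V]

theorem isDistributive_multitensor (hE : E.IsDistributive) : G.multitensor.IsDistributive := by
  intro (l : List (Alg E)) (r : List (Alg E)) I
  have := hE.preserves_unary I
  refine ⟨fun {D} => ⟨fun {c} hc => ?_⟩⟩
  let p : Alg E ⊕ I → Option (Alg E) := Sum.elim some fun _ => none
  let β : Alg E ⊕ I → Alg E := Sum.elim id fun i => D.obj ⟨i⟩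
  let φ : Option (Alg E) → Alg E := fun s => s.elim c.pt id
  let ι : ∀ z, β z ⟶ φ (p z)
    | .inl a => 𝟙 a
    | .inr i => c.ι.app ⟨i⟩
  have : ∀ s, Small.{v} {z // p z = s} := by
    rintro (_ | a)
    · refine small_of_surjective (f := fun i : I => ⟨.inr i, rfl⟩) ?_
      rintro ⟨a | i, h⟩
      · cases h
      · exact ⟨i, rfl⟩
    · have : Subsingleton {z // p z = some a} := by
        constructor
        rintro ⟨b | i, h⟩ ⟨b' | i', h'⟩ <;> cases h <;> cases h'
        rfl
      infer_instance
  have hι : ∀ s, IsLanAt p ι s := by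
    rintro (_ | a) Q g
    · let t : Cocone D := Cocone.mk Q (Discrete.natTrans fun i => g (.inr i.as) rfl)
      refine ⟨hc.desc t, ?_, fun m hm => hc.uniq t m fun i => ?_⟩
      · rintro (a | i) e
        · cases e
        · exact (congrArg (_ ≫ ·) (Category.id_comp _)).trans (hc.fac t ⟨i⟩)
      · exact (congrArg (_ ≫ ·) (Category.id_comp _)).symm.trans (hm (.inr i.as) rfl)
    · refine ⟨g (.inl a) rfl, ?_, fun m hm => ?_⟩
      · rintro (a | i) e
        · cases e
          exact (Category.id_comp _).trans (Category.id_comp _)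
        · cases e
      · exact ((Category.id_comp _).trans (Category.id_comp _)).symm.trans (hm (.inl a) rfl)
  suffices Nonempty (IsColimit (E.unaryMonad.forget.mapCocone
      ((Seq.insert l r ⋙ G.tensor).mapCocone c))) from
    this.map fun h => isColimitOfReflects E.unaryMonad.forget h
  have hmap : (l.map some ++ none :: r.map some).map φ = l ++ c.pt :: r := by
    simp [φ, Function.comp_def]
  refine (G.isLanAt_tensorMap hE hι (l.map some ++ none :: r.map some)).isColimit _
    (fun i => l.map .inl ++ .inr i :: r.map .inl) (fun i => ?_) (fun i i' h => ?_) (fun z hz => ?_)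
    (congrArg (fun y => (G.alg y).A) hmap) fun i => ?_
  · simp [p, Function.comp_def]
  · simpa using! h
  · obtain ⟨z₁, z₂, rfl, h₁, h₂⟩ := List.map_eq_append_iff.1 hz
    obtain ⟨z, z₃, rfl, h₃, h₄⟩ := List.map_eq_cons_iff.1 h₂
    have aux : ∀ {z : List (Alg E ⊕ I)} {l : List (Alg E)}, z.map p = l.map some →
        l.map .inl = z := by
      intro z l h
      induction z generalizing l with
      | nil => cases l with
        | nil => rfl
        | cons a l => cases h
      | cons b z ih => cases l with
        | nil => cases h
        | cons a l =>
          obtain ⟨e₁, e₂⟩ := List.cons_eq_cons.1 h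
          match b, e₁ with
          | .inl b, e₁ => exact congrArg₂ List.cons (congrArg _ (Option.some.inj e₁).symm) (ih e₂)
          | .inr i, e₁ => cases e₁
    match z, h₃ with
    | .inl a, h₃ => cases h₃
    | .inr i, _ => exact ⟨i, congrArg₂ (fun x y => x ++ Sum.inr i :: y) (aux h₁) (aux h₄)⟩
  · have := Seq.arrow_mk_homFib_insert (ι := ι) (f := Sum.inl) (fun a => rfl) l r (.inr i)
      (k := c.ι.app ⟨i⟩) rfl
    exact (Seq.arrow_mk_map (G.tensor ⋙ E.unaryMonad.forget) this).symm

end Words.Free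

end Multi

namespace Multi

variable {V : Type u} [Category.{v} V] {E : Multitensor V}

namespace MultiAlg

section Colimit

variable {α : Type*} {I : Index α}

/-- Morphisms of multialgebras. -/
def Hom (X Y : MultiAlg E I) := { k : ∀ t, X.obj t ⟶ Y.obj t // IsMor X Y k }

instance : Category (MultiAlg E I) where
  Hom := Hom
  id X := ⟨_, IsMor.id X⟩
  comp f g := ⟨_, f.2.comp g.2⟩
  id_comp f := Subtype.ext (funext fun t => Category.id_comp (f.1 t))
  comp_id f := Subtype.ext (funext fun t => Category.comp_id (f.1 t))
  assoc f g h := Subtype.ext (funext fun t => Category.assoc (f.1 t) (g.1 t) (h.1 t))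

/-- The family of values of a multialgebra. -/
@[simps] def values : MultiAlg E I ⥤ (I.W → V) where
  obj X := X.obj
  map f := f.1

/-- The values at the members of a sequence. -/
abbrev tupleEval {W : Type*} (l : List W) : (W → V) ⥤ Seq V :=
  Seq.tuple (fun t => Pi.eval (fun _ : W => V) t) l

theorem exists_colimit {J : Type*} [Category* J] [Nonempty J] [HasColimitsOfShape J V]
    [PreservesColimitsOfShape J E.tensor] (M : J ⥤ MultiAlg E I) :
    ∃ c : Cocone M, Nonempty (IsColimit (values.mapCocone c)) := by
  obtain ⟨⟨c, hc⟩⟩ := (inferInstance : HasColimit (M ⋙ values)).exists_colimit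
  have h₀ := fun t => isColimitOfPreserves (Pi.eval (fun _ : I.W => V) t) hc
  have h₁ := fun l : List I.W => isColimitOfPreserves (tupleEval l ⋙ E.tensor) hc
  have h₂ := fun L : List (List I.W) => isColimitOfPreserves
    (Seq.tuple (fun l => tupleEval (V := V) l ⋙ E.tensor) L ⋙ E.tensor) hc
  have ex : ∀ (l : List I.W) (t : I.W) (d : I.Dec l t), ∃ k : E.tensor.obj (l.map c.pt) ⟶ c.pt t,
      ∀ j, E.tensor.map (Seq.homMap (c.ι.app j) l) ≫ k = (M.obj j).comp d ≫ c.ι.app j t := by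
    intro l t d
    refine ⟨(h₁ l).desc ⟨c.pt t, ⟨fun j => (M.obj j).comp d ≫ c.ι.app j t, fun j j' f => ?_⟩⟩,
      (h₁ l).fac _⟩
    refine ((comp_eq_left ((M.map f).2 l t d).symm).trans
      ((Category.assoc _ _ _).trans ?_)).trans (Category.comp_id _).symm
    exact congrArg (_ ≫ ·) (congrFun (c.w f) t)
  choose k hk using ex
  let X : MultiAlg E I :=
    { obj := c.pt
      comp := fun {l t} d => k l t d
      unit_comp := fun t => (h₀ t).hom_ext fun j => by
        have e₁ := (reassoc_of% (E.unit.naturality (c.ι.app j t))) (k _ _ (I.dec_single t))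
        refine e₁.trans ((congrArg (_ ≫ ·) (hk _ _ (I.dec_single t) j)).trans ?_)
        refine (comp_eq_left ((M.obj j).unit_comp t)).trans ?_
        exact (Category.id_comp _).trans (Category.comp_id _).symm
      assoc := fun {ls l t} r d => (h₂ ls).hom_ext fun j => by
        have e₁ : Seq.homMap (fun l => E.tensor.map (Seq.homMap (c.ι.app j) l)) ls ≫
            Seq.homRel (fun l t d => k l t d) r =
            Seq.homRel (fun _ _ d => (M.obj j).comp d) r ≫ Seq.homMap (c.ι.app j) l :=
          (Seq.homMap_homRel _ _ r).trans (Eq.trans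
            (Seq.homRel_congr (fun l t d _ => hk l t d j) r r) (Seq.homRel_homMap _ _ r).symm)
        have e₂ := (E.tensor.map_comp _ _).symm.trans
          ((congrArg E.tensor.map e₁).trans (E.tensor.map_comp _ _))
        refine (comp_eq_left e₂).trans ?_
        refine (comp_eq_right (hk _ _ d j)).trans ?_
        refine (comp_eq_left ((M.obj j).assoc r d)).trans ?_
        refine (comp_eq_right (hk _ _ (I.dec_flatten r d) j).symm).trans ?_
        refine (Category.assoc _ _ _).symm.trans (Eq.trans ?_ (Category.assoc _ _ _))
        refine congrArg (· ≫ _) (Eq.symm ?_)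
        exact E.substTo_naturality_map (fun l : List I.W => l) (c.ι.app j) ls
          (congrArg List.flatten (List.map_id ls)) _ _ }
  let c' : Cocone M :=
    { pt := X
      ι := { app := fun j => ⟨c.ι.app j, fun l t d => (hk l t d j).symm⟩
             naturality := fun j j' f => Subtype.ext (c.ι.naturality f) } }
  exact ⟨c', ⟨hc.ofIsoColimit (Cocone.ext (CategoryTheory.Iso.refl _) fun j => Category.comp_id _)⟩⟩

end Colimit

end MultiAlg

namespace Words.Free

variable {G : Free E} {S : Type (max u v)} {φ : S → Alg E}

theorem isMor_ext_map {ψ : S → Alg E} {X : MultiAlg E (Index.ofMap φ)} (hψ)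
    {h h' : ∀ y : List S, (G.alg (y.map ψ)).A ⟶ X.obj y}
    (hh : MultiAlg.IsMor (G.toMultiAlg.pull (I := Index.ofMap φ) (I' := Index.words (Alg E))
      (List.map ψ) hψ) X h)
    (hh' : MultiAlg.IsMor (G.toMultiAlg.pull (I := Index.ofMap φ) (I' := Index.words (Alg E))
      (List.map ψ) hψ) X h') (e : ∀ s, h [s] = h' [s]) : h = h' := by
  have hid : ∀ (l : List (List S)) (t : List S), (Index.ofMap ψ).Dec l t →
    (Index.ofMap φ).Dec (l.map fun y => y) t := fun l t d =>
      (congrArg List.flatten (List.map_id l)).trans d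
  have key : ∀ {h : ∀ y : List S, (G.alg (y.map ψ)).A ⟶ X.obj y},
      MultiAlg.IsMor (G.toMultiAlg.pull (I := Index.ofMap φ) (I' := Index.words (Alg E))
        (List.map ψ) hψ) X h →
      MultiAlg.IsMor (G.reindex (Index.ofMap ψ))
        (X.pull (I := Index.ofMap ψ) (fun y => y) hid) h := by
    intro h hh l t d
    refine (hh l t d).trans (congrArg (_ ≫ ·) (Eq.symm ?_))
    have p : l.map X.obj = (l.map fun y => y).map X.obj := by rw [List.map_id']
    refine Eq.trans (congrArg (E.tensor.map · ≫ _) (Seq.unfuse_eq (fun y => y) X.obj l)) ?_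
    exact X.comp_congr (List.map_id l).symm d (hid l t d) p
  exact isMor_ext_ofMap (key hh) (key hh') e

end Words.Free

end Multi

namespace Multi

variable {V : Type u} [Category.{v} V] {E : Multitensor V}

namespace Words.Free

theorem pull_alg (G : Free E) {α : Type*} {I : Index α} (ψ : I.W → List (Alg E)) (hψ) (t : I.W) :
    (G.toMultiAlg.pull (I := I) (I' := Index.words (Alg E)) ψ hψ).alg t = G.alg (ψ t) :=
  algebra_ext ((congrArg (· ≫ _) (E.tensor.map_id _)).trans (Category.id_comp _)) _ _ _ _

variable (G : Free E) {S : Type (max u v)} {J : Type*} [Category* J]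

/-- The values of the free multialgebra at a diagram of families of letters. -/
noncomputable abbrev diagram (D : J ⥤ (S → Alg E)) (φ : S → Alg E) :
    J ⥤ MultiAlg E (Index.ofMap φ) where
  obj j := G.toMultiAlg.pull (I := Index.ofMap φ) (I' := Index.words (Alg E)) (List.map (D.obj j))
    (isConcat_map _)
  map f := ⟨fun y => (G.tensorMap (Seq.homMap (D.map f) y)).f,
    (G.isMult_tensorMap _ (Seq.isConcatHom_homMap _)).isMor _ _⟩
  map_id j := Subtype.ext (funext fun y =>
    (D ⋙ MultiAlg.tupleEval y ⋙ G.tensor ⋙ E.unaryMonad.forget).map_id j)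
  map_comp f g := Subtype.ext (funext fun y =>
    (D ⋙ MultiAlg.tupleEval y ⋙ G.tensor ⋙ E.unaryMonad.forget).map_comp f g)

theorem isColimit_tupleEval_tensor [Nonempty J] [HasColimitsOfShape J V]
    [PreservesColimitsOfShape J E.tensor] {D : J ⥤ (S → Alg E)} {c : Cocone D}
    (hc : ∀ s, IsColimit ((Pi.eval (fun _ : S => Alg E) s).mapCocone c)) (y : List S) :
    Nonempty (IsColimit ((MultiAlg.tupleEval y ⋙ G.tensor ⋙ E.unaryMonad.forget).mapCocone c)) := by
  obtain ⟨cX, ⟨hX⟩⟩ := MultiAlg.exists_colimit (G.diagram D c.pt)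
  let X := cX.pt
  let ι : ∀ (j : J) (y : List S), (G.alg (y.map (D.obj j))).A ⟶ X.obj y := fun j => (cX.ι.app j).1
  have hι : ∀ j, MultiAlg.IsMor ((G.diagram D c.pt).obj j) X (ι j) := fun j => (cX.ι.app j).2
  have hXt := fun y : List S => isColimitOfPreserves (Pi.eval (fun _ : List S => V) y) hX
  have hXl := fun l : List (List S) => isColimitOfPreserves
    (MultiAlg.tupleEval l ⋙ E.tensor) hX
  have hιw : ∀ {j j' : J} (f : j ⟶ j') (y : List S),
      (G.tensorMap (Seq.homMap (D.map f) y)).f ≫ ι j' y = ι j y := fun f y =>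
    congrFun (congrArg Subtype.val (cX.w f)) y
  have hβ : ∀ j s, D.obj j s = ((G.diagram D c.pt).obj j).alg [s] := fun j s =>
    (G.alg_single (D.obj j s)).symm.trans
      (G.pull_alg (I := Index.ofMap c.pt) (List.map (D.obj j)) (isConcat_map _) [s]).symm
  have leg : ∀ j s, (eqToHom (hβ j s) ≫ (hι j).alg [s]).f =
      (eqToHom (G.alg_single (D.obj j s)).symm).f ≫ ι j [s] := fun j s =>
    congrArg (· ≫ ι j [s]) ((eqToHom_f (hβ j s)).trans
      (eqToHom_f (G.alg_single (D.obj j s)).symm).symm)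
  have hnat : ∀ s {j j' : J} (f : j ⟶ j'), D.map f s ≫ eqToHom (hβ j' s) ≫ (hι j').alg [s] =
      (eqToHom (hβ j s) ≫ (hι j).alg [s]) := by
    intro s j j' f
    ext
    refine (congrArg (_ ≫ ·) (leg j' s)).trans (Eq.trans ?_ (leg j s).symm)
    refine (comp_eq_left (congrArg Monad.Algebra.Hom.f
      (G.tensorMap_single (D.map f s))).symm).trans ?_
    exact comp_eq_right (hιw f [s])
  let x : ∀ s, c.pt s ⟶ X.alg [s] := fun s => (hc s).desc ⟨X.alg [s],
    ⟨fun j => eqToHom (hβ j s) ≫ (hι j).alg [s], fun j j' f =>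
      (hnat s f).trans (Category.comp_id _).symm⟩⟩
  have hx : ∀ j s, (c.ι.app j s).f ≫ (x s).f =
      (eqToHom (G.alg_single (D.obj j s)).symm).f ≫ ι j [s] := fun j s =>
    (congrArg Monad.Algebra.Hom.f ((hc s).fac _ j)).trans (leg j s)
  obtain ⟨θ, hθ, hθs⟩ := exists_isMor (G := G) X x
  let T : ∀ (j : J) (y : List S), (G.alg (y.map (D.obj j))).A ⟶ (G.alg (y.map c.pt)).A :=
    fun j y => (G.tensorMap (Seq.homMap (c.ι.app j) y)).f
  have hT : ∀ j, MultiAlg.IsMor ((G.diagram D c.pt).obj j) (G.reindex (Index.ofMap c.pt)) (T j) :=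
    fun j => (G.isMult_tensorMap _ (Seq.isConcatHom_homMap _)).isMor _ _
  have hTs : ∀ j s, (eqToHom (G.alg_single (D.obj j s)).symm).f ≫ T j [s] =
      (c.ι.app j s).f ≫ (eqToHom (G.alg_single (c.pt s)).symm).f := fun j s =>
    congrArg Monad.Algebra.Hom.f (G.tensorMap_single (c.ι.app j s))
  have h₂ : ∀ j, (fun y => T j y ≫ θ y) = ι j := by
    intro j
    refine isMor_ext_map _ ((hT j).comp hθ) (hι j) fun s => ?_
    refine eqToHom_f_cancel (G.alg_single (D.obj j s)).symm ?_
    refine (comp_eq_left (hTs j s)).trans ?_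
    exact (comp_eq_right (hθs s)).trans (hx j s)
  have hTw : ∀ {j j' : J} (f : j ⟶ j') (y : List S),
      (G.tensorMap (Seq.homMap (D.map f) y)).f ≫ T j' y = T j y := fun f y =>
    ((MultiAlg.tupleEval y ⋙ G.tensor ⋙ E.unaryMonad.forget).mapCocone c).w f
  let can : ∀ y, X.obj y ⟶ (G.alg (y.map c.pt)).A := fun y => (hXt y).desc
    ⟨(G.alg (y.map c.pt)).A, ⟨fun j => T j y, fun j j' f =>
      (hTw f y).trans (Category.comp_id _).symm⟩⟩
  have hcan : ∀ j y, ι j y ≫ can y = T j y := fun j y => (hXt y).fac _ j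
  have hcanm : MultiAlg.IsMor X (G.reindex (Index.ofMap c.pt)) can := by
    intro l t d
    refine (hXl l).hom_ext fun j => ?_
    change E.tensor.map (Seq.homMap (ι j) l) ≫ X.comp d ≫ can t =
      E.tensor.map (Seq.homMap (ι j) l) ≫ E.tensor.map (Seq.homMap can l) ≫ _
    refine (comp_eq_left (hι j l t d).symm).trans ?_
    refine (comp_eq_right (hcan j t)).trans ?_
    refine (hT j l t d).trans (Eq.trans ?_ (Category.assoc _ _ _))
    refine congrArg (· ≫ _) (Eq.trans (congrArg E.tensor.map ?_) (E.tensor.map_comp _ _))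
    exact (congrArg (fun k => Seq.homMap k l) (funext fun t => (hcan j t).symm)).trans
      (Seq.homMap_comp (ι j) can l)
  have h₁ : (fun y => θ y ≫ can y) = fun y => 𝟙 _ := by
    refine isMor_ext_ofMap (hθ.comp hcanm) (MultiAlg.IsMor.id _) fun s => ?_
    have e : x s ≫ hcanm.alg [s] ≫ eqToHom (reindex_alg (I := Index.ofMap c.pt) [s]) =
        eqToHom (G.alg_single (c.pt s)).symm := by
      refine (hc s).hom_ext fun j => ?_
      ext
      refine (congrArg (fun t => _ ≫ _ ≫ _ ≫ t) (eqToHom_f _)).trans ?_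
      refine (congrArg (fun t => _ ≫ _ ≫ t) (Category.comp_id _)).trans ?_
      refine (comp_eq_left (hx j s)).trans ?_
      exact (comp_eq_right (hcan j [s])).trans (hTs j s)
    have e' := congrArg Monad.Algebra.Hom.f e
    refine eqToHom_f_cancel (G.alg_single (c.pt s)).symm ?_
    refine (comp_eq_left (hθs s)).trans ?_
    refine Eq.trans ?_ (e'.trans (Category.comp_id _).symm)
    exact congrArg (_ ≫ ·) ((congrArg (_ ≫ ·) (eqToHom_f _)).trans (Category.comp_id _)).symm
  choose d hd using fun (s : Cocone (D ⋙ MultiAlg.tupleEval y ⋙ G.tensor ⋙ E.unaryMonad.forget)) =>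
    (⟨(hXt y).desc ⟨s.pt, ⟨fun j => s.ι.app j, fun j j' f => s.ι.naturality f⟩⟩,
      fun j => (hXt y).fac _ j⟩ : ∃ k : X.obj y ⟶ s.pt, ∀ j, ι j y ≫ k = s.ι.app j)
  refine ⟨⟨fun s => θ y ≫ d s, fun s j => ?_, fun s m hm => ?_⟩⟩
  · exact (comp_eq_left (congrFun (h₂ j) y)).trans (hd s j)
  · have : can y ≫ m = d s := (hXt y).hom_ext fun j => by
      refine Eq.trans ?_ (hd s j).symm
      refine (Category.assoc _ _ _).symm.trans ((congrArg (· ≫ m) (hcan j y)).trans (hm j))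
    rw [← this]
    refine Eq.symm ((Category.assoc _ _ _).symm.trans ((congrArg (· ≫ m) (congrFun h₁ y)).trans ?_))
    exact Category.id_comp _

end Words.Free

end Multi

namespace Multi

namespace Seq

variable {C : Type u} [Category.{v} C] {J : Type*} [Category* J]

theorem length_eq_of_hom : ∀ {l m : List C}, Hom l m → l.length = m.length
  | [], [], _ => rfl
  | _ :: _, _ :: _, f => congrArg (· + 1) (length_eq_of_hom f.2)
  | [], _ :: _, f => f.elim
  | _ :: _, [], f => f.elim

theorem exists_tuple_iso_of_length (n : ℕ) (D : J ⥤ Seq C) (hD : ∀ j, (D.obj j).length = n) :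
    ∃ l : List (J ⥤ C), Nonempty (D ≅ tuple (fun F => F) l) := by
  induction n generalizing D with
  | zero =>
    refine ⟨[], ⟨NatIso.ofComponents
      (fun j => eqToIso (List.eq_nil_iff_length_eq_zero.2 (hD j))) fun {j j'} f => ?_⟩⟩
    refine (cancel_epi (eqToHom (List.eq_nil_iff_length_eq_zero.2 (hD j)).symm)).1 ?_
    exact nil_hom_ext _ _
  | succ n ih =>
    choose X R hXR using fun j => List.exists_cons_of_length_eq_add_one (hD j)
    obtain ⟨D', e, hD'⟩ : ∃ (D' : J ⥤ Seq C) (_ : D ≅ D'), D'.obj = fun j => cons (X j) (R j) :=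
      ⟨_, D.isoCopyObj _ fun j => eqToIso (hXR j), rfl⟩
    obtain ⟨obj, map, map_id, map_comp⟩ := D'
    obtain rfl : obj = fun j => cons (X j) (R j) := hD'
    let F : J ⥤ C :=
      { obj := X
        map := fun {j j'} f => (map f : Hom (_ :: _) (_ :: _)).1
        map_id := fun j => congrArg Prod.fst (map_id j)
        map_comp := fun f g => congrArg Prod.fst (map_comp f g) }
    let T : J ⥤ Seq C :=
      { obj := R
        map := fun {j j'} f => (map f : Hom (_ :: _) (_ :: _)).2
        map_id := fun j => congrArg Prod.snd (map_id j)
        map_comp := fun f g => congrArg Prod.snd (map_comp f g) }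
    obtain ⟨l, ⟨e'⟩⟩ := ih T fun j => by
      have := hD j
      rw [hXR] at this
      exact Nat.succ_injective this
    refine ⟨F :: l, ⟨e ≪≫ NatIso.ofComponents (fun j =>
      { hom := consHom (𝟙 (X j)) (e'.hom.app j)
        inv := consHom (𝟙 (X j)) (e'.inv.app j)
        hom_inv_id := congrArg₂ consHom (Category.id_comp _) (e'.hom_inv_id_app j)
        inv_hom_id := congrArg₂ consHom (Category.id_comp _) (e'.inv_hom_id_app j) })
      fun {j j'} f => ?_⟩⟩
    exact congrArg₂ consHom ((Category.comp_id _).trans (Category.id_comp _).symm)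
      (e'.hom.naturality f)

theorem exists_tuple_iso [IsConnected J] (D : J ⥤ Seq C) :
    ∃ l : List (J ⥤ C), Nonempty (D ≅ tuple (fun F => F) l) := by
  obtain ⟨j₀⟩ := (inferInstance : Nonempty J)
  exact exists_tuple_iso_of_length _ D fun j => constant_of_preserves_morphisms
    (fun j => (D.obj j).length) (fun _ _ f => length_eq_of_hom (D.map f)) j j₀

end Seq

variable {V : Type u} [Category.{v} V] {E : Multitensor V}

namespace Words.Free

theorem isAccessible_multitensor (G : Free E) [HasColimits V] (κ : Cardinal.{v}) [Fact κ.IsRegular]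
    (hE : E.IsAccessible κ) : G.multitensor.IsAccessible κ := by
  constructor
  intro J _ _
  have := isFiltered_of_isCardinalFiltered J κ
  have : IsConnected J := IsFiltered.isConnected J
  have : PreservesColimitsOfShape J E.tensor :=
    letI : E.tensor.IsCardinalAccessible κ := hE
    E.tensor.preservesColimitsOfShape_of_isCardinalAccessible κ J
  have : PreservesColimitsOfShape J (E.unaryMonad : V ⥤ V) :=
    inferInstanceAs (PreservesColimitsOfShape J
      (Seq.consFunctor (𝟭 V) ((Functor.const V).obj Seq.nil) ⋙ E.tensor))
  have : HasColimitsOfShape J (Alg E) := hasColimitsOfShape_of_hasColimitsOfShape_createsColimitsOfShape E.unaryMonad.forget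
  refine ⟨fun {D₀} => ?_⟩
  obtain ⟨l, ⟨e⟩⟩ := Seq.exists_tuple_iso D₀
  let D : J ⥤ ((J ⥤ Alg E) → Alg E) :=
    { obj := fun j F => F.obj j
      map := fun f F => F.map f
      map_id := fun j => funext fun F => F.map_id j
      map_comp := fun f g => funext fun F => F.map_comp f g }
  have hc := piColimitCoconeIsColimit D
  have e' : D ⋙ MultiAlg.tupleEval l ≅ D₀ := e.symm
  have : PreservesColimit (D ⋙ MultiAlg.tupleEval l) G.tensor := by
    refine preservesColimit_of_preserves_colimit_cocone
      (isColimitOfPreserves (MultiAlg.tupleEval l) hc) ?_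
    have := G.isColimit_tupleEval_tensor (S := J ⥤ Alg E)
      (fun s => isColimitOfPreserves (Pi.eval (fun _ => Alg E) s) hc) l
    exact isColimitOfReflects E.unaryMonad.forget this.some
  exact preservesColimit_of_iso_diagram G.tensor e'

end Words.Free

end Multi

namespace Multi

section Chain

variable {S : Type w} {O : Type w'} (s t : S → O)

/-- `Chain s t a l b` says that the edges in `l` are composable and lead from `a` to `b`. -/
def Chain : O → List S → O → Prop
  | a, [], b => a = b
  | a, e :: l, b => s e = a ∧ Chain (t e) l b

variable {s t}

theorem chain_append {l m : List S} {a b : O} :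
    Chain s t a (l ++ m) b ↔ ∃ c, Chain s t a l c ∧ Chain s t c m b := by
  induction l generalizing a with
  | nil => exact ⟨fun h => ⟨a, rfl, h⟩, fun ⟨_, h, h'⟩ => h.symm ▸ h'⟩
  | cons e l ih =>
    refine ⟨fun h => ?_, fun ⟨c, h, h'⟩ => ⟨h.1, ih.2 ⟨c, h.2, h'⟩⟩⟩
    obtain ⟨c, h₁, h₂⟩ := ih.1 h.2
    exact ⟨c, ⟨h.1, h₁⟩, h₂⟩

theorem Chain.unique {l : List S} {a b b' : O} (h : Chain s t a l b) (h' : Chain s t a l b') :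
    b = b' := by
  induction l generalizing a with
  | nil => exact h.symm.trans h'
  | cons e l ih => exact ih h.2 h'.2

theorem Chain.map {S' : Type*} {s' t' : S' → O} {f : S' → S} (hs : ∀ e, s (f e) = s' e)
    (ht : ∀ e, t (f e) = t' e) {l : List S'} {a b : O} (h : Chain s' t' a l b) :
    Chain s t a (l.map f) b := by
  induction l generalizing a with
  | nil => exact h
  | cons e l ih => exact ⟨(hs e).trans h.1, (ht e).symm ▸ ih h.2⟩

variable (s t) in
/-- Composable sequences of edges. -/
abbrev Walk := { w : O × List S × O // Chain s t w.1 w.2.1 w.2.2 }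

namespace Walk

/-- The initial vertex. -/
abbrev src (w : Walk s t) : O := w.1.1

/-- The sequence of edges. -/
abbrev edges (w : Walk s t) : List S := w.1.2.1

/-- The final vertex. -/
abbrev tgt (w : Walk s t) : O := w.1.2.2

/-- `Dec l w` says that `w` is the concatenation of the composable sequence `l`. -/
def Dec (l : List (Walk s t)) (w : Walk s t) : Prop :=
  Chain src tgt w.src l w.tgt ∧ (l.map edges).flatten = w.edges

theorem chain_flatten {l : List (Walk s t)} {a b : O} (h : Chain src tgt a l b) :
    Chain s t a (l.map edges).flatten b := by
  induction l generalizing a with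
  | nil => exact h
  | cons w l ih =>
    obtain ⟨rfl, h⟩ := h
    exact chain_append.2 ⟨w.tgt, w.2, ih h⟩

theorem exists_chain (L : List (List S)) {a b : O} (h : Chain s t a L.flatten b) :
    ∃ l : List (Walk s t), Chain src tgt a l b ∧ l.map edges = L := by
  induction L generalizing a with
  | nil => exact ⟨[], h, rfl⟩
  | cons y L ih =>
    obtain ⟨c, h₁, h₂⟩ := chain_append.1 (List.flatten_cons ▸ h)
    obtain ⟨l, hl, e⟩ := ih h₂
    exact ⟨⟨(a, y, c), h₁⟩ :: l, ⟨rfl, hl⟩, congrArg (List.cons y) e⟩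

theorem chain_injective {l l' : List (Walk s t)} {a b b' : O} (h : Chain src tgt a l b)
    (h' : Chain src tgt a l' b') (e : l.map edges = l'.map edges) : l = l' := by
  induction l generalizing a l' with
  | nil => exact (List.map_eq_nil_iff.1 e.symm).symm
  | cons w l ih =>
    match l', h', e with
    | w' :: l', h', e =>
      obtain ⟨e₁, e₂⟩ := List.cons_eq_cons.1 e
      obtain ⟨⟨a₁, y, c⟩, hw⟩ := w
      obtain ⟨⟨a₂, y', c'⟩, hw'⟩ := w'
      obtain rfl : y = y' := e₁
      obtain rfl : a₁ = a := h.1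
      obtain rfl : a₂ = a₁ := h'.1
      obtain rfl : c = c' := hw.unique hw'
      exact congrArg (List.cons _) (ih h.2 h'.2 e₂)

theorem Dec.flatten {ls : List (List (Walk s t))} {l : List (Walk s t)} {a b : O}
    (r : List.Forall₂ Dec ls l) (h : Chain src tgt a l b) :
    Chain src tgt a ls.flatten b ∧ (ls.flatten.map edges).flatten = (l.map edges).flatten := by
  induction r generalizing a with
  | nil => exact ⟨h, rfl⟩
  | cons d r ih =>
    obtain ⟨h₁, h₂⟩ := h
    subst h₁
    obtain ⟨h₃, h₄⟩ := ih h₂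
    refine ⟨chain_append.2 ⟨_, d.1, h₃⟩, ?_⟩
    rw [List.flatten_cons, List.map_append, List.flatten_append, d.2, h₄, List.map_cons,
      List.flatten_cons]

end Walk

end Chain

/-- The words formed by the labels of composable sequences of edges. -/
abbrev Index.walks {S α : Type (max u v)} {O : Type v} (s t : S → O) (φ : S → α) : Index α where
  W := Walk s t
  π w := w.edges.map φ
  Dec := Walk.Dec
  flatten_eq h := Eq.trans (by rw [List.map_map]; rfl) (Words.flatten_map_map φ h.2)
  exists_lift {w} L h := by
    obtain ⟨l, hl, rfl⟩ := exists_flatten_lift φ L _ h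
    obtain ⟨m, hm, rfl⟩ := Walk.exists_chain (s := s) (t := t) l
      ((congrArg (Chain s t w.src · w.tgt) hl).mpr w.2)
    exact ⟨m, ⟨hm, hl⟩, List.map_map.symm⟩
  lift_unique {w l l'} h h' e := Walk.chain_injective h.1 h'.1
    (flatten_injective_of_map φ (h.2.trans h'.2.symm) (by rw [List.map_map, List.map_map]; exact e))
  dec_single w := ⟨⟨rfl, rfl⟩, List.append_nil _⟩
  dec_flatten r d := ⟨(Walk.Dec.flatten r d.1).1, (Walk.Dec.flatten r d.1).2.trans d.2⟩

end Multi

namespace Multi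

theorem Seq.arrow_mk_map_eqToHom_comp {V : Type u} [Category.{v} V] {W : Type u'}
    [Category.{v'} W] (T : V ⥤ W) {X Y : V} {Z : W} (p : X = Y) (f : T.obj Y ⟶ Z) :
    Arrow.mk (T.map (eqToHom p) ≫ f) = Arrow.mk f := by
  subst p
  rw [eqToHom_refl, T.map_id, Category.id_comp]

namespace VPath

variable {O : Type v}

/-- The sequence of edges of a path. -/
def edges : ∀ {a b : O}, VPath O a b → List (O × O)
  | _, _, .nil _ => []
  | _, _, .cons a (b := b) p => (a, b) :: edges p

theorem edges_injective : ∀ {a b : O} (p q : VPath O a b), p.edges = q.edges → p = q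
  | _, _, .nil _, .nil _, _ => rfl
  | _, _, .cons a p, .cons _ q, e => by
    obtain ⟨e₁, e₂⟩ := List.cons_eq_cons.1 e
    obtain ⟨-, rfl⟩ := Prod.mk.inj e₁
    exact congrArg _ (edges_injective p q e₂)
  | _, _, .nil _, .cons _ _, e => by cases e
  | _, _, .cons _ _, .nil _, e => by cases e

theorem chain_edges : ∀ {a b : O} (p : VPath O a b), Chain Prod.fst Prod.snd a p.edges b
  | _, _, .nil _ => rfl
  | _, _, .cons _ p => ⟨rfl, chain_edges p⟩

theorem edges_append : ∀ {a b c : O} (p : VPath O a b) (q : VPath O b c),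
    (p.append q).edges = p.edges ++ q.edges
  | _, _, _, .nil _, _ => rfl
  | _, _, _, .cons _ p, q => congrArg _ (edges_append p q)

theorem exists_of_chain {S : Type*} {s t : S → O} {l : List S} {a b : O} (h : Chain s t a l b) :
    ∃ p : VPath O a b, p.edges = l.map fun e => (s e, t e) := by
  induction l generalizing a with
  | nil =>
    obtain rfl := h
    exact ⟨.nil a, rfl⟩
  | cons e l ih =>
    obtain ⟨rfl, h⟩ := h
    obtain ⟨p, hp⟩ := ih h
    exact ⟨.cons _ p, congrArg _ hp⟩

theorem seq_eq {V : Type u} [Category.{v} V] (X : VGraph V) : ∀ {a b : X.vert}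
    (p : VPath X.vert a b), p.seq X = p.edges.map fun e => X.hom e.1 e.2
  | _, _, .nil _ => rfl
  | _, _, .cons _ p => congrArg _ (seq_eq X p)

end VPath

namespace Enrich

variable {V : Type u} [Category.{v} V] {E : Multitensor V} (X : Enrich E)

section Walk

variable {S : Type*} {s t : S → X.graph.vert}

theorem seq_eq_of_edges {l : List S} {a b : X.graph.vert} {p : VPath X.graph.vert a b}
    (hp : p.edges = l.map fun e => (s e, t e)) :
    (l.map fun e => X.graph.hom (s e) (t e)) = p.seq X.graph := by
  rw [VPath.seq_eq, hp, List.map_map]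
  rfl

/-- Composition along a composable sequence of edges. -/
noncomputable def walkComp {l : List S} {a b : X.graph.vert} (h : Chain s t a l b) :
    E.tensor.obj (l.map fun e => X.graph.hom (s e) (t e)) ⟶ X.graph.hom a b :=
  E.tensor.map (eqToHom (X.seq_eq_of_edges (VPath.exists_of_chain h).choose_spec)) ≫ X.comp _

theorem walkComp_eq {l : List S} {a b : X.graph.vert} (h : Chain s t a l b)
    {p : VPath X.graph.vert a b} (hp : p.edges = l.map fun e => (s e, t e)) :
    X.walkComp h = E.tensor.map (eqToHom (X.seq_eq_of_edges hp)) ≫ X.comp p := by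
  obtain rfl : p = _ := VPath.edges_injective _ _
    (hp.trans (VPath.exists_of_chain h).choose_spec.symm)
  rfl

theorem arrow_mk_walkComp {l : List S} {a b : X.graph.vert} (h : Chain s t a l b)
    {p : VPath X.graph.vert a b} (hp : p.edges = l.map fun e => (s e, t e)) :
    Arrow.mk (X.walkComp h) = Arrow.mk (X.comp p) := by
  rw [X.walkComp_eq h hp, eqToHom_map]
  exact Seq.arrow_mk_eqToHom_comp rfl _

theorem exists_pathSeq {S' : Type*} {s' t' : S' → X.graph.vert} {R : List S → S' → Prop}
    (hR : ∀ y e, R y e → Chain s t (s' e) y (t' e)) {ls : List (List S)} {l : List S'}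
    {a b : X.graph.vert} (r : List.Forall₂ R ls l) (h : Chain s' t' a l b) :
    ∃ P : PathSeq X.graph.vert a b, (P.ends.edges = l.map fun e => (s' e, t' e)) ∧
      (P.flat.edges = ls.flatten.map fun e => (s e, t e)) ∧
      (Arrow.mk (Seq.homRel (fun y e d => X.walkComp (hR y e d)) r :
        ((ls.map fun l => E.tensor.obj (l.map fun e => X.graph.hom (s e) (t e)) : Seq V) ⟶
          l.map fun e => X.graph.hom (s' e) (t' e))) =
        Arrow.mk (P.compSeq E.tensor X.graph X.comp)) ∧
      ls.map (List.map fun e => X.graph.hom (s e) (t e)) = P.seqs X.graph := by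
  induction r generalizing a with
  | nil =>
    obtain rfl := h
    exact ⟨.nil a, rfl, rfl, rfl, rfl⟩
  | @cons l w ls ws d r ih =>
    obtain ⟨rfl, h⟩ := h
    obtain ⟨P, h₁, h₂, h₃, h₄⟩ := ih h
    obtain ⟨p, hp⟩ := VPath.exists_of_chain (hR _ _ d)
    refine ⟨.cons p P, congrArg (List.cons _) h₁, ?_,
      Seq.arrow_mk_consHom (X.arrow_mk_walkComp (hR _ _ d) hp) h₃,
      congrArg₂ List.cons (X.seq_eq_of_edges hp) h₄⟩
    refine (VPath.edges_append p P.flat).trans ?_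
    rw [hp, h₂, List.flatten_cons, List.map_append]

end Walk

theorem _root_.Multi.Multitensor.arrow_mk_substTo {α : Type*} (k : α → Seq V) (M : List α)
    {l : Seq V} (h : (M.map k).flatten = l) :
    Arrow.mk (E.substTo k M h) = Arrow.mk (E.subst.app (M.map k)) := by
  unfold Multitensor.substTo
  rw [Seq.fuse_eq]
  exact (Seq.arrow_mk_map_eqToHom_comp E.tensor List.map_map.symm _).trans
    (Seq.arrow_mk_comp_map_eqToHom E.tensor _ _)

/-- The multialgebra of homs of an enriched category, indexed by the composable sequences in a
graph on its set of objects. -/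
noncomputable abbrev walkAlg {S α : Type (max u v)} (s t : S → X.graph.vert) (φ : S → α) :
    MultiAlg E (Index.walks s t φ) where
  obj w := X.graph.hom w.src w.tgt
  comp d := X.walkComp d.1
  unit_comp w := by
    have e := X.walkComp_eq (s := Walk.src) (t := Walk.tgt) (l := [w]) ⟨rfl, rfl⟩
      (p := VPath.edge w.src w.tgt) rfl
    refine (congrArg (_ ≫ ·) e).trans (Eq.trans ?_ (X.unit_comp w.src w.tgt))
    refine congrArg (_ ≫ ·) ((congrArg (· ≫ _) (E.tensor.map_id _)).trans (Category.id_comp _))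
  assoc {ls l w} r d := by
    obtain ⟨P, h₁, h₂, h₃, h₄⟩ := X.exists_pathSeq (fun _ _ d => d.1) r d.1
    refine Arrow.mk_injective _ _ ((Seq.arrow_mk_comp (Seq.arrow_mk_map E.tensor h₃)
      (X.arrow_mk_walkComp d.1 h₁)).trans ((congrArg Arrow.mk (X.assoc P).symm).trans
      (Seq.arrow_mk_comp ?_ ?_).symm))
    · exact (Multitensor.arrow_mk_substTo _ _ _).trans (Multitensor.arrow_mk_app _ h₄)
    · refine (X.arrow_mk_walkComp _ h₂).trans (Eq.symm ?_)
      rw [eqToHom_map]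
      exact Seq.arrow_mk_eqToHom_comp rfl _

end Enrich

end Multi

namespace Multi

namespace Seq

variable {C : Type u} [Category.{v} C] {α β γ : Type*}

theorem homFib_homMap₂ {Y : γ → C} {f : α → C} {g : β → C} (p : γ → α) (q : γ → β)
    (ι : ∀ s, Y s ⟶ f (p s)) (x : ∀ s, f (p s) ⟶ g (q s)) (l : List γ) :
    homFib p ι l ≫ homMap₂ p q x l = homFib q (fun s => ι s ≫ x s) l := by
  induction l with
  | nil => rfl
  | cons a l ih => exact congrArg (consHom _) ih

theorem homFib_eqToHom {Y : γ → C} {f : α → C} (p : γ → α) (e : ∀ s, Y s = f (p s)) (l : List γ) :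
    homFib p (fun s => eqToHom (e s)) l = eqToHom
      ((List.map_congr_left fun s _ => e s).trans List.map_map.symm) := by
  induction l with
  | nil => rfl
  | cons a l ih => exact (congrArg (consHom _) ih).trans (consHom_eqToHom _ _)

theorem arrow_mk_homFib_map {Y : β → C} {f : α → C} (p : β → α) (ι : ∀ s, Y s ⟶ f (p s))
    (g : γ → β) (l : List γ) : Arrow.mk (homFib p ι (l.map g)) =
      Arrow.mk (homFib (fun s => p (g s)) (fun s => ι (g s)) l) := by
  induction l with
  | nil => rfl
  | cons a l ih => exact arrow_mk_consHom rfl ih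

end Seq

variable {V : Type u} [Category.{v} V] {E : Multitensor V}

namespace Words.Free

theorem flatten_map_singleton {S : Type*} (y : List S) : (y.map fun s => [s]).flatten = y := by
  induction y with
  | nil => rfl
  | cons s y ih => exact congrArg (List.cons s) ih

theorem IsConcat.flatten_map {S α : Type*} {ψ : List S → List α} (hψ : IsConcat ψ) (y : List S) :
    (y.map fun s => ψ [s]).flatten = ψ y := by
  refine Eq.trans ?_ (hψ (y.map fun s => [s]) y (flatten_map_singleton y))
  rw [List.map_map]
  rfl

variable (G : Free E) {S : Type*}

/-- An algebra as a word of length one. -/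
abbrev letter (a : Alg E) : a.A ⟶ (G.alg [a]).A := (eqToHom (G.alg_single a).symm).f

/-- The canonical map to a value of the free multialgebra determined by maps to its letters. -/
abbrev gen {ψ : List S → List (Alg E)} {Y : S → V} (ι : ∀ s, Y s ⟶ (G.alg (ψ [s])).A) (y : List S)
    (h : (y.map fun s => ψ [s]).flatten = ψ y) : E.tensor.obj (y.map Y) ⟶ (G.alg (ψ y)).A :=
  E.tensor.map (Seq.homFib (P := fun w => (G.alg w).A) (fun s => ψ [s]) ι y) ≫ G.comp h

/-- The comparison between the tensors. -/
abbrev can (l : List (Alg E)) : E.tensor.obj (l.map fun a => a.A) ⟶ (G.alg l).A :=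
  G.gen (ψ := fun l => l) G.letter l (Seq.flatten_map_single l)

variable {G} in
theorem IsMult.gen {ψ χ : List S → List (Alg E)} (hψ : IsConcat ψ) (hχ : IsConcat χ)
    {k : ∀ y, G.alg (ψ y) ⟶ G.alg (χ y)}
    (hk : G.IsMult ψ χ k) {Y : S → V} (ι : ∀ s, Y s ⟶ (G.alg (ψ [s])).A) (y : List S) (h h') :
    G.gen ι y h ≫ (k y).f = G.gen (fun s => ι s ≫ (k [s]).f) y h' := by
  have e₀ := flatten_map_singleton y
  have e₁ := hk _ y e₀ (hψ _ _ e₀) (hχ _ _ e₀)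
  have h₁ : (y.map fun s => ψ [s]) = (y.map fun s => [s]).map ψ := by rw [List.map_map]; rfl
  have h₂ : (y.map fun s => χ [s]) = (y.map fun s => [s]).map χ := by rw [List.map_map]; rfl
  have e₂ := G.toMultiAlg.comp_congr (I := Index.words (Alg E)) (t := ψ y) h₁ h (hψ _ _ e₀)
    (congrArg (List.map _) h₁)
  have e₃ := G.toMultiAlg.comp_congr (I := Index.words (Alg E)) (t := χ y) h₂ h' (hχ _ _ e₀)
    (congrArg (List.map _) h₂)
  have e₄ := congrArg E.tensor.map (Seq.eqToHom_comp_eq_comp_eqToHom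
    (Seq.arrow_mk_homMap₂ (f := fun w => (G.alg w).A) (g := fun w => (G.alg w).A) ψ χ
      (fun y => (k y).f) (fun s => [s]) y).symm (congrArg (List.map _) h₁) (congrArg (List.map _) h₂))
  have e₅ := congrArg E.tensor.map (Seq.homFib_homMap₂ (f := fun w => (G.alg w).A)
    (g := fun w => (G.alg w).A) (fun s => ψ [s]) (fun s => χ [s]) ι (fun s => (k [s]).f) y)
  rw [E.tensor.map_comp, E.tensor.map_comp] at e₄
  rw [E.tensor.map_comp] at e₅
  refine (Category.assoc _ _ _).trans ?_
  refine (congrArg (fun t => _ ≫ t ≫ _) e₂.symm).trans ((congrArg (_ ≫ ·) ((comp_eq_right e₁).trans ((comp_eq_left e₄).trans (comp_eq_right e₃)))).trans ?_)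
  exact comp_eq_left e₅

theorem arrow_mk_comp_congr {L L' : List (List (Alg E))} {w w' : List (Alg E)} (h : L = L')
    (d : L.flatten = w) (d' : L'.flatten = w') : Arrow.mk (G.comp d) = Arrow.mk (G.comp d') := by
  subst h d d'
  rfl

theorem arrow_mk_can (g : S → Alg E) (y : List S) (h) :
    Arrow.mk (G.can (y.map g)) =
      Arrow.mk (G.gen (ψ := List.map g) (fun s => G.letter (g s)) y h) := by
  refine Seq.arrow_mk_comp (Seq.arrow_mk_map E.tensor ?_) (G.arrow_mk_comp_congr List.map_map _ _)
  exact Seq.arrow_mk_homFib_map _ _ _ _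

theorem can_naturality {l m : Seq (Alg E)} (f : l ⟶ m) :
    E.tensor.map ((Seq.map E.unaryMonad.forget).map f) ≫ G.can m =
      G.can l ≫ (G.tensorMap f).f := by
  have h := Seq.arrow_mk_arrows f
  generalize Seq.arrows f = y at h
  obtain rfl : _ = l := congrArg (fun t : Arrow (Seq (Alg E)) => t.left) h
  obtain rfl : _ = m := congrArg (fun t : Arrow (Seq (Alg E)) => t.right) h
  obtain rfl := Arrow.mk_injective _ _ h
  have hl := fun g : Arrow (Alg E) → Alg E => (isConcat_map g).flatten_map y
  have e := IsMult.gen (isConcat_map _) (isConcat_map _) (G.isMult_tensorMap _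
    (Seq.isConcatHom_homMap fun s : Arrow (Alg E) => s.hom)) (fun s => G.letter s.left) y (hl _)
    (hl _)
  have e' : ∀ s : Arrow (Alg E), G.letter s.left ≫
      (G.tensorMap (Seq.homMap (fun s : Arrow (Alg E) => s.hom) [s])).f =
      s.hom.f ≫ G.letter s.right := fun s =>
    congrArg Monad.Algebra.Hom.f (G.tensorMap_single s.hom)
  rw [funext e'] at e
  refine Arrow.mk_injective _ _ ((Seq.arrow_mk_comp
    (f' := E.tensor.map (Seq.homMap (fun s : Arrow (Alg E) => s.hom.f) y)) ?_
    (G.arrow_mk_can _ y (hl _))).trans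
    ((congrArg Arrow.mk ?_).trans (Seq.arrow_mk_comp (G.arrow_mk_can _ y (hl _)) rfl).symm))
  · refine Seq.arrow_mk_map E.tensor ?_
    clear h e hl
    induction y with
    | nil => rfl
    | cons s y ih => exact Seq.arrow_mk_consHom rfl ih
  · refine Eq.trans (comp_eq_left ?_) e.symm
    refine (E.tensor.map_comp _ _).symm.trans (congrArg E.tensor.map ?_)
    clear h e hl
    induction y with
    | nil => rfl
    | cons s y ih => exact congrArg (Seq.consHom _) ih

theorem homMap_can_comp (L : List (List (Alg E)))
    (h : (L.map (List.map fun a : Alg E => a.A)).flatten = L.flatten.map fun a => a.A) :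
    E.tensor.map (Seq.homMap G.can L) ≫ G.comp rfl =
      E.substTo (List.map fun a => a.A) L h ≫ G.can L.flatten := by
  have h₀ : (L.map (List.map fun a => [a])).flatten = L.flatten.map fun a => [a] :=
    List.map_flatten.symm
  have h₁ : (L.map fun w => (w.map fun a => [a]).map fun w => (G.alg w).A).flatten =
    (L.flatten.map fun a => [a]).map fun w => (G.alg w).A := by
    rw [← h₀, List.map_flatten, List.map_map]
    rfl
  have e := G.toMultiAlg.comp_map (I := Index.words (Alg E)) (List.map fun a => [a])
    Seq.flatten_map_single h₀ h₁ (t := L.flatten) rfl (Seq.flatten_map_single L.flatten)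
  have e₁ := E.substTo_naturality (fun w => Seq.homFib (P := fun w => (G.alg w).A) (fun a => [a])
    G.letter w) L h h₁ (Seq.homFib (P := fun w => (G.alg w).A) (fun a => [a]) G.letter L.flatten)
    (Seq.isConcatHom_homFib _ _ L _ rfl)
  refine (congrArg (· ≫ _) ((congrArg E.tensor.map (Seq.homMap_comp _ _ L)).trans
    (E.tensor.map_comp _ _))).trans ?_
  refine (comp_eq_right e).trans ?_
  exact (comp_eq_left e₁).trans (Category.assoc _ _ _)

theorem arrow_mk_can_subst (L : List (List (Alg E))) :
    Arrow.mk (G.can (L.map G.alg) ≫ (G.subst L).f) =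
      Arrow.mk (G.comp (L := L) rfl) := by
  have h₁ : (L.map fun s => List.map G.alg [s]).flatten = L.map G.alg :=
    (isConcat_map G.alg).flatten_map L
  have h₂ : (L.map fun s => List.flatten [s]).flatten = L.flatten :=
    isConcat_flatten.flatten_map L
  have e := IsMult.gen (isConcat_map _) isConcat_flatten G.isMult_subst
    (fun w => G.letter (G.alg w)) L h₁ h₂
  refine (Seq.arrow_mk_comp (G.arrow_mk_can G.alg L h₁) rfl).trans ((congrArg Arrow.mk e).trans ?_)
  have e' : (fun w => G.letter (G.alg w) ≫ (G.subst [w]).f) = fun w => eqToHom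
      (congrArg (fun w => (G.alg w).A) (List.append_nil w).symm) := by
    funext w
    exact (congrArg Monad.Algebra.Hom.f (G.subst_single w)).trans (eqToHom_f _)
  rw [e']
  refine (congrArg (fun k => Arrow.mk (E.tensor.map k ≫ G.comp h₂)) (Seq.homFib_eqToHom
    (fun s => List.flatten [s]) _ L)).trans ?_
  refine (Seq.arrow_mk_map_eqToHom_comp E.tensor _ _).trans (G.arrow_mk_comp_congr ?_ _ _)
  exact (List.map_congr_left fun w _ => List.append_nil w).trans (List.map_id L)

theorem can_single (a : Alg E) : G.can [a] = a.a ≫ G.letter a :=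
  (eqToHom (G.alg_single a).symm).h

end Words.Free

end Multi

namespace Multi

section

variable {V : Type u} [Category.{v} V] {V' : Type u'} [Category.{v} V'] (F : V ⥤ V')

theorem VPath.seq_mapFunctor (X : VGraph V) : ∀ {a b : X.vert} (p : VPath X.vert a b),
    p.seq ((VGraph.mapFunctor F).obj X) = List.map F.obj (p.seq X)
  | _, _, .nil _ => rfl
  | _, _, .cons _ p => congrArg (List.cons _) (seq_mapFunctor X p)

theorem VPath.seqMap_mapFunctor {X Y : VGraph V} (f : X ⟶ Y) : ∀ {a b : X.vert}
    (p : VPath X.vert a b), Arrow.mk (p.seqMap ((VGraph.mapFunctor F).map f)) =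
      Arrow.mk ((Seq.map F).map (p.seqMap f))
  | _, _, .nil _ => rfl
  | _, _, .cons _ p => Seq.arrow_mk_consHom rfl (seqMap_mapFunctor f p)

theorem PathSeq.seqs_mapFunctor (X : VGraph V) : ∀ {a b : X.vert} (P : PathSeq X.vert a b),
    P.seqs ((VGraph.mapFunctor F).obj X) = List.map (List.map F.obj) (P.seqs X)
  | _, _, .nil _ => rfl
  | _, _, .cons p P => congrArg₂ List.cons (p.seq_mapFunctor F X) (seqs_mapFunctor X P)

instance [F.Faithful] : (VGraph.mapFunctor F).Faithful where
  map_injective {X Y f g} h := by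
    obtain ⟨fo, fm⟩ := f
    obtain ⟨go, gm⟩ := g
    obtain rfl : fo = go := congrArg VGraph.Hom.obj h
    refine congrArg (VGraph.Hom.mk fo) (funext fun a => funext fun b => F.map_injective ?_)
    have h' := eq_of_heq (VGraph.Hom.mk.inj h).2
    exact congrFun (congrFun h' a) b

theorem functor_ext_of_faithful {C : Type*} [Category* C] {B : Type*} [Category* B] {B' : Type*}
    [Category* B'] {P Q : C ⥤ B} (T : B ⥤ B') [T.Faithful] (h : ∀ X, P.obj X = Q.obj X)
    (e : P ⋙ T = Q ⋙ T) : P = Q := by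
  refine CategoryTheory.Functor.ext h fun X Y f => T.map_injective ?_
  have := Functor.congr_hom e f
  simpa only [Functor.comp_map, Functor.map_comp, eqToHom_map] using! this

end

variable {V : Type u} [Category.{v} V] {E : Multitensor V}

namespace Words.Free

variable (G : Free E)

theorem subst_can (L : List (List (Alg E)))
    (h : (L.map (List.map fun a : Alg E => a.A)).flatten = L.flatten.map fun a => a.A) :
    E.tensor.map (Seq.homFib (P := fun a : Alg E => a.A) G.alg G.can L) ≫ G.can (L.map G.alg) ≫
      (G.subst L).f = E.substTo (List.map fun a => a.A) L h ≫ G.can L.flatten := by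
  refine Eq.trans (Arrow.mk_injective _ _ (Seq.arrow_mk_comp ?_ (G.arrow_mk_can_subst L)))
    (G.homMap_can_comp L h)
  refine Seq.arrow_mk_map E.tensor ?_
  clear h
  induction L with
  | nil => rfl
  | cons l L ih => exact Seq.arrow_mk_consHom rfl ih

section Lower

variable (Y : Enrich G.multitensor)

/-- Composition maps for the original multitensor. -/
noncomputable abbrev lowerComp {a b : Y.graph.vert} (p : VPath Y.graph.vert a b) :
    E.tensor.obj (p.seq ((VGraph.mapFunctor E.unaryMonad.forget).obj Y.graph)) ⟶
      (Y.graph.hom a b).A :=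
  E.tensor.map (eqToHom (p.seq_mapFunctor E.unaryMonad.forget Y.graph)) ≫ G.can (p.seq Y.graph) ≫
    (Y.comp p).f

theorem arrow_mk_lowerComp {a b : Y.graph.vert} (p : VPath Y.graph.vert a b) :
    Arrow.mk (G.lowerComp Y p) = Arrow.mk (G.can (p.seq Y.graph) ≫ (Y.comp p).f) :=
  Seq.arrow_mk_map_eqToHom_comp E.tensor _ _

theorem lowerComp_edge (a b : Y.graph.vert) :
    G.lowerComp Y (VPath.edge a b) = (Y.graph.hom a b).a := by
  refine (congrArg (· ≫ _) (E.tensor.map_id _)).trans ((Category.id_comp _).trans ?_)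
  refine (congrArg (· ≫ _) (G.can_single _)).trans ((Category.assoc _ _ _).trans ?_)
  exact (congrArg (_ ≫ ·) (congrArg Monad.Algebra.Hom.f (Y.unit_comp a b))).trans
    (Category.comp_id _)

theorem arrow_mk_compSeq_lowerComp : ∀ {a b : Y.graph.vert} (P : PathSeq Y.graph.vert a b),
    Arrow.mk (P.compSeq E.tensor ((VGraph.mapFunctor E.unaryMonad.forget).obj Y.graph)
        (G.lowerComp Y)) =
      Arrow.mk (Seq.homFib (P := fun a : Alg E => a.A) G.alg G.can (P.seqs Y.graph) ≫
        (Seq.map E.unaryMonad.forget).map (P.compSeq G.tensor Y.graph Y.comp))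
  | _, _, .nil _ => rfl
  | _, _, .cons p P => Seq.arrow_mk_consHom (G.arrow_mk_lowerComp Y p)
      (arrow_mk_compSeq_lowerComp P)

/-- The category enriched in the original multitensor underlying a category enriched in the lifted
one. -/
@[simps] noncomputable def lower : Enrich E where
  graph := (VGraph.mapFunctor E.unaryMonad.forget).obj Y.graph
  comp := G.lowerComp Y
  unit_comp a b := (congrArg (_ ≫ ·) (G.lowerComp_edge Y a b)).trans (Y.graph.hom a b).unit
  assoc {a b} P := by
    have h : (List.map (List.map fun a : Alg E => a.A) (P.seqs Y.graph)).flatten =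
      (List.flatten (P.seqs Y.graph)).map fun a => a.A := List.map_flatten.symm
    have e := congrArg Monad.Algebra.Hom.f (Y.assoc P)
    have e' : E.substTo (List.map fun a => a.A) (P.seqs Y.graph) h ≫
        G.can (List.flatten (P.seqs Y.graph)) ≫ (G.tensorMap (eqToHom (P.flatten_seqs Y.graph))).f ≫
          (Y.comp P.flat).f =
        E.tensor.map (Seq.homFib (P := fun a : Alg E => a.A) G.alg G.can (P.seqs Y.graph) ≫
          (Seq.map E.unaryMonad.forget).map (P.compSeq G.tensor Y.graph Y.comp)) ≫
          G.can (P.ends.seq Y.graph) ≫ (Y.comp P.ends).f := by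
      refine Eq.trans ?_ (congrArg (· ≫ _) (E.tensor.map_comp _ _)).symm
      refine Eq.trans ?_ (Category.assoc _ _ _).symm
      refine Eq.trans ?_ (congrArg (_ ≫ ·) (Category.assoc _ _ _))
      refine Eq.trans ?_ (congrArg (fun k => _ ≫ k ≫ _)
        (G.can_naturality (P.compSeq G.tensor Y.graph Y.comp))).symm
      refine Eq.trans ?_ (congrArg (_ ≫ ·) ((congrArg (_ ≫ ·) e).trans
        (Category.assoc _ _ _).symm))
      refine Eq.trans (comp_eq_left (G.subst_can _ h).symm) ?_
      refine comp_eq_right ((Category.assoc _ _ _).trans ?_)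
      rfl
    refine Arrow.mk_injective _ _ (Eq.trans ?_ ((congrArg Arrow.mk e').trans
      (Seq.arrow_mk_comp (Seq.arrow_mk_map E.tensor (G.arrow_mk_compSeq_lowerComp Y P))
        (G.arrow_mk_lowerComp Y P.ends)).symm))
    refine Seq.arrow_mk_comp ?_ ((Seq.arrow_mk_map_eqToHom_comp E.tensor _ _).trans
      ((G.arrow_mk_lowerComp Y P.flat).trans ?_))
    · exact ((Multitensor.arrow_mk_substTo _ _ h).trans (Multitensor.arrow_mk_app _
        (P.seqs_mapFunctor E.unaryMonad.forget Y.graph).symm)).symm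
    · have aux : ∀ {l m : List (Alg E)} (q : l = m), Arrow.mk (G.can m) =
          Arrow.mk (G.can l ≫ (G.tensorMap (eqToHom q)).f) := by
        rintro l _ rfl
        rw [eqToHom_refl, tensorMap_id]
        exact congrArg Arrow.mk (Category.comp_id _).symm
      refine (Seq.arrow_mk_comp (aux (P.flatten_seqs Y.graph)) rfl).trans (congrArg Arrow.mk ?_)
      exact Category.assoc _ _ _

theorem lower_hom_iff {Y Y' : Enrich G.multitensor} (f : Y.graph ⟶ Y'.graph) {a b : Y.graph.vert}
    (p : VPath Y.graph.vert a b) :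
    ((G.lower Y).comp p ≫ (f.map a b).f = E.tensor.map (p.seqMap ((VGraph.mapFunctor
      E.unaryMonad.forget).map f)) ≫ (G.lower Y').comp (p.map f.obj)) ↔
    G.can (p.seq Y.graph) ≫ (Y.comp p ≫ f.map a b).f =
      G.can (p.seq Y.graph) ≫ (G.tensorMap (p.seqMap f) ≫ Y'.comp (p.map f.obj)).f := by
  have h₁ : Arrow.mk ((G.lower Y).comp p ≫ (f.map a b).f) =
      Arrow.mk (G.can (p.seq Y.graph) ≫ (Y.comp p ≫ f.map a b).f) :=
    (Seq.arrow_mk_comp (G.arrow_mk_lowerComp Y p) rfl).trans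
      (congrArg Arrow.mk (Category.assoc _ _ _))
  have h₂ : Arrow.mk (E.tensor.map (p.seqMap ((VGraph.mapFunctor
      E.unaryMonad.forget).map f)) ≫ (G.lower Y').comp (p.map f.obj)) =
      Arrow.mk (G.can (p.seq Y.graph) ≫ (G.tensorMap (p.seqMap f) ≫ Y'.comp (p.map f.obj)).f) := by
    refine (Seq.arrow_mk_comp (Seq.arrow_mk_map E.tensor (p.seqMap_mapFunctor _ f))
      (G.arrow_mk_lowerComp Y' (p.map f.obj))).trans (congrArg Arrow.mk ?_)
    refine (comp_eq_left (G.can_naturality _)).trans ?_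
    exact Category.assoc _ _ _
  constructor
  · exact fun h => Arrow.mk_injective _ _ (h₁.symm.trans ((congrArg Arrow.mk h).trans h₂))
  · exact fun h => Arrow.mk_injective _ _ (h₁.trans ((congrArg Arrow.mk h).trans h₂.symm))

/-- The functor to categories enriched in the original multitensor. -/
@[simps] noncomputable def lowerFunctor : Enrich G.multitensor ⥤ Enrich E where
  obj := G.lower
  map {Y Y'} f :=
    { graphHom := (VGraph.mapFunctor E.unaryMonad.forget).map f.graphHom
      map_comp := fun p => (G.lower_hom_iff f.graphHom p).2
        (congrArg (fun k => _ ≫ Monad.Algebra.Hom.f k) (f.map_comp p)) }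

theorem forgetToAlgebra_lower :
    (Enrich.forgetToAlgebra E).obj (G.lower Y) = Y.graph := by
  refine congrArg (VGraph.mk Y.graph.vert) (funext fun a => funext fun b => ?_)
  exact algebra_ext (G.lowerComp_edge Y a b) _ _ _ _

theorem lowerFunctor_forgetToAlgebra :
    G.lowerFunctor ⋙ Enrich.forgetToAlgebra E = Enrich.forget G.multitensor :=
  functor_ext_of_faithful (VGraph.mapFunctor E.unaryMonad.forget) G.forgetToAlgebra_lower rfl

end Lower

end Words.Free

end Multi

namespace Multi

variable {V : Type u} [Category.{v} V] {E : Multitensor V}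

theorem VPath.edges_map {O O' : Type v} (f : O → O') : ∀ {a b : O} (p : VPath O a b),
    (p.map f).edges = p.edges.map fun e => (f e.1, f e.2)
  | _, _, .nil _ => rfl
  | _, _, .cons _ p => congrArg _ (edges_map f p)

theorem Enrich.arrow_mk_seqMap {S : Type*} {X X' : VGraph V} (g : X ⟶ X') {s t : S → X.vert} :
    ∀ {a b : X.vert} (p : VPath X.vert a b) {l : List S}
    (_ : p.edges = l.map fun e => (s e, t e)), Arrow.mk (p.seqMap g) =
      Arrow.mk (Seq.homMap (fun e => g.map (s e) (t e)) l)
  | _, _, .nil _, [], _ => rfl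
  | _, _, .cons a p, e :: l, h => by
    obtain ⟨h₁, h₂⟩ := List.cons_eq_cons.1 h
    obtain ⟨rfl, rfl⟩ := Prod.mk.inj h₁
    exact Seq.arrow_mk_consHom rfl (arrow_mk_seqMap g p h₂)
  | _, _, .nil _, _ :: _, h => by cases h
  | _, _, .cons _ _, [], h => by cases h

theorem Enrich.walkComp_map {X X' : Enrich E} (g : X ⟶ X') {S S' : Type*} {s t : S → X.graph.vert}
    {s' t' : S' → X'.graph.vert} {l : List S} {l' : List S'} {a b : X.graph.vert}
    (hl : l'.map (fun e => (s' e, t' e)) =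
      l.map fun e => (g.graphHom.obj (s e), g.graphHom.obj (t e)))
    (h : Chain s t a l b) (h' : Chain s' t' (g.graphHom.obj a) l' (g.graphHom.obj b)) (q) :
    X.walkComp h ≫ g.graphHom.map a b =
      E.tensor.map (Seq.homMap (fun e => g.graphHom.map (s e) (t e)) l) ≫
        E.tensor.map (eqToHom q) ≫ X'.walkComp h' := by
  obtain ⟨p, hp⟩ := VPath.exists_of_chain h
  have hp' : (p.map g.graphHom.obj).edges = l'.map fun e => (s' e, t' e) := by
    rw [VPath.edges_map, hp, List.map_map, hl]
    rfl
  refine Arrow.mk_injective _ _ ((Seq.arrow_mk_comp (X.arrow_mk_walkComp h hp) rfl).trans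
    ((congrArg Arrow.mk (g.map_comp p)).trans (Seq.arrow_mk_comp (Seq.arrow_mk_map E.tensor
      (Enrich.arrow_mk_seqMap g.graphHom p hp)) ?_)))
  refine (X'.arrow_mk_walkComp h' hp').symm.trans (Eq.symm ?_)
  exact Seq.arrow_mk_map_eqToHom_comp E.tensor _ _

/-- Functoriality of the multialgebras of homs. -/
theorem Enrich.isMor_walkAlg {X X' : Enrich E} (g : X ⟶ X') {S S' α : Type (max u v)}
    {s t : S → X.graph.vert} {s' t' : S' → X'.graph.vert} (φ : S → α) (φ' : S' → α)
    (e : Walk s t → List S')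
    (he : ∀ w, Chain s' t' (g.graphHom.obj w.src) (e w) (g.graphHom.obj w.tgt)) (hρ) :
    MultiAlg.IsMor (X.walkAlg s t φ) ((X'.walkAlg s' t' φ').pull (I := Index.walks s t φ)
      (fun w => (⟨(g.graphHom.obj w.src, e w, g.graphHom.obj w.tgt), he w⟩ : Walk s' t')) hρ)
      (fun w => g.graphHom.map w.src w.tgt) := by
  intro l w d
  refine (Enrich.walkComp_map g (by rw [List.map_map]; rfl) d.1 (hρ l w d).1
    (by rw [List.map_map]; rfl)).trans ?_
  refine congrArg (fun k => _ ≫ E.tensor.map k ≫ _) ?_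
  exact (Seq.unfuse_eq (fun w : Walk s t => (⟨(g.graphHom.obj w.src, e w, g.graphHom.obj w.tgt),
    he w⟩ : Walk s' t')) (X'.walkAlg s' t' φ').obj l).symm

namespace Words.Free

variable {G : Free E}

theorem IsMult.isMor_pull {S : Type (max u v)} {I : Index (Alg E)} {π ψ : List S → List (Alg E)}
    (hπ : IsConcat π) (hψ : IsConcat ψ) {h : ∀ y, G.alg (π y) ⟶ G.alg (ψ y)}
    (hh : G.IsMult π ψ h) (e : I.W → List S) (he : ∀ l t, I.Dec l t → (l.map e).flatten = e t) :
    MultiAlg.IsMor (G.toMultiAlg.pull (I := I) (I' := Index.words (Alg E)) (fun t => π (e t))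
        fun l t d => List.map_map (l := l) (g := π) (f := e) ▸ hπ _ _ (he l t d))
      (G.toMultiAlg.pull (I := I) (I' := Index.words (Alg E)) (fun t => ψ (e t))
        fun l t d => List.map_map (l := l) (g := ψ) (f := e) ▸ hψ _ _ (he l t d))
      fun t => (h (e t)).f := by
  intro l t d
  have := ((hh.isMor (φ := fun _ : S => G.alg []) hπ hψ).pull (J := I) e he) l t d
  have e₁ := MultiAlg.pull_pull_comp (K := I) (J := Index.ofMap fun _ : S => G.alg [])
    G.toMultiAlg π hπ e he (fun l t d => List.map_map (l := l) (g := π) (f := e) ▸ hπ _ _ (he l t d)) d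
  have e₂ := MultiAlg.pull_pull_comp (K := I) (J := Index.ofMap fun _ : S => G.alg [])
    G.toMultiAlg ψ hψ e he (fun l t d => List.map_map (l := l) (g := ψ) (f := e) ▸ hψ _ _ (he l t d)) d
  exact (congrArg (· ≫ _) e₁.symm).trans (this.trans (congrArg (_ ≫ ·) e₂))

theorem isMor_walkComp (Y : Enrich G.multitensor) {S : Type (max u v)} (s t : S → Y.graph.vert) :
    MultiAlg.IsMor (G.reindex (Index.walks s t fun e => Y.graph.hom (s e) (t e)))
      ((G.lower Y).walkAlg s t fun e => Y.graph.hom (s e) (t e))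
      (fun w => (Y.walkComp w.2).f) := by
  intro l w d
  have r : List.Forall₂ (fun y (w : Walk s t) => w.edges = y) (l.map Walk.edges) l := by
    rw [List.forall₂_map_left_iff, List.forall₂_same]
    exact fun _ _ => rfl
  obtain ⟨P, h₁, h₂, h₃, h₄⟩ := Y.exists_pathSeq (s := s) (t := t) (fun y w d => d ▸ w.2) r d.1
  let U := E.unaryMonad.forget
  have h₅ : Arrow.mk ((Seq.map U).map (P.compSeq G.tensor Y.graph Y.comp)) = Arrow.mk
      (Seq.homMap (fun w : Walk s t => (Y.walkComp w.2).f) l) := by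
    refine (Seq.arrow_mk_map (Seq.map U) h₃).symm.trans ?_
    clear h₁ h₂ h₃ h₄ d
    induction l with
    | nil => rfl
    | cons w l ih => exact Seq.arrow_mk_consHom rfl (ih (List.forall₂_cons.1 r).2)
  have e := congrArg Monad.Algebra.Hom.f (Y.assoc P)
  have h₆ : (l.map fun w : Walk s t => w.edges.map fun e => Y.graph.hom (s e) (t e)) =
    P.seqs Y.graph := by rw [← h₄, List.map_map]; rfl
  have e₁ : Arrow.mk ((G.reindex (Index.walks s t fun e => Y.graph.hom (s e) (t e))).comp d) =
      Arrow.mk (G.can (List.map G.alg (P.seqs Y.graph)) ≫ (G.subst (P.seqs Y.graph)).f) := by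
    refine (congrArg (fun k => Arrow.mk (E.tensor.map k ≫ _)) (Seq.unfuse_eq _ _ _)).trans ?_
    refine (Seq.arrow_mk_map_eqToHom_comp E.tensor _ _).trans ?_
    exact (G.arrow_mk_comp_congr h₆ _ _).trans (G.arrow_mk_can_subst _).symm
  have hw : Arrow.mk (Y.walkComp w.2) = Arrow.mk (G.tensorMap (eqToHom (P.flatten_seqs Y.graph)) ≫
      Y.comp P.flat) := by
    refine (Y.arrow_mk_walkComp w.2 (h₂.trans (congrArg _ d.2))).trans (Eq.symm ?_)
    exact Seq.arrow_mk_map_eqToHom_comp G.tensor _ _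
  have h₇ : Arrow.mk ((G.lower Y).walkComp d.1) =
      Arrow.mk (G.can (P.ends.seq Y.graph) ≫ (Y.comp P.ends).f) :=
    ((G.lower Y).arrow_mk_walkComp d.1 h₁).trans (G.arrow_mk_lowerComp Y P.ends)
  refine Arrow.mk_injective _ _ ((Seq.arrow_mk_comp e₁ (Seq.arrow_mk_map U hw)).trans (Eq.trans
    (congrArg Arrow.mk ?_) (Seq.arrow_mk_comp (g' := (G.lower Y).walkComp d.1)
      (Seq.arrow_mk_map E.tensor h₅) h₇.symm)))
  refine (comp_eq_right e).trans ?_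
  refine (comp_eq_left (G.can_naturality _).symm).trans ?_
  exact Category.assoc _ _ _

end Words.Free

end Multi

namespace Multi

theorem Chain.comp {S : Type*} {O O' : Type*} {s t : S → O} {l : List S} {a b : O}
    (h : Chain s t a l b) (f : O → O') :
    Chain (fun e => f (s e)) (fun e => f (t e)) (f a) l (f b) := by
  induction l generalizing a with
  | nil => exact congrArg f h
  | cons e l ih => exact ⟨congrArg f h.1, ih h.2⟩

theorem Walk.Dec.map {S S' O O' : Type*} {s t : S → O} {s' t' : S' → O'} (f : O → O')
    (e : Walk s t → List S') (he : ∀ w, Chain s' t' (f w.src) (e w) (f w.tgt))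
    (hc : ∀ l w, Walk.Dec l w → (l.map e).flatten = e w) {l : List (Walk s t)} {w : Walk s t}
    (d : Walk.Dec l w) :
    Walk.Dec (l.map fun w => (⟨(f w.src, e w, f w.tgt), he w⟩ : Walk s' t'))
      ⟨(f w.src, e w, f w.tgt), he w⟩ :=
  ⟨(d.1.comp f).map (fun _ => rfl) fun _ => rfl, Eq.trans (by rw [List.map_map]; rfl) (hc l w d)⟩

theorem VPath.edges_lift {O : Type v} {a b : O} (p : VPath O a b) : p.edges =
    (p.edges.map ULift.up.{u}).map fun e => (e.down.1, e.down.2) := by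
  rw [List.map_map]
  exact (List.map_id _).symm

variable {V : Type u} [Category.{v} V] {E : Multitensor V}

namespace Words.Free

variable {G : Free E}

theorem unit_walkComp (Y : Enrich G.multitensor) {S : Type*} {s t : S → Y.graph.vert} (e : S)
    (h : Chain s t (s e) [e] (t e)) :
    eqToHom (G.alg_single (Y.graph.hom (s e) (t e))).symm ≫ Y.walkComp h = 𝟙 _ := by
  refine (congrArg (_ ≫ ·) (Y.walkComp_eq h (p := VPath.edge (s e) (t e)) rfl)).trans ?_
  refine Eq.trans ?_ (Y.unit_comp (s e) (t e))
  exact congrArg (_ ≫ ·) ((congrArg (· ≫ _) (G.tensor.map_id _)).trans (Category.id_comp _))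

theorem map_comp_of_lower {Y Y' : Enrich G.multitensor} (f : Y.graph ⟶ Y'.graph)
    (hf : ∀ {a b : Y.graph.vert} (p : VPath Y.graph.vert a b), (G.lower Y).comp p ≫ (f.map a b).f =
      E.tensor.map (p.seqMap ((VGraph.mapFunctor E.unaryMonad.forget).map f)) ≫
        (G.lower Y').comp (p.map f.obj)) {a b : Y.graph.vert} (p : VPath Y.graph.vert a b) :
    Y.comp p ≫ f.map a b = G.tensorMap (p.seqMap f) ≫ Y'.comp (p.map f.obj) := by
  let S := ULift.{u} (Y.graph.vert × Y.graph.vert)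
  let s : S → Y.graph.vert := fun e => e.down.1
  let t : S → Y.graph.vert := fun e => e.down.2
  let φ : S → Alg E := fun e => Y.graph.hom (s e) (t e)
  let φ' : S → Alg E := fun e => Y'.graph.hom (f.obj (s e)) (f.obj (t e))
  let g : G.lower Y ⟶ G.lower Y' := ⟨(VGraph.mapFunctor E.unaryMonad.forget).map f, hf⟩
  have he : ∀ w : Walk s t, Chain (fun e => f.obj (s e)) (fun e => f.obj (t e)) (f.obj w.src)
    w.edges (f.obj w.tgt) := fun w => w.2.comp f.obj
  let ρ : Walk s t → Walk (fun e => f.obj (s e)) (fun e => f.obj (t e)) := fun w =>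
    ⟨(f.obj w.src, w.edges, f.obj w.tgt), he w⟩
  have hρ : ∀ l w, (Index.walks s t φ).Dec l w →
    (Index.walks (fun e => f.obj (s e)) (fun e => f.obj (t e)) φ').Dec (l.map ρ) (ρ w) :=
    fun l w d => Walk.Dec.map f.obj Walk.edges he (fun _ _ d => d.2) d
  have h₁ := (isMor_walkComp Y s t).comp (Enrich.isMor_walkAlg g φ φ' Walk.edges he hρ)
  have h₂ := (G.isMult_tensorMap _ (Seq.isConcatHom_homMap fun e : S =>
    f.map (s e) (t e))).isMor_pull (I := Index.walks s t φ) (isConcat_map φ) (isConcat_map φ')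
      Walk.edges fun _ _ d => d.2
  have h₃ := (isMor_walkComp Y' (fun e => f.obj (s e)) fun e => f.obj (t e)).pull
    (J := Index.walks s t φ) ρ hρ
  have h₄ : MultiAlg.IsMor (G.toMultiAlg.pull (I := Index.walks s t φ)
      (I' := Index.words (Alg E)) (fun w => w.edges.map φ')
        fun l t d => List.map_map (l := l) (g := List.map φ') (f := Walk.edges) ▸
          (isConcat_map φ') _ _ d.2)
      (((G.lower Y').walkAlg (fun e => f.obj (s e)) (fun e => f.obj (t e)) φ').pull
        (I := Index.walks s t φ) ρ hρ) (fun w => (Y'.walkComp (he w)).f) := fun l w d =>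
    (congrArg (· ≫ (Y'.walkComp (he w)).f) (MultiAlg.pull_pull_comp (K := Index.walks s t φ)
      (J := Index.walks (fun e => f.obj (s e)) (fun e => f.obj (t e)) φ')
        G.toMultiAlg (fun w : Walk _ _ => w.edges.map φ') (fun _ _ d => Index.flatten_eq _ d) ρ hρ _
          d).symm).trans (h₃ l w d)
  have key := isMor_ext h₁ (h₂.comp h₄) ?_
  · have hp := VPath.edges_lift.{v, u} p
    have hc : Chain s t a (p.edges.map ULift.up) b :=
      Chain.map (s := s) (t := t) (f := ULift.up) (s' := Prod.fst) (t' := Prod.snd)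
        (fun _ => rfl) (fun _ => rfl) (VPath.chain_edges p)
    have e : Y.walkComp hc ≫ f.map a b = G.tensorMap (Seq.homMap (fun e : S =>
        f.map (s e) (t e)) _) ≫ Y'.walkComp (hc.comp f.obj) :=
      Monad.Algebra.Hom.ext (congrFun key ⟨(a, p.edges.map ULift.up, b), hc⟩)
    have hp' : (p.map f.obj).edges = (p.edges.map ULift.up.{u}).map fun e =>
        (f.obj (s e), f.obj (t e)) := by
      rw [VPath.edges_map, List.map_map]
      rfl
    exact Arrow.mk_injective _ _ ((Seq.arrow_mk_comp (Y.arrow_mk_walkComp hc hp).symm rfl).trans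
      ((congrArg Arrow.mk e).trans (Seq.arrow_mk_comp (Seq.arrow_mk_map G.tensor
        (Enrich.arrow_mk_seqMap f p hp)).symm (Y'.arrow_mk_walkComp _ hp'))))
  · rintro ⟨⟨a, l, b⟩, h⟩ c q
    obtain ⟨e, rfl, -⟩ := List.map_eq_singleton_iff.1 q.symm
    · obtain ⟨rfl, rfl⟩ : s e = a ∧ t e = b := h
      refine eqToHom_f_cancel (G.alg_single (φ e)).symm ?_
      have e₁ := unit_walkComp Y (s := s) (t := t) e ⟨rfl, rfl⟩
      have e₂ := unit_walkComp Y' (s := fun e => f.obj (s e)) (t := fun e => f.obj (t e)) e ⟨rfl, rfl⟩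
      have e₃ := G.tensorMap_single (f.map (s e) (t e))
      have e₄ : eqToHom (G.alg_single (φ e)).symm ≫ Y.walkComp (s := s) (t := t) (l := [e]) ⟨rfl, rfl⟩ ≫ f.map (s e) (t e) =
          eqToHom (G.alg_single (φ e)).symm ≫ G.tensorMap (Seq.homMap (fun e : S => f.map (s e) (t e)) [e]) ≫
          Y'.walkComp (s := fun e => f.obj (s e)) (t := fun e => f.obj (t e)) (l := [e]) ⟨rfl, rfl⟩ := by
        refine ((comp_eq_left e₁).trans (Category.id_comp _)).trans ?_
        refine Eq.symm ((comp_eq_left e₃).trans ?_)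
        exact (comp_eq_right e₂).trans (Category.comp_id _)
      exact congrArg Monad.Algebra.Hom.f e₄

end Words.Free

end Multi

namespace Multi

variable {V : Type u} [Category.{v} V] {E : Multitensor V}

namespace Words.Free

variable (G : Free E)

instance : G.lowerFunctor.Faithful where
  map_injective {_ _ _ _} h := Enrich.Hom.ext ((VGraph.mapFunctor
    E.unaryMonad.forget).map_injective (congrArg Enrich.Hom.graphHom h))

variable {G} in
/-- Fullness of the passage to categories enriched in the original multitensor. -/
def raise {Y Y' : Enrich G.multitensor} (g : G.lower Y ⟶ G.lower Y') : Y ⟶ Y' where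
  graphHom :=
    { obj := g.graphHom.obj
      map := fun a b =>
        { f := g.graphHom.map a b
          h := (congrArg (E.unaryMonad.map (g.graphHom.map a b) ≫ ·)
            (G.lowerComp_edge Y' _ _).symm).trans ((g.map_comp (VPath.edge a b)).symm.trans
              (congrArg (· ≫ g.graphHom.map a b) (G.lowerComp_edge Y a b))) } }
  map_comp := map_comp_of_lower _ g.map_comp

instance : G.lowerFunctor.Full where
  map_surjective g := ⟨raise g, rfl⟩

theorem lower_injective : Function.Injective G.lower := by
  intro Y Y' h
  have h₁ := (G.forgetToAlgebra_lower Y).symm.trans ((congrArg _ h).trans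
    (G.forgetToAlgebra_lower Y'))
  obtain ⟨X, c, hu, ha⟩ := Y
  obtain ⟨X', c', hu', ha'⟩ := Y'
  obtain rfl : X = X' := h₁
  have h₂ : (fun {a b} => c (a := a) (b := b)) = @c' := by
    funext a b p
    let g : G.lower ⟨X, c, hu, ha⟩ ⟶ G.lower ⟨X, c', hu', ha'⟩ := eqToHom h
    have hg : g.graphHom = 𝟙 ((VGraph.mapFunctor E.unaryMonad.forget).obj X) :=
      eqToHom_map (Enrich.forget E) h
    have e := map_comp_of_lower (Y := ⟨X, c, hu, ha⟩) (Y' := ⟨X, c', hu', ha'⟩) (𝟙 X)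
      (fun p => by
        have := g.map_comp p
        rw [hg] at this
        exact this) p
    exact (Category.comp_id _).symm.trans (e.trans
      (Enrich.seqMap_id_comp (⟨X, c', hu', ha'⟩ : Enrich G.multitensor) p))
  subst h₂
  rfl

end Words.Free

/-- A fully faithful functor that is bijective on objects has a strict inverse. -/
theorem exists_strict_inverse {C : Type*} [Category* C] {D : Type*} [Category* D] (K : C ⥤ D)
    [K.Full] [K.Faithful] (hK : Function.Bijective K.obj) :
    ∃ L : D ⥤ C, K ⋙ L = 𝟭 C ∧ L ⋙ K = 𝟭 D := by
  let e := Equiv.ofBijective K.obj hK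
  have h (X : D) : K.obj (e.symm X) = X := e.apply_symm_apply X
  let L : D ⥤ C :=
    { obj := e.symm
      map := fun f => K.preimage (eqToHom (h _) ≫ f ≫ eqToHom (h _).symm)
      map_id := fun X => K.map_injective (by simp)
      map_comp := fun f g => K.map_injective (by simp) }
  have hL : L ⋙ K = 𝟭 D := CategoryTheory.Functor.ext h fun X Y f => K.map_preimage _
  refine ⟨L, ?_, hL⟩
  refine functor_ext_of_faithful K (fun X => e.symm_apply_apply X) ?_
  rw [Functor.assoc, hL]
  rfl

end Multi

namespace Multi

theorem Seq.arrow_mk_homFib_congr {C : Type u} [Category.{v} C] {Z S S' : Type*} {Y : Z → C}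
    {P : S → C} {P' : S' → C} {p : Z → S} {p' : Z → S'} {ι : ∀ z, Y z ⟶ P (p z)}
    {ι' : ∀ z, Y z ⟶ P' (p' z)} (h : ∀ z, Arrow.mk (ι z) = Arrow.mk (ι' z)) (l : List Z) :
    Arrow.mk (homFib p ι l) = Arrow.mk (homFib p' ι' l) := by
  induction l with
  | nil => rfl
  | cons z l ih => exact arrow_mk_consHom (h z) ih

variable {V : Type u} [Category.{v} V] {E : Multitensor V}

namespace Enrich

variable (X : Enrich E)

/-- The graph of algebras underlying an enriched category. -/
abbrev algGraph : VGraph (Words.Alg E) := (forgetToAlgebra E).obj X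

theorem walkAlg_pull_comp {S S' α β : Type (max u v)} {s t : S → X.graph.vert}
    {s' t' : S' → X.graph.vert} (φ : S → α) (φ' : S' → β) (e : Walk s' t' → List S)
    (he : ∀ w, Chain s t w.src (e w) w.tgt) (hρ) {l w} (d : (Index.walks s' t' φ').Dec l w) :
    ((X.walkAlg s t φ).pull (I := Index.walks s' t' φ')
      (fun w => (⟨(w.src, e w, w.tgt), he w⟩ : Walk s t)) hρ).comp d =
      (X.walkAlg s' t' φ').comp d := by
  have q : (l.map fun w => (⟨(w.src, e w, w.tgt), he w⟩ : Walk s t)).map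
      (fun w : Walk s t => (w.src, w.tgt)) = l.map fun w : Walk s' t' => (w.src, w.tgt) := by
    rw [List.map_map]
    rfl
  refine Arrow.mk_injective _ _ ?_
  obtain ⟨p, hp⟩ := VPath.exists_of_chain d.1
  refine Eq.trans ?_ (X.arrow_mk_walkComp d.1 hp).symm
  refine Eq.trans ?_ (X.arrow_mk_walkComp (hρ l w d).1 (hp.trans q.symm))
  refine (congrArg (fun k => Arrow.mk (E.tensor.map k ≫ _)) (Seq.unfuse_eq _ _ _)).trans ?_
  exact Seq.arrow_mk_map_eqToHom_comp E.tensor _ _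

end Enrich

namespace Words.Free

variable {G : Free E} (X : Enrich E)

section

variable {S : Type (max u v)} {s t : S → X.graph.vert}

theorem walkAlg_alg (w : Walk s t) : (X.walkAlg s t fun e => X.algGraph.hom (s e) (t e)).alg w =
    X.algGraph.hom w.src w.tgt :=
  algebra_ext ((X.walkComp_eq (s := Walk.src) (t := Walk.tgt) (l := [w]) ⟨rfl, rfl⟩
    (p := VPath.edge w.src w.tgt) rfl).trans
    ((congrArg (· ≫ _) (E.tensor.map_id _)).trans (Category.id_comp _))) _ _ _ _

variable (G s t) in
theorem exists_isMor_walkAlg : ∃ h : ∀ w : Walk s t,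
    G.alg (w.edges.map fun e => X.algGraph.hom (s e) (t e)) ⟶ X.algGraph.hom w.src w.tgt,
    MultiAlg.IsMor (G.reindex (Index.walks s t fun e => X.algGraph.hom (s e) (t e)))
      (X.walkAlg s t fun e => X.algGraph.hom (s e) (t e)) (fun w => (h w).f) ∧
    ∀ e, eqToHom (G.alg_single _).symm ≫ h ⟨(s e, [e], t e), rfl, rfl⟩ = 𝟙 _ := by
  let φ : S → Alg E := fun e => X.algGraph.hom (s e) (t e)
  have hl (w : Walk s t) (a : Alg E) (q : [a] = w.edges.map φ) :
      a = (X.walkAlg s t φ).alg w := by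
    obtain ⟨⟨a₀, l, b₀⟩, hw⟩ := w
    obtain ⟨e, rfl, rfl⟩ := List.map_eq_singleton_iff.1 q.symm
    obtain ⟨rfl, rfl⟩ : s e = a₀ ∧ t e = b₀ := hw
    exact (walkAlg_alg X (s := s) (t := t) ⟨(s e, [e], t e), rfl, rfl⟩).symm
  obtain ⟨h, ⟨h₁, h₂⟩, -⟩ := existsUnique_isMor (G := G) (X.walkAlg s t φ)
    fun w a q => eqToHom (hl w a q)
  refine ⟨fun w => eqToHom (reindex_alg (I := Index.walks s t φ) w).symm ≫ h₁.alg w ≫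
    eqToHom (walkAlg_alg X w), ?_, fun e => ?_⟩
  · have : (fun w : Walk s t => (eqToHom (reindex_alg (G := G) (I := Index.walks s t φ) w).symm ≫
        h₁.alg w ≫ eqToHom (walkAlg_alg X w)).f) = h := by
      funext w
      refine (congrArg₂ (fun a b => a ≫ h w ≫ b) (eqToHom_f _) (eqToHom_f _)).trans ?_
      exact (Category.id_comp _).trans (Category.comp_id _)
    exact (congrArg (MultiAlg.IsMor (G.reindex (Index.walks s t φ)) (X.walkAlg s t φ)) this).mpr h₁
  · ext
    have e₂ := h₂ ⟨(s e, [e], t e), rfl, rfl⟩ (φ e) rfl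
    refine (congrArg₂ (fun a b => a ≫ b ≫ h _ ≫ _) (eqToHom_f _) (eqToHom_f _)).trans ?_
    refine (congrArg (fun b => _ ≫ _ ≫ h _ ≫ b) (eqToHom_f _)).trans ?_
    refine (congrArg (_ ≫ ·) ((Category.id_comp _).trans (Category.comp_id _))).trans ?_
    exact e₂.trans (eqToHom_f _)

theorem isMor_pull_walkAlg {φ : S → Alg E} {k : ∀ w : Walk s t,
      (G.alg (w.edges.map φ)).A ⟶ X.graph.hom w.src w.tgt}
    (hk : MultiAlg.IsMor (G.reindex (Index.walks s t φ)) (X.walkAlg s t φ) k)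
    {S' : Type (max u v)} {s' t' : S' → X.graph.vert} (φ' : S' → Alg E) (e : Walk s' t' → List S)
    (he : ∀ w, Chain s t w.src (e w) w.tgt)
    (hρ : ∀ l w, (Index.walks s' t' φ').Dec l w → (Index.walks s t φ).Dec
      (l.map fun w => (⟨(w.src, e w, w.tgt), he w⟩ : Walk s t)) ⟨(w.src, e w, w.tgt), he w⟩) (hc) :
    MultiAlg.IsMor (G.toMultiAlg.pull (I := Index.walks s' t' φ') (I' := Index.words (Alg E))
      (fun w => (e w).map φ) hc) (X.walkAlg s' t' φ')
      fun w => k ⟨(w.src, e w, w.tgt), he w⟩ := fun l w d =>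
  (congrArg (· ≫ k ⟨(w.src, e w, w.tgt), he w⟩) (MultiAlg.pull_pull_comp
    (K := Index.walks s' t' φ') (J := Index.walks s t φ) G.toMultiAlg
    (fun w : Walk _ _ => w.edges.map φ) (fun _ _ d => Index.flatten_eq _ d) _ hρ _ d).symm).trans
    ((hk.pull (J := Index.walks s' t' φ') _ hρ l w d).trans
      (congrArg (_ ≫ ·) (X.walkAlg_pull_comp φ φ' e he hρ d)))

theorem gen_walkComp {h : ∀ w : Walk s t,
      G.alg (w.edges.map fun e => X.algGraph.hom (s e) (t e)) ⟶ X.algGraph.hom w.src w.tgt}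
    (h₁ : MultiAlg.IsMor (G.reindex (Index.walks s t fun e => X.algGraph.hom (s e) (t e)))
      (X.walkAlg s t fun e => X.algGraph.hom (s e) (t e)) (fun w => (h w).f))
    (h₂ : ∀ e, eqToHom (G.alg_single _).symm ≫ h ⟨(s e, [e], t e), rfl, rfl⟩ = 𝟙 _)
    (w : Walk s t) (q) : G.gen (ψ := List.map fun e => X.algGraph.hom (s e) (t e))
      (fun e => G.letter _) w.edges q ≫ (h w).f = X.walkComp w.2 := by
  let φ : S → Alg E := fun e => X.algGraph.hom (s e) (t e)
  let σ : S → Walk s t := fun e => ⟨(s e, [e], t e), rfl, rfl⟩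
  have d : (Index.walks s t φ).Dec (w.edges.map σ) w :=
    ⟨w.2.map (f := σ) (fun _ => rfl) fun _ => rfl, by
      rw [List.map_map]
      exact flatten_map_singleton _⟩
  let ι : ∀ e, (φ e).A ⟶ (G.reindex (Index.walks s t φ)).obj (σ e) := fun e => G.letter (φ e)
  have e₁ := congrArg (E.tensor.map (Seq.homFib σ ι w.edges) ≫ ·) (h₁ _ _ d)
  have e₂ : Seq.homFib σ ι w.edges ≫ Seq.homMap (fun w => (h w).f) (w.edges.map σ) = eqToHom _ :=
    (Seq.homFib_homMap _ _ _ _).trans ((congrArg (fun k => Seq.homFib σ k w.edges) (funext fun e =>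
      congrArg Monad.Algebra.Hom.f (h₂ e))).trans (Seq.homFib_eqToHom σ (fun _ => rfl) w.edges))
  have e₃ : Arrow.mk (G.gen (ψ := List.map φ) (fun e => G.letter _) w.edges q) = Arrow.mk
      (E.tensor.map (Seq.homFib σ ι w.edges) ≫ (G.reindex (Index.walks s t φ)).comp d) := by
    refine Seq.arrow_mk_comp (Seq.arrow_mk_map E.tensor
      (Seq.arrow_mk_homFib_congr (P := fun w => (G.alg w).A)
        (P' := (G.reindex (Index.walks s t φ)).obj) (p := fun e => [φ e]) (p' := σ)
        (ι := fun e => G.letter (φ e)) (ι' := ι) (fun _ => rfl) w.edges)) (Eq.symm ?_)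
    refine (congrArg (fun k => Arrow.mk (E.tensor.map k ≫ _)) (Seq.unfuse_eq _ _ _)).trans ?_
    refine (Seq.arrow_mk_map_eqToHom_comp E.tensor _ _).trans ?_
    exact G.arrow_mk_comp_congr List.map_map _ _
  obtain ⟨p, hp⟩ := VPath.exists_of_chain w.2
  refine Arrow.mk_injective _ _ ((Seq.arrow_mk_comp e₃ rfl).trans ?_)
  refine (congrArg Arrow.mk ((Category.assoc _ _ _).trans (e₁.trans
    (comp_eq_left ((E.tensor.map_comp _ _).symm.trans
      (congrArg E.tensor.map e₂)))))).trans ?_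
  refine (Seq.arrow_mk_map_eqToHom_comp E.tensor _ _).trans ?_
  refine (X.arrow_mk_walkComp d.1 (hp.trans ?_)).trans (X.arrow_mk_walkComp w.2 hp).symm
  rw [List.map_map]
  rfl

end

end Words.Free

end Multi

namespace Multi

variable {V : Type u} [Category.{v} V] {E : Multitensor V}

namespace Words.Free

variable (G : Free E) (X : Enrich E)

section

variable {S : Type (max u v)} (s t : S → X.graph.vert)

/-- Composition along composable sequences of edges, as morphisms of algebras. -/
noncomputable def walkHom (w : Walk s t) :
    G.alg (w.edges.map fun e => X.algGraph.hom (s e) (t e)) ⟶ X.algGraph.hom w.src w.tgt :=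
  (exists_isMor_walkAlg G X s t).choose w

variable {s t}

theorem walkHom_isMor :
    MultiAlg.IsMor (G.reindex (Index.walks s t fun e => X.algGraph.hom (s e) (t e)))
      (X.walkAlg s t fun e => X.algGraph.hom (s e) (t e)) (fun w => (G.walkHom X s t w).f) :=
  (exists_isMor_walkAlg G X s t).choose_spec.1

theorem walkHom_single (e : S) :
    eqToHom (G.alg_single _).symm ≫ G.walkHom X s t ⟨(s e, [e], t e), rfl, rfl⟩ = 𝟙 _ :=
  (exists_isMor_walkAlg G X s t).choose_spec.2 e

theorem arrow_mk_walkHom_single {e : S} {a b : X.graph.vert} (h : Chain s t a [e] b) :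
    Arrow.mk (eqToHom (G.alg_single _).symm ≫ G.walkHom X s t ⟨(a, [e], b), h⟩) =
      Arrow.mk (𝟙 (X.algGraph.hom (s e) (t e))) := by
  obtain ⟨rfl, rfl⟩ := h
  exact congrArg Arrow.mk (G.walkHom_single X e)

/-- Substitution, for sequences of words indexed by a set. -/
noncomputable abbrev substMap {T : Type*} (φ : S → Alg E) (k : T → List S) (y : List T) :
    G.alg (y.map fun a => G.alg ((k a).map φ)) ⟶ G.alg ((y.map k).flatten.map φ) :=
  eqToHom (congrArg G.alg (List.map_map (l := y) (f := fun a => (k a).map φ) (g := G.alg)).symm) ≫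
    G.subst (y.map fun a => (k a).map φ) ≫
      eqToHom (congrArg G.alg ((congrArg List.flatten
        (List.map_map (l := y) (f := k) (g := List.map φ)).symm).trans List.map_flatten.symm))

theorem arrow_mk_substMap {T : Type*} (φ : S → Alg E) (k : T → List S) (y : List T) :
    Arrow.mk (G.substMap φ k y) = Arrow.mk (G.subst (y.map fun a => (k a).map φ)) :=
  Seq.arrow_mk_eqToHom_comp (Seq.arrow_mk_comp_eqToHom rfl _) _

theorem isMult_substMap {T : Type*} (φ : S → Alg E) (k : T → List S) :
    G.IsMult (List.map fun a => G.alg ((k a).map φ)) (fun y => (y.map k).flatten.map φ)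
      (G.substMap φ k) :=
  (IsMult.eqTo fun _ => List.map_map.symm).comp
    ((G.isMult_subst.reindex (isConcat_map _) isConcat_flatten (isConcat_map _)).comp
      (IsMult.eqTo fun _ => (congrArg List.flatten List.map_map.symm).trans List.map_flatten.symm)
      (isConcat_flatten.comp (isConcat_map _))) ((isConcat_map _).comp (isConcat_map _))

variable {G X} in
theorem walkHom_congr {w w' : Walk s t} (h : w = w') :
    Arrow.mk (G.walkHom X s t w) = Arrow.mk (G.walkHom X s t w') := by
  subst h
  rfl

theorem walkHom_assoc (c : Walk s t → S) (hs : ∀ w, s (c w) = w.src) (ht : ∀ w, t (c w) = w.tgt)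
    (x : ∀ w : Walk s t, G.alg (w.edges.map fun e => X.algGraph.hom (s e) (t e)) ⟶
      X.algGraph.hom (s (c w)) (t (c w)))
    (hx : ∀ w, Arrow.mk (x w) = Arrow.mk (G.walkHom X s t w))
    (W : Walk (Walk.src (s := s) (t := t)) Walk.tgt) :
    G.substMap (fun e => X.algGraph.hom (s e) (t e)) Walk.edges W.edges ≫ G.walkHom X s t
      ⟨(W.src, (W.edges.map Walk.edges).flatten, W.tgt), Walk.chain_flatten W.2⟩ =
    G.tensorMap (Seq.homFib (P := fun e => X.algGraph.hom (s e) (t e)) c x W.edges) ≫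
      G.walkHom X s t ⟨(W.src, W.edges.map c, W.tgt), W.2.map hs ht⟩ := by
  let φ : S → Alg E := fun e => X.algGraph.hom (s e) (t e)
  let φ₁ : Walk s t → Alg E := fun w => G.alg (w.edges.map φ)
  have hd : ∀ {α : Type (max u v)} (ψ : List (Walk s t) → List α) (_ : IsConcat ψ)
      (l : List (Walk (Walk.src (s := s) (t := t)) Walk.tgt)) (w), Walk.Dec l w →
      (l.map fun w => ψ w.edges).flatten = ψ w.edges := fun ψ hψ l w d =>
    List.map_map (l := l) (g := ψ) (f := Walk.edges) ▸ hψ _ _ d.2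
  have c₁ : IsConcat fun y : List (Walk s t) => (y.map Walk.edges).flatten :=
    isConcat_flatten.comp (isConcat_map _)
  have h₁ := ((G.isMult_substMap φ Walk.edges).isMor_pull
    (I := Index.walks (Walk.src (s := s) (t := t)) Walk.tgt φ₁)
    (isConcat_map φ₁) ((isConcat_map φ).comp c₁) Walk.edges fun _ _ d => d.2).comp
    (isMor_pull_walkAlg X (G.walkHom_isMor X) φ₁ (fun W => (W.edges.map Walk.edges).flatten)
      (fun W => Walk.chain_flatten W.2)
      (fun l w d => Walk.Dec.map (fun x => x) _ (fun W => Walk.chain_flatten W.2) (hd _ c₁) d)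
      (fun l w d => hd _ ((isConcat_map φ).comp c₁) l w d))
  have h₂ := ((G.isMult_tensorMap _ (Seq.isConcatHom_homFib (P := φ) c x)).isMor_pull
    (I := Index.walks (Walk.src (s := s) (t := t)) Walk.tgt φ₁)
    (isConcat_map φ₁) ((isConcat_map φ).comp (isConcat_map c)) Walk.edges fun _ _ d => d.2).comp
    (isMor_pull_walkAlg X (G.walkHom_isMor X) φ₁ (fun W => W.edges.map c)
      (fun W => W.2.map hs ht)
      (fun l w d => Walk.Dec.map (fun x => x) _ (fun W => W.2.map hs ht) (hd _ (isConcat_map c)) d)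
      (fun l w d => hd _ ((isConcat_map φ).comp (isConcat_map c)) l w d))
  refine Monad.Algebra.Hom.ext (congrFun (isMor_ext h₁ h₂ ?_) W)
  rintro ⟨⟨a, l, b⟩, h⟩ q hq
  obtain ⟨w, rfl, -⟩ := List.map_eq_singleton_iff.1 hq.symm
  obtain ⟨rfl, rfl⟩ : w.src = a ∧ w.tgt = b := h
  have e : eqToHom (G.alg_single (φ₁ w)).symm ≫ G.substMap φ Walk.edges [w] ≫ G.walkHom X s t
      ⟨(w.src, ([w].map Walk.edges).flatten, w.tgt), Walk.chain_flatten ⟨rfl, rfl⟩⟩ =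
      eqToHom (G.alg_single (φ₁ w)).symm ≫ G.tensorMap (Seq.homFib (P := φ) c x [w]) ≫
        G.walkHom X s t ⟨(w.src, [c w], w.tgt), hs w, ht w⟩ := by
    have hw : (⟨(w.src, (List.map Walk.edges [w]).flatten, w.tgt), Walk.chain_flatten ⟨rfl, rfl⟩⟩ :
        Walk s t) = w := Subtype.ext (Prod.ext rfl (Prod.ext (List.append_nil _) rfl))
    refine Arrow.mk_injective _ _ (Eq.trans (b := Arrow.mk (G.walkHom X s t w)) ?_ ?_)
    · have aux : ∀ {A B B' : Alg E} (p : A = B) (q : A = B'),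
          Arrow.mk (eqToHom p) = Arrow.mk (eqToHom q) := by
        rintro A _ _ rfl rfl
        rfl
      have e := (Seq.arrow_mk_comp (f := eqToHom (G.alg_single (φ₁ w)).symm) rfl
        (G.arrow_mk_substMap φ Walk.edges [w])).trans
          (congrArg Arrow.mk (G.subst_single (w.edges.map φ)))
      refine (congrArg Arrow.mk (Category.assoc _ _ _).symm).trans
        ((Seq.arrow_mk_comp (e.trans (aux _ rfl)) (walkHom_congr hw)).trans
          (congrArg Arrow.mk (Category.id_comp _)))
    · refine (hx w).symm.trans (Eq.symm ((congrArg Arrow.mk (comp_eq_left (G.tensorMap_single (x w)))).trans ?_))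
      refine (congrArg Arrow.mk (Category.assoc _ _ _)).trans ?_
      refine (Seq.arrow_mk_comp rfl (G.arrow_mk_walkHom_single X _)).trans ?_
      exact congrArg Arrow.mk (Category.comp_id _)
  exact eqToHom_f_cancel (G.alg_single (φ₁ w)).symm (congrArg Monad.Algebra.Hom.f e)

end

end Words.Free

end Multi

namespace Multi

variable {V : Type u} [Category.{v} V] {E : Multitensor V}

namespace Enrich

variable (X : Enrich E)

/-- The pairs of objects. -/
abbrev Pair := ULift.{u} (X.graph.vert × X.graph.vert)

/-- The first object. -/
abbrev pairSrc (e : X.Pair) : X.graph.vert := e.down.1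

/-- The second object. -/
abbrev pairTgt (e : X.Pair) : X.graph.vert := e.down.2

/-- A path as a composable sequence of pairs. -/
abbrev toWalk {a b : X.graph.vert} (p : VPath X.graph.vert a b) : Walk X.pairSrc X.pairTgt :=
  ⟨(a, p.edges.map ULift.up, b), Chain.map (s' := Prod.fst) (t' := Prod.snd) (s := X.pairSrc)
    (t := X.pairTgt) (f := ULift.up) (fun _ => rfl) (fun _ => rfl) (VPath.chain_edges p)⟩

end Enrich

namespace Words.Free

variable (G : Free E) (X : Enrich E)

theorem seq_algGraph {a b : X.graph.vert} (p : VPath X.graph.vert a b) : p.seq X.algGraph =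
    (X.toWalk p).edges.map fun e => X.algGraph.hom (X.pairSrc e) (X.pairTgt e) :=
  (VPath.seq_eq X.algGraph p).trans (List.map_map (l := p.edges) (f := ULift.up)
    (g := fun e : X.Pair => X.algGraph.hom (X.pairSrc e) (X.pairTgt e))).symm

/-- Composition maps for the lifted multitensor. -/
noncomputable abbrev upperComp {a b : X.graph.vert} (p : VPath X.graph.vert a b) :
    G.tensor.obj (p.seq X.algGraph) ⟶ X.algGraph.hom a b :=
  eqToHom (congrArg G.alg (seq_algGraph X p)) ≫ G.walkHom X X.pairSrc X.pairTgt (X.toWalk p)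

theorem arrow_mk_upperComp {a b : X.graph.vert} (p : VPath X.graph.vert a b) :
    Arrow.mk (G.upperComp X p) = Arrow.mk (G.walkHom X X.pairSrc X.pairTgt (X.toWalk p)) :=
  Seq.arrow_mk_eqToHom_comp rfl _

theorem exists_walks {a b : X.graph.vert} (P : PathSeq X.graph.vert a b) :
    ∃ l : List (Walk X.pairSrc X.pairTgt), Chain Walk.src Walk.tgt a l b ∧
      P.ends.edges.map ULift.up = l.map (fun w => (⟨(w.src, w.tgt)⟩ : X.Pair)) ∧
      P.flat.edges.map ULift.up = (l.map Walk.edges).flatten ∧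
      P.seqs X.algGraph = l.map (fun w => w.edges.map fun e =>
        X.algGraph.hom (X.pairSrc e) (X.pairTgt e)) ∧
      Arrow.mk (P.compSeq G.tensor X.algGraph (G.upperComp X)) = Arrow.mk
        (Seq.homFib (P := fun e : X.Pair => X.algGraph.hom (X.pairSrc e) (X.pairTgt e))
          (fun w => (⟨(w.src, w.tgt)⟩ : X.Pair)) (G.walkHom X X.pairSrc X.pairTgt) l) := by
  induction P with
  | nil a => exact ⟨[], rfl, rfl, rfl, rfl, rfl⟩
  | cons p P ih =>
    obtain ⟨l, h₁, h₂, h₃, h₄, h₅⟩ := ih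
    refine ⟨X.toWalk p :: l, ⟨rfl, h₁⟩, congrArg (List.cons _) h₂, ?_,
      congrArg₂ List.cons (seq_algGraph X p) h₄,
      Seq.arrow_mk_consHom (G.arrow_mk_upperComp X p) h₅⟩
    refine (congrArg _ (VPath.edges_append p P.flat)).trans ?_
    rw [List.map_append, h₃]
    rfl

variable {G X} in
theorem walkHom_congr_edges {S : Type (max u v)} {s t : S → X.graph.vert} {a b : X.graph.vert}
    {l l' : List S} (e : l = l') (h : Chain s t a l b) (h' : Chain s t a l' b) :
    Arrow.mk (G.walkHom X s t ⟨(a, l, b), h⟩) = Arrow.mk (G.walkHom X s t ⟨(a, l', b), h'⟩) := by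
  subst e
  rfl

/-- The category enriched in the lifted multitensor determined by a category enriched in the
original one. -/
noncomputable def upper : Enrich G.multitensor where
  graph := X.algGraph
  comp := G.upperComp X
  unit_comp a b := by
    refine (congrArg (eqToHom (G.alg_single (X.algGraph.hom a b)).symm ≫ ·)
      (Category.id_comp _)).trans ?_
    exact G.walkHom_single X (s := X.pairSrc) (t := X.pairTgt) ⟨(a, b)⟩
  assoc {a b} P := by
    obtain ⟨l, h₁, h₂, h₃, h₄, h₅⟩ := G.exists_walks X P
    have e := G.walkHom_assoc X (s := X.pairSrc) (t := X.pairTgt)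
      (fun w => (⟨(w.src, w.tgt)⟩ : X.Pair)) (fun _ => rfl) (fun _ => rfl)
      (G.walkHom X X.pairSrc X.pairTgt) (fun _ => rfl) ⟨(a, l, b), h₁⟩
    refine Arrow.mk_injective _ _ (Eq.trans ?_ ((congrArg Arrow.mk e).trans (Seq.arrow_mk_comp
      (Seq.arrow_mk_map G.tensor h₅) ((G.arrow_mk_upperComp X P.ends).trans
        (walkHom_congr_edges h₂ _ _))).symm))
    refine Seq.arrow_mk_comp ?_ ((Seq.arrow_mk_map_eqToHom_comp G.tensor _ _).trans
      ((G.arrow_mk_upperComp X P.flat).trans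
        (walkHom_congr_edges h₃ _ _)))
    refine Eq.trans ?_ (G.arrow_mk_substMap _ Walk.edges l).symm
    exact Multitensor.arrow_mk_app G.multitensor.subst h₄

theorem lower_upper : G.lower (G.upper X) = X := by
  obtain ⟨Γ, c, hu, ha⟩ := X
  let X : Enrich E := ⟨Γ, c, hu, ha⟩
  have h : (fun {a b} => (G.lower (G.upper X)).comp (a := a) (b := b)) = @c := by
    funext a b p
    refine Arrow.mk_injective _ _ ((G.arrow_mk_lowerComp (G.upper X) p).trans ?_)
    have e := gen_walkComp X (G.walkHom_isMor X) (G.walkHom_single X) (X.toWalk p)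
      ((isConcat_map _).flatten_map _)
    refine Eq.trans ?_ ((congrArg Arrow.mk e).trans (X.arrow_mk_walkComp _ (VPath.edges_lift p)))
    refine Seq.arrow_mk_comp (Eq.trans ?_ (G.arrow_mk_can _ _ _))
      (Seq.arrow_mk_map E.unaryMonad.forget (G.arrow_mk_upperComp X p))
    exact congrArg (fun l => Arrow.mk (G.can l)) (seq_algGraph X p)
  have h' : ∀ (c' : ∀ {a b : Γ.vert} (p : VPath Γ.vert a b), E.tensor.obj (p.seq Γ) ⟶ Γ.hom a b)
      (hu' ha'), (fun {a b} => c' (a := a) (b := b)) = @c →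
      (⟨Γ, c', hu', ha'⟩ : Enrich E) = ⟨Γ, c, hu, ha⟩ := by
    rintro c' hu' ha' rfl
    rfl
  exact h' _ _ _ h

theorem isoOver : IsoOver (Enrich.forget G.multitensor) (Enrich.forgetToAlgebra E) := by
  obtain ⟨L, h₁, h₂⟩ := exists_strict_inverse G.lowerFunctor
    ⟨G.lower_injective, fun X => ⟨G.upper X, G.lower_upper X⟩⟩
  exact ⟨G.lowerFunctor, L, h₁, h₂, G.lowerFunctor_forgetToAlgebra⟩

end Words.Free

end Multi

namespace Multi

variable {A : Type u} [Category.{v} A] {F : Multitensor A}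

/-- A tensor product with an initial factor is initial. -/
theorem Multitensor.IsDistributive.isInitial (hF : F.IsDistributive) {Y : A} (hY : IsInitial Y)
    {l : Seq A} (h : List.Mem Y l) : Nonempty (IsInitial (F.tensor.obj l)) := by
  obtain ⟨m, r, rfl⟩ := List.append_of_mem h
  have := hF m r PEmpty.{v + 1}
  have : PreservesColimitsOfShape (Discrete PEmpty.{1}) (Seq.insert m r ⋙ F.tensor) :=
    preservesColimitsOfShape_of_equiv (Discrete.equivalence (Equiv.equivPEmpty PEmpty.{v + 1})) _
  exact ⟨IsInitial.isInitialObj (Seq.insert m r ⋙ F.tensor) Y hY⟩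

theorem Enrich.subst_walkComp (X : Enrich F) {S Z : Type*} {s t : S → X.graph.vert}
    {src tgt : Z → X.graph.vert} {k : Z → List S} (hk : ∀ z, Chain s t (src z) (k z) (tgt z))
    {W : List Z} {a b : X.graph.vert} (d : Chain src tgt a W b)
    (d' : Chain s t a (W.map k).flatten b) (q) :
    F.substTo (fun z => (k z).map fun e => X.graph.hom (s e) (t e)) W q ≫ X.walkComp d' =
      F.tensor.map (Seq.homMap (fun z => X.walkComp (hk z)) W) ≫ X.walkComp d := by
  have r : List.Forall₂ (fun y z => k z = y) (W.map k) W := by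
    rw [List.forall₂_map_left_iff, List.forall₂_same]
    exact fun _ _ => rfl
  obtain ⟨P, h₁, h₂, h₃, h₄⟩ := X.exists_pathSeq (s := s) (t := t) (fun y z d => d ▸ hk z) r d
  have h₅ : Arrow.mk (P.compSeq F.tensor X.graph X.comp) = Arrow.mk
      (Seq.homMap (fun z => X.walkComp (hk z)) W) := by
    refine h₃.symm.trans ?_
    clear h₁ h₂ h₃ h₄ d d' q
    induction W with
    | nil => rfl
    | cons w l ih => exact Seq.arrow_mk_consHom rfl (ih (List.forall₂_cons.1 r).2)
  refine Arrow.mk_injective _ _ (Eq.trans ?_ ((congrArg Arrow.mk (X.assoc P)).trans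
    (Seq.arrow_mk_comp (Seq.arrow_mk_map F.tensor h₅) (X.arrow_mk_walkComp d h₁).symm)))
  refine Seq.arrow_mk_comp ((Multitensor.arrow_mk_substTo _ _ _).trans
    (Multitensor.arrow_mk_app _ ?_)) ?_
  · rw [← h₄, List.map_map]
    rfl
  · exact (X.arrow_mk_walkComp d' h₂).trans (Seq.arrow_mk_map_eqToHom_comp F.tensor _ _).symm

section Lin

variable {S O : Type v}

/-- The property that any two vertices are connected by at most one composable sequence. -/
def Thin (s t : S → O) : Prop :=
  ∀ (a b : O) (l l' : List S), Chain s t a l b → Chain s t a l' b → l = l'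

variable {s t : S → O}

theorem Thin.map_injective (hu : Thin s t) {W W' : List (Walk s t)}
    (h : W.map (fun w => (w.src, w.tgt)) = W'.map fun w => (w.src, w.tgt)) : W = W' := by
  refine List.map_injective_iff.2 ?_ h
  rintro ⟨⟨a, l, b⟩, h⟩ ⟨⟨a', l', b'⟩, h'⟩ e
  obtain ⟨rfl, rfl⟩ := Prod.mk.inj e
  obtain rfl := hu _ _ _ _ h h'
  rfl

theorem exists_walks {a b : O} (p : VPath O a b)
    (h : ∀ x ∈ p.edges, ∃ l, Chain s t x.1 l x.2) : ∃ W : List (Walk s t),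
    Chain Walk.src Walk.tgt a W b ∧ p.edges = W.map fun w => (w.src, w.tgt) := by
  induction p with
  | nil a => exact ⟨[], rfl, rfl⟩
  | @cons a b c p ih =>
    obtain ⟨W, h₁, h₂⟩ := ih fun x hx => h x (List.mem_cons_of_mem _ hx)
    obtain ⟨l, hl⟩ := h (a, b) List.mem_cons_self
    exact ⟨⟨(a, l, b), hl⟩ :: W, ⟨rfl, h₁⟩, congrArg (List.cons (a, b)) h₂⟩

variable (F) (g : S → A) (Y : A)

variable (s t) in
open scoped Classical in
/-- The hom from `a` to `b` of the free enriched category on a thin graph. -/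
noncomputable def linHom (a b : O) : A :=
  if h : ∃ l, Chain s t a l b then F.tensor.obj (h.choose.map g) else Y

theorem linHom_eq (hu : Thin s t) {a b : O} {l : List S} (h : Chain s t a l b) :
    linHom F s t g Y a b = F.tensor.obj (l.map g) := by
  have h' : ∃ l, Chain s t a l b := ⟨l, h⟩
  rw [linHom, dif_pos h', hu _ _ _ _ h h'.choose_spec]

theorem linHom_eq_of_not {a b : O} (h : ¬∃ l, Chain s t a l b) : linHom F s t g Y a b = Y :=
  dif_neg h

variable (s t) in
/-- The graph underlying the free enriched category on a thin graph. -/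
noncomputable abbrev linGraph : VGraph A := ⟨O, linHom F s t g Y⟩

variable {F g Y}

theorem linGraph_seq (hu : Thin s t) {a b : O} {p : VPath O a b} {W : List (Walk s t)}
    (h : p.edges = W.map fun w => (w.src, w.tgt)) :
    p.seq (linGraph F s t g Y) = W.map fun w => F.tensor.obj (w.edges.map g) := by
  rw [VPath.seq_eq, h, List.map_map]
  exact List.map_congr_left fun w _ => linHom_eq F g Y hu w.2

theorem isInitial_linHom (hY : IsInitial Y) {a b : O} (h : ¬∃ l, Chain s t a l b) :
    Nonempty (IsInitial (linHom F s t g Y a b)) :=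
  ⟨hY.ofIso (eqToIso (linHom_eq_of_not F g Y h).symm)⟩

theorem isInitial_seq (hF : F.IsDistributive) (hY : IsInitial Y) {a b : O} {p : VPath O a b}
    (h : ¬∃ W : List (Walk s t), Chain Walk.src Walk.tgt a W b ∧
      p.edges = W.map fun w => (w.src, w.tgt)) :
    Nonempty (IsInitial (F.tensor.obj (p.seq (linGraph F s t g Y)))) := by
  have h' : ∃ x ∈ p.edges, ¬∃ l, Chain s t x.1 l x.2 := by
    by_contra h'
    push Not at h'
    exact h (exists_walks p fun x hx => h' x hx)
  obtain ⟨x, hx, hn⟩ := h'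
  obtain ⟨i⟩ := isInitial_linHom (F := F) (g := g) hY hn
  refine hF.isInitial i ?_
  rw [VPath.seq_eq]
  exact List.mem_map_of_mem (f := fun e => linHom F s t g Y e.1 e.2) hx

theorem exists_linComp (hu : Thin s t) (hF : F.IsDistributive) (hY : IsInitial Y) {a b : O}
    (p : VPath O a b) : ∃ k : F.tensor.obj (p.seq (linGraph F s t g Y)) ⟶ linHom F s t g Y a b,
      ∀ W : List (Walk s t), Chain Walk.src Walk.tgt a W b →
        p.edges = W.map (fun w => (w.src, w.tgt)) →
        Arrow.mk k = Arrow.mk (F.subst.app (W.map fun w => w.edges.map g)) := by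
  by_cases h : ∃ W : List (Walk s t), Chain Walk.src Walk.tgt a W b ∧
    p.edges = W.map fun w => (w.src, w.tgt)
  · obtain ⟨W, h₁, h₂⟩ := h
    have q : (W.map fun w => w.edges.map g).flatten = (W.map Walk.edges).flatten.map g :=
      Eq.trans (congrArg List.flatten List.map_map.symm) List.map_flatten.symm
    refine ⟨F.tensor.map (eqToHom (linGraph_seq hu h₂)) ≫ F.substTo _ W q ≫
      eqToHom (linHom_eq F g Y hu (Walk.chain_flatten h₁)).symm, fun W' _ h => ?_⟩
    obtain rfl := hu.map_injective (h₂.symm.trans h)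
    refine (Seq.arrow_mk_map_eqToHom_comp F.tensor _ _).trans ?_
    exact (Seq.arrow_mk_comp_eqToHom rfl _).trans (Multitensor.arrow_mk_substTo _ _ _)
  · obtain ⟨i⟩ := isInitial_seq (F := F) (g := g) hF hY h
    exact ⟨i.to _, fun W h₁ h₂ => (h ⟨W, h₁, h₂⟩).elim⟩

/-- Composition in the free enriched category on a thin graph. -/
noncomputable def linComp (hu : Thin s t) (hF : F.IsDistributive) (hY : IsInitial Y) {a b : O}
    (p : VPath O a b) : F.tensor.obj (p.seq (linGraph F s t g Y)) ⟶ linHom F s t g Y a b :=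
  (exists_linComp hu hF hY p).choose

theorem arrow_mk_linComp (hu : Thin s t) (hF : F.IsDistributive) (hY : IsInitial Y) {a b : O}
    {p : VPath O a b} {W : List (Walk s t)} (h₁ : Chain Walk.src Walk.tgt a W b)
    (h₂ : p.edges = W.map fun w => (w.src, w.tgt)) :
    Arrow.mk (linComp (F := F) (g := g) hu hF hY p) =
      Arrow.mk (F.subst.app (W.map fun w => w.edges.map g)) :=
  (exists_linComp hu hF hY p).choose_spec W h₁ h₂

theorem exists_linAssoc (hu : Thin s t) (hF : F.IsDistributive) (hY : IsInitial Y) {a b : O}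
    (P : PathSeq O a b) (h : ∀ x ∈ P.flat.edges, ∃ l, Chain s t x.1 l x.2) :
    ∃ L : Seq (Seq (Seq A)),
      P.seqs (linGraph F s t g Y) = (Seq.map (Seq.map F.tensor)).obj L ∧
      Arrow.mk (P.compSeq F.tensor (linGraph F s t g Y) (linComp hu hF hY)) =
        Arrow.mk (Seq.mapNat₂ F.subst L) ∧
      (∃ W : List (Walk s t), Chain Walk.src Walk.tgt a W b ∧
        (P.flat.edges = W.map fun w => (w.src, w.tgt)) ∧
        (W.map fun w => w.edges.map g) = Seq.flatten.obj L) ∧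
      ∃ W : List (Walk s t), Chain Walk.src Walk.tgt a W b ∧
        (P.ends.edges = W.map fun w => (w.src, w.tgt)) ∧
        (W.map fun w => w.edges.map g) = (Seq.map Seq.flatten).obj L := by
  induction P with
  | nil a => exact ⟨[], rfl, rfl, ⟨[], rfl, rfl, rfl⟩, [], rfl, rfl, rfl⟩
  | @cons a b c p P ih =>
    have hp : (PathSeq.cons p P).flat.edges = p.edges ++ P.flat.edges :=
      VPath.edges_append p P.flat
    rw [hp] at h
    obtain ⟨L, h₁, h₂, ⟨W, h₃, h₄, h₅⟩, W', h₆, h₇, h₈⟩ :=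
      ih fun x hx => h x (List.mem_append_right _ hx)
    obtain ⟨U, h₉, h₁₀⟩ := exists_walks p fun x hx => h x (List.mem_append_left _ hx)
    refine ⟨(U.map fun w => w.edges.map g) :: L, congrArg₂ List.cons ?_ h₁,
      Seq.arrow_mk_consHom (arrow_mk_linComp hu hF hY h₉ h₁₀) h₂,
      ⟨U ++ W, chain_append.2 ⟨_, h₉, h₃⟩, ?_, ?_⟩,
      ⟨(a, (U.map Walk.edges).flatten, b), Walk.chain_flatten h₉⟩ :: W', ⟨rfl, h₆⟩,
      congrArg (List.cons (a, b)) h₇, congrArg₂ List.cons ?_ h₈⟩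
    · exact (linGraph_seq hu h₁₀).trans (List.map_map (l := U) (g := F.tensor.obj)
        (f := fun w : Walk s t => w.edges.map g)).symm
    · rw [hp, h₁₀, h₄, List.map_append]
    · rw [List.map_append, h₅]
      rfl
    · exact List.map_flatten.trans (congrArg List.flatten List.map_map)

theorem exists_isInitial_mem (hF : F.IsDistributive) (hY : IsInitial Y) {a b : O}
    (P : PathSeq O a b) (h : ∃ x ∈ P.flat.edges, ¬∃ l, Chain s t x.1 l x.2) :
    ∃ Z, Nonempty (IsInitial Z) ∧
      List.Mem Z (List.map F.tensor.obj (P.seqs (linGraph F s t g Y))) := by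
  induction P with
  | nil a =>
    obtain ⟨x, hx, -⟩ := h
    cases hx
  | @cons a b c p P ih =>
    have hp : (PathSeq.cons p P).flat.edges = p.edges ++ P.flat.edges :=
      VPath.edges_append p P.flat
    rw [hp] at h
    obtain ⟨x, hx, hn⟩ := h
    rcases List.mem_append.1 hx with hx | hx
    · refine ⟨_, isInitial_seq (F := F) (g := g) hF hY (p := p) ?_, List.Mem.head _⟩
      rintro ⟨W, -, hW⟩
      rw [hW] at hx
      obtain ⟨w, -, rfl⟩ := List.mem_map.1 hx
      exact hn ⟨_, w.2⟩
    · obtain ⟨Z, hZ, hm⟩ := ih ⟨x, hx, hn⟩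
      exact ⟨Z, hZ, List.Mem.tail _ hm⟩

variable (F g) in
/-- The free enriched category on a thin graph. -/
@[simps graph] noncomputable def lin (hu : Thin s t) (hF : F.IsDistributive) (hY : IsInitial Y) :
    Enrich F where
  graph := linGraph F s t g Y
  comp := linComp hu hF hY
  unit_comp a b := by
    by_cases h : ∃ l, Chain s t a l b
    · obtain ⟨l, h⟩ := h
      refine Arrow.mk_injective _ _ (Eq.trans (Seq.arrow_mk_comp
        (Multitensor.arrow_mk_app F.unit (linHom_eq F g Y hu h)) (arrow_mk_linComp hu hF hY
          (W := [⟨(a, l, b), h⟩]) ⟨rfl, rfl⟩ rfl)) ?_)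
      have e := F.unit_subst (l.map g)
      refine Eq.trans ?_ ((congrArg Arrow.mk e).trans ?_)
      · refine Eq.trans ?_ (congrArg Arrow.mk (Category.assoc _ _ _))
        exact (Seq.arrow_mk_comp_map_eqToHom F.tensor _ _).symm
      · exact congrArg (fun Z => Arrow.mk (𝟙 Z)) (linHom_eq F g Y hu h).symm
    · obtain ⟨i⟩ := isInitial_linHom (F := F) (g := g) hY h
      exact i.hom_ext _ _
  assoc {a b} P := by
    by_cases h : ∀ x ∈ P.flat.edges, ∃ l, Chain s t x.1 l x.2
    · obtain ⟨L, h₁, h₂, ⟨W, h₃, h₄, h₅⟩, W', h₆, h₇, h₈⟩ :=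
        exists_linAssoc (F := F) (g := g) hu hF hY P h
      refine Arrow.mk_injective _ _ (Eq.trans (Seq.arrow_mk_comp
        (Multitensor.arrow_mk_app F.subst h₁) ((Seq.arrow_mk_map_eqToHom_comp F.tensor _ _).trans
          ((arrow_mk_linComp hu hF hY h₃ h₄).trans ((Multitensor.arrow_mk_app F.subst h₅).trans
            (Seq.arrow_mk_map_eqToHom_comp F.tensor (Seq.flatten_map_map F.tensor L) _).symm))))
        (Eq.trans ?_ (Seq.arrow_mk_comp (Seq.arrow_mk_map F.tensor h₂)
          ((arrow_mk_linComp hu hF hY h₆ h₇).trans (Multitensor.arrow_mk_app F.subst h₈))).symm))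
      have e := congrArg Arrow.mk (F.assoc L)
      exact e.symm.trans (Seq.arrow_mk_comp rfl (Seq.arrow_mk_comp_map_eqToHom F.tensor _ _))
    · push Not at h
      obtain ⟨x, hx, hn⟩ := h
      obtain ⟨Z, ⟨i⟩, hm⟩ := exists_isInitial_mem (F := F) (g := g) hF hY P
        ⟨x, hx, fun ⟨l, hl⟩ => hn l hl⟩
      obtain ⟨j⟩ := hF.isInitial i hm
      exact j.hom_ext _ _

end Lin

end Multi

namespace Multi

variable {A : Type u} [Category.{v} A] {F : Multitensor A}

theorem Seq.arrow_mk_homMap_congr {ι : Type*} {f g f' g' : ι → A} {x : ∀ i, f i ⟶ g i}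
    {y : ∀ i, f' i ⟶ g' i} (h : ∀ i, Arrow.mk (x i) = Arrow.mk (y i)) (l : List ι) :
    Arrow.mk (homMap x l) = Arrow.mk (homMap y l) := by
  induction l with
  | nil => rfl
  | cons i l ih => exact arrow_mk_consHom (h i) ih

variable {S O : Type v} {s t : S → O} {g : S → A} {Y : A} (hu : Thin s t)
  (hF : F.IsDistributive) (hY : IsInitial Y)

section Desc

variable (X : Enrich F) (x : O → X.graph.vert) (f : ∀ e, g e ⟶ X.graph.hom (x (s e)) (x (t e)))

/-- The value of the functor determined by morphisms on edges. -/
noncomputable abbrev linVal {a b : O} {l : List S} (h : Chain s t a l b) :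
    F.tensor.obj (l.map g) ⟶ X.graph.hom (x a) (x b) :=
  F.tensor.map (Seq.homMap f l) ≫ X.walkComp (h.comp x)

include hu hY in
theorem exists_linMap (a b : O) : ∃ k : linHom F s t g Y a b ⟶ X.graph.hom (x a) (x b),
    ∀ l (h : Chain s t a l b), Arrow.mk k = Arrow.mk (linVal X x f h) := by
  by_cases h : ∃ l, Chain s t a l b
  · obtain ⟨l, h⟩ := h
    refine ⟨eqToHom (linHom_eq F g Y hu h) ≫ linVal X x f h, fun l' h' => ?_⟩
    obtain rfl := hu _ _ _ _ h h'
    exact Seq.arrow_mk_eqToHom_comp rfl _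
  · obtain ⟨i⟩ := isInitial_linHom (F := F) (g := g) hY h
    exact ⟨i.to _, fun l h' => (h ⟨l, h'⟩).elim⟩

theorem arrow_mk_linMap {a b : O} {l : List S} (h : Chain s t a l b) :
    Arrow.mk (exists_linMap hu hY X x f a b).choose = Arrow.mk (linVal X x f h) :=
  (exists_linMap hu hY X x f a b).choose_spec l h

/-- The functor out of a free enriched category determined by morphisms on edges. -/
@[simps] noncomputable def linDesc : lin F g hu hF hY ⟶ X where
  graphHom := ⟨x, fun a b => (exists_linMap hu hY X x f a b).choose⟩
  map_comp {a b} p := by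
    by_cases h : ∃ W : List (Walk s t), Chain Walk.src Walk.tgt a W b ∧
      p.edges = W.map fun w => (w.src, w.tgt)
    · obtain ⟨W, h₁, h₂⟩ := h
      let hom : S → A := fun e => X.graph.hom (x (s e)) (x (t e))
      have hq (g : S → A) : (W.map fun w => w.edges.map g).flatten =
        (W.map Walk.edges).flatten.map g :=
          Eq.trans (congrArg List.flatten List.map_map.symm) List.map_flatten.symm
      have e₁ := F.substTo_naturality (k := fun w : Walk s t => w.edges.map g)
        (k' := fun w => w.edges.map hom) (fun w => Seq.homMap f w.edges) W (hq g) (hq hom)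
        (Seq.homMap f _) (by
          have := Seq.isConcatHom_homMap f (W.map Walk.edges) _ rfl
          refine Eq.trans ?_ this
          have e : Arrow.mk (Seq.homMap (fun w : Walk s t => Seq.homMap f w.edges) W) =
              Arrow.mk (Seq.homMap (Seq.homMap f) (W.map Walk.edges)) := by
            clear h₁ h₂ this
            induction W with
            | nil => rfl
            | cons w W ih => exact Seq.arrow_mk_consHom rfl (ih fun g =>
                Eq.trans (congrArg List.flatten List.map_map.symm) List.map_flatten.symm)
          exact Seq.arrow_mk_map Seq.flatten e)
      have e₂ := X.subst_walkComp (s := fun e => x (s e)) (t := fun e => x (t e))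
        (fun w : Walk s t => w.2.comp x) (h₁.comp x) ((Walk.chain_flatten h₁).comp x) (hq hom)
      have e₃ : F.substTo _ W (hq g) ≫ linVal X x f (Walk.chain_flatten h₁) =
          F.tensor.map (Seq.homMap (fun w : Walk s t => linVal X x f w.2) W) ≫
            X.walkComp (h₁.comp x) := by
        refine (comp_eq_left e₁.symm).trans ?_
        refine (comp_eq_right e₂).trans ?_
        refine comp_eq_left ?_
        refine (F.tensor.map_comp _ _).symm.trans (congrArg F.tensor.map ?_)
        exact (Seq.homMap_comp _ _ _).symm
      refine Arrow.mk_injective _ _ (Eq.trans (Seq.arrow_mk_comp ((arrow_mk_linComp hu hF hY h₁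
        h₂).trans (Multitensor.arrow_mk_substTo _ _ (hq g)).symm) (arrow_mk_linMap hu hY X x f
        (Walk.chain_flatten h₁))) ((congrArg Arrow.mk e₃).trans (Seq.arrow_mk_comp
        (Seq.arrow_mk_map F.tensor ?_) ?_)))
      · refine Eq.symm ((Enrich.arrow_mk_seqMap (X := linGraph F s t g Y)
          ⟨x, fun a b => (exists_linMap hu hY X x f a b).choose⟩ p h₂).trans ?_)
        exact Seq.arrow_mk_homMap_congr (fun w => arrow_mk_linMap hu hY X x f w.2) W
      · refine X.arrow_mk_walkComp _ ?_
        exact (VPath.edges_map x p).trans ((congrArg _ h₂).trans List.map_map)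
    · obtain ⟨i⟩ := isInitial_seq (F := F) (g := g) hF hY h
      exact i.hom_ext _ _

end Desc

/-- The morphisms from the generators to the homs of a free enriched category. -/
noncomputable def linUnit (e : S) : g e ⟶ linHom F s t g Y (s e) (t e) :=
  F.unit.app (g e) ≫ eqToHom (linHom_eq F g Y hu (l := [e]) ⟨rfl, rfl⟩).symm

theorem arrow_mk_linUnit (e : S) :
    Arrow.mk (linUnit (F := F) (g := g) (Y := Y) hu e) = Arrow.mk (F.unit.app (g e)) :=
  Seq.arrow_mk_comp_eqToHom rfl _

theorem linUnit_linDesc (X : Enrich F) (x : O → X.graph.vert)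
    (f : ∀ e, g e ⟶ X.graph.hom (x (s e)) (x (t e))) (e : S) :
    linUnit hu e ≫ (linDesc hu hF hY X x f).graphHom.map (s e) (t e) = f e := by
  refine Arrow.mk_injective _ _ ((Seq.arrow_mk_comp (arrow_mk_linUnit hu e)
    (arrow_mk_linMap hu hY X x f (l := [e]) ⟨rfl, rfl⟩)).trans (congrArg Arrow.mk ?_))
  have e₁ := F.unit.naturality (f e)
  have e₂ := X.walkComp_eq (s := fun e => x (s e)) (t := fun e => x (t e)) (l := [e]) ⟨rfl, rfl⟩
    (p := VPath.edge (x (s e)) (x (t e))) rfl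
  refine (comp_eq_left e₁.symm).trans ?_
  refine (Category.assoc _ _ _).trans (Eq.trans (congrArg (f e ≫ ·) ?_) (Category.comp_id _))
  refine (congrArg (_ ≫ ·) e₂).trans (Eq.trans ?_ (X.unit_comp _ _))
  exact congrArg (_ ≫ ·) ((congrArg (· ≫ _) (F.tensor.map_id _)).trans (Category.id_comp _))

theorem linUnit_walkComp {a b : O} {l : List S} (h : Chain s t a l b) :
    F.tensor.map (Seq.homMap (linUnit (g := g) hu) l) ≫ (lin F g hu hF hY).walkComp h =
      eqToHom (linHom_eq F g Y hu h).symm := by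
  let σ : S → Walk s t := fun e => ⟨(s e, [e], t e), rfl, rfl⟩
  obtain ⟨p, hp⟩ := VPath.exists_of_chain h
  have h₁ : Chain Walk.src Walk.tgt a (l.map σ) b := h.map (f := σ) (fun _ => rfl) fun _ => rfl
  have h₂ : p.edges = (l.map σ).map fun w => (w.src, w.tgt) := by
    rw [hp, List.map_map]
    rfl
  have h₃ : ((l.map σ).map fun w => w.edges.map g) = (Seq.map Seq.single).obj (l.map g) :=
    List.map_map.trans (List.map_map (l := l) (f := g) (g := Seq.single.obj)).symm
  have h₄ : Arrow.mk (Seq.homMap (linUnit (F := F) (g := g) (Y := Y) hu) l) =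
      Arrow.mk (Seq.mapNatUnit F.unit (l.map g)) := by
    clear h hp h₁ h₂ h₃
    induction l with
    | nil => rfl
    | cons e l ih => exact Seq.arrow_mk_consHom (arrow_mk_linUnit hu e) ih
  refine Arrow.mk_injective _ _ ((Seq.arrow_mk_comp (Seq.arrow_mk_map F.tensor h₄)
    (((lin F g hu hF hY).arrow_mk_walkComp h hp).trans ((arrow_mk_linComp hu hF hY h₁ h₂).trans
    ((Multitensor.arrow_mk_app F.subst h₃).trans (Seq.arrow_mk_comp_map_eqToHom F.tensor _
      (Seq.flatten_map_single (l.map g))).symm)))).trans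
    ((congrArg Arrow.mk (F.map_unit_subst (l.map g))).trans ?_))
  exact (Seq.arrow_mk_comp_eqToHom rfl (linHom_eq F g Y hu h).symm).symm.trans
    (congrArg Arrow.mk (Category.id_comp _))

theorem lin_map {X : Enrich F} (R : lin F g hu hF hY ⟶ X) {a b : O} {l : List S}
    (h : Chain s t a l b) :
    eqToHom (linHom_eq F g Y hu h).symm ≫ R.graphHom.map a b =
      linVal X R.graphHom.obj (fun e => linUnit hu e ≫ R.graphHom.map (s e) (t e)) h := by
  have e := Enrich.walkComp_map R (l' := l) rfl h (h.comp R.graphHom.obj) rfl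
  refine (congrArg (· ≫ _) (linUnit_walkComp hu hF hY h).symm).trans ?_
  refine (comp_eq_right e).trans ?_
  refine (congrArg (fun k => _ ≫ _ ≫ k) ((congrArg (· ≫ _) (F.tensor.map_id _)).trans
    (Category.id_comp _))).trans ?_
  refine comp_eq_left ?_
  refine (F.tensor.map_comp _ _).symm.trans (congrArg F.tensor.map ?_)
  exact (Seq.homMap_comp _ _ _).symm

end Multi

namespace Multi

variable {A B : Type u} [Category.{v} A] [Category.{v} B]

/-- The structure of an enriched category on a graph. -/
structure Str (F : Multitensor A) (Γ : VGraph A) where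
  /-- The composition maps. -/
  comp {a b : Γ.vert} (p : VPath Γ.vert a b) : F.tensor.obj (p.seq Γ) ⟶ Γ.hom a b
  unit_comp (a b : Γ.vert) : F.unit.app (Γ.hom a b) ≫ comp (VPath.edge a b) = 𝟙 (Γ.hom a b)
  assoc {a b : Γ.vert} (P : PathSeq Γ.vert a b) :
    F.subst.app (P.seqs Γ) ≫ F.tensor.map (eqToHom (P.flatten_seqs Γ)) ≫ comp P.flat =
      F.tensor.map (P.compSeq F.tensor Γ comp) ≫ comp P.ends

/-- The enriched category with a given graph and structure. -/
abbrev Str.toEnrich {F : Multitensor A} {Γ : VGraph A} (z : Str F Γ) : Enrich F :=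
  ⟨Γ, z.comp, z.unit_comp, z.assoc⟩

/-- A construction of `F'`-categories from `F`-categories lying strictly over a functor `H`. -/
structure Transfer (H : A ⥤ B) (F : Multitensor A) (F' : Multitensor B) where
  /-- The structure on the underlying graph. -/
  str (X : Enrich F) : Str F' ((VGraph.mapFunctor H).obj X.graph)
  exists_map {X X' : Enrich F} (f : X ⟶ X') : ∃ m : (str X).toEnrich ⟶ (str X').toEnrich,
    m.graphHom = (VGraph.mapFunctor H).map f.graphHom

namespace Transfer

variable {H : A ⥤ B} {F : Multitensor A} {F' : Multitensor B} (T : Transfer H F F')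

/-- The value on an object. -/
abbrev obj (X : Enrich F) : Enrich F' := (T.str X).toEnrich

/-- The value on a morphism. -/
def map {X X' : Enrich F} (f : X ⟶ X') : T.obj X ⟶ T.obj X' where
  graphHom := (VGraph.mapFunctor H).map f.graphHom
  map_comp := by
    obtain ⟨m, hm⟩ := T.exists_map f
    exact hm ▸ m.map_comp

variable {S O : Type v} {s t : S → O} (g : S → A) {Y : A} (hu : Thin s t)
  (hF : F.IsDistributive) (hY : IsInitial Y)

theorem map_eqToHom_cancel {P : B} {M N Q : A} (H : A ⥤ B) (q : M = N) (w : P ⟶ H.obj M)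
    (k : M ⟶ Q) : (w ≫ H.map (eqToHom q)) ≫ H.map (eqToHom q.symm ≫ k) = w ≫ H.map k := by
  subst q
  simp

/-- The comparison between the tensors. -/
noncomputable def phi {a b : O} {l : List S} (h : Chain s t a l b) :
    F'.tensor.obj (l.map fun e => H.obj (g e)) ⟶ H.obj (F.tensor.obj (l.map g)) :=
  linVal (T.obj (lin F g hu hF hY)) (fun a => a) (fun e => H.map (linUnit hu e)) h ≫
    H.map (eqToHom (linHom_eq F g Y hu h))

variable {g} in
theorem phi_linVal (X : Enrich F) (x : O → X.graph.vert)
    (f : ∀ e, g e ⟶ X.graph.hom (x (s e)) (x (t e))) {a b : O} {l : List S} (h : Chain s t a l b) :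
    linVal (T.obj X) x (fun e => H.map (f e)) h =
      T.phi g hu hF hY h ≫ H.map (linVal X x f h) := by
  let R := linDesc hu hF hY X x f
  have e₁ : eqToHom (linHom_eq F g Y hu h).symm ≫ R.graphHom.map a b = linVal X x f h :=
    (lin_map hu hF hY R h).trans (congrArg (fun f => linVal X x f h)
      (funext (linUnit_linDesc hu hF hY X x f)))
  have e₂ : linVal (T.obj (lin F g hu hF hY)) (fun a => a) (fun e => H.map (linUnit hu e)) h ≫
      H.map (R.graphHom.map a b) = linVal (T.obj X) x (fun e => H.map (f e)) h := by
    refine (comp_eq_right (Enrich.walkComp_map (T.map R)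
      (s := s) (t := t) (l' := l) rfl h (h.comp x) rfl)).trans ?_
    refine (congrArg (fun k => _ ≫ _ ≫ k) ((congrArg (· ≫ _) (F'.tensor.map_id _)).trans
      (Category.id_comp _))).trans ?_
    refine comp_eq_left ?_
    refine (F'.tensor.map_comp _ _).symm.trans (congrArg F'.tensor.map ?_)
    refine (Seq.homMap_comp _ _ _).symm.trans (congrArg (Seq.homMap · l) (funext fun e => ?_))
    exact (H.map_comp _ _).symm.trans (congrArg H.map (linUnit_linDesc hu hF hY X x f e))
  exact e₂.symm.trans ((map_eqToHom_cancel H _ _ _).symm.trans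
    (congrArg (fun k => T.phi g hu hF hY h ≫ H.map k) e₁))

theorem _root_.Multi.isIso_of_retracts {Hi : B ⥤ A} (η : Hi ⋙ H ≅ 𝟭 B) (η' : H ⋙ Hi ≅ 𝟭 A)
    (hη : ∀ X, H.map (η'.hom.app X) = η.hom.app (H.obj X)) {P M : B} {Q N : A} {i : P ⟶ M}
    [IsIso i] {j : Q ⟶ N} [IsIso j] {θ : M ⟶ H.obj N} {θ₀ : N ⟶ Hi.obj M} {φ : P ⟶ H.obj Q}
    (e₀ : i ≫ θ = φ ≫ H.map j) (e₁ : i ≫ θ ≫ H.map θ₀ ≫ η.hom.app M = i)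
    (e₂ : j ≫ θ₀ ≫ Hi.map θ ≫ η'.hom.app N = j) : IsIso φ := by
  have h₁ : θ ≫ H.map θ₀ ≫ η.hom.app M = 𝟙 _ :=
    (cancel_epi i).1 (e₁.trans (Category.comp_id _).symm)
  have h₂ : θ₀ ≫ Hi.map θ ≫ η'.hom.app N = 𝟙 _ :=
    (cancel_epi j).1 (e₂.trans (Category.comp_id _).symm)
  have h₃ := η.hom.naturality θ
  have : IsIso θ := by
    refine ⟨H.map θ₀ ≫ η.hom.app M, h₁, ?_⟩
    rw [Category.assoc]
    refine (congrArg (_ ≫ ·) h₃.symm).trans ?_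
    rw [← hη]
    exact (congrArg (_ ≫ ·) (H.map_comp _ _).symm).trans ((H.map_comp _ _).symm.trans
      ((congrArg H.map h₂).trans (H.map_id _)))
  have : IsIso (φ ≫ H.map j) := e₀ ▸ inferInstance
  exact IsIso.of_isIso_comp_right φ (H.map j)

variable {g} in
theorem _root_.Multi.lin_endo {m : ∀ a b, linHom F s t g Y a b ⟶ linHom F s t g Y a b}
    (hm : ∃ R : lin F g hu hF hY ⟶ lin F g hu hF hY, R.graphHom = ⟨fun a => a, m⟩)
    (e : ∀ e, linUnit hu e ≫ m (s e) (t e) = linUnit hu e) {a b : O} {l : List S}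
    (h : Chain s t a l b) : eqToHom (linHom_eq F g Y hu h).symm ≫ m a b =
      eqToHom (linHom_eq F g Y hu h).symm := by
  obtain ⟨⟨R, hR⟩, rfl⟩ := hm
  refine (lin_map hu hF hY ⟨_, hR⟩ h).trans (Eq.trans ?_ (linUnit_walkComp hu hF hY h))
  exact congrArg (fun f => F.tensor.map (Seq.homMap f l) ≫ _) (funext e)

variable {Hi : B ⥤ A} (T' : Transfer Hi F' F) {Y' : B} (hF' : F'.IsDistributive)
  (hY' : IsInitial Y') (η : Hi ⋙ H ≅ 𝟭 B) (η' : H ⋙ Hi ≅ 𝟭 A)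

include T' hF' hY' η η' in
theorem isIso_phi (hη : ∀ X, H.map (η'.hom.app X) = η.hom.app (H.obj X))
    (ε : ∀ Z, ∃ m : T.obj (T'.obj Z) ⟶ Z, m.graphHom = ⟨fun a => a, fun _ _ => η.hom.app _⟩)
    (ε' : ∀ Z, ∃ m : T'.obj (T.obj Z) ⟶ Z, m.graphHom = ⟨fun a => a, fun _ _ => η'.hom.app _⟩)
    {a b : O} {l : List S} (h : Chain s t a l b) : IsIso (T.phi g hu hF hY h) := by
  let g' : S → B := fun e => H.obj (g e)
  let N := lin F g hu hF hY
  let M := lin F' g' hu hF' hY'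
  let u (e : S) : g e ⟶ linHom F s t g Y (s e) (t e) := linUnit hu e
  let u' (e : S) : g' e ⟶ linHom F' s t g' Y' (s e) (t e) := linUnit hu e
  let θ : M ⟶ T.obj N := linDesc hu hF' hY' (T.obj N) (fun a => a) fun e => H.map (u e)
  let θ₀ : N ⟶ T'.obj M := linDesc hu hF hY (T'.obj M) (fun a => a) fun e =>
    η'.inv.app (g e) ≫ Hi.map (u' e)
  have hθ (e) : u' e ≫ θ.graphHom.map (s e) (t e) = H.map (u e) := linUnit_linDesc hu hF' hY' _ _ _ e
  have hθ₀ (e) : u e ≫ θ₀.graphHom.map (s e) (t e) = η'.inv.app (g e) ≫ Hi.map (u' e) :=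
    linUnit_linDesc hu hF hY _ _ _ e
  have e₀ : eqToHom (linHom_eq F' g' Y' hu h).symm ≫ θ.graphHom.map a b =
      T.phi g hu hF hY h ≫ H.map (eqToHom (linHom_eq F g Y hu h).symm) := by
    refine (lin_map hu hF' hY' θ h).trans ((congrArg (fun f => linVal (T.obj N) (fun a => a) f h)
      (funext hθ)).trans ?_)
    have e := (map_eqToHom_cancel H (linHom_eq F g Y hu h) (linVal (T.obj N) (fun a => a)
      (fun e => H.map (u e)) h) (𝟙 _)).symm
    rw [H.map_id, Category.comp_id (eqToHom _)] at e
    exact (Category.comp_id _).symm.trans e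
  have e₁ := lin_endo hu hF' hY' (g := g') (m := fun a b => θ.graphHom.map a b ≫
    H.map (θ₀.graphHom.map a b) ≫ η.hom.app _) (by
      obtain ⟨m, hm⟩ := ε M
      refine ⟨θ ≫ T.map θ₀ ≫ m, ?_⟩
      change θ.graphHom ≫ (VGraph.mapFunctor H).map θ₀.graphHom ≫ m.graphHom = _
      rw [hm]
      rfl) (fun e => by
      refine (comp_eq_left (hθ e)).trans ?_
      refine (comp_eq_left ((H.map_comp _ _).symm.trans
        ((congrArg H.map (hθ₀ e)).trans (H.map_comp _ _)))).trans ((Category.assoc _ _ _).trans ?_)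
      refine (congrArg (_ ≫ ·) (η.hom.naturality (u' e))).trans ?_
      refine (congrArg (fun k => _ ≫ k ≫ _) (hη (g e)).symm).trans ?_
      refine (comp_eq_left ((H.map_comp _ _).symm.trans
        ((congrArg H.map (η'.inv_hom_id_app _)).trans (H.map_id _)))).trans (Category.id_comp _)) h
  have e₂ := lin_endo hu hF hY (g := g) (m := fun a b => θ₀.graphHom.map a b ≫
    Hi.map (θ.graphHom.map a b) ≫ η'.hom.app _) (by
      obtain ⟨m, hm⟩ := ε' N
      refine ⟨θ₀ ≫ T'.map θ ≫ m, ?_⟩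
      change θ₀.graphHom ≫ (VGraph.mapFunctor Hi).map θ.graphHom ≫ m.graphHom = _
      rw [hm]
      rfl) (fun e => by
      refine (comp_eq_left (hθ₀ e)).trans ?_
      refine (comp_eq_right (comp_eq_left ((Hi.map_comp _ _).symm.trans (congrArg Hi.map (hθ e))))).trans ?_
      refine (congrArg (_ ≫ ·) (η'.hom.naturality (u e))).trans ?_
      exact (comp_eq_left (η'.inv_hom_id_app _)).trans
        (Category.id_comp _)) h
  exact isIso_of_retracts (i := eqToHom (linHom_eq F' g' Y' hu h).symm)
    (j := eqToHom (linHom_eq F g Y hu h).symm) η η' hη e₀ e₁ e₂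

end Transfer

end Multi

namespace Multi

variable {A B : Type u} [Category.{v} A] [Category.{v} B]

/-- The next natural number. -/
abbrev next (e : ULift.{v} ℕ) : ULift.{v} ℕ := ⟨e.down + 1⟩

/-- The natural numbers below `n`. -/
abbrev line : ℕ → List (ULift.{v} ℕ)
  | 0 => []
  | n + 1 => ⟨0⟩ :: (line n).map next

theorem chain_line : ∀ n, Chain (fun e => e) next ⟨0⟩ (line.{v} n) ⟨n⟩
  | 0 => rfl
  | n + 1 => ⟨rfl, ((chain_line n).comp next).map (f := next) (fun _ => rfl) fun _ => rfl⟩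

theorem down_add_length {l : List (ULift.{v} ℕ)} {a b : ULift.{v} ℕ}
    (h : Chain (fun e => e) next a l b) : a.down + l.length = b.down := by
  induction l generalizing a with
  | nil => exact congrArg ULift.down h
  | cons e l ih =>
    obtain ⟨rfl, h⟩ := h
    have := ih h
    simp only [List.length_cons] at this ⊢
    omega

theorem thin_next : Thin (fun e : ULift.{v} ℕ => e) next := by
  intro a b l l' h h'
  have e : l.length = l'.length := by have := down_add_length h; have := down_add_length h'; omega
  induction l generalizing a l' with
  | nil => exact (List.length_eq_zero_iff.1 e.symm).symm
  | cons x l ih =>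
    cases l' with
    | nil => cases e
    | cons x' l' =>
      obtain ⟨rfl, h⟩ := h
      obtain ⟨rfl, h'⟩ := h'
      exact congrArg _ (ih _ _ h h' (Nat.succ.inj e))

namespace Seq

/-- The entries of a sequence, continued by a fixed object. -/
abbrev entry (Y : A) : List A → ℕ → A
  | [], _ => Y
  | X :: _, 0 => X
  | _ :: l, i + 1 => entry Y l i

theorem map_entry (Y : A) : ∀ l : List A,
    (line.{v} l.length).map (fun e => entry Y l e.down) = l
  | [] => rfl
  | X :: l => congrArg (List.cons X) (List.map_map.trans (map_entry Y l))

theorem arrow_mk_homMap_map {ι κ : Type*} {f g : κ → A} (x : ∀ i, f i ⟶ g i) (k : ι → κ) (l : List ι) :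
    Arrow.mk (homMap x (l.map k)) = Arrow.mk (homMap (fun i => x (k i)) l) := by
  induction l with
  | nil => rfl
  | cons i l ih => exact arrow_mk_consHom rfl ih

theorem map_homMap (H : A ⥤ B) {ι : Type*} {f g : ι → A} (x : ∀ i, f i ⟶ g i) (l : List ι) :
    Arrow.mk ((map H).map (homMap x l)) = Arrow.mk (homMap (fun i => H.map (x i)) l) := by
  induction l with
  | nil => rfl
  | cons i l ih => exact arrow_mk_consHom rfl ih

theorem exists_family {Y : A} (hY : IsInitial Y) (X : VGraph A) : ∀ {a b : X.vert}
    (p : VPath X.vert a b) (l : List A) (f : Hom l (p.seq X)), ∃ (x : ℕ → X.vert)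
      (m : ∀ i, entry Y l i ⟶ X.hom (x i) (x (i + 1))), x 0 = a ∧ x l.length = b ∧
      (p.edges = (line.{v} l.length).map fun e => (x e.down, x (e.down + 1))) ∧
      Arrow.mk (homMap (fun e : ULift ℕ => m e.down) (line.{v} l.length)) =
        Arrow.mk (T := Seq A) (X := l) (Y := p.seq X) f
  | _, _, .nil a, [], _ => ⟨fun _ => a, fun _ => hY.to _, rfl, rfl, rfl, rfl⟩
  | _, _, .cons a p, Z :: l, f => by
    obtain ⟨x, m, rfl, h₁, h₂, h₃⟩ := exists_family hY X p l f.2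
    refine ⟨fun | 0 => a | i + 1 => x i, fun | 0 => f.1 | i + 1 => m i, rfl, h₁,
      congrArg (List.cons (a, x 0)) (h₂.trans (by rw [List.map_map]; rfl)),
      arrow_mk_consHom rfl ((arrow_mk_homMap_map _ _ _).trans h₃)⟩
  | _, _, .nil _, _ :: _, f => f.elim
  | _, _, .cons _ _, [], f => f.elim

theorem exists_split₂ (X : VGraph A) : ∀ {a b : X.vert} (p : VPath X.vert a b) (l m : List A)
    (f : Hom (l ++ m) (p.seq X)), ∃ (c : X.vert) (q : VPath X.vert a c) (r : VPath X.vert c b)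
      (f₁ : Hom l (q.seq X)) (f₂ : Hom m (r.seq X)), p = q.append r ∧
        Arrow.mk (T := Seq A) (X := l ++ m) (Y := q.seq X ++ r.seq X) (appendHom f₁ f₂) =
          Arrow.mk (T := Seq A) (X := l ++ m) (Y := p.seq X) f
  | a, _, p, [], _, f => ⟨a, .nil a, p, PUnit.unit, f, rfl, rfl⟩
  | _, _, .cons a p, Z :: l, m, f => by
    obtain ⟨c, q, r, f₁, f₂, rfl, h⟩ := exists_split₂ X p l m f.2
    exact ⟨c, .cons a q, r, (f.1, f₁), f₂, rfl, arrow_mk_consHom (f := f.1) rfl h⟩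
  | _, _, .nil _, _ :: _, _, f => f.elim

theorem exists_split (X : VGraph A) : ∀ {a b : X.vert} (p : VPath X.vert a b) (L : List (List A))
    (f : Hom L.flatten (p.seq X)), ∃ (P : PathSeq X.vert a b)
      (f' : Hom (V := Seq A) L (P.seqs X)), p = P.flat ∧
        Arrow.mk (T := Seq A) (X := L.flatten) (Y := List.flatten (P.seqs X)) (flattenHom f') =
          Arrow.mk (T := Seq A) (X := L.flatten) (Y := p.seq X) f
  | _, _, .nil a, [], f => ⟨.nil a, PUnit.unit, rfl, rfl⟩
  | _, _, .cons _ _, [], f => f.elim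
  | a, b, p, l :: L, f => by
    obtain ⟨c, q, r, f₁, f₂, rfl, h⟩ := exists_split₂ X p l L.flatten f
    obtain ⟨P, f', rfl, h'⟩ := exists_split X r L f₂
    refine ⟨.cons q P, (f₁, f'), rfl, Eq.trans ?_ h⟩
    have aux : ∀ {m n n' : Seq A} (k : m ⟶ n) (k' : m ⟶ n'), Arrow.mk k = Arrow.mk k' →
        Arrow.mk (T := Seq A) (X := l ++ m) (Y := q.seq X ++ n) (appendHom f₁ k) =
          Arrow.mk (T := Seq A) (X := l ++ m) (Y := q.seq X ++ n') (appendHom f₁ k') := by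
      intro m n n' k k' e
      obtain rfl : n = n' := congrArg (fun z : Arrow (Seq A) => z.right) e
      obtain rfl := Arrow.mk_injective _ _ e
      rfl
    exact aux _ _ h'

end Seq

theorem exists_test {F : Multitensor A} (hF : F.IsDistributive) {Y : A} (hY : IsInitial Y)
    (l : Seq A) : ∃ (N : Enrich F) (a b : N.graph.vert) (p : VPath N.graph.vert a b)
      (u : l ⟶ p.seq N.graph), IsIso (F.tensor.map u ≫ N.comp p) := by
  let g (e : ULift.{v} ℕ) := Seq.entry Y l e.down
  let h := chain_line.{v} l.length
  obtain ⟨p, hp⟩ := VPath.exists_of_chain h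
  have e := linUnit_walkComp (F := F) (g := g) thin_next hF hY h
  rw [(lin F g thin_next hF hY).walkComp_eq h hp] at e
  refine ⟨lin F g thin_next hF hY, _, _, p, eqToHom (Seq.map_entry Y l).symm ≫
    Seq.homMap (linUnit (F := F) (g := g) thin_next) (line l.length) ≫
      eqToHom ((lin F g thin_next hF hY).seq_eq_of_edges hp), ?_⟩
  rw [F.tensor.map_comp, F.tensor.map_comp, Category.assoc, Category.assoc]
  refine (congrArg (fun k => IsIso (F.tensor.map (eqToHom (Seq.map_entry Y l).symm) ≫ k)) e).mpr ?_
  exact IsIso.comp_isIso' inferInstance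
    (eqToIso (linHom_eq F g Y thin_next h).symm).isIso_hom

namespace Transfer

variable {H : A ⥤ B} {F : Multitensor A} {F' : Multitensor B} (T : Transfer H F F')
  (hF : F.IsDistributive) {Y : A} (hY : IsInitial Y)

/-- The comparison between the tensors. -/
noncomputable def compare (l : Seq A) :
    F'.tensor.obj ((Seq.map H).obj l) ⟶ H.obj (F.tensor.obj l) :=
  F'.tensor.map (eqToHom ((congrArg (List.map H.obj) (Seq.map_entry Y l).symm).trans List.map_map)) ≫
    T.phi (fun e => Seq.entry Y l e.down) thin_next hF hY (chain_line l.length) ≫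
      H.map (F.tensor.map (eqToHom (Seq.map_entry Y l)))

theorem compare_comp (X : Enrich F) {a b : X.graph.vert} (p : VPath X.graph.vert a b) (l : Seq A)
    (f : l ⟶ p.seq X.graph) : F'.tensor.map ((Seq.map H).map f) ≫
      F'.tensor.map (eqToHom (p.seq_mapFunctor H X.graph).symm) ≫ (T.obj X).comp p =
      T.compare hF hY l ≫ H.map (F.tensor.map f ≫ X.comp p) := by
  obtain ⟨x, m, rfl, rfl, h₁, h₂⟩ := Seq.exists_family hY X.graph p l f
  have e := T.phi_linVal thin_next hF hY X (fun i => x i.down) (fun e => m e.down)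
    (chain_line l.length)
  refine Arrow.mk_injective _ _ (Eq.trans ?_ ((congrArg Arrow.mk e).trans (Seq.arrow_mk_comp ?_
    (Seq.arrow_mk_map H (Seq.arrow_mk_comp (Seq.arrow_mk_map F.tensor h₂)
      (X.arrow_mk_walkComp _ h₁))))))
  · refine Seq.arrow_mk_comp (Seq.arrow_mk_map F'.tensor ((Seq.arrow_mk_map (Seq.map H) h₂).symm.trans
      (Seq.map_homMap H _ _))) ?_
    exact (Seq.arrow_mk_map_eqToHom_comp F'.tensor _ _).trans
      ((T.obj X).arrow_mk_walkComp ((chain_line l.length).comp fun i => x i.down) h₁).symm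
  · exact ((Seq.arrow_mk_map_eqToHom_comp F'.tensor _ _).trans
      (Seq.arrow_mk_comp_map_eqToHom (F.tensor ⋙ H) _ _)).symm

end Transfer

end Multi

namespace Multi

variable {A B : Type u} [Category.{v} A] [Category.{v} B]

theorem Seq.arrow_mk_flattenHom_map (H : A ⥤ B) : ∀ {L M : List (List A)} (f : Hom L M),
    Arrow.mk (T := Seq B) (X := List.flatten (L.map (List.map H.obj)))
      (Y := List.flatten (M.map (List.map H.obj))) (flattenHom (mapHom (map H) f)) =
      Arrow.mk (T := Seq B) (X := L.flatten.map H.obj) (Y := M.flatten.map H.obj)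
        (mapHom H (flattenHom f))
  | [], [], _ => rfl
  | l :: L, m :: M, f => by
    have aux : ∀ {l m : List A} (k : Hom l m) {n n₁ : List A} (h : Hom n n₁)
        {x y : Seq B} (h' : x ⟶ y), Arrow.mk h' = Arrow.mk (T := Seq B) (X := n.map H.obj)
          (Y := n₁.map H.obj) (mapHom H h) →
        Arrow.mk (T := Seq B) (X := l.map H.obj ++ x) (Y := m.map H.obj ++ y)
          (appendHom (mapHom H k) h') = Arrow.mk (T := Seq B) (X := (l ++ n).map H.obj)
          (Y := (m ++ n₁).map H.obj) (mapHom H (appendHom k h)) := by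
      intro l
      induction l with
      | nil =>
        intro m k
        cases m with
        | nil => intro _ _ h x y h' e; exact e
        | cons => exact k.elim
      | cons X l ih =>
        intro m k
        cases m with
        | nil => exact k.elim
        | cons Z m =>
          intro _ _ h x y h' e
          exact Seq.arrow_mk_consHom (l := l.map H.obj ++ x) (m := m.map H.obj ++ y) rfl
            (ih k.2 h h' e)
    exact aux f.1 (flattenHom f.2) _ (arrow_mk_flattenHom_map H f.2)
  | [], _ :: _, f => f.elim
  | _ :: _, [], f => f.elim

namespace Transfer

variable {H : A ⥤ B} {F : Multitensor A} {F' : Multitensor B} (T : Transfer H F F')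
  (hF : F.IsDistributive) {Y : A} (hY : IsInitial Y)

theorem compare_naturality {l m : Seq A} (f : l ⟶ m) :
    F'.tensor.map ((Seq.map H).map f) ≫ T.compare hF hY m =
      T.compare hF hY l ≫ H.map (F.tensor.map f) := by
  obtain ⟨N, a, b, p, u, hw⟩ := exists_test hF hY m
  have e₁ := T.compare_comp hF hY N p m u
  have e₂ := T.compare_comp hF hY N p l (f ≫ u)
  rw [F.tensor.map_comp, Category.assoc, H.map_comp, Functor.map_comp, Functor.map_comp,
    Category.assoc] at e₂
  exact (cancel_mono (H.map (F.tensor.map u ≫ N.comp p))).1 ((comp_eq_right e₁.symm).trans (e₂.trans (Category.assoc _ _ _).symm))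

theorem unit_compare (X : A) :
    F'.unit.app (H.obj X) ≫ T.compare hF hY (Seq.single.obj X) = H.map (F.unit.app X) := by
  obtain ⟨N, a, b, p, u, hw⟩ := exists_test hF hY (Seq.single.obj X)
  have e₁ := T.compare_comp hF hY N p _ u
  obtain _ | ⟨a, _ | _⟩ := p
  · exact u.elim
  · refine (cancel_mono (H.map (F.tensor.map u ≫ N.comp _))).1 ((comp_eq_right e₁.symm).trans ?_)
    obtain ⟨f, ⟨⟩⟩ := u
    have e₃ : F.unit.app X ≫ F.tensor.map (Seq.single.map f) ≫ N.comp (VPath.edge a b) = f :=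
      (comp_eq_left (F.unit.naturality f).symm).trans
        ((comp_eq_right (N.unit_comp a b)).trans
          (Category.comp_id _))
    refine Eq.trans ?_ ((congrArg H.map e₃).symm.trans (H.map_comp _ _))
    refine (congrArg (fun k => _ ≫ _ ≫ k) ((congrArg (· ≫ _) (F'.tensor.map_id _)).trans
      (Category.id_comp _))).trans ?_
    exact (comp_eq_left
      (F'.unit.naturality (H.map f)).symm).trans ((comp_eq_right ((T.obj N).unit_comp a b)).trans (Category.comp_id _))
  · exact u.2.elim

/-- The comparison as a natural transformation. -/
noncomputable def compareNat : Seq.map H ⋙ F'.tensor ⟶ F.tensor ⋙ H where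
  app l := T.compare hF hY l
  naturality _ _ f := T.compare_naturality hF hY f

theorem compSeq_compare (X : Enrich F) : ∀ {a b : X.graph.vert} (P : PathSeq X.graph.vert a b)
    (L : List (List A)) (f : Seq.Hom (V := Seq A) L (P.seqs X.graph)),
    (Seq.map F'.tensor).map ((Seq.map (Seq.map H)).map f ≫
        eqToHom (P.seqs_mapFunctor H X.graph).symm) ≫
      P.compSeq F'.tensor ((VGraph.mapFunctor H).obj X.graph) (T.obj X).comp =
    Seq.mapNat₂ (T.compareNat hF hY) L ≫ (Seq.map H).map ((Seq.map F.tensor).map f ≫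
      P.compSeq F.tensor X.graph X.comp) ≫ eqToHom (P.ends.seq_mapFunctor H X.graph).symm
  | _, _, .nil _, [], _ => rfl
  | _, _, .nil _, _ :: _, f => f.elim
  | _, _, .cons _ _, [], f => f.elim
  | a, c, .cons (b := b) p P, l :: L, f => by
    have e₁ := (Seq.consHom_eqToHom (p.seq_mapFunctor H X.graph).symm
      (P.seqs_mapFunctor H X.graph).symm).symm
    have e₂ := (Seq.consHom_eqToHom (rfl : H.obj (X.graph.hom a b) = _)
      (P.ends.seq_mapFunctor H X.graph).symm).symm
    refine (congrArg (fun k => (Seq.map F'.tensor).map ((Seq.map (Seq.map H)).map f ≫ k) ≫ _)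
      e₁).trans (Eq.trans ?_ (congrArg (fun k => _ ≫ _ ≫ k) e₂).symm)
    refine Prod.ext ?_ (compSeq_compare X P L f.2)
    refine (congrArg (· ≫ _) (F'.tensor.map_comp _ _)).trans ((Category.assoc _ _ _).trans
      ((T.compare_comp hF hY X p l f.1).trans (congrArg (_ ≫ ·) (Category.comp_id _).symm)))

theorem subst_compare (L : Seq (Seq A)) :
    F'.subst.app ((Seq.map (Seq.map H)).obj L) ≫
        F'.tensor.map (eqToHom (Seq.flatten_map_map H L)) ≫ T.compare hF hY (Seq.flatten.obj L) =
      F'.tensor.map (Seq.mapNat₂ (T.compareNat hF hY) L) ≫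
        T.compare hF hY ((Seq.map F.tensor).obj L) ≫ H.map (F.subst.app L) := by
  obtain ⟨N, a, b, p, u, hw⟩ := exists_test hF hY (Seq.flatten.obj L)
  obtain ⟨P, f, rfl, hf⟩ := Seq.exists_split N.graph p L u
  let f' : L ⟶ P.seqs N.graph := f
  have hf' : Seq.flatten.map f' ≫ eqToHom (P.flatten_seqs N.graph) = u :=
    Arrow.mk_injective _ _ (Seq.arrow_mk_comp_eqToHom hf _)
  let k := (Seq.map (Seq.map H)).map f' ≫ eqToHom (P.seqs_mapFunctor H N.graph).symm
  have hk : Seq.flatten.map k ≫ eqToHom (P.flatten_seqs ((VGraph.mapFunctor H).obj N.graph)) =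
      eqToHom (Seq.flatten_map_map H L) ≫ (Seq.map H).map u ≫
        eqToHom (P.flat.seq_mapFunctor H N.graph).symm :=
    Arrow.mk_injective _ _ ((Seq.arrow_mk_comp_eqToHom ((Seq.arrow_mk_map Seq.flatten
      (Seq.arrow_mk_comp_eqToHom rfl _)).trans ((Seq.arrow_mk_flattenHom_map H f).trans
        (Seq.arrow_mk_map (Seq.map H) hf))) _).trans
          (Seq.arrow_mk_eqToHom_comp (Seq.arrow_mk_comp_eqToHom rfl _) _).symm)
  have e₁ := T.compare_comp hF hY N P.flat _ u
  have e₂ := T.compare_comp hF hY N P.ends ((Seq.map F.tensor).obj L)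
    ((Seq.map F.tensor).map f' ≫ P.compSeq F.tensor N.graph N.comp)
  have e₃ : F.subst.app L ≫ F.tensor.map u ≫ N.comp P.flat =
      F.tensor.map ((Seq.map F.tensor).map f' ≫ P.compSeq F.tensor N.graph N.comp) ≫
        N.comp P.ends := by
    rw [← hf', F.tensor.map_comp, F.tensor.map_comp, Category.assoc, Category.assoc, ← N.assoc P]
    exact (comp_eq_left
      (F.subst.naturality f').symm).trans (Category.assoc _ _ _)
  have e₄ : F'.subst.app ((Seq.map (Seq.map H)).obj L) ≫ F'.tensor.map (Seq.flatten.map k ≫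
      eqToHom (P.flatten_seqs ((VGraph.mapFunctor H).obj N.graph))) ≫ (T.obj N).comp P.flat =
      F'.tensor.map ((Seq.map F'.tensor).map k ≫
        P.compSeq F'.tensor ((VGraph.mapFunctor H).obj N.graph) (T.obj N).comp) ≫
          (T.obj N).comp P.ends := by
    refine (congrArg (fun w => _ ≫ w ≫ _) (F'.tensor.map_comp _ _)).trans ((congrArg (_ ≫ ·)
      (Category.assoc _ _ _)).trans (Eq.trans ?_ ((congrArg (_ ≫ ·) ((T.obj N).assoc P)).trans
        (comp_eq_left (F'.tensor.map_comp _ _).symm))))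
    exact (comp_eq_left
      (F'.subst.naturality k).symm).trans (Category.assoc _ _ _)
  refine (cancel_mono (H.map (F.tensor.map u ≫ N.comp P.flat))).1 ?_
  refine (comp_eq_right (comp_eq_right e₁.symm)).trans (Eq.trans ?_ ((congrArg (_ ≫ ·) ((congrArg (_ ≫ ·)
      ((congrArg H.map e₃.symm).trans (H.map_comp _ _))).trans (Category.assoc _ _ _).symm)).trans
        (Category.assoc _ _ _).symm))
  have aux {P Q R S : Seq B} {Z : B} (f : P ⟶ Q) (g : Q ⟶ R) (h : R ⟶ S)
      (w : F'.tensor.obj S ⟶ Z) : F'.tensor.map f ≫ F'.tensor.map g ≫ F'.tensor.map h ≫ w =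
        F'.tensor.map (f ≫ g ≫ h) ≫ w := by
    simp
  refine Eq.trans ?_ ((e₄.trans (congrArg (· ≫ _) (congrArg F'.tensor.map
    (T.compSeq_compare hF hY N P L f)))).trans ?_)
  · exact congrArg (_ ≫ ·) ((aux _ _ _ _).trans (congrArg (F'.tensor.map · ≫ _) hk.symm))
  · exact (aux _ _ _ _).symm.trans (congrArg (_ ≫ ·) e₂)

/-- The isomorphism of multitensors along `H` given by an invertible comparison. -/
noncomputable def isoAlong (h : ∀ l, IsIso (T.compare hF hY l)) :
    Multitensor.IsoAlong H F F' := by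
  have : IsIso (T.compareNat hF hY) := @NatIso.isIso_of_isIso_app _ _ _ _ _ _ _ h
  let i := asIso (T.compareNat hF hY)
  have cancel (L : List (Seq A)) : Seq.mapNat₂ i.inv L ≫ Seq.mapNat₂ i.hom L = 𝟙 _ := by
    induction L with
    | nil => rfl
    | cons l L ih => exact Prod.ext (i.inv_hom_id_app l) ih
  refine ⟨i.symm, fun X => ?_, fun L => ?_⟩
  · exact (congrArg (· ≫ _) (T.unit_compare hF hY X).symm).trans ((Category.assoc _ _ _).trans
      ((congrArg (F'.unit.app (H.obj X) ≫ ·) (i.hom_inv_id_app (Seq.single.obj X))).trans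
        (Category.comp_id _)))
  · have e := congrArg (fun k => i.inv.app _ ≫ F'.tensor.map (Seq.mapNat₂ i.inv L) ≫ k)
      (T.subst_compare hF hY L)
    refine (cancel_mono (i.hom.app _)).1 (Eq.trans ?_ (e.symm.trans ?_))
    · refine ((comp_eq_right (i.inv_hom_id_app _)).trans
        (Category.comp_id _)).trans (Eq.symm ?_)
      refine (congrArg (_ ≫ ·) ((comp_eq_left
        ((F'.tensor.map_comp _ _).symm.trans ((congrArg F'.tensor.map (cancel L)).trans
          (F'.tensor.map_id _)))).trans (Category.id_comp _))).trans ?_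
      exact (comp_eq_left (i.inv_hom_id_app _)).trans
        (Category.id_comp _)
    · simp only [Category.assoc]
      rfl

end Transfer

end Multi

namespace Multi

theorem IsoOver.symm {C : Type*} [Category* C] {D : Type*} [Category* D] {B : Type*} [Category* B]
    {P : C ⥤ B} {Q : D ⥤ B} : IsoOver P Q → IsoOver Q P
  | ⟨K, L, h₁, h₂, h⟩ => ⟨L, K, h₂, h₁, by rw [← h, ← Functor.assoc, h₂, Functor.id_comp]⟩

theorem IsoOver.trans {C : Type*} [Category* C] {D : Type*} [Category* D] {D' : Type*}
    [Category* D'] {B : Type*} [Category* B] {P : C ⥤ B} {Q : D ⥤ B} {R : D' ⥤ B} :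
    IsoOver P Q → IsoOver Q R → IsoOver P R
  | ⟨K, L, h₁, h₂, h⟩, ⟨K', L', h₁', h₂', h'⟩ => ⟨K ⋙ K', L' ⋙ L,
      by rw [Functor.assoc, ← Functor.assoc K', h₁', Functor.id_comp, h₁],
      by rw [Functor.assoc, ← Functor.assoc L, h₂, Functor.id_comp, h₂'],
      by rw [Functor.assoc, h', h]⟩

variable {A B : Type u} [Category.{v} A] [Category.{v} B]

/-- The structure carried by an enriched category. -/
abbrev Enrich.str {F : Multitensor A} (X : Enrich F) : Str F X.graph :=
  ⟨X.comp, X.unit_comp, X.assoc⟩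

theorem Str.toEnrich_cast {F : Multitensor A} (X : Enrich F) {Γ : VGraph A} (h : X.graph = Γ) :
    (h ▸ X.str : Str F Γ).toEnrich = X := by
  subst h
  rfl

theorem Str.exists_map_cast {F : Multitensor A} {X X' : Enrich F} (m : X ⟶ X') {Γ Γ' : VGraph A}
    (h : X.graph = Γ) (h' : X'.graph = Γ') :
    ∃ n : (h ▸ X.str : Str F Γ).toEnrich ⟶ (h' ▸ X'.str : Str F Γ').toEnrich,
      n.graphHom = eqToHom h.symm ≫ m.graphHom ≫ eqToHom h' := by
  subst h h'
  exact ⟨m, ((Category.id_comp _).trans (Category.comp_id _)).symm⟩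

theorem VGraph.eqToHom_mk {S : Type v} {d d' : S → S → A} (e : ∀ a b, d a b = d' a b)
    (h : VGraph.mk S d = VGraph.mk S d') :
    eqToHom h = ⟨fun a => a, fun a b => eqToHom (e a b)⟩ := by
  obtain rfl : d = d' := funext₂ e
  rfl

namespace Transfer

variable {H : A ⥤ B} {F : Multitensor A} {F' : Multitensor B}

/-- A functor between categories of enriched categories lying strictly over `H`. -/
def ofFunctor (K : Enrich F ⥤ Enrich F')
    (hK : K ⋙ Enrich.forget F' = Enrich.forget F ⋙ VGraph.mapFunctor H) : Transfer H F F' where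
  str X := Functor.congr_obj hK X ▸ (K.obj X).str
  exists_map {X X'} f := by
    obtain ⟨n, hn⟩ := Str.exists_map_cast (K.map f) (Functor.congr_obj hK X)
      (Functor.congr_obj hK X')
    exact ⟨n, hn.trans (Functor.congr_hom hK.symm f).symm⟩

theorem ofFunctor_obj (K : Enrich F ⥤ Enrich F')
    (hK : K ⋙ Enrich.forget F' = Enrich.forget F ⋙ VGraph.mapFunctor H) (X : Enrich F) :
    (ofFunctor K hK).obj X = K.obj X :=
  Str.toEnrich_cast _ _

theorem exists_counit {Hi : B ⥤ A} {T : Transfer H F F'} {T' : Transfer Hi F' F}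
    (e : Hi ⋙ H = 𝟭 B) {Z : Enrich F'} (h : T.obj (T'.obj Z) = Z) :
    ∃ m : T.obj (T'.obj Z) ⟶ Z, m.graphHom = ⟨fun a => a, fun _ _ => (eqToIso e).hom.app _⟩ := by
  refine ⟨eqToHom h, (eqToHom_map (Enrich.forget F') h).trans
    ((VGraph.eqToHom_mk (fun _ _ => Functor.congr_obj e _) _).trans ?_)⟩
  exact congrArg (VGraph.Hom.mk _) (funext fun _ => funext fun _ => (eqToHom_app e _).symm)

end Transfer

theorem nonempty_isoAlong {H : A ⥤ B} {Hi : B ⥤ A} (h₁ : H ⋙ Hi = 𝟭 A) (h₂ : Hi ⋙ H = 𝟭 B)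
    {F : Multitensor A} {F' : Multitensor B} (hF : F.IsDistributive) (hF' : F'.IsDistributive)
    {Y : A} (hY : IsInitial Y) {Y' : B} (hY' : IsInitial Y') {K : Enrich F ⥤ Enrich F'}
    {K' : Enrich F' ⥤ Enrich F} (k₁ : K ⋙ K' = 𝟭 _) (k₂ : K' ⋙ K = 𝟭 _)
    (hK : K ⋙ Enrich.forget F' = Enrich.forget F ⋙ VGraph.mapFunctor H) :
    Nonempty (Multitensor.IsoAlong H F F') := by
  have hK' : K' ⋙ Enrich.forget F = Enrich.forget F' ⋙ VGraph.mapFunctor Hi := by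
    have e : VGraph.mapFunctor H ⋙ VGraph.mapFunctor Hi = 𝟭 _ :=
      congrArg (fun P : A ⥤ A => VGraph.mapFunctor P) h₁
    calc K' ⋙ Enrich.forget F
      _ = K' ⋙ (Enrich.forget F ⋙ VGraph.mapFunctor H) ⋙ VGraph.mapFunctor Hi := by
        rw [Functor.assoc, e, Functor.comp_id]
      _ = (K' ⋙ K) ⋙ Enrich.forget F' ⋙ VGraph.mapFunctor Hi := by
        rw [← hK]
        rfl
      _ = _ := by rw [k₂, Functor.id_comp]
  refine ⟨(Transfer.ofFunctor K hK).isoAlong hF hY fun l => ?_⟩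
  have : IsIso ((Transfer.ofFunctor K hK).phi (fun e => Seq.entry Y l e.down) thin_next hF hY
      (chain_line l.length)) :=
    Transfer.isIso_phi _ _ _ hF hY (Transfer.ofFunctor K' hK') hF' hY' (eqToIso h₂) (eqToIso h₁)
      (fun X => by simp [eqToHom_map]) (fun Z => Transfer.exists_counit h₂ (by
        rw [Transfer.ofFunctor_obj, Transfer.ofFunctor_obj]
        exact Functor.congr_obj k₂ Z)) (fun Z => Transfer.exists_counit h₁ (by
        rw [Transfer.ofFunctor_obj, Transfer.ofFunctor_obj]
        exact Functor.congr_obj k₁ Z)) _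
  exact IsIso.comp_isIso' (F'.tensor.mapIso (eqToIso ((congrArg (List.map H.obj)
    (Seq.map_entry Y l).symm).trans List.map_map))).isIso_hom
      (IsIso.comp_isIso' this (H.mapIso (F.tensor.mapIso (eqToIso (Seq.map_entry Y l)))).isIso_hom)

/-- An isomorphism of multitensors along the identity functor is an isomorphism of multitensors. -/
def Multitensor.IsoAlong.toIso {F F' : Multitensor A} (j : IsoAlong (𝟭 A) F F') : Iso F F' := by
  have h (l : Seq A) : (Seq.map (𝟭 A)).obj l = l := List.map_id l
  have h' (L : Seq (Seq A)) : (Seq.map (Seq.map (𝟭 A))).obj L = L :=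
    (congrArg (fun f => List.map f L) (funext h)).trans (List.map_id L)
  have hf : ∀ {l m : List A} (f : Seq.Hom l m), Arrow.mk (T := Seq A) (X := l.map (𝟭 A).obj)
      (Y := m.map (𝟭 A).obj) (Seq.mapHom (𝟭 A) f) = Arrow.mk (T := Seq A) (X := l) (Y := m) f := by
    intro l
    induction l with
    | nil =>
      rintro (_ | _) f
      · rfl
      · exact f.elim
    | cons X l ih =>
      rintro (_ | ⟨Z, m⟩) f
      · exact f.elim
      · exact Seq.arrow_mk_consHom rfl (ih f.2)
  let d : Seq.map (𝟭 A) ≅ 𝟭 (Seq A) := NatIso.ofComponents (fun l => eqToIso (h l)) fun f =>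
    Arrow.mk_injective _ _ ((Seq.arrow_mk_comp_eqToHom (hf f) (h _)).trans
      (Seq.arrow_mk_eqToHom_comp (f := f) rfl (h _)).symm)
  refine ⟨j.iso ≪≫ Functor.isoWhiskerRight d F'.tensor, fun X => ?_, fun L => ?_⟩
  · refine (congrArg (F.unit.app X ≫ j.iso.hom.app _ ≫ ·) (F'.tensor.map_id _)).trans ?_
    exact (congrArg (_ ≫ ·) (Category.comp_id _)).trans (j.unit_iso X)
  · have e₁ : ∀ L : List (Seq A), Seq.mapNat₂ j.iso.hom L ≫
        (Seq.map F'.tensor).map (eqToHom (h' L)) = eqToHom (h _) ≫ Seq.mapNat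
          (j.iso ≪≫ Functor.isoWhiskerRight d F'.tensor).hom L := by
      intro L
      induction L with
      | nil => rfl
      | cons l L ih =>
        have a₁ := (Seq.consHom_eqToHom (h l) (h' L)).symm
        have a₂ := (Seq.consHom_eqToHom (rfl : F.tensor.obj l = _) (h ((Seq.map F.tensor).obj L))).symm
        refine (congrArg (fun k => Seq.mapNat₂ j.iso.hom (l :: L) ≫ (Seq.map F'.tensor).map k)
          a₁).trans (Eq.trans ?_ (congrArg (· ≫ _) a₂).symm)
        exact Prod.ext (Category.id_comp _).symm ih
    have e₂ : F'.subst.app ((Seq.map (Seq.map (𝟭 A))).obj L) ≫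
        F'.tensor.map (eqToHom (Seq.flatten_map_map (𝟭 A) L)) ≫ F'.tensor.map (eqToHom (h _)) =
          F'.tensor.map ((Seq.map F'.tensor).map (eqToHom (h' L))) ≫ F'.subst.app L := by
      refine Arrow.mk_injective _ _ ?_
      have aux : ∀ {M : Seq (Seq A)} (q : M = L), Arrow.mk (F'.tensor.map ((Seq.map F'.tensor).map
          (eqToHom q)) ≫ F'.subst.app L) = Arrow.mk (F'.subst.app M) := by
        rintro _ rfl
        simp
      refine Eq.trans ?_ (aux (h' L)).symm
      rw [← Category.assoc]
      exact (Seq.arrow_mk_comp_map_eqToHom F'.tensor _ _).trans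
        (Seq.arrow_mk_comp_map_eqToHom F'.tensor _ _)
    have aux {P Q R : Seq A} {Z : A} (f : P ⟶ Q) (g : Q ⟶ R) (w : F'.tensor.obj R ⟶ Z) :
        F'.tensor.map f ≫ F'.tensor.map g ≫ w = F'.tensor.map (f ≫ g) ≫ w := by
      simp
    refine (comp_eq_left (j.subst_iso L)).trans ?_
    refine (Category.assoc _ _ _).trans (((congrArg (_ ≫ ·) (comp_eq_right ((Category.assoc _ _ _).trans e₂))).trans (congrArg (_ ≫ ·) ?_)).trans
        (Category.assoc _ _ _).symm)
    exact (aux _ _ _).trans ((congrArg (F'.tensor.map · ≫ _) (e₁ L)).trans (aux _ _ _).symm)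

end Multi

namespace Multi

namespace VGraph

variable {A : Type u} [Category.{v} A] {B : Type u'} [Category.{v} B] (U : A ⥤ B)

theorem exists_lift {Δ Γ : VGraph A} (h : (mapFunctor U).obj Δ = (mapFunctor U).obj Γ) :
    ∃ d : Γ.vert → Γ.vert → A, (∀ a b, U.obj (d a b) = U.obj (Γ.hom a b)) ∧ Δ = ⟨Γ.vert, d⟩ := by
  obtain ⟨S, d⟩ := Δ
  obtain ⟨S', d'⟩ := Γ
  obtain ⟨rfl, h⟩ := VGraph.mk.inj h
  exact ⟨d, fun a b => congrFun₂ (eq_of_heq h) a b, rfl⟩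

theorem exists_lift_map {Γ Γ' Δ Δ' : VGraph A} {d : Γ.vert → Γ.vert → A}
    {d' : Γ'.vert → Γ'.vert → A} (hd : ∀ a b, U.obj (d a b) = U.obj (Γ.hom a b))
    (hd' : ∀ a b, U.obj (d' a b) = U.obj (Γ'.hom a b)) (hΔ : Δ = ⟨Γ.vert, d⟩)
    (hΔ' : Δ' = ⟨Γ'.vert, d'⟩) (m : Δ ⟶ Δ') (f : Γ ⟶ Γ')
    (p : (mapFunctor U).obj Δ = (mapFunctor U).obj Γ)
    (p' : (mapFunctor U).obj Γ' = (mapFunctor U).obj Δ')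
    (h : (mapFunctor U).map m = eqToHom p ≫ (mapFunctor U).map f ≫ eqToHom p') (a b : Γ.vert) :
    ∃ k : d a b ⟶ d' (f.obj a) (f.obj b), Arrow.mk (U.map k) = Arrow.mk (U.map (f.map a b)) := by
  subst hΔ hΔ'
  have e := h.trans (congrArg₂ (· ≫ ·) (eqToHom_mk hd p) (congrArg (_ ≫ ·)
    (eqToHom_mk (fun a b => (hd' a b).symm) p')))
  obtain ⟨m₀, m⟩ := m
  obtain rfl : m₀ = f.obj := congrArg VGraph.Hom.obj e
  have e' := congrFun₂ (eq_of_heq (VGraph.Hom.mk.inj e).2) a b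
  exact ⟨m a b, (congrArg Arrow.mk e').trans (Seq.arrow_mk_eqToHom_comp
    (f := U.map (f.map a b) ≫ eqToHom (hd' _ _).symm) (Seq.arrow_mk_comp_eqToHom rfl _) (hd a b))⟩

end VGraph

section Test

variable {A : Type u} [Category.{v} A] {F : Multitensor A}

theorem thin_bool : Thin (fun _ : PUnit.{v + 1} => ULift.up.{v} false) fun _ => ⟨true⟩
  | _, _, [], [], _, _ => rfl
  | _, _, [], _ :: [], rfl, h => nomatch h
  | _, _, [], _ :: _ :: _, rfl, h => nomatch h
  | _, _, _ :: [], [], h, rfl => nomatch h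
  | _, _, _ :: _ :: _, [], h, rfl => nomatch h
  | _, _, [_], [_], _, _ => rfl
  | _, _, _ :: _ :: _, _ :: _, h, _ => nomatch h
  | _, _, _ :: _, _ :: _ :: _, _, h => nomatch h

theorem exists_classifier (hF : F.IsDistributive) (hF₁ : F.IsFunctorOperad) {Z : A}
    (hZ : IsInitial Z) (Y : A) : ∃ (X : Enrich F) (a b : X.graph.vert), X.graph.hom a b = Y ∧
      ∀ (X' : Enrich F) (a' b' : X'.graph.vert) (f : Y ⟶ X'.graph.hom a' b'), ∃ R : X ⟶ X',
        R.graphHom.obj a = a' ∧ R.graphHom.obj b = b' ∧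
          Arrow.mk (R.graphHom.map a b) = Arrow.mk f := by
  obtain ⟨h, hu⟩ := hF₁
  have hu' : F.unit.app Y = eqToHom (Functor.congr_obj h Y) := by
    rw [hu, eqToHom_app]
  refine ⟨lin F (fun _ => Y) thin_bool hF hZ, ⟨false⟩, ⟨true⟩,
    (linHom_eq F (fun _ => Y) Z thin_bool (l := [⟨⟩]) ⟨rfl, rfl⟩).trans
      (Functor.congr_obj h Y).symm, fun X' a' b' f => ?_⟩
  refine ⟨linDesc thin_bool hF hZ X' (fun o => if o.down then b' else a') fun _ => f, rfl, rfl, ?_⟩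
  have e := linUnit_linDesc thin_bool hF hZ X' (fun o => if o.down then b' else a') (fun _ => f) ⟨⟩
  rw [linUnit, hu'] at e
  exact (Seq.arrow_mk_eqToHom_comp (Seq.arrow_mk_eqToHom_comp rfl _) _).symm.trans
    ((congrArg Arrow.mk (Category.assoc _ _ _)).symm.trans (congrArg Arrow.mk e))

end Test

variable {V : Type u} [Category.{v} V] {M : Monad V}

theorem algebra_eq_of_arrow_mk {X Y : M.Algebra} (k : X ⟶ Y) {Z : V}
    (h : Arrow.mk (M.forget.map k) = Arrow.mk (𝟙 Z)) : X = Y := by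
  obtain ⟨X, a, ha, ha'⟩ := X
  obtain ⟨Y, b, hb, hb'⟩ := Y
  obtain ⟨f, hf⟩ := k
  obtain rfl : X = Z := congrArg (fun t : Arrow V => t.left) h
  obtain rfl : Y = X := congrArg (fun t : Arrow V => t.right) h
  obtain rfl : f = 𝟙 Y := Arrow.mk_injective _ _ h
  obtain rfl : b = a := by simpa using hf
  rfl

variable {F F' : Multitensor M.Algebra}

theorem exists_functor_of_over (hF : F.IsDistributive) (hF₁ : F.IsFunctorOperad)
    {Z : M.Algebra} (hZ : IsInitial Z) (K : Enrich F ⥤ Enrich F')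
    (hK : K ⋙ Enrich.forget F' ⋙ VGraph.mapFunctor M.forget =
      Enrich.forget F ⋙ VGraph.mapFunctor M.forget) :
    ∃ H : M.Algebra ⥤ M.Algebra, H ⋙ M.forget = M.forget ∧
      K ⋙ Enrich.forget F' = Enrich.forget F ⋙ VGraph.mapFunctor H := by
  choose d hd hΔ using fun X => VGraph.exists_lift M.forget (Functor.congr_obj hK X)
  choose X a b e R using exists_classifier hF hF₁ hZ
  have lift (Y : M.Algebra) (X' a' b') (f : Y ⟶ X'.graph.hom a' b') :
      ∃ k : d (X Y) (a Y) (b Y) ⟶ d X' a' b',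
        Arrow.mk (M.forget.map k) = Arrow.mk (M.forget.map f) := by
    obtain ⟨R, rfl, rfl, hR⟩ := R Y X' a' b' f
    obtain ⟨k, hk⟩ := VGraph.exists_lift_map M.forget (hd _) (hd _) (hΔ _) (hΔ _)
      (K.map R).graphHom R.graphHom (Functor.congr_obj hK _) (Functor.congr_obj hK _).symm
        (Functor.congr_hom hK R) (a Y) (b Y)
    exact ⟨k, hk.trans (Seq.arrow_mk_map M.forget hR)⟩
  have lift' {Y Y' : M.Algebra} (f : Y ⟶ Y') : ∃ k : d (X Y) (a Y) (b Y) ⟶ d (X Y') (a Y') (b Y'),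
      Arrow.mk (M.forget.map k) = Arrow.mk (M.forget.map f) := by
    obtain ⟨k, hk⟩ := lift Y _ (a Y') (b Y') (f ≫ eqToHom (e Y').symm)
    exact ⟨k, hk.trans (Seq.arrow_mk_map M.forget (Seq.arrow_mk_comp_eqToHom rfl _))⟩
  choose φ hφ using @lift'
  have hU (Y) : M.forget.obj (d (X Y) (a Y) (b Y)) = M.forget.obj Y :=
    (hd _ _ _).trans (congrArg M.forget.obj (e Y))
  let H : M.Algebra ⥤ M.Algebra :=
    { obj := fun Y => d (X Y) (a Y) (b Y)
      map := φ
      map_id := fun Y => M.forget.map_injective (Arrow.mk_injective _ _ ((hφ _).trans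
        (congrArg (fun Z => Arrow.mk (𝟙 Z)) (hU Y)).symm))
      map_comp := fun f g => M.forget.map_injective (Arrow.mk_injective _ _ ((hφ _).trans
        (Seq.arrow_mk_comp (hφ f) (hφ g)).symm)) }
  have hH : H ⋙ M.forget = M.forget := CategoryTheory.Functor.ext hU fun Y Y' f =>
    Arrow.mk_injective _ _ ((hφ f).trans (Seq.arrow_mk_eqToHom_comp
      (Seq.arrow_mk_comp_eqToHom rfl _) _).symm)
  refine ⟨H, hH, functor_ext_of_faithful (VGraph.mapFunctor M.forget) (fun N => ?_) (hK.trans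
    (congrArg (fun P : M.Algebra ⥤ V => Enrich.forget F ⋙ VGraph.mapFunctor P) hH).symm)⟩
  refine (hΔ N).trans (congrArg (VGraph.mk _) (funext₂ fun x y => ?_))
  obtain ⟨k, hk⟩ := lift _ N x y (𝟙 _)
  exact (algebra_eq_of_arrow_mk k hk).symm

theorem comp_eq_id_of_over (hF : F.IsDistributive) (hF₁ : F.IsFunctorOperad)
    {Z : M.Algebra} (hZ : IsInitial Z) {K : Enrich F ⥤ Enrich F'} {K' : Enrich F' ⥤ Enrich F}
    (hKK : K ⋙ K' = 𝟭 _) {H H' : M.Algebra ⥤ M.Algebra} (hH : H ⋙ M.forget = M.forget)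
    (hH' : H' ⋙ M.forget = M.forget)
    (hK : K ⋙ Enrich.forget F' = Enrich.forget F ⋙ VGraph.mapFunctor H)
    (hK' : K' ⋙ Enrich.forget F = Enrich.forget F' ⋙ VGraph.mapFunctor H') :
    H ⋙ H' = 𝟭 _ := by
  refine functor_ext_of_faithful M.forget (fun Y => ?_) (by
    rw [Functor.assoc, hH', hH, Functor.id_comp])
  obtain ⟨X, a, b, rfl, -⟩ := exists_classifier hF hF₁ hZ Y
  have e : Enrich.forget F = Enrich.forget F ⋙ VGraph.mapFunctor H ⋙ VGraph.mapFunctor H' := by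
    rw [← Functor.assoc, ← hK, Functor.assoc, ← hK', ← Functor.assoc, hKK, Functor.id_comp]
  have e' := (VGraph.mk.inj (Functor.congr_obj e X)).2
  exact (congrFun₂ (eq_of_heq e') a b).symm

theorem nonempty_iso_of_isoOver (hF : F.IsDistributive) (hF' : F'.IsDistributive)
    {Z : M.Algebra} (hZ : IsInitial Z)
    (h : IsoOver (Enrich.forget F) (Enrich.forget F')) : Nonempty (Multitensor.Iso F F') := by
  obtain ⟨K, K', h₁, h₂, h⟩ := h
  obtain ⟨j⟩ := nonempty_isoAlong (H := 𝟭 _) (Hi := 𝟭 _) rfl rfl hF hF' hZ hZ h₁ h₂ h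
  exact ⟨j.toIso⟩

theorem exists_isoAlong_of_isoOver (hF : F.IsDistributive) (hF₁ : F.IsFunctorOperad)
    (hF' : F'.IsDistributive) (hF₁' : F'.IsFunctorOperad) {Z : M.Algebra} (hZ : IsInitial Z)
    (h : IsoOver (Enrich.forget F ⋙ VGraph.mapFunctor M.forget)
      (Enrich.forget F' ⋙ VGraph.mapFunctor M.forget)) :
    ∃ H : M.Algebra ⥤ M.Algebra, (∃ L, H ⋙ L = 𝟭 _ ∧ L ⋙ H = 𝟭 _) ∧
      H ⋙ M.forget = M.forget ∧ Nonempty (Multitensor.IsoAlong H F F') := by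
  obtain ⟨K, K', h₁, h₂, h⟩ := h
  obtain ⟨H, hH, hK⟩ := exists_functor_of_over hF hF₁ hZ K h
  obtain ⟨L, hL, hK'⟩ := exists_functor_of_over hF' hF₁' hZ K' (by
    rw [← h, ← Functor.assoc, h₂, Functor.id_comp])
  have e₁ := comp_eq_id_of_over hF hF₁ hZ h₁ hH hL hK hK'
  have e₂ := comp_eq_id_of_over hF' hF₁' hZ h₂ hL hH hK' hK
  exact ⟨H, ⟨L, e₁, e₂⟩, hH, nonempty_isoAlong e₁ e₂ hF hF' hZ hZ h₁ h₂ hK⟩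

end Multi

theorem mainTheorem1 {V : Type u} [Category.{v} V] [HasColimits V]
    (κ : Cardinal.{v}) [Fact κ.IsRegular] (E : Multi.Multitensor V)
    (hdist : E.IsDistributive) (hacc : E.IsAccessible κ) :
    ∃ E' : Multi.Multitensor E.unaryMonad.Algebra,
      E'.IsFunctorOperad ∧ E'.IsDistributive ∧
      Multi.IsoOver (Multi.Enrich.forget E') (Multi.Enrich.forgetToAlgebra E) ∧
      E'.IsAccessible κ ∧
      ∀ F : Multi.Multitensor E.unaryMonad.Algebra, F.IsFunctorOperad → F.IsDistributive →
        (Multi.IsoOver (Multi.Enrich.forget F) (Multi.Enrich.forgetToAlgebra E) →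
          Nonempty (Multi.Multitensor.Iso F E')) ∧
        (Multi.IsoOver (Multi.Enrich.forget F ⋙ Multi.VGraph.mapFunctor E.unaryMonad.forget)
            (Multi.Enrich.forget E) →
          ∃ H : E.unaryMonad.Algebra ⥤ E.unaryMonad.Algebra,
            (∃ L : E.unaryMonad.Algebra ⥤ E.unaryMonad.Algebra,
              H ⋙ L = 𝟭 E.unaryMonad.Algebra ∧ L ⋙ H = 𝟭 E.unaryMonad.Algebra) ∧
            H ⋙ E.unaryMonad.forget = E.unaryMonad.forget ∧
            Nonempty (Multi.Multitensor.IsoAlong H F E')) := by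
  obtain ⟨G₀, j, h⟩ := Multi.Words.exists_initial E κ hacc
  obtain ⟨G⟩ := Multi.Words.exists_strict h
  have : PreservesColimitsOfSize.{0, 0} E.unaryMonad.free :=
    E.unaryMonad.adj.leftAdjoint_preservesColimits
  have hZ : IsInitial (E.unaryMonad.free.obj (⊥_ V)) := initialIsInitial.isInitialObj _ _
  have hG := G.isFunctorOperad_multitensor
  have hG' := G.isDistributive_multitensor hdist
  obtain ⟨K, L, h₁, h₂, hK⟩ := G.isoOver
  refine ⟨G.multitensor, hG, hG', ⟨K, L, h₁, h₂, hK⟩, G.isAccessible_multitensor κ hacc,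
    fun F hF hF' => ⟨fun hi => ?_, fun hi => ?_⟩⟩
  · exact Multi.nonempty_iso_of_isoOver hF' hG' hZ (hi.trans (Multi.IsoOver.symm
      ⟨K, L, h₁, h₂, hK⟩))
  · refine Multi.exists_isoAlong_of_isoOver hF' hF hG' hG hZ (hi.trans (Multi.IsoOver.symm
      ⟨K, L, h₁, h₂, ?_⟩))
    exact congrArg (· ⋙ Multi.VGraph.mapFunctor E.unaryMonad.forget) hK
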